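/- Let $n\ge 3$, $N\ge 1$, $1<p\le \frac{2n}{n+2}$, $0<c_a\le C_a$, $\vartheta>\frac{2n}{p}-(2+n)$, and set $$\sigma=p+\vartheta+\frac{p(\vartheta+2)}{n},\qquad \sigma_1=p+\frac{n\vartheta}{n+\vartheta+2}.$$ Then $\sigma>\frac{n(2-p)}{p}$ and $\sigma_1>\frac{n(2-p)}{2}$. Moreover there are $\eta_0\in(0,1)$ and $C_0\ge 0$, finite constants $C(\eta)\ge0$ for every $\eta\in(0,1)$, and finite constants $C(\eta,\kappa_0)\ge0$ for all $\eta,\kappa_0\in(0,1)$, all depending otherwise only on $n,N,p,c_a,C_a,\vartheta$, such that the following holds with $c(\eta):=\eta$ if $\eta\le\eta_0$ and $c(\eta):=C_0$ if $\eta>\eta_0$. **Setting.** Let $\Omega\subset\mathbb R^n$ be bounded and open, $T>0$, $\Omega_T=\Omega\times(0,T)$. Let $a$ be a Borel function on $\Omega\times(-\infty,T]$ with $c_a\le a\le C_a$, let $F\in L^p(\Omega_T,\mathbb R^{N\times n})$, and let $u\in C^0([0,T];L^2(\Omega,\mathbb R^N))\cap L^p(0,T;W^{1,p}_0(\Omega,\mathbb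 R^N))$ with $u(\cdot,0)=0$ be a weak solution of $$u_t-\operatorname{div}(a|\nabla u|^{p-2}\nabla u)=\operatorname{div}(|F|^{p-2}F)\quad\text{in }\Omega_T,$$ that is, $\int_{\Omega_T}\big(u\cdot\phi_t-a|\nabla u|^{p-2}\nabla u:\nabla\phi-|F|^{p-2}F:\nabla\phi\big)\,dx\,dt=0$ for all $\phi\in C^1_c(\Omega_T,\mathbb R^N)$. Extend $u$ and $F$ by $0$ to $t<0$. For $r_0>0$ let $$[a]_{r_0}=\sup_{t\in[0,T]}\ \sup_{x\in\Omega,\,0<r\le r_0}\ {-\!\!\!\!\!\!\int}_{B_r(x)\cap\Omega}\Big|a(y,t)-{-\!\!\!\!\!\!\int}_{B_r(x)\cap\Omega}a(z,t)\,dz\Big|\,dy .$$ For $\lambda,\rho>0$ write $Q^\lambda_\rho(x_0,t_0)=B_\rho(x_0)\times(t_0-\lambda^{p-2}\rho^2,t_0)$. Let $\lambda,R>0$, $\overline{B_{2R}(x_0)}\subset\Omega$, $t_0\in[0,T]$, $I=(t_0-\lambda^{p-2}(2R)^2,t_0)$ and $Q=Q_{2R}^\lambda(x_0,t_0)$. Let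 $w\in C^0(\overline I;L^2(B_{2R}(x_0),\mathbb R^N))\cap L^p(I;W^{1,p}(B_{2R}(x_0),\mathbb R^N))$ be a weak solution (same sense, with zero datum) of $$w_t-\operatorname{div}\big((a(t))_{B_{2R}(x_0)}|\nabla w|^{p-2}\nabla w\big)=0\ \text{ in }Q,\qquad w=u\ \text{ on }\partial_pQ,$$ where $(a(t))_{B_{2R}(x_0)}={-\!\!\!\!\!\!\int}_{B_{2R}(x_0)}a(x,t)\,dx$, and the boundary condition means $w(t)-u(t)\in W_0^{1,p}(B_{2R}(x_0),\mathbb R^N)$ for a.e. $t\in I$ and $w=u$ in $L^2(B_{2R}(x_0))$ at the initial time $t_0-\lambda^{p-2}(2R)^2$. **Claim.** Let $\eta,\kappa_0\in(0,1)$. If $\nabla u\in L^{\sigma_1+\kappa_0}(Q)$, $F\in L^{\sigma_1}(Q)$ and $[a]_{2R}\le \eta^{\frac{n^4}{\kappa_0^4(p-1)^4}}$, then (1) $$\Big({-\!\!\!\!\!\!\int}_{Q}|\lambda\nabla(u-w)|^p\Big)^{\frac1p}\le C(\eta)\Big({-\!\!\!\!\!\!\int}_{Q}|\lambda F|^p\Big)^{\frac1p}+c(\eta)\Big({-\!\!\!\!\!\!\int}_{Q}|\lambda\nabla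 u|^{\sigma_1}\Big)^{\frac1{\sigma_1}};$$ (2) $$\Big[{-\!\!\!\!\!\!\int}_{I}\Big({-\!\!\!\!\!\!\int}_{B_{2R}(x_0)}\big(\tfrac{\lambda}{R}|u-w|\big)^{\sigma}dx\Big)^{\frac2\sigma}dt\Big]^{\frac12}\le C(\eta,\kappa_0)\Big({-\!\!\!\!\!\!\int}_{Q}|\lambda F|^{\sigma_1}\Big)^{\frac{n+p}{\sigma_1(n+2)}}+c(\eta)\Big({-\!\!\!\!\!\!\int}_{Q}|\lambda\nabla u|^{\sigma_1+\kappa_0}\Big)^{\frac{n+p}{(\sigma_1+\kappa_0)(n+2)}}.$$ Here ${-\!\!\!\!\!\!\int}_A f=\frac1{|A|}\int_A f$ is the mean value, and matrices carry the Frobenius norm. -/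

import Mathlib

open MeasureTheory Set Filter Topology Metric
open scoped ENNReal NNReal ContDiff

noncomputable section

/-- The physical space `ℝⁿ` with its Euclidean norm. -/
abbrev Space (n : ℕ) : Type := EuclideanSpace ℝ (Fin n)

/-- The target space `ℝᴺ` with its Euclidean norm. -/
abbrev Vec (N : ℕ) : Type := EuclideanSpace ℝ (Fin N)

/-- The space `ℝ^{N × n}` of matrices with the Frobenius norm and inner product. -/
abbrev Mat (N n : ℕ) : Type := EuclideanSpace ℝ (Fin N × Fin n)

/-- The `p`-Laplacian flux `|M|^{p-2} M` (equal to `0` at `M = 0`, as `p > 1`). -/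
def flux {N n : ℕ} (p : ℝ) (M : Mat N n) : Mat N n := ‖M‖ ^ (p - 2) • M

/-- The classical gradient `(∂_j φ_i)_{i,j}` of a differentiable map `φ : ℝⁿ → ℝᴺ`. -/
def spatialGrad {N n : ℕ} (φ : Space n → Vec N) (x : Space n) : Mat N n :=
  WithLp.toLp 2 fun ij => fderiv ℝ φ x (EuclideanSpace.single ij.2 1) ij.1

/-- `Df` is the weak gradient of `f` in the open set `U`. -/
def IsWeakGrad {N n : ℕ} (U : Set (Space n)) (f : Space n → Vec N) (Df : Space n → Mat N n) :
    Prop :=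
  ∀ ψ : Space n → ℝ, ContDiff ℝ ∞ ψ → HasCompactSupport ψ → tsupport ψ ⊆ U →
    ∀ (i : Fin N) (j : Fin n),
      ∫ x in U, f x i * fderiv ℝ ψ x (EuclideanSpace.single j 1) = -∫ x in U, Df x (i, j) * ψ x

/-- `f`, with gradient `Df`, belongs to `W₀^{1,p}(U)`: it is a limit in the norm of `W^{1,p}(U)`
of smooth maps with compact support in `U`. -/
def MemW1pZero {N n : ℕ} (p : ℝ) (U : Set (Space n)) (f : Space n → Vec N)
    (Df : Space n → Mat N n) : Prop :=
  ∃ φ : ℕ → Space n → Vec N,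
    (∀ k, ContDiff ℝ ∞ (φ k) ∧ HasCompactSupport (φ k) ∧ tsupport (φ k) ⊆ U) ∧
    Tendsto (fun k => eLpNorm (fun x => φ k x - f x) (ENNReal.ofReal p) (volume.restrict U))
      atTop (𝓝 0) ∧
    Tendsto (fun k => eLpNorm (fun x => spatialGrad (φ k) x - Df x) (ENNReal.ofReal p)
      (volume.restrict U)) atTop (𝓝 0)

/-- `u ∈ C⁰([t₁, t₂]; L²(U, ℝᴺ)) ∩ L^p(t₁, t₂; W^{1,p}(U, ℝᴺ))`, with spatial gradient `Du`. -/
structure MemEnergySpace {N n : ℕ} (p t₁ t₂ : ℝ) (U : Set (Space n))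
    (u : ℝ → Space n → Vec N) (Du : ℝ → Space n → Mat N n) : Prop where
  memLp : MemLp (Function.uncurry u) (ENNReal.ofReal p) (volume.restrict (Ioo t₁ t₂ ×ˢ U))
  memLp_grad : MemLp (Function.uncurry Du) (ENNReal.ofReal p) (volume.restrict (Ioo t₁ t₂ ×ˢ U))
  weakGrad : ∀ᵐ t ∂(volume.restrict (Ioo t₁ t₂)), IsWeakGrad U (u t) (Du t)
  memLp_two : ∀ t ∈ Icc t₁ t₂, MemLp (u t) 2 (volume.restrict U)
  continuous : ∀ t ∈ Icc t₁ t₂,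
    Tendsto (fun s => eLpNorm (fun x => u s x - u t x) 2 (volume.restrict U))
      (𝓝[Icc t₁ t₂] t) (𝓝 0)

/-- `u`, with spatial gradient `Du`, is a weak solution of the system
`u_t - div (a |∇u|^{p-2} ∇u) = div (|F|^{p-2} F)` in `U × (t₁, t₂)`. -/
structure IsWeakSolution {N n : ℕ} (p t₁ t₂ : ℝ) (U : Set (Space n))
    (a : ℝ → Space n → ℝ) (F : ℝ → Space n → Mat N n)
    (u : ℝ → Space n → Vec N) (Du : ℝ → Space n → Mat N n) : Prop
    extends MemEnergySpace p t₁ t₂ U u Du where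
  weakForm : ∀ φ : ℝ × Space n → Vec N, ContDiff ℝ 1 φ → HasCompactSupport φ →
    tsupport φ ⊆ Ioo t₁ t₂ ×ˢ U →
    ∫ z in Ioo t₁ t₂ ×ˢ U,
      (inner ℝ (u z.1 z.2) (fderiv ℝ φ z (1, 0))
        - a z.1 z.2 * inner ℝ (flux p (Du z.1 z.2)) (spatialGrad (fun y => φ (z.1, y)) z.2)
        - inner ℝ (flux p (F z.1 z.2)) (spatialGrad (fun y => φ (z.1, y)) z.2)) = 0

/-- `u` is a weak solution in `U × (t₁, t₂)` that agrees with `g` (with spatial gradient `Dg`) on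
the parabolic boundary: `u(t) - g(t) ∈ W₀^{1,p}(U)` for a.e. `t`, and `u(t₁) = g(t₁)`. -/
structure IsDirichletSolution {N n : ℕ} (p t₁ t₂ : ℝ) (U : Set (Space n))
    (a : ℝ → Space n → ℝ) (F : ℝ → Space n → Mat N n)
    (g : ℝ → Space n → Vec N) (Dg : ℝ → Space n → Mat N n)
    (u : ℝ → Space n → Vec N) (Du : ℝ → Space n → Mat N n) : Prop
    extends IsWeakSolution p t₁ t₂ U a F u Du where
  lateral : ∀ᵐ t ∂(volume.restrict (Ioo t₁ t₂)),
    MemW1pZero p U (fun x => u t x - g t x) (fun x => Du t x - Dg t x)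
  initial : ∀ᵐ x ∂(volume.restrict U), u t₁ x = g t₁ x

/-- The seminorm `[a]_{r₀}`: the supremum over `t ∈ [0,T]`, `x ∈ Ω` and `0 < r ≤ r₀` of the mean
oscillation of `a(·,t)` over `B_r(x) ∩ Ω` (`a` being given on `Ω` only). -/
def bmoSeminorm {n : ℕ} (T : ℝ) (Ω : Set (Space n)) (a : ℝ → Space n → ℝ) (r₀ : ℝ) : ℝ≥0∞ :=
  ⨆ t ∈ Icc 0 T, ⨆ x ∈ Ω, ⨆ r ∈ Ioc 0 r₀,
    ⨍⁻ y in ball x r ∩ Ω, ‖a t y - ⨍ z in ball x r ∩ Ω, a t z‖ₑ ∂volume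

/-- The time interval `(t₀ - λ^{p-2} ρ², t₀)` of an intrinsic cylinder. -/
def cylTime (p lam ρ t₀ : ℝ) : Set ℝ := Ioo (t₀ - lam ^ (p - 2) * ρ ^ 2) t₀

/-- The intrinsic cylinder `Q_ρ^λ(x₀,t₀)`, time coordinate first. -/
def cyl {n : ℕ} (p lam ρ : ℝ) (x₀ : Space n) (t₀ : ℝ) : Set (ℝ × Space n) :=
  cylTime p lam ρ t₀ ×ˢ ball x₀ ρ

end

/-! Write `v = u - w`, `ξ = ∇u`, `M = ∇v`, and let `b` be the spatial mean of `a` over the ball. On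
the cylinder `v` has zero initial and lateral values and solves `v_t = div H` with `H = a|ξ|^{p-2}ξ
+ |F|^{p-2}F - b|ξ-M|^{p-2}(ξ-M)`. Both estimates come from testing this equation with `g(v)`, where
`g` is a Lipschitz `C¹` field that is a subgradient of a convex potential `Φ`. As `v_t` is not a
function, the test is justified by differences in time: convexity gives `Φ(v(t)) - Φ(v(t-h)) ≤
⟨g(v(t)), v(t) - v(t-h)⟩`, the equation integrated over `(t-h,t)` is tested with `g(v(t))` at the
fixed time `t`, and the continuity of translations in `L^q` lets `h` tend to zero
(`energy_inequality_extended`).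

For (1) take `g(v) = v`. For `p < 2` the monotonicity of the flux degenerates where `|ξ|` is large
compared with `|M|`, so it controls `|M|^p` only up to `ε|ξ|^p` (`norm_rpow_le_eps_add`). The
coefficient error `|a-b||ξ|^{p-1}` is written as `(D|ξ|)^{p-1}` with `D = |a-b|^{1/(p-1)}`. The
John–Nirenberg inequality makes `D` small in every `L^r`, so `D|ξ|` is small in `L^p` when `ξ ∈
L^{σ₁}`, because `σ₁ > p`. Then `ε` is chosen as a power of `η`.

For (2) take `g(v)` to be a bounded approximation of `|v|^ϑ` times `v`. The flux difference agrees
with `|M|^{p-2}M` up to `3 min(|M|,|ξ|)^{p-1}`, so both parts of the weighted energy are bounded by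
`J = ∫ |v|^ϑ S^p` with the source `S = min(|M|,|ξ|) + D|ξ| + |F|`. The Sobolev inequality at fixed
times then gives `∫ |v|^σ ≤ C J^{1+p/n}`. Since `ϑ/σ + p/σ₁ = 1`, Hölder's inequality bounds `J` by
`(∫|v|^σ)^{ϑ/σ} (∫S^{σ₁})^{p/σ₁}`. The resulting total power of `∫|v|^σ` on the right is below one
and is absorbed (`IsComparison.lintegral_norm_rpow_le`).

It remains to bound `S` in `L^{σ₁}`. The minimum is interpolated between `|M|` in `L^p`, which is
small by the first estimate, and `|ξ|` in `L^{σ₁+κ₀}`; the term `D|ξ|` is treated by Hölder's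
inequality between the same exponents (`lpMean_source_le`). The interpolation exponent is only of
order `κ₀`, and the large power of `η` in the smallness condition makes up for it, so that the
constant in front of `∇u` does not depend on `κ₀`. The intrinsic scaling removes `λ` and `R`. Both
estimates are proved with `Cη²` in place of `c(η)`; this is at most `η` once `η ≤ η₀ = 1/C`. -/

noncomputable section

/-! ### Algebra of the `p`-Laplacian flux for `1 < p < 2` -/

section Flux

variable {N n : ℕ} {p : ℝ}

lemma flux_zero : flux p (0 : Mat N n) = 0 := by simp [flux]

lemma norm_flux (hp : 1 < p) (M : Mat N n) : ‖flux p M‖ = ‖M‖ ^ (p - 1) := by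
  rcases eq_or_ne M 0 with rfl | hM
  · rw [flux_zero, norm_zero, Real.zero_rpow (by linarith)]
  · have h : 0 < ‖M‖ := norm_pos_iff.2 hM
    rw [flux, norm_smul, Real.norm_of_nonneg (by positivity)]
    nth_rewrite 2 [← Real.rpow_one ‖M‖]
    rw [← Real.rpow_add h]
    ring_nf

lemma rpow_sub_one_mul_self {x : ℝ} (hp : 1 < p) (hx : 0 ≤ x) : x ^ (p - 1) * x = x ^ p := by
  rcases hx.eq_or_lt with rfl | h
  · rw [mul_zero, Real.zero_rpow (by linarith)]
  · nth_rewrite 2 [← Real.rpow_one x]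
    rw [← Real.rpow_add h]
    ring_nf

lemma inner_flux_self (hp : 1 < p) (M : Mat N n) : inner ℝ (flux p M) M = ‖M‖ ^ p := by
  rcases eq_or_ne M 0 with rfl | hM
  · rw [flux_zero, norm_zero, Real.zero_rpow (by linarith), inner_zero_left]
  · have h : 0 < ‖M‖ := norm_pos_iff.2 hM
    rw [flux, inner_smul_left, real_inner_self_eq_norm_sq, ← Real.rpow_natCast ‖M‖ 2]
    simp only [RCLike.conj_to_real]
    rw [← Real.rpow_add h]
    norm_num

lemma flux_neg (M : Mat N n) : flux p (-M) = -flux p M := by simp [flux]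

lemma measurable_flux : Measurable (flux p : Mat N n → Mat N n) := by
  unfold flux
  exact (measurable_norm.pow_const _).smul measurable_id

/-- If `|ξ| ≤ |ξ-ζ|`, both fluxes are separately bounded by `|ξ-ζ|^{p-1}`. Otherwise the difference
splits into `|ξ|^{p-2}(ξ-ζ)` and a multiple of `ζ` due to the change of weight; as `t ↦ t^{p-1}` is
increasing, the second part is no larger than the first. -/
lemma norm_flux_sub_le_of_le (hp : 1 < p) (hp2 : p < 2) {ξ ζ : Mat N n} (h : ‖ζ‖ ≤ ‖ξ‖) :
    ‖flux p ξ - flux p ζ‖ ≤ 2 * ‖ξ - ζ‖ ^ (p - 1) := by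
  rcases eq_or_ne ζ 0 with rfl | hζ
  · rw [flux_zero, sub_zero, sub_zero, norm_flux hp]
    linarith [Real.rpow_nonneg (norm_nonneg ξ) (p - 1)]
  have hζ0 : 0 < ‖ζ‖ := norm_pos_iff.2 hζ
  have hξ0 : 0 < ‖ξ‖ := hζ0.trans_le h
  rcases le_total ‖ξ‖ ‖ξ - ζ‖ with h1 | h1
  · calc ‖flux p ξ - flux p ζ‖ ≤ ‖flux p ξ‖ + ‖flux p ζ‖ := norm_sub_le _ _
      _ ≤ ‖ξ - ζ‖ ^ (p - 1) + ‖ξ - ζ‖ ^ (p - 1) := by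
        rw [norm_flux hp, norm_flux hp]
        exact add_le_add (Real.rpow_le_rpow (norm_nonneg _) h1 (by linarith))
          (Real.rpow_le_rpow (norm_nonneg _) (h.trans h1) (by linarith))
      _ = _ := by ring
  · rcases eq_or_ne ξ ζ with rfl | hne
    · simp only [sub_self, norm_zero]; positivity
    have hd : 0 < ‖ξ - ζ‖ := norm_pos_iff.2 (sub_ne_zero.2 hne)
    have key : ‖ξ‖ ^ (p - 2) * ‖ξ - ζ‖ ≤ ‖ξ - ζ‖ ^ (p - 1) := by
      calc ‖ξ‖ ^ (p - 2) * ‖ξ - ζ‖ ≤ ‖ξ - ζ‖ ^ (p - 2) * ‖ξ - ζ‖ := by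
            gcongr ?_ * _
            exact Real.rpow_le_rpow_of_nonpos hd h1 (by linarith)
        _ = ‖ξ - ζ‖ ^ (p - 1) := by
            nth_rewrite 2 [← Real.rpow_one ‖ξ - ζ‖]
            rw [← Real.rpow_add hd]; ring_nf
    have e : flux p ξ - flux p ζ = ‖ξ‖ ^ (p - 2) • (ξ - ζ) - (‖ζ‖ ^ (p - 2) - ‖ξ‖ ^ (p - 2)) • ζ := by
      unfold flux; module
    have h2 : ‖ξ‖ ^ (p - 2) ≤ ‖ζ‖ ^ (p - 2) := Real.rpow_le_rpow_of_nonpos hζ0 h (by linarith)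
    have h3 : (‖ζ‖ ^ (p - 2) - ‖ξ‖ ^ (p - 2)) * ‖ζ‖ ≤ ‖ξ‖ ^ (p - 2) * ‖ξ - ζ‖ := by
      have e1 : ‖ζ‖ ^ (p - 2) * ‖ζ‖ = ‖ζ‖ ^ (p - 1) := by
        nth_rewrite 2 [← Real.rpow_one ‖ζ‖]
        rw [← Real.rpow_add hζ0]; ring_nf
      have e2 : ‖ξ‖ ^ (p - 2) * ‖ξ‖ = ‖ξ‖ ^ (p - 1) := by
        nth_rewrite 2 [← Real.rpow_one ‖ξ‖]
        rw [← Real.rpow_add hξ0]; ring_nf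
      have e3 : ‖ζ‖ ^ (p - 1) ≤ ‖ξ‖ ^ (p - 1) := Real.rpow_le_rpow hζ0.le h (by linarith)
      have e4 : ‖ξ‖ - ‖ζ‖ ≤ ‖ξ - ζ‖ := norm_sub_norm_le _ _
      have e5 : 0 ≤ ‖ξ‖ ^ (p - 2) := by positivity
      nlinarith
    calc ‖flux p ξ - flux p ζ‖
        ≤ ‖ξ‖ ^ (p - 2) * ‖ξ - ζ‖ + (‖ζ‖ ^ (p - 2) - ‖ξ‖ ^ (p - 2)) * ‖ζ‖ := by
          rw [e]
          refine (norm_sub_le _ _).trans ?_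
          rw [norm_smul, norm_smul, Real.norm_of_nonneg (by positivity),
            Real.norm_of_nonneg (by linarith)]
      _ ≤ 2 * ‖ξ - ζ‖ ^ (p - 1) := by linarith

/-- The flux is Hölder continuous with exponent `p - 1`. -/
lemma norm_flux_sub_le (hp : 1 < p) (hp2 : p < 2) (ξ ζ : Mat N n) :
    ‖flux p ξ - flux p ζ‖ ≤ 2 * ‖ξ - ζ‖ ^ (p - 1) := by
  rcases le_total ‖ζ‖ ‖ξ‖ with h | h
  · exact norm_flux_sub_le_of_le hp hp2 h
  · rw [norm_sub_rev, norm_sub_rev ξ]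
    exact norm_flux_sub_le_of_le hp hp2 h

/-- The case of parallel vectors. Bernoulli's inequality for the concave power `p - 1 < 1`, applied
to `b/a`, gives `a^{p-1} - b^{p-1} ≥ (p-1)(a-b)a^{p-2}`. -/
lemma rpow_sub_rpow_mul_sub_ge (hp : 1 < p) (hp2 : p < 2) {a b : ℝ} (hb : 0 < b) (hab : b ≤ a) :
    (p - 1) * (a - b) ^ 2 * (a + b) ^ (p - 2) ≤ (a ^ (p - 1) - b ^ (p - 1)) * (a - b) := by
  have ha : 0 < a := hb.trans_le hab
  have h1 : (a + b) ^ (p - 2) ≤ a ^ (p - 2) :=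
    Real.rpow_le_rpow_of_nonpos ha (by linarith) (by linarith)
  have h2 : (b / a) ^ (p - 1) ≤ 1 + (p - 1) * (b / a - 1) := by
    have := rpow_one_add_le_one_add_mul_self (s := b / a - 1) (p := p - 1)
      (by have : 0 < b / a := by positivity
          linarith) (by linarith) (by linarith)
    simpa using this
  have h3 : b ^ (p - 1) = a ^ (p - 1) * (b / a) ^ (p - 1) := by
    rw [← Real.mul_rpow ha.le (by positivity)]
    congr 1
    field_simp
  have e2 : a ^ (p - 2) * a = a ^ (p - 1) := by
    nth_rewrite 2 [← Real.rpow_one a]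
    rw [← Real.rpow_add ha]; ring_nf
  have h4 : (p - 1) * (a - b) * a ^ (p - 2) ≤ a ^ (p - 1) - b ^ (p - 1) := by
    rw [h3, ← e2]
    have hq : 0 < a ^ (p - 2) * a := by positivity
    have h5 := mul_le_mul_of_nonneg_left h2 hq.le
    have h6 : a ^ (p - 2) * a * (1 + (p - 1) * (b / a - 1)) =
        a ^ (p - 2) * a - (p - 1) * (a - b) * a ^ (p - 2) := by
      field_simp; ring
    linarith
  calc (p - 1) * (a - b) ^ 2 * (a + b) ^ (p - 2)
      ≤ (p - 1) * (a - b) ^ 2 * a ^ (p - 2) := by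
        have : 0 ≤ (p - 1) * (a - b) ^ 2 := mul_nonneg (by linarith) (sq_nonneg _)
        gcongr
    _ = ((p - 1) * (a - b) * a ^ (p - 2)) * (a - b) := by ring
    _ ≤ _ := mul_le_mul_of_nonneg_right h4 (by linarith)

/-- For fixed norms both sides are affine in the inner product `c = ⟨ξ,ζ⟩ ≤ |ξ||ζ|`. At `c = |ξ||ζ|`
the claim is the scalar inequality, and lowering `c` only helps, since `|ξ|^{p-2}` and `|ζ|^{p-2}`
both dominate `(p-1)(|ξ|+|ζ|)^{p-2}`. -/
lemma inner_flux_sub_ge_of_le (hp : 1 < p) (hp2 : p < 2) {ξ ζ : Mat N n} (h : ‖ζ‖ ≤ ‖ξ‖) :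
    (p - 1) * ‖ξ - ζ‖ ^ 2 * (‖ξ‖ + ‖ζ‖) ^ (p - 2) ≤ inner ℝ (flux p ξ - flux p ζ) (ξ - ζ) := by
  rcases eq_or_ne ζ 0 with rfl | hζ
  · rw [flux_zero, sub_zero, sub_zero, inner_flux_self hp, norm_zero, add_zero]
    rcases eq_or_ne ξ 0 with rfl | hξ
    · simp [Real.zero_rpow (by linarith : p ≠ 0)]
    have h : 0 < ‖ξ‖ := norm_pos_iff.2 hξ
    have : ‖ξ‖ ^ 2 * ‖ξ‖ ^ (p - 2) = ‖ξ‖ ^ p := by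
      rw [← Real.rpow_natCast ‖ξ‖ 2, ← Real.rpow_add h]; norm_num
    rw [mul_assoc, this]
    have h0 : 0 ≤ ‖ξ‖ ^ p := by positivity
    nlinarith
  have hb : 0 < ‖ζ‖ := norm_pos_iff.2 hζ
  have ha : 0 < ‖ξ‖ := hb.trans_le h
  set a := ‖ξ‖ with ha'
  set b := ‖ζ‖ with hb'
  set c : ℝ := inner ℝ ξ ζ with hc
  have hcab : c ≤ a * b := real_inner_le_norm ξ ζ
  have e1 : ‖ξ - ζ‖ ^ 2 = a ^ 2 + b ^ 2 - 2 * c := by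
    rw [norm_sub_sq_real]; ring
  have e2 : inner ℝ (flux p ξ - flux p ζ) (ξ - ζ)
      = a ^ (p - 2) * a ^ 2 + b ^ (p - 2) * b ^ 2 - (a ^ (p - 2) + b ^ (p - 2)) * c := by
    simp only [flux, inner_sub_left, inner_sub_right, real_inner_smul_left,
      real_inner_self_eq_norm_sq, ← ha', ← hb']
    rw [real_inner_comm ξ ζ, ← hc]; ring
  have f1 : a ^ (p - 2) * a = a ^ (p - 1) := by
    nth_rewrite 2 [← Real.rpow_one a]
    rw [← Real.rpow_add ha]; ring_nf
  have f2 : b ^ (p - 2) * b = b ^ (p - 1) := by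
    nth_rewrite 2 [← Real.rpow_one b]
    rw [← Real.rpow_add hb]; ring_nf
  have g1 : (a + b) ^ (p - 2) ≤ a ^ (p - 2) :=
    Real.rpow_le_rpow_of_nonpos ha (by linarith) (by linarith)
  have g2 : (a + b) ^ (p - 2) ≤ b ^ (p - 2) :=
    Real.rpow_le_rpow_of_nonpos hb (by linarith) (by linarith)
  have g0 : 0 < (a + b) ^ (p - 2) := by positivity
  have key := rpow_sub_rpow_mul_sub_ge hp hp2 hb h
  rw [← f1, ← f2] at key
  rw [e1, e2]
  have g3 : 0 ≤ (a ^ (p - 2) + b ^ (p - 2) - 2 * (p - 1) * (a + b) ^ (p - 2)) * (a * b - c) := by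
    refine mul_nonneg ?_ (by linarith)
    nlinarith
  nlinarith [g3, key]

/-- Quantitative monotonicity of the flux for `1 < p < 2`. -/
lemma inner_flux_sub_ge (hp : 1 < p) (hp2 : p < 2) (ξ ζ : Mat N n) :
    (p - 1) * ‖ξ - ζ‖ ^ 2 * (‖ξ‖ + ‖ζ‖) ^ (p - 2) ≤ inner ℝ (flux p ξ - flux p ζ) (ξ - ζ) := by
  rcases le_total ‖ζ‖ ‖ξ‖ with h | h
  · exact inner_flux_sub_ge_of_le hp hp2 h
  · have := inner_flux_sub_ge_of_le hp hp2 h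
    rw [norm_sub_rev, add_comm, ← neg_sub (flux p ζ), ← neg_sub ζ, inner_neg_neg]
    exact this

lemma inner_flux_sub_nonneg (hp : 1 < p) (hp2 : p < 2) (ξ ζ : Mat N n) :
    0 ≤ inner ℝ (flux p ξ - flux p ζ) (ξ - ζ) := by
  refine le_trans ?_ (inner_flux_sub_ge hp hp2 ξ ζ)
  have : 0 < p - 1 := by linarith
  positivity

/-- Up to a small multiple of `|ξ|^p`, the monotonicity of the flux controls `|M|^p`. -/
lemma norm_rpow_le_eps_add (hp : 1 < p) (hp2 : p < 2) {ε : ℝ} (hε : 0 < ε) (hε1 : ε ≤ 1)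
    (ξ M : Mat N n) :
    ‖M‖ ^ p ≤ ε * ‖ξ‖ ^ p + 3 / (p - 1) * ε⁻¹ * inner ℝ (flux p ξ - flux p (ξ - M)) M := by
  have hmono := inner_flux_sub_ge hp hp2 ξ (ξ - M)
  have hnn := inner_flux_sub_nonneg hp hp2 ξ (ξ - M)
  rw [sub_sub_cancel] at hmono hnn
  have hp1 : 0 < p - 1 := by linarith
  set D := inner ℝ (flux p ξ - flux p (ξ - M)) M
  rcases eq_or_ne M 0 with rfl | hM
  · rw [norm_zero, Real.zero_rpow (by linarith)]; positivity
  have hM0 : 0 < ‖M‖ := norm_pos_iff.2 hM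
  by_cases hc : ‖M‖ ^ p ≤ ε * ‖ξ‖ ^ p
  · have : 0 ≤ 3 / (p - 1) * ε⁻¹ * D := by positivity
    linarith
  push Not at hc
  -- Unless `|M|^p ≤ ε|ξ|^p`, which needs no proof, `|ξ|` is at most `|M|/ε`. Then the degenerate
  -- factor `(|ξ|+|ξ-M|)^{p-2}` is at least `(3/ε)^{-1}|M|^{p-2}`, because `p - 2 ≥ -1` and `3/ε ≥
  -- 1`.
  have h1 : ‖ξ‖ ≤ ε⁻¹ * ‖M‖ := by
    by_contra hcon
    push Not at hcon
    have h2 : ‖M‖ < ε * ‖ξ‖ := by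
      rw [inv_mul_lt_iff₀ hε] at hcon; exact hcon
    have h3 : ‖M‖ ^ p ≤ (ε * ‖ξ‖) ^ p := Real.rpow_le_rpow hM0.le h2.le (by linarith)
    rw [Real.mul_rpow hε.le (norm_nonneg _)] at h3
    have h4 : ε ^ p ≤ ε := by
      calc ε ^ p ≤ ε ^ (1 : ℝ) := Real.rpow_le_rpow_of_exponent_ge hε hε1 hp.le
        _ = ε := Real.rpow_one ε
    have h5 : ε ^ p * ‖ξ‖ ^ p ≤ ε * ‖ξ‖ ^ p := by gcongr
    linarith
  have hεi : 1 ≤ ε⁻¹ := (one_le_inv₀ hε).2 hε1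
  have h6 : ‖ξ‖ + ‖ξ - M‖ ≤ 3 * ε⁻¹ * ‖M‖ := by
    have := norm_sub_le ξ M
    nlinarith
  have h6' : 0 < ‖ξ‖ + ‖ξ - M‖ := by
    have : ‖M‖ ≤ ‖ξ‖ + ‖ξ - M‖ := by
      calc ‖M‖ = ‖ξ - (ξ - M)‖ := by rw [sub_sub_cancel]
        _ ≤ _ := norm_sub_le _ _
    linarith
  have h7 : (3 * ε⁻¹ * ‖M‖) ^ (p - 2) ≤ (‖ξ‖ + ‖ξ - M‖) ^ (p - 2) :=
    Real.rpow_le_rpow_of_nonpos h6' h6 (by linarith)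
  have h8 : (3 * ε⁻¹)⁻¹ ≤ (3 * ε⁻¹) ^ (p - 2) := by
    rw [← Real.rpow_neg_one]
    exact Real.rpow_le_rpow_of_exponent_le (by linarith) (by linarith)
  have h9 : (p - 1) * ((3 * ε⁻¹)⁻¹ * ‖M‖ ^ p) ≤ D := by
    refine le_trans ?_ hmono
    rw [mul_assoc]
    refine mul_le_mul_of_nonneg_left ?_ hp1.le
    rw [Real.mul_rpow (by positivity) hM0.le] at h7
    have e : ‖M‖ ^ p = ‖M‖ ^ 2 * ‖M‖ ^ (p - 2) := by
      rw [← Real.rpow_natCast ‖M‖ 2, ← Real.rpow_add hM0]; norm_num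
    rw [e]
    calc (3 * ε⁻¹)⁻¹ * (‖M‖ ^ 2 * ‖M‖ ^ (p - 2))
        ≤ (3 * ε⁻¹) ^ (p - 2) * (‖M‖ ^ 2 * ‖M‖ ^ (p - 2)) := by gcongr
      _ = ‖M‖ ^ 2 * ((3 * ε⁻¹) ^ (p - 2) * ‖M‖ ^ (p - 2)) := by ring
      _ ≤ _ := by gcongr
  have h10 : ‖M‖ ^ p ≤ 3 / (p - 1) * ε⁻¹ * D := by
    calc ‖M‖ ^ p = 3 / (p - 1) * ε⁻¹ * ((p - 1) * ((3 * ε⁻¹)⁻¹ * ‖M‖ ^ p)) := by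
          field_simp
      _ ≤ _ := by gcongr
  have : 0 ≤ ε * ‖ξ‖ ^ p := by positivity
  linarith

/-- Young's inequality in the form `K a^{p-1} b ≤ δ b^p + (K^{p'} / δ^{p'-1}) a^p`. -/
lemma young_flux (hp : 1 < p) {K δ a b : ℝ} (hK : 0 ≤ K) (hδ : 0 < δ) (ha : 0 ≤ a) (hb : 0 ≤ b) :
    K * a ^ (p - 1) * b ≤ δ * b ^ p + (K / δ) ^ (1 / (p - 1)) * K * a ^ p := by
  have hp1 : 0 < p - 1 := by linarith
  set κ := (K / δ) ^ (1 / (p - 1)) with hκ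
  have hκ0 : 0 ≤ κ := by positivity
  have hκp : κ ^ (p - 1) = K / δ := by
    rw [hκ, ← Real.rpow_mul (by positivity)]
    rw [one_div, inv_mul_cancel₀ hp1.ne', Real.rpow_one]
  have hbp := rpow_sub_one_mul_self hp hb
  have hap := rpow_sub_one_mul_self hp ha
  -- The threshold `κ` solves `δκ^{p-1} = K`: above it the product is absorbed by `δ b^p`, below it
  -- `b` is replaced by `κ a`.
  rcases le_total (κ * a) b with h | h
  · have h1 : (K / δ) * a ^ (p - 1) ≤ b ^ (p - 1) := by
      rw [← hκp, ← Real.mul_rpow hκ0 ha]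
      exact Real.rpow_le_rpow (by positivity) h hp1.le
    have h2 : K * a ^ (p - 1) * b ≤ δ * b ^ p := by
      rw [← hbp]
      calc K * a ^ (p - 1) * b = δ * ((K / δ) * a ^ (p - 1) * b) := by field_simp
        _ ≤ δ * (b ^ (p - 1) * b) := by gcongr
    have : 0 ≤ κ * K * a ^ p := by positivity
    linarith
  · have h2 : K * a ^ (p - 1) * b ≤ κ * K * a ^ p := by
      rw [← hap]
      calc K * a ^ (p - 1) * b ≤ K * a ^ (p - 1) * (κ * a) := by gcongr
        _ = _ := by ring
    have : 0 ≤ δ * b ^ p := by positivity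
    linarith

/-- The flux difference tested with a perturbation of `M`: since `ξ ↦ |ξ|^{p-2} ξ` is Hölder
continuous, the flux difference agrees with the flux of `M` up to `3 (min |M| |ξ|)^{p-1}`. -/
lemma inner_flux_sub_add_ge (hp : 1 < p) (hp2 : p < 2) {K : ℝ} (hK : 0 ≤ K) {ξ M T : Mat N n}
    (hT : 0 ≤ inner ℝ M T) (hTK : ‖T‖ ≤ K * ‖M‖) :
    1 / 2 * ‖M‖ ^ p - (6 * (1 + K)) ^ (1 / (p - 1)) * (3 * (1 + K)) * min ‖M‖ ‖ξ‖ ^ p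
      ≤ inner ℝ (flux p ξ - flux p (ξ - M)) (M + T) := by
  have hp1 : 0 < p - 1 := by linarith
  -- The error sees only the smaller of the two norms. If `|M| ≤ |ξ|`, Hölder continuity bounds the
  -- first difference by `2|M|^{p-1}`. If `|ξ| ≤ |M|`, it compares the fluxes of `ξ-M` and `-M`,
  -- which differ by at most `2|ξ|^{p-1}`.
  have hE : ‖flux p ξ - flux p (ξ - M) - flux p M‖ ≤ 3 * min ‖M‖ ‖ξ‖ ^ (p - 1) := by
    rcases le_total ‖M‖ ‖ξ‖ with h | h
    · rw [min_eq_left h]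
      have h1 := norm_flux_sub_le hp hp2 ξ (ξ - M)
      rw [sub_sub_cancel] at h1
      have h2 := norm_flux hp M
      have h3 := norm_sub_le (flux p ξ - flux p (ξ - M)) (flux p M)
      linarith
    · rw [min_eq_right h]
      have h1 := norm_flux_sub_le hp hp2 (ξ - M) (-M)
      rw [sub_neg_eq_add, sub_add_cancel, flux_neg] at h1
      have h2 := norm_flux hp ξ
      have h3 := norm_sub_le (flux p ξ) (flux p (ξ - M) - -flux p M)
      have e : flux p ξ - flux p (ξ - M) - flux p M
        = flux p ξ - (flux p (ξ - M) - -flux p M) := by abel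
      rw [e]
      linarith
  set m := min ‖M‖ ‖ξ‖ with hm
  have hm0 : 0 ≤ m := le_min (norm_nonneg _) (norm_nonneg _)
  have h1 : inner ℝ (flux p ξ - flux p (ξ - M)) (M + T)
      = ‖M‖ ^ p + ‖M‖ ^ (p - 2) * inner ℝ M T
        + inner ℝ (flux p ξ - flux p (ξ - M) - flux p M) (M + T) := by
    have e1 : inner ℝ (flux p M) T = ‖M‖ ^ (p - 2) * inner ℝ M T := by
      rw [flux, real_inner_smul_left]
    rw [inner_sub_left (flux p ξ - flux p (ξ - M)) (flux p M), inner_add_right (flux p M),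
      inner_flux_self hp, e1]
    ring
  have h2 : -(3 * m ^ (p - 1) * ((1 + K) * ‖M‖))
      ≤ inner ℝ (flux p ξ - flux p (ξ - M) - flux p M) (M + T) := by
    have h3 := abs_real_inner_le_norm (flux p ξ - flux p (ξ - M) - flux p M) (M + T)
    have h4 : ‖M + T‖ ≤ (1 + K) * ‖M‖ := by
      have := norm_add_le M T
      linarith
    have h5 : ‖flux p ξ - flux p (ξ - M) - flux p M‖ * ‖M + T‖
        ≤ 3 * m ^ (p - 1) * ((1 + K) * ‖M‖) := by gcongr
    linarith [neg_abs_le (inner ℝ (flux p ξ - flux p (ξ - M) - flux p M) (M + T))]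
  have h6 := young_flux hp (K := 3 * (1 + K)) (δ := 1 / 2) (a := m) (b := ‖M‖) (by positivity)
    (by norm_num) hm0 (norm_nonneg _)
  have h7 : 0 ≤ ‖M‖ ^ (p - 2) * inner ℝ M T := by positivity
  have e6 : 3 * (1 + K) / (1 / 2) = 6 * (1 + K) := by ring
  rw [e6] at h6
  rw [h1]
  nlinarith

end Flux

/-! ### Linear maps acting on the columns of a gradient, and the chain rule -/

section MatMap

variable {N n : ℕ}

/-- The `j`-th column of a matrix. -/
def matCol (M : Mat N n) (j : Fin n) : Vec N := WithLp.toLp 2 fun i => M (i, j)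

/-- A linear map applied to every column of a matrix. -/
def matMap (L : Vec N →L[ℝ] Vec N) (M : Mat N n) : Mat N n :=
  WithLp.toLp 2 fun ij => L (matCol M ij.2) ij.1

lemma inner_eq_sum_matCol (A M : Mat N n) :
    inner ℝ A M = ∑ j, inner ℝ (matCol A j) (matCol M j) := by
  simp only [PiLp.inner_apply, matCol]
  rw [Fintype.sum_prod_type, Finset.sum_comm]

lemma norm_sq_eq_sum_matCol (M : Mat N n) : ‖M‖ ^ 2 = ∑ j, ‖matCol M j‖ ^ 2 := by
  simp only [← real_inner_self_eq_norm_sq]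
  exact inner_eq_sum_matCol M M

lemma matCol_matMap (L : Vec N →L[ℝ] Vec N) (M : Mat N n) (j : Fin n) :
    matCol (matMap L M) j = L (matCol M j) := rfl

lemma norm_matMap_le (L : Vec N →L[ℝ] Vec N) (M : Mat N n) : ‖matMap L M‖ ≤ ‖L‖ * ‖M‖ := by
  refine le_of_sq_le_sq ?_ (by positivity)
  rw [mul_pow, norm_sq_eq_sum_matCol, norm_sq_eq_sum_matCol, Finset.mul_sum]
  refine Finset.sum_le_sum fun j _ => ?_
  rw [matCol_matMap, ← mul_pow]
  gcongr
  exact L.le_opNorm _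

lemma matCol_sub (A M : Mat N n) (j : Fin n) : matCol (A - M) j = matCol A j - matCol M j := rfl

lemma matMap_sub (L : Vec N →L[ℝ] Vec N) (A M : Mat N n) :
    matMap L (A - M) = matMap L A - matMap L M := by
  ext ij
  simp [matMap, matCol_sub]

lemma matMap_add_left (L L' : Vec N →L[ℝ] Vec N) (M : Mat N n) :
    matMap (L + L') M = matMap L M + matMap L' M := by
  ext ij
  simp [matMap]

lemma matMap_smul_left (c : ℝ) (L : Vec N →L[ℝ] Vec N) (M : Mat N n) :
    matMap (c • L) M = c • matMap L M := by
  ext ij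
  simp [matMap]

lemma matMap_id (M : Mat N n) : matMap (ContinuousLinearMap.id ℝ (Vec N)) M = M := rfl

/-- The linear map `h ↦ ⟪v, h⟫ v`. -/
def selfTensor (v : Vec N) : Vec N →L[ℝ] Vec N := (innerSL ℝ v).smulRight v

lemma selfTensor_apply (v h : Vec N) : selfTensor v h = inner ℝ v h • v := rfl

lemma norm_selfTensor_le (v : Vec N) : ‖selfTensor v‖ ≤ ‖v‖ ^ 2 := by
  refine ContinuousLinearMap.opNorm_le_bound _ (by positivity) fun h => ?_
  rw [selfTensor_apply, norm_smul]
  calc ‖(inner ℝ v h : ℝ)‖ * ‖v‖ ≤ (‖v‖ * ‖h‖) * ‖v‖ := by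
        gcongr; exact norm_inner_le_norm v h
    _ = _ := by ring

lemma inner_matMap_selfTensor_nonneg (v : Vec N) (M : Mat N n) :
    0 ≤ inner ℝ M (matMap (selfTensor v) M) := by
  rw [inner_eq_sum_matCol]
  refine Finset.sum_nonneg fun j _ => ?_
  rw [matCol_matMap, selfTensor_apply, real_inner_smul_right, real_inner_comm]
  exact mul_self_nonneg _

lemma continuous_selfTensor : Continuous (selfTensor : Vec N → _) := by
  have h : Continuous fun v : Vec N => ContinuousLinearMap.smulRightL ℝ (Vec N) (Vec N) (innerSL ℝ v) v := by
    fun_prop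
  exact h

lemma continuous_matCol (j : Fin n) : Continuous fun M : Mat N n => matCol M j := by
  unfold matCol
  fun_prop

lemma continuous_matMap :
    Continuous fun q : (Vec N →L[ℝ] Vec N) × Mat N n => matMap q.1 q.2 := by
  unfold matMap
  refine (PiLp.continuous_toLp 2 _).comp (continuous_pi fun ij => ?_)
  have h : Continuous fun q : (Vec N →L[ℝ] Vec N) × Mat N n => q.1 (matCol q.2 ij.2) :=
    continuous_fst.clm_apply ((continuous_matCol ij.2).comp continuous_snd)
  exact (EuclideanSpace.proj ij.1).continuous.comp h

/-- Chain rule for the spatial gradient. -/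
lemma spatialGrad_comp {g : Vec N → Vec N} {φ : Space n → Vec N} (hg : Differentiable ℝ g)
    (hφ : Differentiable ℝ φ) (x : Space n) :
    spatialGrad (fun y => g (φ y)) x = matMap (fderiv ℝ g (φ x)) (spatialGrad φ x) := by
  ext ij
  have h : fderiv ℝ (fun y => g (φ y)) x = (fderiv ℝ g (φ x)).comp (fderiv ℝ φ x) :=
    fderiv_comp x (hg _) (hφ _)
  simp only [spatialGrad, matMap, h]
  rfl

/-- Cauchy–Schwarz over the columns: the operator norm is at most the Frobenius norm. This transfers
the Sobolev inequality, formulated with the operator norm, to the gradients used here. -/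
lemma norm_fderiv_le_spatialGrad (φ : Space n → Vec N) (x : Space n) :
    ‖fderiv ℝ φ x‖ ≤ ‖spatialGrad φ x‖ := by
  refine ContinuousLinearMap.opNorm_le_bound _ (norm_nonneg _) fun h => ?_
  have e : fderiv ℝ φ x h = ∑ j, h j • matCol (spatialGrad φ x) j := by
    have h1 : h = ∑ j, h j • EuclideanSpace.single j (1 : ℝ) := by
      ext i
      simp [Finset.sum_apply, Pi.single_apply]
    conv_lhs => rw [h1]
    rw [map_sum]
    refine Finset.sum_congr rfl fun j _ => ?_
    rw [map_smul]
    rfl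
  rw [e]
  refine (norm_sum_le _ _).trans ?_
  refine le_of_sq_le_sq ?_ (by positivity)
  simp only [norm_smul]
  rw [mul_pow, norm_sq_eq_sum_matCol (spatialGrad φ x), EuclideanSpace.norm_sq_eq, mul_comm]
  exact Finset.sum_mul_sq_le_sq_mul_sq _ _ _

lemma continuous_spatialGrad {φ : Space n → Vec N} (hφ : ContDiff ℝ 1 φ) :
    Continuous (spatialGrad φ) := by
  unfold spatialGrad
  refine (PiLp.continuous_toLp 2 _).comp (continuous_pi fun ij => ?_)
  have h : Continuous fun x => fderiv ℝ φ x (EuclideanSpace.single ij.2 1) :=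
    (hφ.continuous_fderiv one_ne_zero).clm_apply continuous_const
  exact (EuclideanSpace.proj ij.1).continuous.comp h

end MatMap

/-! ### Convergence and pairings in `L^p` -/

section Lp

variable {α : Type*} [MeasurableSpace α] {μ : Measure α}

lemma tendsto_eLpNorm_zero_of_dominated {E : Type*} [NormedAddCommGroup E] {p : ℝ} (hp : 0 < p)
    {F : ℕ → α → E} {bound : α → ℝ} (hF : ∀ k, AEStronglyMeasurable (F k) μ)
    (hb : MemLp bound (ENNReal.ofReal p) μ) (h : ∀ k, ∀ᵐ x ∂μ, ‖F k x‖ ≤ bound x)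
    (hlim : ∀ᵐ x ∂μ, Tendsto (fun k => F k x) atTop (𝓝 0)) :
    Tendsto (fun k => eLpNorm (F k) (ENNReal.ofReal p) μ) atTop (𝓝 0) := by
  have h0 : ENNReal.ofReal p ≠ 0 := by simpa using hp
  simp only [eLpNorm_eq_lintegral_rpow_enorm_toReal h0 ENNReal.ofReal_ne_top,
    ENNReal.toReal_ofReal hp.le]
  have h1 : Tendsto (fun k => ∫⁻ x, ‖F k x‖ₑ ^ p ∂μ) atTop (𝓝 (∫⁻ _, 0 ∂μ)) := by
    refine tendsto_lintegral_of_dominated_convergence' (fun x => ‖bound x‖ₑ ^ p)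
      (fun k => (hF k).enorm.pow_const _) (fun k => ?_) ?_ ?_
    · filter_upwards [h k] with x hx
      gcongr
      rw [enorm_le_iff_norm_le]
      exact hx.trans (le_abs_self _)
    · have := hb.2
      rw [eLpNorm_lt_top_iff_lintegral_rpow_enorm_lt_top h0 ENNReal.ofReal_ne_top,
        ENNReal.toReal_ofReal hp.le] at this
      exact this.ne
    · filter_upwards [hlim] with x hx
      have h2 : Tendsto (fun k => ‖F k x‖ₑ) atTop (𝓝 0) := by
        have h4 := (continuous_enorm.tendsto (0 : E)).comp hx
        rwa [enorm_zero] at h4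
      have h3 := (ENNReal.continuous_rpow_const (y := p)).tendsto 0
      rw [ENNReal.zero_rpow_of_pos hp] at h3
      exact h3.comp h2
  rw [lintegral_zero] at h1
  have h3 := (ENNReal.continuous_rpow_const (y := 1 / p)).tendsto 0
  rw [ENNReal.zero_rpow_of_pos (by positivity)] at h3
  exact h3.comp h1

variable {E : Type*} [NormedAddCommGroup E] [InnerProductSpace ℝ E]

lemma eLpNorm_inner_le {p q : ℝ≥0∞} [ENNReal.HolderTriple p q 1] {f g : α → E}
    (hf : AEStronglyMeasurable f μ) (hg : AEStronglyMeasurable g μ) :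
    eLpNorm (fun x => (inner ℝ (f x) (g x) : ℝ)) 1 μ ≤ eLpNorm f p μ * eLpNorm g q μ := by
  have := eLpNorm_le_eLpNorm_mul_eLpNorm_of_nnnorm (r := 1) (p := p) (q := q) hf hg
    (fun a b => (inner ℝ a b : ℝ)) 1 (Eventually.of_forall fun x => by
      rw [one_mul]; exact nnnorm_inner_le_nnnorm _ _)
  simpa using this

lemma integrable_inner_of_memLp {p q : ℝ≥0∞} [ENNReal.HolderTriple p q 1] {f g : α → E}
    (hf : MemLp f p μ) (hg : MemLp g q μ) : Integrable (fun x => (inner ℝ (f x) (g x) : ℝ)) μ := by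
  rw [← memLp_one_iff_integrable]
  exact ⟨hf.1.inner hg.1,
    (eLpNorm_inner_le hf.1 hg.1).trans_lt (ENNReal.mul_lt_top hf.2 hg.2)⟩

lemma tendsto_integral_inner {p q : ℝ≥0∞} [ENNReal.HolderTriple p q 1] {f : α → E}
    {g : ℕ → α → E} {g₀ : α → E} (hf : MemLp f p μ) (hg : ∀ k, MemLp (g k) q μ)
    (hg₀ : MemLp g₀ q μ) (h : Tendsto (fun k => eLpNorm (g k - g₀) q μ) atTop (𝓝 0)) :
    Tendsto (fun k => ∫ x, (inner ℝ (f x) (g k x) : ℝ) ∂μ) atTop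
      (𝓝 (∫ x, (inner ℝ (f x) (g₀ x) : ℝ) ∂μ)) := by
  refine tendsto_integral_of_L1' _ (integrable_inner_of_memLp hf hg₀).1
    (Eventually.of_forall fun k => integrable_inner_of_memLp hf (hg k)) ?_
  have h1 : Tendsto (fun k => eLpNorm f p μ * eLpNorm (g k - g₀) q μ) atTop (𝓝 0) := by
    have := ENNReal.Tendsto.const_mul h (Or.inr hf.2.ne)
    rwa [mul_zero] at this
  refine tendsto_of_tendsto_of_tendsto_of_le_of_le tendsto_const_nhds h1 (fun _ => zero_le)
    fun k => ?_
  refine le_trans (le_of_eq ?_) (eLpNorm_inner_le hf.1 ((hg k).sub hg₀).1)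
  refine eLpNorm_congr_ae (Eventually.of_forall fun x => ?_)
  simp [inner_sub_right]

end Lp

/-! ### Bounded approximations of Lipschitz test fields -/

section Cutoff

variable {N : ℕ}

lemma norm_le_of_fderiv_le {g : Vec N → Vec N} (hg : ContDiff ℝ 1 g) (hg0 : g 0 = 0) {L : ℝ}
    (hL : ∀ y, ‖fderiv ℝ g y‖ ≤ L) (y : Vec N) : ‖g y‖ ≤ L * ‖y‖ := by
  have := Convex.norm_image_sub_le_of_norm_fderiv_le (𝕜 := ℝ) (f := g) (s := univ) (x := 0) (y := y)
    (fun x _ => (hg.differentiable one_ne_zero) x) (fun x _ => hL x) convex_univ trivial trivial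
  simpa [hg0] using this

/-- A smooth compactly supported map that is the identity near the origin. -/
lemma exists_smooth_truncation (N : ℕ) : ∃ (T : Vec N → Vec N) (K C : ℝ), ContDiff ℝ 1 T ∧ T 0 = 0 ∧
    (∀ y, ‖T y‖ ≤ C) ∧ (∀ y, ‖fderiv ℝ T y‖ ≤ K) ∧ ∀ᶠ y in 𝓝 (0 : Vec N), T y = y := by
  let χ : ContDiffBump (0 : Vec N) := ⟨1, 2, by norm_num, by norm_num⟩
  have h1 : ContDiff ℝ 1 fun y => χ y • y := (χ.contDiff (n := 1)).smul contDiff_id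
  have hc : HasCompactSupport fun y => χ y • y := χ.hasCompactSupport.smul_right
  obtain ⟨C, hC⟩ := hc.exists_bound_of_continuous h1.continuous
  obtain ⟨K, hK⟩ := (hc.fderiv (𝕜 := ℝ)).exists_bound_of_continuous (h1.continuous_fderiv one_ne_zero)
  refine ⟨fun y => χ y • y, K, C, h1, by simp, hC, hK, ?_⟩
  filter_upwards [closedBall_mem_nhds (0 : Vec N) (by norm_num : (0 : ℝ) < 1)] with y hy
  rw [χ.one_of_mem_closedBall hy, one_smul]

/-- A Lipschitz `C¹` map is a pointwise eventually constant limit of bounded `C¹` maps with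
uniformly bounded derivatives. -/
lemma exists_bounded_approx {g : Vec N → Vec N} (hg : ContDiff ℝ 1 g) (hg0 : g 0 = 0) {L : ℝ}
    (hL : ∀ y, ‖fderiv ℝ g y‖ ≤ L) : ∃ (G : ℕ → Vec N → Vec N) (K : ℝ),
      (∀ j, ContDiff ℝ 1 (G j) ∧ G j 0 = 0 ∧ (∃ C, ∀ y, ‖G j y‖ ≤ C) ∧
        ∀ y, ‖fderiv ℝ (G j) y‖ ≤ K) ∧
      ∀ y, ∀ᶠ j in atTop, G j y = g y ∧ fderiv ℝ (G j) y = fderiv ℝ g y := by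
  obtain ⟨T, K, C, hT, hT0, hTC, hTK, hTid⟩ := exists_smooth_truncation N
  have hL0 : 0 ≤ L := (norm_nonneg _).trans (hL 0)
  -- Dilating one fixed truncation keeps the derivative bound `K` uniform in `j`, while the region
  -- where the map is the identity grows to the whole space.
  let S : ℕ → Vec N → Vec N := fun j y => ((j : ℝ) + 1) • T (((j : ℝ) + 1)⁻¹ • y)
  have hS : ∀ j, ContDiff ℝ 1 (S j) := fun j => by fun_prop
  have hS0 : ∀ j, S j 0 = 0 := fun j => by simp [S, hT0]
  have hSd : ∀ j y, ‖fderiv ℝ (S j) y‖ ≤ K := by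
    intro j y
    have h1 : HasFDerivAt (S j) (((j : ℝ) + 1) • (fderiv ℝ T (((j : ℝ) + 1)⁻¹ • y)).comp
        (((j : ℝ) + 1)⁻¹ • ContinuousLinearMap.id ℝ (Vec N))) y := by
      have h2 : HasFDerivAt (fun y : Vec N => ((j : ℝ) + 1)⁻¹ • y)
        (((j : ℝ) + 1)⁻¹ • ContinuousLinearMap.id ℝ (Vec N)) y :=
        (((j : ℝ) + 1)⁻¹ • ContinuousLinearMap.id ℝ (Vec N)).hasFDerivAt
      exact (((hT.differentiable one_ne_zero) _).hasFDerivAt.comp y h2).const_smul ((j : ℝ) + 1)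
    rw [h1.fderiv, ContinuousLinearMap.comp_smul, smul_smul, mul_inv_cancel₀ (by positivity),
      one_smul, ContinuousLinearMap.comp_id]
    exact hTK _
  refine ⟨fun j y => g (S j y), L * K, fun j => ⟨hg.comp (hS j), by simp [hS0, hg0], ?_, ?_⟩, ?_⟩
  · refine ⟨L * (((j : ℝ) + 1) * C), fun y => (norm_le_of_fderiv_le hg hg0 hL _).trans ?_⟩
    gcongr
    simp only [S]
    rw [norm_smul, Real.norm_of_nonneg (by positivity)]
    gcongr
    exact hTC _
  · intro y
    have : fderiv ℝ (fun y => g (S j y)) y = (fderiv ℝ g (S j y)).comp (fderiv ℝ (S j) y) :=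
      fderiv_comp y ((hg.differentiable one_ne_zero) _) (((hS j).differentiable one_ne_zero) _)
    rw [this]
    refine (ContinuousLinearMap.opNorm_comp_le _ _).trans ?_
    gcongr
    · exact hL _
    · exact hSd _ _
  · intro y
    have ht : Tendsto (fun j : ℕ => ((j : ℝ) + 1)⁻¹ • y) atTop (𝓝 0) := by
      have : Tendsto (fun j : ℕ => ((j : ℝ) + 1)⁻¹) atTop (𝓝 0) := by
        simpa using tendsto_one_div_add_atTop_nhds_zero_nat (𝕜 := ℝ)
      simpa using this.smul_const y
    filter_upwards [ht.eventually hTid.eventually_nhds] with j hj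
    have hev : ∀ᶠ y' in 𝓝 y, S j y' = y' := by
      have hcont : Tendsto (fun y' : Vec N => ((j : ℝ) + 1)⁻¹ • y') (𝓝 y)
          (𝓝 (((j : ℝ) + 1)⁻¹ • y)) := (continuous_const_smul _).tendsto y
      filter_upwards [hcont.eventually hj] with y' hy'
      simp only [S]
      rw [hy', smul_smul, mul_inv_cancel₀ (by positivity), one_smul]
    have hev2 : (fun y' => g (S j y')) =ᶠ[𝓝 y] g := hev.mono fun y' hy' => by
      simp only [hy']
    exact ⟨hev2.self_of_nhds, hev2.fderiv_eq⟩

end Cutoff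

/-! ### Testing with functions of an element of `W₀^{1,p}` -/

section Spatial

variable {N n : ℕ} {p : ℝ} {U : Set (Space n)} {V : Space n → Vec N} {DV : Space n → Mat N n}

/-- Smooth approximations of an element of `W₀^{1,p}`, converging also almost everywhere. -/
lemma MemW1pZero.exists_seq (hp : 0 < p) (hV : MemW1pZero p U V DV)
    (hVm : AEStronglyMeasurable V (volume.restrict U)) :
    ∃ φ : ℕ → Space n → Vec N,
      (∀ k, ContDiff ℝ ∞ (φ k) ∧ HasCompactSupport (φ k) ∧ tsupport (φ k) ⊆ U) ∧
      (∀ᵐ x ∂volume.restrict U, Tendsto (fun k => φ k x) atTop (𝓝 (V x))) ∧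
      Tendsto (fun k => eLpNorm (fun x => spatialGrad (φ k) x - DV x) (ENNReal.ofReal p)
        (volume.restrict U)) atTop (𝓝 0) := by
  obtain ⟨φ, h1, h2, h3⟩ := hV
  have hm : TendstoInMeasure (volume.restrict U) φ atTop V :=
    tendstoInMeasure_of_tendsto_eLpNorm (p := ENNReal.ofReal p) (by simpa using hp)
      (fun k => (h1 k).1.continuous.aestronglyMeasurable) hVm h2
  obtain ⟨ns, hns, hae⟩ := hm.exists_seq_tendsto_ae
  exact ⟨fun k => φ (ns k), fun k => h1 _, hae, h3.comp hns.tendsto_atTop⟩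

variable {g : Vec N → Vec N} {L : ℝ}

lemma aestronglyMeasurable_matMap {α : Type*} [MeasurableSpace α] {μ : Measure α}
    (hg : ContDiff ℝ 1 g) {V : α → Vec N} {W : α → Mat N n}
    (hV : AEStronglyMeasurable V μ) (hW : AEStronglyMeasurable W μ) :
    AEStronglyMeasurable (fun x => matMap (fderiv ℝ g (V x)) (W x)) μ :=
  continuous_matMap.comp_aestronglyMeasurable
    (((hg.continuous_fderiv one_ne_zero).comp_aestronglyMeasurable hV).prodMk hW)

lemma memLp_matMap {α : Type*} [MeasurableSpace α] {μ : Measure α} {q : ℝ≥0∞}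
    (hg : ContDiff ℝ 1 g) (hL : ∀ y, ‖fderiv ℝ g y‖ ≤ L) {V : α → Vec N} {W : α → Mat N n}
    (hV : AEStronglyMeasurable V μ) (hW : MemLp W q μ) :
    MemLp (fun x => matMap (fderiv ℝ g (V x)) (W x)) q μ := by
  have hL0 : 0 ≤ L := (norm_nonneg _).trans (hL 0)
  refine hW.of_le_mul (c := L) (aestronglyMeasurable_matMap hg hV hW.1)
    (Eventually.of_forall fun x => (norm_matMap_le _ _).trans ?_)
  gcongr
  exact hL _

/-- The difference is `Dg(φ_k)(W_k - DV)` plus `(Dg(φ_k) - Dg(V))DV`. The first part is small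
because `Dg` is bounded, the second by dominated convergence with majorant `2L|DV|`. -/
lemma tendsto_eLpNorm_matMap_zero {α : Type*} [MeasurableSpace α] {μ : Measure α} (hp : 1 ≤ p)
    (hg : ContDiff ℝ 1 g) (hL : ∀ y, ‖fderiv ℝ g y‖ ≤ L)
    {V : α → Vec N} {DV : α → Mat N n} {φ : ℕ → α → Vec N} {W : ℕ → α → Mat N n}
    (hφ : ∀ k, AEStronglyMeasurable (φ k) μ) (hW : ∀ k, AEStronglyMeasurable (W k) μ)
    (hVm : AEStronglyMeasurable V μ) (hDV : MemLp DV (ENNReal.ofReal p) μ)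
    (h1 : ∀ᵐ x ∂μ, Tendsto (fun k => φ k x) atTop (𝓝 (V x)))
    (h2 : Tendsto (fun k => eLpNorm (fun x => W k x - DV x) (ENNReal.ofReal p) μ) atTop (𝓝 0)) :
    Tendsto (fun k => eLpNorm ((fun x => matMap (fderiv ℝ g (φ k x)) (W k x)) -
      fun x => matMap (fderiv ℝ g (V x)) (DV x)) (ENNReal.ofReal p) μ) atTop (𝓝 0) := by
  have hL0 : 0 ≤ L := (norm_nonneg _).trans (hL 0)
  have hp0 : 0 < p := by linarith
  have hdom : Tendsto (fun k => eLpNorm (fun x =>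
      matMap (fderiv ℝ g (φ k x)) (DV x) - matMap (fderiv ℝ g (V x)) (DV x))
      (ENNReal.ofReal p) μ) atTop (𝓝 0) := by
    refine tendsto_eLpNorm_zero_of_dominated hp0 (bound := fun x => 2 * L * ‖DV x‖)
      (fun k => (aestronglyMeasurable_matMap hg (hφ k) hDV.1).sub
        (aestronglyMeasurable_matMap hg hVm hDV.1)) (hDV.norm.const_mul _)
      (fun k => Eventually.of_forall fun x => ?_) ?_
    · refine (norm_sub_le _ _).trans ?_
      have h3 := norm_matMap_le (fderiv ℝ g (φ k x)) (DV x)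
      have h4 := norm_matMap_le (fderiv ℝ g (V x)) (DV x)
      have h5 := hL (φ k x)
      have h6 := hL (V x)
      have h7 := norm_nonneg (DV x)
      nlinarith
    · filter_upwards [h1] with x hx
      have h3 : Tendsto (fun k => fderiv ℝ g (φ k x)) atTop (𝓝 (fderiv ℝ g (V x))) :=
        ((hg.continuous_fderiv one_ne_zero).tendsto _).comp hx
      have h4 : Tendsto (fun k => matMap (fderiv ℝ g (φ k x)) (DV x)) atTop
          (𝓝 (matMap (fderiv ℝ g (V x)) (DV x))) :=
        (continuous_matMap.tendsto (fderiv ℝ g (V x), DV x)).comp (h3.prodMk_nhds tendsto_const_nhds)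
      simpa using h4.sub_const (matMap (fderiv ℝ g (V x)) (DV x))
  have hlin : Tendsto (fun k => ENNReal.ofReal L *
      eLpNorm (fun x => W k x - DV x) (ENNReal.ofReal p) μ) atTop (𝓝 0) := by
    have := ENNReal.Tendsto.const_mul h2 (Or.inr (ENNReal.ofReal_ne_top (r := L)))
    rwa [mul_zero] at this
  have hsum := hlin.add hdom
  rw [add_zero] at hsum
  refine tendsto_of_tendsto_of_tendsto_of_le_of_le tendsto_const_nhds hsum (fun _ => zero_le)
    fun k => ?_
  have e : ((fun x => matMap (fderiv ℝ g (φ k x)) (W k x)) -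
      fun x => matMap (fderiv ℝ g (V x)) (DV x)) =
      (fun x => matMap (fderiv ℝ g (φ k x)) (W k x - DV x)) +
      fun x => matMap (fderiv ℝ g (φ k x)) (DV x) - matMap (fderiv ℝ g (V x)) (DV x) := by
    funext x
    simp only [Pi.sub_apply, Pi.add_apply, matMap_sub]
    abel
  rw [e]
  refine (eLpNorm_add_le (aestronglyMeasurable_matMap hg (hφ k) ((hW k).sub hDV.1))
    ((aestronglyMeasurable_matMap hg (hφ k) hDV.1).sub
        (aestronglyMeasurable_matMap hg hVm hDV.1)) (by simpa using hp)).trans ?_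
  refine add_le_add ?_ le_rfl
  refine eLpNorm_le_mul_eLpNorm_of_ae_le_mul (Eventually.of_forall fun x => ?_) _
  refine (norm_matMap_le _ _).trans ?_
  exact mul_le_mul_of_nonneg_right (hL _) (norm_nonneg _)

lemma memLp_spatialGrad {φ : Space n → Vec N} (hφ : ContDiff ℝ 1 φ) (hc : HasCompactSupport φ)
    (q : ℝ≥0∞) (μ : Measure (Space n)) [IsFiniteMeasureOnCompacts μ] :
    MemLp (spatialGrad φ) q μ := by
  refine (continuous_spatialGrad hφ).memLp_of_hasCompactSupport ?_
  refine (hc.fderiv (𝕜 := ℝ)).mono' fun x hx => subset_tsupport _ ?_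
  contrapose! hx
  rw [Function.notMem_support] at hx ⊢
  ext ij
  simp [spatialGrad, hx]

/-- The distributional identity `z = div K`, tested with a bounded `C¹` function of `V`. -/
lemma integral_inner_comp_of_bounded {q : ℝ} (hpq : p.HolderConjugate q)
    (hUf : volume U ≠ ⊤) (hV : MemW1pZero p U V DV)
    (hVm : AEStronglyMeasurable V (volume.restrict U))
    (hDV : MemLp DV (ENNReal.ofReal p) (volume.restrict U))
    {z : Space n → Vec N} {K : Space n → Mat N n} (hz : MemLp z 2 (volume.restrict U))
    (hK : MemLp K (ENNReal.ofReal q) (volume.restrict U))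
    (h : ∀ ψ : Space n → Vec N, ContDiff ℝ 1 ψ → HasCompactSupport ψ → tsupport ψ ⊆ U →
      ∫ x in U, (inner ℝ (z x) (ψ x) : ℝ) = -∫ x in U, (inner ℝ (K x) (spatialGrad ψ x) : ℝ))
    (hg : ContDiff ℝ 1 g) (hg0 : g 0 = 0) (hL : ∀ y, ‖fderiv ℝ g y‖ ≤ L)
    {C : ℝ} (hC : ∀ y, ‖g y‖ ≤ C) :
    ∫ x in U, (inner ℝ (z x) (g (V x)) : ℝ) =
      -∫ x in U, (inner ℝ (K x) (matMap (fderiv ℝ g (V x)) (DV x)) : ℝ) := by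
  have : IsFiniteMeasure (volume.restrict U) := ⟨by simpa using hUf.lt_top⟩
  have hpq' := hpq.ennrealOfReal.symm
  obtain ⟨φ, hφ, hae, hgrad⟩ := hV.exists_seq hpq.pos hVm
  have hφ1 : ∀ k, ContDiff ℝ 1 (φ k) := fun k => (hφ k).1.of_le (by exact_mod_cast le_top)
  have hgφ : ∀ k, ContDiff ℝ 1 fun x => g (φ k x) := fun k => hg.comp (hφ1 k)
  have hgc : ∀ k, HasCompactSupport fun x => g (φ k x) := fun k => (hφ k).2.1.comp_left hg0
  have eq1 : ∀ k, ∫ x in U, (inner ℝ (z x) (g (φ k x)) : ℝ) =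
      -∫ x in U, (inner ℝ (K x) (matMap (fderiv ℝ g (φ k x)) (spatialGrad (φ k) x)) : ℝ) := by
    intro k
    rw [h _ (hgφ k) (hgc k) ((tsupport_comp_subset hg0 (φ k)).trans (hφ k).2.2)]
    congr 2 with x
    rw [spatialGrad_comp (hg.differentiable one_ne_zero) ((hφ1 k).differentiable one_ne_zero)]
  have hconv := tendsto_eLpNorm_matMap_zero hpq.lt.le hg hL
    (fun k => (hφ k).1.continuous.aestronglyMeasurable)
    (fun k => (continuous_spatialGrad (hφ1 k)).aestronglyMeasurable) hVm hDV hae hgrad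
  have t2 := tendsto_integral_inner hK (fun k => memLp_matMap hg hL
    (hφ k).1.continuous.aestronglyMeasurable (memLp_spatialGrad (hφ1 k) (hφ k).2.1 _ _))
    (memLp_matMap hg hL hVm hDV) hconv
  -- The approximations are known to converge only in `L^p` and almost everywhere, while `z` lies in
  -- `L²`; the bound on `g` provides the majorant. For unbounded `g` the approximating fields are
  -- afterwards evaluated at `V ∈ L²` itself, where `|z||V|` is a majorant.
  have t1 : Tendsto (fun k => ∫ x in U, (inner ℝ (z x) (g (φ k x)) : ℝ)) atTop
      (𝓝 (∫ x in U, (inner ℝ (z x) (g (V x)) : ℝ))) := by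
    refine tendsto_integral_of_dominated_convergence (fun x => ‖z x‖ * C)
      (fun k => hz.1.inner (hgφ k).continuous.aestronglyMeasurable)
      ((hz.integrable (by norm_num)).norm.mul_const _) (fun k => Eventually.of_forall fun x => ?_) ?_
    · refine (norm_inner_le_norm _ _).trans ?_
      gcongr
      exact hC _
    · filter_upwards [hae] with x hx
      exact ((continuous_const.inner hg.continuous).tendsto (V x)).comp hx
  simp only [eq1] at t1
  exact tendsto_nhds_unique t1 t2.neg

/-- The distributional identity `z = div K`, tested with a Lipschitz `C¹` function of `V`. -/
lemma integral_inner_comp {q : ℝ} (hpq : p.HolderConjugate q)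
    (hUf : volume U ≠ ⊤) (hV : MemW1pZero p U V DV) (hV2 : MemLp V 2 (volume.restrict U))
    (hDV : MemLp DV (ENNReal.ofReal p) (volume.restrict U))
    {z : Space n → Vec N} {K : Space n → Mat N n} (hz : MemLp z 2 (volume.restrict U))
    (hK : MemLp K (ENNReal.ofReal q) (volume.restrict U))
    (h : ∀ ψ : Space n → Vec N, ContDiff ℝ 1 ψ → HasCompactSupport ψ → tsupport ψ ⊆ U →
      ∫ x in U, (inner ℝ (z x) (ψ x) : ℝ) = -∫ x in U, (inner ℝ (K x) (spatialGrad ψ x) : ℝ))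
    (hg : ContDiff ℝ 1 g) (hg0 : g 0 = 0) (hL : ∀ y, ‖fderiv ℝ g y‖ ≤ L) :
    ∫ x in U, (inner ℝ (z x) (g (V x)) : ℝ) =
      -∫ x in U, (inner ℝ (K x) (matMap (fderiv ℝ g (V x)) (DV x)) : ℝ) := by
  obtain ⟨G, C, hG, hGlim⟩ := exists_bounded_approx hg hg0 hL
  have hpq' := hpq.ennrealOfReal.symm
  have eq1 : ∀ j, ∫ x in U, (inner ℝ (z x) (G j (V x)) : ℝ) =
      -∫ x in U, (inner ℝ (K x) (matMap (fderiv ℝ (G j) (V x)) (DV x)) : ℝ) := by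
    intro j
    obtain ⟨h1, h2, ⟨B, hB⟩, h4⟩ := hG j
    exact integral_inner_comp_of_bounded hpq hUf hV hV2.1 hDV hz hK h h1 h2 h4 hB
  have t1 : Tendsto (fun j => ∫ x in U, (inner ℝ (z x) (G j (V x)) : ℝ)) atTop
      (𝓝 (∫ x in U, (inner ℝ (z x) (g (V x)) : ℝ))) := by
    refine tendsto_integral_of_dominated_convergence (fun x => C * (‖z x‖ * ‖V x‖))
      (fun j => hz.1.inner ((hG j).1.continuous.comp_aestronglyMeasurable hV2.1))
      ((hz.norm.integrable_mul hV2.norm).const_mul C)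
      (fun j => Eventually.of_forall fun x => ?_) (Eventually.of_forall fun x => ?_)
    · refine (norm_inner_le_norm _ _).trans ?_
      have := norm_le_of_fderiv_le (hG j).1 (hG j).2.1 (hG j).2.2.2 (V x)
      calc ‖z x‖ * ‖G j (V x)‖ ≤ ‖z x‖ * (C * ‖V x‖) := by gcongr
        _ = _ := by ring
    · refine tendsto_const_nhds.congr' ?_
      filter_upwards [hGlim (V x)] with j hj
      rw [hj.1]
  have t2 : Tendsto (fun j => ∫ x in U,
      (inner ℝ (K x) (matMap (fderiv ℝ (G j) (V x)) (DV x)) : ℝ)) atTop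
      (𝓝 (∫ x in U, (inner ℝ (K x) (matMap (fderiv ℝ g (V x)) (DV x)) : ℝ))) := by
    refine tendsto_integral_of_dominated_convergence (fun x => C * (‖K x‖ * ‖DV x‖))
      (fun j => hK.1.inner (aestronglyMeasurable_matMap (hG j).1 hV2.1 hDV.1))
      ((hK.norm.integrable_mul hDV.norm).const_mul C)
      (fun j => Eventually.of_forall fun x => ?_) (Eventually.of_forall fun x => ?_)
    · refine (norm_inner_le_norm _ _).trans ?_
      have h1 := norm_matMap_le (fderiv ℝ (G j) (V x)) (DV x)
      have h2 := (hG j).2.2.2 (V x)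
      calc ‖K x‖ * ‖matMap (fderiv ℝ (G j) (V x)) (DV x)‖
          ≤ ‖K x‖ * (C * ‖DV x‖) := by gcongr; exact h1.trans (by gcongr)
        _ = _ := by ring
    · refine tendsto_const_nhds.congr' ?_
      filter_upwards [hGlim (V x)] with j hj
      rw [hj.2]
  simp only [eq1] at t1
  exact tendsto_nhds_unique t1 t2.neg

/-- The Sobolev inequality for a `C¹` function of an element of `W₀^{1,p}`. -/
lemma MemW1pZero.eLpNorm_comp_le {p q : ℝ≥0} (hp : 1 ≤ p) (hn : 0 < n)
    (hq : (q : ℝ)⁻¹ = (p : ℝ)⁻¹ - (n : ℝ)⁻¹) (hV : MemW1pZero p U V DV)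
    (hVm : AEStronglyMeasurable V (volume.restrict U))
    (hDV : MemLp DV p (volume.restrict U))
    (hg : ContDiff ℝ 1 g) (hg0 : g 0 = 0) (hL : ∀ y, ‖fderiv ℝ g y‖ ≤ L) :
    eLpNorm (fun x => g (V x)) q (volume.restrict U) ≤
      SNormLESNormFDerivOfEqConst (E := Space n) (Vec N) volume p *
        eLpNorm (fun x => matMap (fderiv ℝ g (V x)) (DV x)) p (volume.restrict U) := by
  have hp1 : (1 : ℝ) ≤ p := by exact_mod_cast hp
  have ep : ENNReal.ofReal (p : ℝ) = p := by simp
  obtain ⟨φ, hφ, hae, hgrad⟩ := hV.exists_seq (by linarith) hVm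
  have hφ1 : ∀ k, ContDiff ℝ 1 (φ k) := fun k => (hφ k).1.of_le (by exact_mod_cast le_top)
  have hgφ : ∀ k, ContDiff ℝ 1 fun x => g (φ k x) := fun k => hg.comp (hφ1 k)
  have hgc : ∀ k, HasCompactSupport fun x => g (φ k x) := fun k => (hφ k).2.1.comp_left hg0
  have hconv := tendsto_eLpNorm_matMap_zero hp1 hg hL
    (fun k => (hφ k).1.continuous.aestronglyMeasurable)
    (fun k => (continuous_spatialGrad (hφ1 k)).aestronglyMeasurable) hVm
    (by rwa [ep]) hae hgrad
  rw [ep] at hconv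
  set C := SNormLESNormFDerivOfEqConst (E := Space n) (Vec N) volume p
  set A := fun x => matMap (fderiv ℝ g (V x)) (DV x) with hA
  have hbound : ∀ k, eLpNorm (fun x => g (φ k x)) q (volume.restrict U) ≤
      C * (eLpNorm ((fun x => matMap (fderiv ℝ g (φ k x)) (spatialGrad (φ k) x)) - A) p
        (volume.restrict U) + eLpNorm A p (volume.restrict U)) := by
    intro k
    have h1 := eLpNorm_le_eLpNorm_fderiv_of_eq (F := Vec N) (volume : Measure (Space n)) (hgφ k)
      (hgc k) hp (by simpa using hn) (p' := q) (by simpa using hq)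
    have hts : tsupport (fun x => g (φ k x)) ⊆ U :=
      (tsupport_comp_subset hg0 (φ k)).trans (hφ k).2.2
    have h2 : eLpNorm (fderiv ℝ fun x => g (φ k x)) p volume ≤
        eLpNorm (fun x => matMap (fderiv ℝ g (φ k x)) (spatialGrad (φ k) x)) p
          (volume.restrict U) := by
      rw [← eLpNorm_restrict_eq_of_support_subset
        ((support_fderiv_subset ℝ).trans hts) (f := fderiv ℝ fun x => g (φ k x))]
      refine eLpNorm_mono fun x => ?_
      rw [← spatialGrad_comp (hg.differentiable one_ne_zero) ((hφ1 k).differentiable one_ne_zero)]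
      exact norm_fderiv_le_spatialGrad _ _
    refine ((eLpNorm_mono_measure _ Measure.restrict_le_self).trans h1).trans ?_
    gcongr
    refine h2.trans ?_
    have h3 := eLpNorm_add_le (μ := volume.restrict U) (p := p)
      (((aestronglyMeasurable_matMap hg ((hφ k).1.continuous.aestronglyMeasurable)
        (continuous_spatialGrad (hφ1 k)).aestronglyMeasurable)).sub
        (aestronglyMeasurable_matMap hg hVm hDV.1)) (aestronglyMeasurable_matMap hg hVm hDV.1)
      (by exact_mod_cast hp)
    refine le_trans (le_of_eq ?_) h3
    congr 1
    funext x
    simp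
  have hlim : Tendsto (fun k => C * (eLpNorm ((fun x => matMap (fderiv ℝ g (φ k x))
      (spatialGrad (φ k) x)) - A) p (volume.restrict U) + eLpNorm A p (volume.restrict U)))
      atTop (𝓝 (C * eLpNorm A p (volume.restrict U))) := by
    have h1 := hconv.add (tendsto_const_nhds (x := eLpNorm A p (volume.restrict U)))
    rw [zero_add] at h1
    exact ENNReal.Tendsto.const_mul h1 (Or.inr ENNReal.coe_ne_top)
  -- Fatou's lemma: almost everywhere convergence of `g(φ_k)` suffices on the left, so no
  -- convergence in `L^q` is needed.
  have hfat := Lp.eLpNorm_lim_le_liminf_eLpNorm (p := q) (μ := volume.restrict U)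
    (fun k => (hgφ k).continuous.aestronglyMeasurable) (fun x => g (V x)) (by
      filter_upwards [hae] with x hx
      exact (hg.continuous.tendsto _).comp hx)
  refine hfat.trans ?_
  rw [← hlim.liminf_eq]
  exact liminf_le_liminf (Eventually.of_forall hbound)

end Spatial

/-! ### Time slices and time integrals of functions on a product -/

section Sections

variable {α β : Type*} [MeasurableSpace α] [MeasurableSpace β] {μ : Measure α} {ν : Measure β}
  {E : Type*} [NormedAddCommGroup E]

lemma memLp_ae_section [SFinite μ] [SFinite ν] {q : ℝ} (hq : 0 < q) {H : α × β → E}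
    (hH : MemLp H (ENNReal.ofReal q) (μ.prod ν)) :
    ∀ᵐ s ∂μ, MemLp (fun x => H (s, x)) (ENNReal.ofReal q) ν := by
  have h0 : ENNReal.ofReal q ≠ 0 := by simpa using hq
  have h1 := hH.2
  rw [eLpNorm_lt_top_iff_lintegral_rpow_enorm_lt_top h0 ENNReal.ofReal_ne_top,
    lintegral_prod _ (hH.1.enorm.pow_const _)] at h1
  have h2 := ae_lt_top' ((hH.1.enorm.pow_const _).lintegral_prod_right') h1.ne
  filter_upwards [h2, hH.1.prodMk_left] with s hs hm
  refine ⟨hm, ?_⟩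
  rw [eLpNorm_lt_top_iff_lintegral_rpow_enorm_lt_top h0 ENNReal.ofReal_ne_top]
  exact hs

/-- Hölder's inequality in the finite measure variable `s`. With `H` a flux on a time slab this
provides the spatial flux `K(x) = ∫ H(s,x) ds` of a single time step. -/
lemma memLp_section_integral [NormedSpace ℝ E] [IsFiniteMeasure μ] [SFinite ν] {q : ℝ} (hq : 1 ≤ q)
    {H : α × β → E} (hH : MemLp H (ENNReal.ofReal q) (μ.prod ν)) :
    MemLp (fun x => ∫ s, H (s, x) ∂μ) (ENNReal.ofReal q) ν := by
  have hq0 : 0 < q := by linarith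
  have h0 : ENNReal.ofReal q ≠ 0 := by simpa using hq0
  have hsw : MemLp (fun z : β × α => H z.swap) (ENNReal.ofReal q) (ν.prod μ) :=
    hH.comp_measurePreserving Measure.measurePreserving_swap
  refine ⟨hsw.1.integral_prod_right', ?_⟩
  rw [eLpNorm_lt_top_iff_lintegral_rpow_enorm_lt_top h0 ENNReal.ofReal_ne_top,
    ENNReal.toReal_ofReal hq0.le]
  have h1 := hsw.2
  rw [eLpNorm_lt_top_iff_lintegral_rpow_enorm_lt_top h0 ENNReal.ofReal_ne_top,
    ENNReal.toReal_ofReal hq0.le, lintegral_prod _ (hsw.1.enorm.pow_const _)] at h1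
  have h2 : ∀ᵐ x ∂ν, ‖∫ s, H (s, x) ∂μ‖ₑ ^ q ≤
      (μ univ ^ (1 / (1 : ℝ≥0∞).toReal - 1 / q)) ^ q * ∫⁻ s, ‖H (s, x)‖ₑ ^ q ∂μ := by
    filter_upwards [hsw.1.prodMk_left] with x hm
    have h3 := eLpNorm_le_eLpNorm_mul_rpow_measure_univ (p := 1) (q := ENNReal.ofReal q)
      (by simpa using hq) hm
    rw [eLpNorm_one_eq_lintegral_enorm, eLpNorm_eq_lintegral_rpow_enorm_toReal h0
      ENNReal.ofReal_ne_top, ENNReal.toReal_ofReal hq0.le] at h3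
    have h4 := (enorm_integral_le_lintegral_enorm _).trans h3
    refine (ENNReal.rpow_le_rpow h4 hq0.le).trans ?_
    rw [ENNReal.mul_rpow_of_nonneg _ _ hq0.le, ← ENNReal.rpow_mul, one_div_mul_cancel hq0.ne',
      ENNReal.rpow_one, mul_comm]
    rfl
  refine (lintegral_mono_ae h2).trans_lt ?_
  have hm : AEMeasurable (fun x => ∫⁻ s, ‖H (s, x)‖ₑ ^ q ∂μ) ν :=
    (hsw.1.enorm.pow_const _).lintegral_prod_right'
  rw [lintegral_const_mul'' _ hm]
  refine ENNReal.mul_lt_top (ENNReal.rpow_lt_top_of_nonneg hq0.le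
    (ENNReal.rpow_ne_top_of_nonneg ?_ (measure_ne_top _ _))) h1
  have : 1 / q ≤ 1 := by rw [div_le_one hq0]; exact hq
  simpa using this

lemma integral_inner_section [InnerProductSpace ℝ E] [CompleteSpace E] [IsFiniteMeasure μ]
    [SFinite ν] {p q : ℝ} (hpq : p.HolderConjugate q) {H : α × β → E} {W : β → E}
    (hH : MemLp H (ENNReal.ofReal q) (μ.prod ν)) (hW : MemLp W (ENNReal.ofReal p) ν) :
    ∫ x, (inner ℝ (∫ s, H (s, x) ∂μ) (W x) : ℝ) ∂ν =
      ∫ s, ∫ x, (inner ℝ (H (s, x)) (W x) : ℝ) ∂ν ∂μ := by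
  have hpq' := hpq.symm.ennrealOfReal
  have hint : Integrable (fun z : α × β => (inner ℝ (H z) (W z.2) : ℝ)) (μ.prod ν) :=
    integrable_inner_of_memLp hH (hW.comp_snd μ)
  rw [integral_integral_swap (f := fun s x => (inner ℝ (H (s, x)) (W x) : ℝ)) hint]
  have hsw : MemLp (fun z : β × α => H z.swap) (ENNReal.ofReal q) (ν.prod μ) :=
    hH.comp_measurePreserving Measure.measurePreserving_swap
  refine integral_congr_ae ?_
  filter_upwards [memLp_ae_section hpq.symm.pos hsw] with x hx
  have hx1 : Integrable (fun s => H (s, x)) μ := hx.integrable (by simpa using hpq.symm.lt.le)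
  simp only [real_inner_comm (W x)]
  rw [← integral_inner hx1]

end Sections

/-! ### Time translations -/

section Translation

variable {n : ℕ} {E : Type*} [NormedAddCommGroup E]

/-- Continuity of time translations in `L^q`. -/
lemma tendsto_eLpNorm_time_translate {q : ℝ≥0∞} (hq : 1 ≤ q) (hq' : q ≠ ⊤) {H : ℝ × Space n → E}
    (hH : MemLp H q volume) :
    Tendsto (fun r : ℝ => eLpNorm (fun z : ℝ × Space n => H (z.1 - r, z.2) - H z) q volume)
      (𝓝 0) (𝓝 0) := by
  have : Fact (1 ≤ q) := ⟨hq⟩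
  let g : ℝ → C(ℝ × Space n, ℝ × Space n) := fun r => ⟨fun z => (z.1 - r, z.2), by fun_prop⟩
  have hg : Continuous g := by
    let F : C(ℝ × (ℝ × Space n), ℝ × Space n) := ⟨fun y => (y.2.1 - y.1, y.2.2), by fun_prop⟩
    exact F.curry.continuous
  have hmp : ∀ r, MeasurePreserving (g r) (volume : Measure (ℝ × Space n)) volume := fun r =>
    (measurePreserving_sub_right (volume : Measure ℝ) r).prod
      (MeasurePreserving.id (volume : Measure (Space n)))
  have h1 := Filter.Tendsto.compMeasurePreservingLp (f := fun _ : ℝ => hH.toLp H)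
    (tendsto_const_nhds (f := 𝓝 (0 : ℝ))) (hg.tendsto 0) hmp (hmp 0) hq'
  rw [tendsto_iff_edist_tendsto_0] at h1
  refine h1.congr fun r => ?_
  rw [Lp.toLp_compMeasurePreserving, Lp.toLp_compMeasurePreserving, Lp.edist_toLp_toLp]
  congr 1
  funext z
  simp [g]

/-- Substituting `s = t - r` and exchanging the order of integration leaves, for each `r ∈ (0,h)`, a
pairing bounded by Hölder's inequality. Hence replacing `H(s)` by `H(t)` in a step of length `h`
costs in total `h` times a quantity that is small with `h`. -/
lemma lintegral_time_translate_le {p q : ℝ} (hpq : p.HolderConjugate q) {H W : ℝ × Space n → E}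
    (hHm : StronglyMeasurable H)
    (hWm : StronglyMeasurable W) {h : ℝ} {m : ℝ≥0∞}
    (hm0 : ∀ r ∈ Ioo 0 h, eLpNorm (fun z : ℝ × Space n => H (z.1 - r, z.2) - H z)
      (ENNReal.ofReal q) volume ≤ m) :
    ∫⁻ t, ∫⁻ s in Ioo (t - h) t, ∫⁻ x, ‖H (s, x) - H (t, x)‖ₑ * ‖W (t, x)‖ₑ ≤
      ENNReal.ofReal h * (m * eLpNorm W (ENNReal.ofReal p) volume) := by
  have hpq' := hpq.symm.ennrealOfReal
  have hm : StronglyMeasurable fun y : ℝ × ℝ × Space n => H (y.2.1 - y.1, y.2.2) - H y.2 := by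
    refine (hHm.comp_measurable ?_).sub (hHm.comp_measurable measurable_snd)
    fun_prop
  have hm2 : Measurable fun y : ℝ × ℝ × Space n =>
      ‖H (y.2.1 - y.1, y.2.2) - H y.2‖ₑ * ‖W y.2‖ₑ :=
    hm.enorm.mul (hWm.comp_measurable measurable_snd).enorm
  have e1 : ∀ t, ∫⁻ s in Ioo (t - h) t, ∫⁻ x, ‖H (s, x) - H (t, x)‖ₑ * ‖W (t, x)‖ₑ =
      ∫⁻ r in Ioo 0 h, ∫⁻ x, ‖H (t - r, x) - H (t, x)‖ₑ * ‖W (t, x)‖ₑ := by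
    intro t
    rw [← lintegral_indicator measurableSet_Ioo, ← lintegral_indicator measurableSet_Ioo,
      ← lintegral_sub_left_eq_self _ t]
    refine lintegral_congr fun r => ?_
    by_cases hr : r ∈ Ioo 0 h
    · rw [indicator_of_mem hr, indicator_of_mem]
      exact ⟨by linarith [hr.2], by linarith [hr.1]⟩
    · rw [indicator_of_notMem hr, indicator_of_notMem]
      exact fun h' => hr ⟨by linarith [h'.2], by linarith [h'.1]⟩
  simp_rw [e1]
  have hm3 : Measurable fun y : ℝ × ℝ =>
      ∫⁻ x, ‖H (y.1 - y.2, x) - H (y.1, x)‖ₑ * ‖W (y.1, x)‖ₑ := by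
    have : Measurable fun y : (ℝ × ℝ) × Space n =>
        ‖H (y.1.1 - y.1.2, y.2) - H (y.1.1, y.2)‖ₑ * ‖W (y.1.1, y.2)‖ₑ := by
      refine hm2.comp (g := fun y : ℝ × ℝ × Space n =>
        ‖H (y.2.1 - y.1, y.2.2) - H y.2‖ₑ * ‖W y.2‖ₑ)
        (f := fun y : (ℝ × ℝ) × Space n => (y.1.2, y.1.1, y.2)) ?_
      fun_prop
    exact this.lintegral_prod_right'
  rw [lintegral_lintegral_swap hm3.aemeasurable]
  have e2 : ∀ r ∈ Ioo 0 h, ∫⁻ t, ∫⁻ x, ‖H (t - r, x) - H (t, x)‖ₑ * ‖W (t, x)‖ₑ ≤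
      m * eLpNorm W (ENNReal.ofReal p) volume := by
    intro r hr
    have hm4 : Measurable fun z : ℝ × Space n => ‖H (z.1 - r, z.2) - H z‖ₑ * ‖W z‖ₑ :=
      hm2.comp measurable_prodMk_left
    have e3 : ∫⁻ t, ∫⁻ x, ‖H (t - r, x) - H (t, x)‖ₑ * ‖W (t, x)‖ₑ =
        ∫⁻ z : ℝ × Space n, ‖H (z.1 - r, z.2) - H z‖ₑ * ‖W z‖ₑ :=
      (lintegral_prod _ hm4.aemeasurable).symm
    rw [e3]
    have h5 := eLpNorm_le_eLpNorm_mul_eLpNorm_of_nnnorm (r := 1) (p := ENNReal.ofReal q)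
      (q := ENNReal.ofReal p) (μ := (volume : Measure (ℝ × Space n)))
      (f := fun z => H (z.1 - r, z.2) - H z) (g := W)
      (hm.comp_measurable measurable_prodMk_left).aestronglyMeasurable hWm.aestronglyMeasurable
      (fun a b => ‖a‖ * ‖b‖) 1 (Eventually.of_forall fun x => by
        rw [one_mul]; simp)
    rw [eLpNorm_one_eq_lintegral_enorm] at h5
    simp only [enorm_mul, enorm_norm, ENNReal.coe_one, one_mul] at h5
    refine h5.trans ?_
    gcongr
    exact hm0 r hr
  calc _ ≤ ∫⁻ _ in Ioo 0 h, m * eLpNorm W (ENNReal.ofReal p) volume :=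
        setLIntegral_mono' measurableSet_Ioo e2
    _ = _ := by rw [setLIntegral_const, Real.volume_Ioo, sub_zero, mul_comm]

end Translation

/-! ### Convex potentials and one step of the energy inequality -/

section Energy

variable {N n : ℕ} {p q : ℝ} {U : Set (Space n)} {g : Vec N → Vec N} {Φ : Vec N → ℝ} {L : ℝ}

/-- The subgradient inequality, used once at each endpoint, bounds the increment from both sides,
and `|g(c)| ≤ L|c|`. So `Φ` is locally Lipschitz with linearly growing constant, which makes its
integral meaningful and continuous on `L²`. -/
lemma abs_sub_le_of_convex (hg : ContDiff ℝ 1 g) (hg0 : g 0 = 0) (hL : ∀ y, ‖fderiv ℝ g y‖ ≤ L)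
    (hΦ : ∀ a b, Φ b - Φ a ≤ inner ℝ (g b) (b - a)) (a b : Vec N) :
    |Φ b - Φ a| ≤ L * ((‖b‖ + ‖a‖) * ‖b - a‖) := by
  have h1 : ∀ c d : Vec N, (inner ℝ (g c) d : ℝ) ≤ L * ‖c‖ * ‖d‖ := fun c d =>
    (real_inner_le_norm _ _).trans (by gcongr; exact norm_le_of_fderiv_le hg hg0 hL c)
  have hL0 : 0 ≤ L := (norm_nonneg _).trans (hL 0)
  have h2 := (hΦ a b).trans (h1 b (b - a))
  have h3 := (hΦ b a).trans (h1 a (a - b))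
  rw [norm_sub_rev a b] at h3
  have h4 : 0 ≤ L * ‖b‖ * ‖b - a‖ := by positivity
  have h5 : 0 ≤ L * ‖a‖ * ‖b - a‖ := by positivity
  rw [abs_le]
  constructor <;> nlinarith

lemma abs_le_of_convex (hg : ContDiff ℝ 1 g) (hg0 : g 0 = 0) (hL : ∀ y, ‖fderiv ℝ g y‖ ≤ L)
    (hΦ0 : Φ 0 = 0)
    (hΦ : ∀ a b, Φ b - Φ a ≤ inner ℝ (g b) (b - a)) (b : Vec N) : |Φ b| ≤ L * ‖b‖ ^ 2 := by
  have := abs_sub_le_of_convex hg hg0 hL hΦ 0 b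
  simpa [hΦ0, sq] using this

lemma integrable_comp_of_convex (hg : ContDiff ℝ 1 g) (hg0 : g 0 = 0)
    (hL : ∀ y, ‖fderiv ℝ g y‖ ≤ L) (hΦ0 : Φ 0 = 0) (hΦc : Continuous Φ)
    (hΦ : ∀ a b, Φ b - Φ a ≤ inner ℝ (g b) (b - a)) {V : Space n → Vec N}
    (hV : MemLp V 2 (volume.restrict U)) : IntegrableOn (fun x => Φ (V x)) U := by
  refine Integrable.mono' (g := fun x => L * ‖V x‖ ^ 2) ?_ (hΦc.comp_aestronglyMeasurable hV.1)
    (Eventually.of_forall fun x => abs_le_of_convex hg hg0 hL hΦ0 hΦ _)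
  exact hV.norm.integrable_sq.const_mul _

/-- By Cauchy–Schwarz the `L¹` distance of `Φ(v(s))` and `Φ(v(t))` is at most `L` times the product
of the `L²` norms of `|v(s)|+|v(t)|` and `v(s)-v(t)`. So the energy inherits continuity in time from
`v ∈ C⁰(L²)`. -/
lemma tendsto_integral_of_convex (hg : ContDiff ℝ 1 g) (hg0 : g 0 = 0)
    (hL : ∀ y, ‖fderiv ℝ g y‖ ≤ L) (hΦ0 : Φ 0 = 0) (hΦc : Continuous Φ)
    (hΦ : ∀ a b, Φ b - Φ a ≤ inner ℝ (g b) (b - a)) {v : ℝ → Space n → Vec N} {t : ℝ} {S : Set ℝ}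
    (ht : t ∈ S) (hv : ∀ s ∈ S, MemLp (v s) 2 (volume.restrict U))
    (hc : Tendsto (fun s => eLpNorm (fun x => v s x - v t x) 2 (volume.restrict U)) (𝓝[S] t) (𝓝 0)) :
    Tendsto (fun s => ∫ x in U, Φ (v s x)) (𝓝[S] t) (𝓝 (∫ x in U, Φ (v t x))) := by
  refine tendsto_integral_of_L1' _
    (integrable_comp_of_convex hg hg0 hL hΦ0 hΦc hΦ (hv t ht)).1 ?_ ?_
  · filter_upwards [self_mem_nhdsWithin] with s hs
    exact integrable_comp_of_convex hg hg0 hL hΦ0 hΦc hΦ (hv s hs)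
  have hL0 : 0 ≤ L := (norm_nonneg _).trans (hL 0)
  set T := eLpNorm (v t) 2 (volume.restrict U) with hT
  have hlim : Tendsto (fun s => ENNReal.ofReal L *
      ((eLpNorm (fun x => v s x - v t x) 2 (volume.restrict U) + T + T) *
        eLpNorm (fun x => v s x - v t x) 2 (volume.restrict U))) (𝓝[S] t) (𝓝 0) := by
    have hTt : T ≠ ⊤ := (hv t ht).2.ne
    have h1 := ENNReal.Tendsto.const_mul (a := ENNReal.ofReal L)
      (ENNReal.Tendsto.mul ((hc.add_const T).add_const T)
      (Or.inr (ENNReal.zero_ne_top)) hc (Or.inr (by simp [hTt]))) (Or.inr ENNReal.ofReal_ne_top)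
    simpa using h1
  refine tendsto_of_tendsto_of_tendsto_of_le_of_le' tendsto_const_nhds hlim
    (Eventually.of_forall fun _ => zero_le) ?_
  filter_upwards [self_mem_nhdsWithin] with s hs
  have hsub : MemLp (fun x => v s x - v t x) 2 (volume.restrict U) := (hv s hs).sub (hv t ht)
  have h1 := eLpNorm_le_eLpNorm_mul_eLpNorm_of_nnnorm (r := 1) (p := 2)
      (q := 2) (μ := volume.restrict U)
      (f := fun x => ‖v s x‖ + ‖v t x‖) (g := fun x => v s x - v t x)
      ((hv s hs).1.norm.add (hv t ht).1.norm) hsub.1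
      (fun a b => a * ‖b‖) 1 (Eventually.of_forall fun x => by
        rw [one_mul]; simp)
  have h2 : eLpNorm (fun x => ‖v s x‖ + ‖v t x‖) 2 (volume.restrict U) ≤
      eLpNorm (fun x => v s x - v t x) 2 (volume.restrict U) + T + T := by
    refine (eLpNorm_add_le (hv s hs).1.norm (hv t ht).1.norm (by norm_num)).trans ?_
    rw [eLpNorm_norm, eLpNorm_norm]
    gcongr
    have h3 := eLpNorm_add_le hsub.1 (hv t ht).1 (p := 2) (by norm_num)
    refine le_trans (le_of_eq ?_) h3
    congr 1
    funext x
    simp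
  calc eLpNorm ((fun x => Φ (v s x)) - fun x => Φ (v t x)) 1 (volume.restrict U)
      ≤ ENNReal.ofReal L * eLpNorm (fun x => (‖v s x‖ + ‖v t x‖) * ‖v s x - v t x‖) 1
          (volume.restrict U) := by
        refine eLpNorm_le_mul_eLpNorm_of_ae_le_mul (Eventually.of_forall fun x => ?_) _
        refine (abs_sub_le_of_convex hg hg0 hL hΦ (v t x) (v s x)).trans ?_
        gcongr
        exact le_abs_self _
    _ ≤ _ := by
        gcongr
        refine h1.trans ?_
        rw [ENNReal.coe_one, one_mul]
        gcongr

/-- One time step of the energy inequality: convexity and the equation on `(t - h, t)`. -/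
lemma energy_step (hpq : p.HolderConjugate q) (hUf : volume U ≠ ⊤)
    {V V' : Space n → Vec N} {DV : Space n → Mat N n} {H : ℝ × Space n → Mat N n}
    (hV : MemLp V 2 (volume.restrict U)) (hV' : MemLp V' 2 (volume.restrict U))
    (hVW : MemW1pZero p U V DV) (hDV : MemLp DV (ENNReal.ofReal p) (volume.restrict U))
    (hH : MemLp H (ENNReal.ofReal q) volume) {s t : ℝ}
    (hweak : ∀ ψ : Space n → Vec N, ContDiff ℝ 1 ψ → HasCompactSupport ψ → tsupport ψ ⊆ U →
      (∫ x in U, (inner ℝ (V x) (ψ x) : ℝ)) - ∫ x in U, (inner ℝ (V' x) (ψ x) : ℝ) =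
        -∫ r in Ioo s t, ∫ x in U, (inner ℝ (H (r, x)) (spatialGrad ψ x) : ℝ))
    (hg : ContDiff ℝ 1 g) (hg0 : g 0 = 0) (hL : ∀ y, ‖fderiv ℝ g y‖ ≤ L)
    (hΦ0 : Φ 0 = 0) (hΦc : Continuous Φ)
    (hΦ : ∀ a b, Φ b - Φ a ≤ inner ℝ (g b) (b - a)) :
    (∫ x in U, Φ (V x)) - ∫ x in U, Φ (V' x) ≤
      -∫ r in Ioo s t, ∫ x in U, (inner ℝ (H (r, x)) (matMap (fderiv ℝ g (V x)) (DV x)) : ℝ) := by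
  have hHr : MemLp H (ENNReal.ofReal q) ((volume.restrict (Ioo s t)).prod (volume.restrict U)) := by
    rw [Measure.prod_restrict]
    exact hH.restrict _
  have hK := memLp_section_integral hpq.symm.lt.le hHr
  have : IsFiniteMeasure (volume.restrict U) := ⟨by simpa using hUf.lt_top⟩
  have hz : MemLp (fun x => V x - V' x) 2 (volume.restrict U) := hV.sub hV'
  -- The increment `V - V'` is the divergence of the time integral of `H`, and it is tested with
  -- `g(V)`. Only the later value `V` has to lie in `W₀^{1,p}`.
  have key := integral_inner_comp hpq hUf hVW hV hDV hz hK (fun ψ h1 h2 h3 => by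
    have hψ : MemLp ψ 2 (volume.restrict U) := h1.continuous.memLp_of_hasCompactSupport h2
    rw [integral_inner_section hpq hHr (memLp_spatialGrad h1 h2 _ _), ← hweak ψ h1 h2 h3,
      ← integral_sub (integrable_inner_of_memLp hV hψ) (integrable_inner_of_memLp hV' hψ)]
    simp only [inner_sub_left]) hg hg0 hL
  rw [integral_inner_section hpq hHr (memLp_matMap hg hL hV.1 hDV)] at key
  rw [← key, ← integral_sub (integrable_comp_of_convex hg hg0 hL hΦ0 hΦc hΦ hV)
    (integrable_comp_of_convex hg hg0 hL hΦ0 hΦc hΦ hV')]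
  have hgV : MemLp (fun x => g (V x)) 2 (volume.restrict U) :=
    hV.of_le_mul (c := L) (hg.continuous.comp_aestronglyMeasurable hV.1)
      (Eventually.of_forall fun x => norm_le_of_fderiv_le hg hg0 hL _)
  refine integral_mono ((integrable_comp_of_convex hg hg0 hL hΦ0 hΦc hΦ hV).sub
    (integrable_comp_of_convex hg hg0 hL hΦ0 hΦc hΦ hV')) (integrable_inner_of_memLp hz hgV)
    fun x => ?_
  simp only
  rw [real_inner_comm]
  exact hΦ _ _

end Energy

/-! ### The energy inequality for `v_t = div H` -/

section EnergyInequality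

variable {N n : ℕ} {p q : ℝ} {U : Set (Space n)} {g : Vec N → Vec N} {Φ : Vec N → ℝ} {L : ℝ}

/-- Replacing `H(s)` by `H(t)` for `s ∈ (t - h, t)` in the pairing with a function of `x`. -/
lemma abs_integral_sub_le (hpq : p.HolderConjugate q) {H : ℝ × Space n → Mat N n}
    {W : Space n → Mat N n}
    (hH : MemLp H (ENNReal.ofReal q) volume)
    (hW : MemLp W (ENNReal.ofReal p) (volume.restrict U)) {t h : ℝ} (hh : 0 < h)
    (hHt : MemLp (fun x => H (t, x)) (ENNReal.ofReal q) (volume.restrict U)) {e : ℝ≥0∞}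
    (he : e ≠ ⊤)
    (hle : ∫⁻ s in Ioo (t - h) t, ∫⁻ x in U, ‖H (s, x) - H (t, x)‖ₑ * ‖W x‖ₑ ≤ e) :
    -(∫ s in Ioo (t - h) t, ∫ x in U, (inner ℝ (H (s, x)) (W x) : ℝ)) ≤
      -(h * ∫ x in U, (inner ℝ (H (t, x)) (W x) : ℝ)) + e.toReal := by
  have hpq' := hpq.symm.ennrealOfReal
  have hHr : MemLp H (ENNReal.ofReal q)
      ((volume.restrict (Ioo (t - h) t)).prod (volume.restrict U)) := by
    rw [Measure.prod_restrict]
    exact hH.restrict _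
  have hI1 : Integrable (fun z : ℝ × Space n => (inner ℝ (H z) (W z.2) : ℝ))
      ((volume.restrict (Ioo (t - h) t)).prod (volume.restrict U)) :=
    integrable_inner_of_memLp hHr (hW.comp_snd _)
  have hsec := memLp_ae_section hpq.symm.pos hHr
  have hI2 : Integrable (fun s => ∫ x in U, (inner ℝ (H (s, x)) (W x) : ℝ))
    (volume.restrict (Ioo (t - h) t)) := hI1.integral_prod_left
  have e1 : (∫ s in Ioo (t - h) t, ∫ x in U, (inner ℝ (H (s, x)) (W x) : ℝ)) -
      h * (∫ x in U, (inner ℝ (H (t, x)) (W x) : ℝ)) =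
      ∫ s in Ioo (t - h) t, ∫ x in U, (inner ℝ (H (s, x) - H (t, x)) (W x) : ℝ) := by
    have e2 : h * (∫ x in U, (inner ℝ (H (t, x)) (W x) : ℝ)) =
        ∫ _ in Ioo (t - h) t, ∫ x in U, (inner ℝ (H (t, x)) (W x) : ℝ) := by
      rw [setIntegral_const, measureReal_def, Real.volume_Ioo, sub_sub_cancel,
        ENNReal.toReal_ofReal hh.le, smul_eq_mul]
    rw [e2, ← integral_sub hI2 (integrable_const _)]
    refine integral_congr_ae ?_
    filter_upwards [hsec] with s hs
    rw [← integral_sub (integrable_inner_of_memLp hs hW) (integrable_inner_of_memLp hHt hW)]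
    simp only [inner_sub_left]
  have h1 : ‖∫ s in Ioo (t - h) t, ∫ x in U, (inner ℝ (H (s, x) - H (t, x)) (W x) : ℝ)‖ₑ ≤ e := by
    refine (enorm_integral_le_lintegral_enorm _).trans (le_trans ?_ hle)
    refine lintegral_mono fun s => ?_
    refine (enorm_integral_le_lintegral_enorm _).trans (lintegral_mono fun x => ?_)
    simp only [← ofReal_norm]
    rw [← ENNReal.ofReal_mul (norm_nonneg _)]
    exact ENNReal.ofReal_le_ofReal (norm_inner_le_norm _ _)
  rw [← e1] at h1
  have h2 := ENNReal.toReal_mono he h1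
  rw [toReal_enorm, Real.norm_eq_abs] at h2
  linarith [neg_abs_le ((∫ s in Ioo (t - h) t, ∫ x in U, (inner ℝ (H (s, x)) (W x) : ℝ)) -
      h * (∫ x in U, (inner ℝ (H (t, x)) (W x) : ℝ)))]

/-- The energy inequality for `v_t = div H`, for data extended by zero to times before `t₁`. -/
lemma energy_inequality_extended (hpq : p.HolderConjugate q) (hUm : MeasurableSet U)
    (hUf : volume U ≠ ⊤) {v : ℝ → Space n → Vec N} {Dv : ℝ → Space n → Mat N n}
    {H : ℝ × Space n → Mat N n} {t₁ τ : ℝ} (hτ : t₁ < τ)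
    (hv2 : ∀ t ≤ τ, MemLp (v t) 2 (volume.restrict U))
    (hvc : ∀ t ≤ τ, Tendsto (fun s => eLpNorm (fun x => v s x - v t x) 2 (volume.restrict U))
      (𝓝[Iic τ] t) (𝓝 0))
    (hv0 : ∀ t ≤ t₁, v t =ᵐ[volume.restrict U] 0)
    (hvm : AEStronglyMeasurable (Function.uncurry v) (volume.restrict (Ioo t₁ τ ×ˢ U)))
    (hDv : MemLp (Function.uncurry Dv) (ENNReal.ofReal p) (volume.restrict (Ioo t₁ τ ×ˢ U)))
    (hlat : ∀ᵐ t ∂(volume.restrict (Ioo t₁ τ)), MemW1pZero p U (v t) (Dv t))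
    (hHm : StronglyMeasurable H) (hH : MemLp H (ENNReal.ofReal q) volume)
    (hweak : ∀ s t, s < t → t ≤ τ →
      ∀ ψ : Space n → Vec N, ContDiff ℝ 1 ψ → HasCompactSupport ψ → tsupport ψ ⊆ U →
      (∫ x in U, (inner ℝ (v t x) (ψ x) : ℝ)) - ∫ x in U, (inner ℝ (v s x) (ψ x) : ℝ) =
        -∫ r in Ioo s t, ∫ x in U, (inner ℝ (H (r, x)) (spatialGrad ψ x) : ℝ))
    (hg : ContDiff ℝ 1 g) (hg0 : g 0 = 0) (hL : ∀ y, ‖fderiv ℝ g y‖ ≤ L)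
    (hΦ0 : Φ 0 = 0) (hΦc : Continuous Φ)
    (hΦ : ∀ a b, Φ b - Φ a ≤ inner ℝ (g b) (b - a)) :
    ∫ x in U, Φ (v τ x) ≤ -∫ t in Ioo t₁ τ, ∫ x in U,
      (inner ℝ (H (t, x)) (matMap (fderiv ℝ g (v t x)) (Dv t x)) : ℝ) := by
  have hpq' := hpq.symm.ennrealOfReal
  set A : ℝ × Space n → Mat N n := fun z => matMap (fderiv ℝ g (v z.1 z.2)) (Dv z.1 z.2) with hA
  have hAp : MemLp A (ENNReal.ofReal p) (volume.restrict (Ioo t₁ τ ×ˢ U)) :=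
    memLp_matMap hg hL hvm hDv
  have hUτ : MeasurableSet (Ioo t₁ τ ×ˢ U) := measurableSet_Ioo.prod hUm
  -- a globally defined strongly measurable version of the test gradient
  set W : ℝ × Space n → Mat N n := (Ioo t₁ τ ×ˢ U).indicator (hAp.1.mk A) with hW
  have hWm : StronglyMeasurable W := hAp.1.stronglyMeasurable_mk.indicator hUτ
  have hAW : ∀ᵐ z ∂(volume.restrict (Ioo t₁ τ ×ˢ U)), A z = W z := by
    filter_upwards [hAp.1.ae_eq_mk, ae_restrict_mem hUτ] with z hz hz2
    rw [hz, hW, indicator_of_mem hz2]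
  have hWp : MemLp W (ENNReal.ofReal p) volume := by
    rw [hW, memLp_indicator_iff_restrict hUτ]
    exact (memLp_congr_ae hAp.1.ae_eq_mk).1 hAp
  have hprod : (volume.restrict (Ioo t₁ τ)).prod (volume.restrict U) =
      (volume.restrict (Ioo t₁ τ ×ˢ U) : Measure (ℝ × Space n)) := Measure.prod_restrict _ _
  have hHr : MemLp H (ENNReal.ofReal q) (volume.restrict (Ioo t₁ τ ×ˢ U)) := hH.restrict _
  have hHs : ∀ᵐ t ∂volume.restrict (Ioo t₁ τ),
      MemLp (fun x => H (t, x)) (ENNReal.ofReal q) (volume.restrict U) :=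
    memLp_ae_section hpq.symm.pos (by rw [hprod]; exact hHr)
  have hDs : ∀ᵐ t ∂volume.restrict (Ioo t₁ τ),
      MemLp (fun x => Dv t x) (ENNReal.ofReal p) (volume.restrict U) :=
    memLp_ae_section (H := Function.uncurry Dv) hpq.pos (by rw [hprod]; exact hDv)
  have hAWs : ∀ᵐ t ∂volume.restrict (Ioo t₁ τ), ∀ᵐ x ∂volume.restrict U,
      A (t, x) = W (t, x) := by
    rw [← hprod] at hAW
    exact Measure.ae_ae_of_ae_prod hAW
  have hint : Integrable (fun t => ∫ x in U, (inner ℝ (H (t, x)) (A (t, x)) : ℝ))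
      (volume.restrict (Ioo t₁ τ)) := by
    have h1 : Integrable (fun z => (inner ℝ (H z) (A z) : ℝ))
      (volume.restrict (Ioo t₁ τ ×ˢ U)) := integrable_inner_of_memLp hHr hAp
    rw [← hprod] at h1
    exact h1.integral_prod_left
  -- the energy
  set E : ℝ → ℝ := fun t => ∫ x in U, Φ (v t x) with hE
  have hEc : ContinuousOn E (Iic τ) := fun t ht =>
    tendsto_integral_of_convex hg hg0 hL hΦ0 hΦc hΦ ht hv2 (hvc t ht)
  have hE0 : ∀ t ≤ t₁, E t = 0 := by
    intro t ht
    have : (fun x => Φ (v t x)) =ᵐ[volume.restrict U] fun _ => 0 := by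
      filter_upwards [hv0 t ht] with x hx
      rw [hx]; exact hΦ0
    simp only [hE]
    rw [integral_congr_ae this, integral_zero]
  set J := ∫ t in Ioo t₁ τ, ∫ x in U, (inner ℝ (H (t, x)) (A (t, x)) : ℝ) with hJ
  set w := (eLpNorm W (ENNReal.ofReal p) volume).toReal with hw
  have hw0 : 0 ≤ w := ENNReal.toReal_nonneg
  -- Choose `h` so small that translations by less than `h` move `H` by at most `ε` in `L^q` and
  -- that `E > E(τ) - ε` on `[τ-h, τ]`. Integrating the one-step inequality over `t ∈ (t₁,τ)` and
  -- dividing by `h` gives the claim.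
  have hmain : ∀ ε > 0, E τ ≤ -J + ε * (1 + w) := by
    intro ε hε
    have htr := tendsto_eLpNorm_time_translate (q := ENNReal.ofReal q)
      (by simpa using hpq.symm.lt.le) ENNReal.ofReal_ne_top hH
    have h1 := htr.eventually (gt_mem_nhds (show (0 : ℝ≥0∞) < ENNReal.ofReal ε by simpa using hε))
    obtain ⟨δ, hδ, hδ'⟩ := Metric.eventually_nhds_iff.1 h1
    have h2 := (hEc τ self_mem_Iic).eventually (lt_mem_nhds (show E τ - ε < E τ by linarith))
    rw [eventually_nhdsWithin_iff] at h2
    obtain ⟨δ₂, hδ₂, hδ₂'⟩ := Metric.eventually_nhds_iff.1 h2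
    set h := min δ δ₂ / 2 with hhdef
    have hh : 0 < h := by positivity
    have hhδ : h < δ := by
      have := min_le_left δ δ₂
      rw [hhdef]; linarith
    have hhδ₂ : h < δ₂ := by
      have := min_le_right δ δ₂
      rw [hhdef]; linarith
    -- the translation error
    have herr := lintegral_time_translate_le hpq hHm hWm (h := h) (m := ENNReal.ofReal ε)
      (fun r hr => (hδ' (by
        rw [Real.dist_eq, sub_zero, abs_of_pos hr.1]; linarith [hr.2])).le)
    set e : ℝ → ℝ≥0∞ := fun t => ∫⁻ s in Ioo (t - h) t, ∫⁻ x, ‖H (s, x) - H (t, x)‖ₑ * ‖W (t, x)‖ₑ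
      with he
    have hem : Measurable e := by
      have hm : Measurable fun y : (ℝ × ℝ) × Space n =>
          ‖H (y.1.2, y.2) - H (y.1.1, y.2)‖ₑ * ‖W (y.1.1, y.2)‖ₑ := by
        refine ((hHm.comp_measurable ?_).sub (hHm.comp_measurable ?_)).enorm.mul
          (hWm.comp_measurable ?_).enorm <;> fun_prop
      have hm2 : Measurable fun y : ℝ × ℝ =>
          ∫⁻ x, ‖H (y.2, x) - H (y.1, x)‖ₑ * ‖W (y.1, x)‖ₑ := hm.lintegral_prod_right'
      have hm3 : Measurable fun y : ℝ × ℝ => (Ioo (y.1 - h) y.1).indicator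
          (fun s => ∫⁻ x, ‖H (s, x) - H (y.1, x)‖ₑ * ‖W (y.1, x)‖ₑ) y.2 := by
        have hs : MeasurableSet ({y : ℝ × ℝ | y.1 - h < y.2} ∩ {y : ℝ × ℝ | y.2 < y.1}) :=
          (measurableSet_lt (measurable_fst.sub_const h) measurable_snd).inter
            (measurableSet_lt measurable_snd measurable_fst)
        convert! hm2.indicator hs using 1
      have hm4 := hm3.lintegral_prod_right' (ν := (volume : Measure ℝ))
      convert hm4 using 1
      funext t
      simp only [he]
      rw [lintegral_indicator measurableSet_Ioo]
    have hwt : eLpNorm W (ENNReal.ofReal p) volume = ENNReal.ofReal w :=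
      (ENNReal.ofReal_toReal hWp.2.ne).symm
    rw [hwt, ← ENNReal.ofReal_mul hε.le, ← ENNReal.ofReal_mul hh.le] at herr
    have hefin : ∫⁻ t, e t ≠ ⊤ := (herr.trans_lt ENNReal.ofReal_lt_top).ne
    have heae : ∀ᵐ t, e t < ⊤ := ae_lt_top hem hefin
    have hstep : ∀ᵐ t ∂volume.restrict (Ioo t₁ τ),
        E t - E (t - h) ≤ -(h * ∫ x in U, (inner ℝ (H (t, x)) (A (t, x)) : ℝ)) + (e t).toReal := by
      filter_upwards [hHs, hDs, hlat, hAWs, ae_restrict_of_ae heae, ae_restrict_mem measurableSet_Ioo]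
        with t h3 h4 h5 h6 h7 h8
      refine (energy_step hpq hUf (hv2 t h8.2.le) (hv2 (t - h) (by linarith [h8.2])) h5 h4 hH
        (fun ψ a b c => hweak (t - h) t (by linarith) h8.2.le ψ a b c) hg hg0 hL hΦ0 hΦc hΦ).trans ?_
      refine abs_integral_sub_le hpq hH (memLp_matMap hg hL (hv2 t h8.2.le).1 h4) hh h3 h7.ne ?_
      refine lintegral_mono fun s => ?_
      refine le_trans (le_of_eq ?_) (setLIntegral_le_lintegral U _)
      refine lintegral_congr_ae ?_
      filter_upwards [h6] with x hx
      simp only [hA] at hx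
      rw [← hx]
    -- integrate in time
    have hEi : ∀ a b, a ≤ τ → b ≤ τ → IntervalIntegrable E volume a b := fun a b ha hb =>
      (hEc.mono (fun x hx => (hx.2.trans (max_le ha hb) : x ≤ τ))).intervalIntegrable
    have hEi2 : IntervalIntegrable (fun t => E (t - h)) volume t₁ τ := by
      refine ContinuousOn.intervalIntegrable (hEc.comp (by fun_prop) fun x hx => ?_)
      rw [uIcc_of_le hτ.le] at hx
      simp only [mem_Iic]
      linarith [hx.2]
    have hei : Integrable (fun t => (e t).toReal) :=
      integrable_toReal_of_lintegral_ne_top hem.aemeasurable hefin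
    have hI := integral_mono_ae (μ := volume.restrict (Ioo t₁ τ))
      (f := fun t => E t - E (t - h))
      (g := fun t => -(h * ∫ x in U, (inner ℝ (H (t, x)) (A (t, x)) : ℝ)) + (e t).toReal) (by
        have := ((hEi t₁ τ hτ.le le_rfl).sub hEi2).1
        exact this.mono_set Ioo_subset_Ioc_self) ((hint.const_mul h).neg.add hei.restrict) hstep
    have hR : ∫ t in Ioo t₁ τ, (-(h * ∫ x in U, (inner ℝ (H (t, x)) (A (t, x)) : ℝ)) +
        (e t).toReal) ≤ -(h * J) + h * (ε * w) := by
      have hadd := integral_add (hint.const_mul h).neg hei.restrict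
      simp only [Pi.neg_apply] at hadd
      rw [hadd, integral_neg, integral_const_mul]
      gcongr
      calc ∫ t in Ioo t₁ τ, (e t).toReal ≤ ∫ t, (e t).toReal :=
            setIntegral_le_integral hei (Eventually.of_forall fun _ => ENNReal.toReal_nonneg)
        _ = (∫⁻ t, e t).toReal := integral_toReal hem.aemeasurable heae
        _ ≤ (ENNReal.ofReal (h * (ε * w))).toReal := ENNReal.toReal_mono ENNReal.ofReal_ne_top herr
        _ = h * (ε * w) := ENNReal.toReal_ofReal (by positivity)
    -- The two integrals overlap and cancel except near the endpoints; the piece over `(t₁-h,t₁)`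
    -- vanishes because `E = 0` up to time `t₁`. This is what the extension by zero is for.
    have hLft : ∫ t in Ioo t₁ τ, (E t - E (t - h)) = ∫ t in (τ - h)..τ, E t := by
      rw [← integral_Ioc_eq_integral_Ioo, ← intervalIntegral.integral_of_le hτ.le,
        intervalIntegral.integral_sub (hEi t₁ τ hτ.le le_rfl) hEi2,
        intervalIntegral.integral_comp_sub_right (fun t => E t)]
      have h3 : ∫ t in (t₁ - h)..t₁, E t = 0 := by
        rw [intervalIntegral.integral_congr (g := fun _ => (0 : ℝ)) (fun x hx => ?_)]
        · simp
        · rw [uIcc_of_le (by linarith)] at hx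
          exact hE0 x hx.2
      have h4 := intervalIntegral.integral_add_adjacent_intervals
        (hEi (t₁ - h) t₁ (by linarith) hτ.le) (hEi t₁ (τ - h) hτ.le (by linarith))
      have h5 := intervalIntegral.integral_add_adjacent_intervals
        (hEi t₁ (τ - h) hτ.le (by linarith)) (hEi (τ - h) τ (by linarith) le_rfl)
      linarith
    have hlow : h * (E τ - ε) ≤ ∫ t in (τ - h)..τ, E t := by
      have h3 : ∫ _ in (τ - h)..τ, (E τ - ε) = h * (E τ - ε) := by
        rw [intervalIntegral.integral_const, smul_eq_mul]; ring
      rw [← h3]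
      refine intervalIntegral.integral_mono_on (by linarith) (by simp)
        (hEi _ _ (by linarith) le_rfl) fun x hx => ?_
      exact (hδ₂' (y := x) (by
        rw [Real.dist_eq, abs_of_nonpos (by linarith [hx.2])]; linarith [hx.1]) hx.2).le
    have hfin : h * (E τ - ε) ≤ h * (-J + ε * w) := by
      calc h * (E τ - ε) ≤ ∫ t in (τ - h)..τ, E t := hlow
        _ = _ := hLft.symm
        _ ≤ _ := hI
        _ ≤ _ := hR
        _ = h * (-J + ε * w) := by ring
    have := le_of_mul_le_mul_left hfin hh
    linarith
  refine le_of_forall_pos_le_add fun ε hε => ?_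
  have h1 := hmain (ε / (1 + w)) (by positivity)
  rwa [div_mul_cancel₀ _ (by positivity)] at h1

/-- `v`, with gradient `Dv`, is a weak solution of `v_t = div H` in `U × (t₁, t₂)` with zero
initial and lateral boundary values; the equation is integrated in time. -/
structure IsZeroDataSolution (p q t₁ t₂ : ℝ) (U : Set (Space n)) (v : ℝ → Space n → Vec N)
    (Dv : ℝ → Space n → Mat N n) (H : ℝ × Space n → Mat N n) : Prop where
  memLp_two : ∀ t ∈ Icc t₁ t₂, MemLp (v t) 2 (volume.restrict U)
  continuous : ∀ t ∈ Icc t₁ t₂,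
    Tendsto (fun s => eLpNorm (fun x => v s x - v t x) 2 (volume.restrict U))
      (𝓝[Icc t₁ t₂] t) (𝓝 0)
  measurable : AEStronglyMeasurable (Function.uncurry v) (volume.restrict (Ioo t₁ t₂ ×ˢ U))
  memLp_grad : MemLp (Function.uncurry Dv) (ENNReal.ofReal p) (volume.restrict (Ioo t₁ t₂ ×ˢ U))
  memLp_flux : MemLp H (ENNReal.ofReal q) (volume.restrict (Ioo t₁ t₂ ×ˢ U))
  lateral : ∀ᵐ t ∂(volume.restrict (Ioo t₁ t₂)), MemW1pZero p U (v t) (Dv t)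
  initial : v t₁ =ᵐ[volume.restrict U] 0
  weak : ∀ s t, t₁ ≤ s → s ≤ t → t ≤ t₂ →
    ∀ ψ : Space n → Vec N, ContDiff ℝ 1 ψ → HasCompactSupport ψ → tsupport ψ ⊆ U →
    (∫ x in U, (inner ℝ (v t x) (ψ x) : ℝ)) - ∫ x in U, (inner ℝ (v s x) (ψ x) : ℝ) =
      -∫ r in Ioo s t, ∫ x in U, (inner ℝ (H (r, x)) (spatialGrad ψ x) : ℝ)

/-- The energy inequality for `v_t = div H`, tested with `g(v)`. -/
lemma IsZeroDataSolution.energy_inequality (hpq : p.HolderConjugate q) (hUm : MeasurableSet U)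
    (hUf : volume U ≠ ⊤) {v : ℝ → Space n → Vec N} {Dv : ℝ → Space n → Mat N n}
    {H : ℝ × Space n → Mat N n} {t₁ t₂ τ : ℝ} (hv : IsZeroDataSolution p q t₁ t₂ U v Dv H)
    (hτ : t₁ < τ) (hτ2 : τ ≤ t₂)
    (hg : ContDiff ℝ 1 g) (hg0 : g 0 = 0) (hL : ∀ y, ‖fderiv ℝ g y‖ ≤ L)
    (hΦ0 : Φ 0 = 0) (hΦc : Continuous Φ)
    (hΦ : ∀ a b, Φ b - Φ a ≤ inner ℝ (g b) (b - a)) :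
    ∫ x in U, Φ (v τ x) ≤ -∫ z in Ioo t₁ τ ×ˢ U,
      (inner ℝ (H z) (matMap (fderiv ℝ g (v z.1 z.2)) (Dv z.1 z.2)) : ℝ) := by
  have hpq' := hpq.symm.ennrealOfReal
  have hS2 : MeasurableSet (Ioo t₁ t₂ ×ˢ U) := measurableSet_Ioo.prod hUm
  have hS : MeasurableSet (Ioo t₁ τ ×ˢ U) := measurableSet_Ioo.prod hUm
  have hsub : Ioo t₁ τ ×ˢ U ⊆ Ioo t₁ t₂ ×ˢ U := prod_mono_left (Ioo_subset_Ioo_right hτ2)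
  have hle : volume.restrict (Ioo t₁ τ ×ˢ U) ≤ volume.restrict (Ioo t₁ t₂ ×ˢ U) :=
    Measure.restrict_mono hsub le_rfl
  -- extension by zero to earlier times
  set v' : ℝ → Space n → Vec N := fun t => if t ≤ t₁ then 0 else v t with hv'
  have hv'1 : ∀ t, t ≤ t₁ → v' t = 0 := fun t ht => by simp [hv', ht]
  have hv'2 : ∀ t, t₁ < t → v' t = v t := fun t ht => by simp [hv', not_le.2 ht]
  set G : ℝ × Space n → Mat N n := (Ioo t₁ t₂ ×ˢ U).indicator (hv.memLp_flux.1.mk H) with hG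
  have hGm : StronglyMeasurable G := hv.memLp_flux.1.stronglyMeasurable_mk.indicator hS2
  have hGH : ∀ᵐ z ∂(volume.restrict (Ioo t₁ t₂ ×ˢ U)), G z = H z := by
    filter_upwards [hv.memLp_flux.1.ae_eq_mk, ae_restrict_mem hS2] with z hz hz2
    rw [hG, indicator_of_mem hz2, hz]
  have hGp : MemLp G (ENNReal.ofReal q) volume := by
    rw [hG, memLp_indicator_iff_restrict hS2]
    exact (memLp_congr_ae hv.memLp_flux.1.ae_eq_mk).1 hv.memLp_flux
  have hGHs : ∀ᵐ t ∂volume.restrict (Ioo t₁ t₂), ∀ᵐ x ∂volume.restrict U, G (t, x) = H (t, x) := by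
    have hprod : (volume.restrict (Ioo t₁ t₂)).prod (volume.restrict U) =
      (volume.restrict (Ioo t₁ t₂ ×ˢ U) : Measure (ℝ × Space n)) := Measure.prod_restrict _ _
    rw [← hprod] at hGH
    exact Measure.ae_ae_of_ae_prod hGH
  have hae : ∀ t, t₁ ≤ t → v' t =ᵐ[volume.restrict U] v t := by
    intro t ht
    rcases ht.eq_or_lt with rfl | h
    · rw [hv'1 _ le_rfl]; exact hv.initial.symm
    · rw [hv'2 _ h]
  have hcongr : ∀ s t, t₁ ≤ s → t₁ ≤ t → eLpNorm (fun x => v' s x - v' t x) 2 (volume.restrict U) =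
      eLpNorm (fun x => v s x - v t x) 2 (volume.restrict U) := fun s t hs ht =>
    eLpNorm_congr_ae ((hae s hs).sub (hae t ht))
  have hweak' : ∀ s t, t₁ ≤ s → s ≤ t → t ≤ t₂ →
      ∀ ψ : Space n → Vec N, ContDiff ℝ 1 ψ → HasCompactSupport ψ → tsupport ψ ⊆ U →
      (∫ x in U, (inner ℝ (v' t x) (ψ x) : ℝ)) - ∫ x in U, (inner ℝ (v' s x) (ψ x) : ℝ) =
      -∫ r in Ioo s t, ∫ x in U, (inner ℝ (G (r, x)) (spatialGrad ψ x) : ℝ) := by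
    intro s t hs hst ht ψ h1 h2 h3
    have e1 : ∀ t, t₁ ≤ t → ∫ x in U, (inner ℝ (v' t x) (ψ x) : ℝ) =
        ∫ x in U, (inner ℝ (v t x) (ψ x) : ℝ) := fun t ht => by
      refine integral_congr_ae ?_
      filter_upwards [hae t ht] with x hx
      rw [hx]
    rw [e1 t (hs.trans hst), e1 s hs, hv.weak s t hs hst ht ψ h1 h2 h3]
    congr 1
    refine integral_congr_ae ?_
    have h4 : ∀ᵐ r ∂volume.restrict (Ioo s t), ∀ᵐ x ∂volume.restrict U, G (r, x) = H (r, x) :=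
      ae_mono (Measure.restrict_mono (Ioo_subset_Ioo hs ht) le_rfl) hGHs
    filter_upwards [h4] with r hr
    refine integral_congr_ae ?_
    filter_upwards [hr] with x hx
    rw [hx]
  have hmain := energy_inequality_extended (v := v') (Dv := Dv) (H := G) hpq hUm hUf hτ
    (fun t ht => ?_) (fun t ht => ?_) (fun t ht => by rw [hv'1 t ht]) ?_
    (hv.memLp_grad.mono_measure hle) ?_ hGm hGp ?_ hg hg0 hL hΦ0 hΦc hΦ
  · rw [hv'2 τ hτ] at hmain
    refine hmain.trans (le_of_eq ?_)
    have hHr := hv.memLp_flux.mono_measure hle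
    have hAp := memLp_matMap hg hL (hv.measurable.mono_measure hle) (hv.memLp_grad.mono_measure hle)
    have hi : IntegrableOn (fun z : ℝ × Space n =>
        (inner ℝ (H z) (matMap (fderiv ℝ g (v z.1 z.2)) (Dv z.1 z.2)) : ℝ)) (Ioo t₁ τ ×ˢ U) :=
      integrable_inner_of_memLp hHr hAp
    rw [Measure.volume_eq_prod, setIntegral_prod _ hi]
    congr 1
    refine setIntegral_congr_ae measurableSet_Ioo ?_
    have h4 : ∀ᵐ r ∂volume.restrict (Ioo t₁ τ), ∀ᵐ x ∂volume.restrict U, G (r, x) = H (r, x) :=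
      ae_mono (Measure.restrict_mono (Ioo_subset_Ioo_right hτ2) le_rfl) hGHs
    rw [ae_restrict_iff' measurableSet_Ioo] at h4
    filter_upwards [h4] with r hr hr2
    refine integral_congr_ae ?_
    filter_upwards [hr hr2] with x hx
    rw [hx, hv'2 r hr2.1]
  · rcases le_total t t₁ with h | h
    · rw [hv'1 t h]; exact MemLp.zero
    · exact (memLp_congr_ae (hae t h)).2 (hv.memLp_two t ⟨h, ht.trans hτ2⟩)
  · rcases lt_trichotomy t t₁ with h | h | h
    · refine tendsto_const_nhds.congr' ?_
      filter_upwards [mem_nhdsWithin_of_mem_nhds (Iio_mem_nhds h)] with s hs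
      have hs' : s ≤ t₁ := le_of_lt hs
      rw [hv'1 s hs', hv'1 t h.le]
      simp
    -- At the gluing time continuity is checked from each side: from the right it is that of `v`,
    -- since the extension equals `v(t₁)` almost everywhere there, and from the left the extension
    -- is identically zero.
    · subst h
      have h5 := hv.continuous t ⟨le_rfl, ht.trans hτ2⟩
      have h6 : Iic τ ⊆ Icc t t₂ ∪ Iic t := fun s hs => by
        rcases le_total s t with h | h
        · exact Or.inr h
        · exact Or.inl ⟨h, le_trans hs hτ2⟩
      refine Tendsto.mono_left ?_ (nhdsWithin_mono t h6)
      rw [nhdsWithin_union]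
      refine Tendsto.sup ?_ ?_
      · refine h5.congr' ?_
        filter_upwards [self_mem_nhdsWithin] with s hs
        rw [hcongr s t hs.1 le_rfl]
      · refine tendsto_const_nhds.congr' ?_
        filter_upwards [self_mem_nhdsWithin] with s hs
        rw [hv'1 s hs, hv'1 t le_rfl]
        simp
    · have h5 := hv.continuous t ⟨h.le, ht.trans hτ2⟩
      have h6 : 𝓝[Iic τ] t ≤ 𝓝[Icc t₁ t₂] t := by
        refine nhdsWithin_le_iff.2 ?_
        filter_upwards [mem_nhdsWithin_of_mem_nhds (Ioi_mem_nhds h), self_mem_nhdsWithin] with s h7 h8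
        exact ⟨le_of_lt h7, le_trans h8 hτ2⟩
      refine (h5.mono_left h6).congr' ?_
      filter_upwards [mem_nhdsWithin_of_mem_nhds (Ioi_mem_nhds h)] with s hs
      rw [hcongr s t (le_of_lt hs) h.le]
  · refine (hv.measurable.mono_measure hle).congr ?_
    filter_upwards [ae_restrict_mem hS] with z hz
    simp only [Function.uncurry]
    rw [hv'2 _ hz.1.1]
  · have h4 := ae_mono (Measure.restrict_mono (Ioo_subset_Ioo_right hτ2) le_rfl) hv.lateral
    filter_upwards [h4, ae_restrict_mem measurableSet_Ioo] with t ht ht2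
    rw [hv'2 t ht2.1]
    exact ht
  · intro s t hst ht ψ h1 h2 h3
    have hz : ∀ s t, t ≤ t₁ → ∫ r in Ioo s t, ∫ x in U,
        (inner ℝ (G (r, x)) (spatialGrad ψ x) : ℝ) = 0 := fun s t ht => by
      refine setIntegral_eq_zero_of_forall_eq_zero fun r hr => ?_
      have : ∀ x, G (r, x) = 0 := fun x => indicator_of_notMem
        (fun h => absurd h.1.1 (not_lt.2 (hr.2.le.trans ht))) _
      simp [this]
    rcases le_total t₁ s with h | h
    · exact hweak' s t h hst.le (ht.trans hτ2) ψ h1 h2 h3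
    rcases le_total t t₁ with h' | h'
    · rw [hv'1 t h', hv'1 s h, hz s t h']; simp
    · have h4 := hweak' t₁ t le_rfl h' (ht.trans hτ2) ψ h1 h2 h3
      rw [hv'1 t₁ le_rfl] at h4
      rw [hv'1 s h, h4]
      congr 1
      refine (setIntegral_eq_of_subset_of_forall_sdiff_eq_zero measurableSet_Ioo
        (Ioo_subset_Ioo_left h) fun r hr => ?_).symm
      have hr1 : r ≤ t₁ := by
        by_contra hcon
        exact hr.2 ⟨not_le.1 hcon, hr.1.2⟩
      have : ∀ x, G (r, x) = 0 := fun x => indicator_of_notMem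
        (fun h => absurd h.1.1 (not_lt.2 hr1)) _
      simp [this]

end EnergyInequality

/-! ### From a distributional time derivative to a primitive -/

section TimeDerivative

/-- A smooth ramp from `0` at `s` to `1` at `s + ε`. -/
def ramp (ε s r : ℝ) : ℝ := Real.smoothTransition (ε⁻¹ * (r - s))

lemma contDiff_ramp (ε s : ℝ) : ContDiff ℝ 1 (ramp ε s) := by
  unfold ramp
  exact (Real.smoothTransition.contDiff (n := 1)).comp (by fun_prop)

lemma deriv_ramp (ε s r : ℝ) :
    deriv (ramp ε s) r = ε⁻¹ * deriv Real.smoothTransition (ε⁻¹ * (r - s)) := by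
  have h1 : HasDerivAt (fun r => ε⁻¹ * (r - s)) ε⁻¹ r := by
    simpa using ((hasDerivAt_id r).sub_const s).const_mul ε⁻¹
  have h2 : HasDerivAt Real.smoothTransition (deriv Real.smoothTransition (ε⁻¹ * (r - s)))
      (ε⁻¹ * (r - s)) :=
    ((Real.smoothTransition.contDiff (n := 1)).differentiable one_ne_zero _).hasDerivAt
  rw [mul_comm]
  exact (h2.comp r h1).deriv

lemma ramp_eq_zero {ε s r : ℝ} (hε : 0 < ε) (h : r ≤ s) : ramp ε s r = 0 :=
  Real.smoothTransition.zero_of_nonpos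
    (mul_nonpos_of_nonneg_of_nonpos (by positivity) (by linarith))

lemma ramp_eq_one {ε s r : ℝ} (hε : 0 < ε) (h : s + ε ≤ r) : ramp ε s r = 1 := by
  refine Real.smoothTransition.one_of_one_le ?_
  rw [← div_eq_inv_mul, one_le_div hε]
  linarith

lemma deriv_ramp_eq_zero {ε s r : ℝ} (hε : 0 < ε) (h : r < s ∨ s + ε < r) :
    deriv (ramp ε s) r = 0 := by
  rcases h with h | h
  · have : ramp ε s =ᶠ[𝓝 r] fun _ => 0 := by
      filter_upwards [Iio_mem_nhds h] with x hx
      exact ramp_eq_zero hε (le_of_lt hx)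
    rw [this.deriv_eq, deriv_const]
  · have : ramp ε s =ᶠ[𝓝 r] fun _ => 1 := by
      filter_upwards [Ioi_mem_nhds h] with x hx
      exact ramp_eq_one hε (le_of_lt hx)
    rw [this.deriv_eq, deriv_const]

variable {t₁ t₂ : ℝ} {G k : ℝ → ℝ}

/-- The derivative of the ramp is supported in `[s, s+ε]`; rescaling that interval to `[0,1]` gives
a kernel independent of `ε`. -/
lemma integral_deriv_ramp_mul {ε s : ℝ} (hε : 0 < ε) (hs : t₁ < s) (hsε : s + ε < t₂) :
    ∫ r in Ioo t₁ t₂, deriv (ramp ε s) r * G r =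
      ∫ y in (0 : ℝ)..1, deriv Real.smoothTransition y * G (ε * y + s) := by
  have h1 := intervalIntegral.smul_integral_comp_mul_add (a := 0) (b := 1)
    (fun r => deriv (ramp ε s) r * G r) ε s
  rw [mul_zero, mul_one, zero_add, add_comm ε s, ← intervalIntegral.integral_smul,
    intervalIntegral.integral_of_le (show s ≤ s + ε by linarith)] at h1
  have h2 : ∫ r in Ioo t₁ t₂, deriv (ramp ε s) r * G r =
      ∫ r in Icc s (s + ε), deriv (ramp ε s) r * G r := by
    refine setIntegral_eq_of_subset_of_forall_sdiff_eq_zero measurableSet_Ioo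
      (fun r hr => ⟨hs.trans_le hr.1, hr.2.trans_lt hsε⟩) fun r hr => ?_
    rw [deriv_ramp_eq_zero hε, zero_mul]
    by_contra hcon
    push Not at hcon
    exact hr.2 hcon
  rw [h2, integral_Icc_eq_integral_Ioc, ← h1]
  refine intervalIntegral.integral_congr fun y _ => ?_
  simp only [smul_eq_mul]
  rw [deriv_ramp, add_sub_cancel_right, inv_mul_cancel_left₀ hε.ne']
  field_simp

/-- The rescaled kernel has total mass one, being the derivative of a function that rises from `0`
to `1`. The derivatives of the ramps are therefore an approximate identity at `s`. -/
lemma tendsto_integral_deriv_ramp_mul {s : ℝ} (hG : ContinuousOn G (Icc t₁ t₂)) (hs : t₁ < s)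
    (hs2 : s < t₂) {ε : ℕ → ℝ} (hε : ∀ j, 0 < ε j) (hε0 : Tendsto ε atTop (𝓝 0))
    (hεs : ∀ j, s + ε j < t₂) :
    Tendsto (fun j => ∫ r in Ioo t₁ t₂, deriv (ramp (ε j) s) r * G r) atTop (𝓝 (G s)) := by
  have hS : Continuous (deriv Real.smoothTransition) :=
    (Real.smoothTransition.contDiff (n := 1)).continuous_deriv le_rfl
  have h1 : ∫ y in (0 : ℝ)..1, deriv Real.smoothTransition y * G s = G s := by
    rw [intervalIntegral.integral_mul_const, intervalIntegral.integral_deriv_eq_sub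
      (fun x _ => (Real.smoothTransition.contDiff (n := 1)).differentiable one_ne_zero x)
      (hS.intervalIntegrable _ _)]
    simp
  simp_rw [fun j => integral_deriv_ramp_mul (G := G) (hε j) hs (hεs j)]
  rw [← h1]
  obtain ⟨C, hC⟩ := isCompact_Icc.exists_bound_of_continuousOn hG
  have hmem : ∀ j, ∀ y ∈ uIoc (0 : ℝ) 1, ε j * y + s ∈ Icc t₁ t₂ := by
    intro j y hy
    rw [uIoc_of_le zero_le_one] at hy
    have h2 := hεs j
    have h3 := hε j
    constructor <;> nlinarith [hy.1, hy.2]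
  refine intervalIntegral.tendsto_integral_filter_of_dominated_convergence
    (fun y => |deriv Real.smoothTransition y| * C) (Eventually.of_forall fun j => ?_)
    (Eventually.of_forall fun j => Eventually.of_forall fun y hy => ?_)
    ((hS.abs.mul continuous_const).intervalIntegrable _ _) (Eventually.of_forall fun y hy => ?_)
  · refine ContinuousOn.aestronglyMeasurable (hS.continuousOn.mul ?_) measurableSet_uIoc
    exact hG.comp (by fun_prop) (hmem j)
  · rw [norm_mul, Real.norm_eq_abs]
    gcongr
    exact hC _ (hmem j y hy)
  · have h4 : Tendsto (fun j => ε j * y + s) atTop (𝓝 s) := by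
      simpa using (hε0.mul_const y).add_const s
    have h5 : ContinuousAt G s := hG.continuousAt (Icc_mem_nhds hs hs2)
    exact (h5.tendsto.comp h4).const_mul _

/-- If the continuous function `G` has distributional derivative `-k`, then `G` is a primitive
of `-k`. -/
lemma sub_eq_neg_integral_of_weak_deriv (hG : ContinuousOn G (Icc t₁ t₂))
    (hk : IntegrableOn k (Ioo t₁ t₂))
    (h : ∀ χ : ℝ → ℝ, ContDiff ℝ 1 χ → HasCompactSupport χ → tsupport χ ⊆ Ioo t₁ t₂ →
      ∫ r in Ioo t₁ t₂, deriv χ r * G r = ∫ r in Ioo t₁ t₂, χ r * k r)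
    {s t : ℝ} (hs : t₁ ≤ s) (hst : s ≤ t) (ht : t ≤ t₂) :
    G t - G s = -∫ r in Ioo s t, k r := by
  rcases (hs.trans (hst.trans ht)).eq_or_lt with heq | hlt
  · have e1 : s = t := by linarith
    subst e1; simp
  -- The test function is the difference of the ramps starting at `s` and at `t`, a smoothed
  -- indicator of `(s,t]`. Its derivative concentrates at the two endpoints with opposite signs.
  have hopen : ∀ s t, t₁ < s → s ≤ t → t < t₂ → G s - G t = ∫ r in Ioc s t, k r := by
    intro s t hs hst ht
    set ε : ℕ → ℝ := fun j => (t₂ - t) / 2 * (1 / ((j : ℝ) + 1)) with hεdef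
    have hε : ∀ j, 0 < ε j := fun j => by
      have : 0 < t₂ - t := by linarith
      positivity
    have hε0 : Tendsto ε atTop (𝓝 0) := by
      have := (tendsto_one_div_add_atTop_nhds_zero_nat (𝕜 := ℝ)).const_mul ((t₂ - t) / 2)
      rwa [mul_zero] at this
    have hεt : ∀ j, t + ε j < t₂ := fun j => by
      have h1 : 1 / ((j : ℝ) + 1) ≤ 1 := by
        rw [div_le_one (by positivity)]
        linarith [(Nat.cast_nonneg j : (0 : ℝ) ≤ j)]
      have h2 : ε j ≤ (t₂ - t) / 2 := mul_le_of_le_one_right (by linarith) h1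
      linarith
    have hεs : ∀ j, s + ε j < t₂ := fun j => by linarith [hεt j]
    have hw : ∀ j, (∫ r in Ioo t₁ t₂, deriv (ramp (ε j) s) r * G r) -
        ∫ r in Ioo t₁ t₂, deriv (ramp (ε j) t) r * G r =
        ∫ r in Ioo t₁ t₂, (ramp (ε j) s r - ramp (ε j) t r) * k r := by
      intro j
      have hsub : tsupport (fun r => ramp (ε j) s r - ramp (ε j) t r) ⊆ Icc s (t + ε j) := by
        refine closure_minimal (fun r hr => ?_) isClosed_Icc
        by_contra hcon
        refine hr ?_
        rw [mem_Icc, not_and_or] at hcon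
        simp only
        rcases hcon with hcon | hcon
        · push Not at hcon
          rw [ramp_eq_zero (hε j) hcon.le, ramp_eq_zero (hε j) (hcon.le.trans hst), sub_zero]
        · push Not at hcon
          rw [ramp_eq_one (hε j) (by linarith), ramp_eq_one (hε j) hcon.le, sub_self]
      rw [← h _ ((contDiff_ramp _ _).sub (contDiff_ramp _ _))
        (isCompact_Icc.of_isClosed_subset (isClosed_tsupport _) hsub)
        (hsub.trans fun r hr => ⟨hs.trans_le hr.1, hr.2.trans_lt (hεt j)⟩)]
      have hi : ∀ σ, IntegrableOn (fun r => deriv (ramp (ε j) σ) r * G r) (Ioo t₁ t₂) := fun σ =>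
        ((((contDiff_ramp (ε j) σ).continuous_deriv le_rfl).continuousOn.mul hG).integrableOn_Icc).mono_set
          Ioo_subset_Icc_self
      rw [← integral_sub (hi s) (hi t)]
      refine integral_congr_ae (Eventually.of_forall fun r => ?_)
      simp only
      have hd : deriv (fun r => ramp (ε j) s r - ramp (ε j) t r) r =
          deriv (ramp (ε j) s) r - deriv (ramp (ε j) t) r :=
        deriv_sub ((contDiff_ramp _ _).differentiable one_ne_zero r)
          ((contDiff_ramp _ _).differentiable one_ne_zero r)
      rw [hd, sub_mul]
    have hl := (tendsto_integral_deriv_ramp_mul hG hs (hst.trans_lt ht) hε hε0 hεs).sub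
      (tendsto_integral_deriv_ramp_mul hG (hs.trans_le hst) ht hε hε0 hεt)
    simp_rw [hw] at hl
    have hr : Tendsto (fun j => ∫ r in Ioo t₁ t₂, (ramp (ε j) s r - ramp (ε j) t r) * k r) atTop
        (𝓝 (∫ r in Ioo t₁ t₂, (Ioc s t).indicator k r)) := by
      have hlim : ∀ σ r, Tendsto (fun j => ramp (ε j) σ r) atTop
          (𝓝 ((Ioi σ).indicator (fun _ => (1 : ℝ)) r)) := by
        intro σ r
        by_cases hσ : r ≤ σ
        · rw [indicator_of_notMem (by simpa using hσ)]
          simp_rw [fun j => ramp_eq_zero (hε j) hσ]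
          exact tendsto_const_nhds
        · push Not at hσ
          rw [indicator_of_mem (by simpa using hσ)]
          refine tendsto_const_nhds.congr' ?_
          filter_upwards [hε0.eventually (gt_mem_nhds (show (0 : ℝ) < r - σ by linarith))] with j hj
          rw [ramp_eq_one (hε j) (by linarith)]
      refine tendsto_integral_of_dominated_convergence (fun r => |k r|) (fun j => ?_) hk.abs
        (fun j => Eventually.of_forall fun r => ?_) (Eventually.of_forall fun r => ?_)
      · exact ((contDiff_ramp _ _).continuous.sub
          (contDiff_ramp _ _).continuous).aestronglyMeasurable.mul hk.1
      · rw [norm_mul, Real.norm_eq_abs (k r)]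
        refine mul_le_of_le_one_left (abs_nonneg _) ?_
        have h1 := Real.smoothTransition.nonneg ((ε j)⁻¹ * (r - s))
        have h2 := Real.smoothTransition.nonneg ((ε j)⁻¹ * (r - t))
        have h3 := Real.smoothTransition.le_one ((ε j)⁻¹ * (r - s))
        have h4 := Real.smoothTransition.le_one ((ε j)⁻¹ * (r - t))
        rw [Real.norm_eq_abs, abs_le]
        unfold ramp
        constructor <;> linarith
      · have h1 := ((hlim s r).sub (hlim t r)).mul_const (k r)
        convert h1 using 2
        by_cases hrs : s < r <;> by_cases hrt : r ≤ t
        · simp [indicator, hrs, hrt, not_lt.2 hrt]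
        · have : t < r := not_le.1 hrt
          simp [indicator, hrs, hrt, this]
        · simp [indicator, hrs, not_lt.2 hrt]
        · exact absurd (hst.trans_lt (not_le.1 hrt)) hrs
    rw [tendsto_nhds_unique hl hr, setIntegral_indicator measurableSet_Ioc]
    congr 2
    exact inter_eq_right.2 fun r hr => ⟨hs.trans hr.1, hr.2.trans_lt ht⟩
  -- extend to the closed interval by continuity
  set P : ℝ → ℝ := fun t => ∫ r in t₁..t, k r with hP
  have hk' : IntervalIntegrable k volume t₁ t₂ := by
    rw [intervalIntegrable_iff_integrableOn_Ioo_of_le hlt.le]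
    exact hk
  have hPc : ContinuousOn P (Icc t₁ t₂) := by
    have := intervalIntegral.continuousOn_primitive_interval' hk' left_mem_uIcc
    rwa [uIcc_of_le hlt.le] at this
  have hki : ∀ a b, t₁ ≤ a → a ≤ t₂ → t₁ ≤ b → b ≤ t₂ → IntervalIntegrable k volume a b :=
    fun a b h1 h2 h3 h4 => hk'.mono_set (by
      rw [uIcc_of_le hlt.le]
      exact fun x hx => ⟨(le_min h1 h3).trans hx.1, hx.2.trans (max_le h2 h4)⟩)
  set m := (t₁ + t₂) / 2 with hm
  have hEq : EqOn (fun t => G t + P t) (fun _ => G m + P m) (Ioo t₁ t₂) := by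
    have hle : ∀ a b, t₁ < a → a ≤ b → b < t₂ → G a + P a = G b + P b := by
      intro a b ha hab hb
      have h1 := hopen a b ha hab hb
      have h2 := intervalIntegral.integral_add_adjacent_intervals
        (hki t₁ a le_rfl (by linarith) ha.le (by linarith))
        (hki a b ha.le (by linarith) (by linarith) hb.le)
      rw [intervalIntegral.integral_of_le hab] at h2
      simp only [hP]
      linarith
    intro x hx
    rcases le_total x m with hxm | hxm
    · exact hle x m hx.1 hxm (by rw [hm]; linarith)
    · exact (hle m x (by rw [hm]; linarith) hxm hx.2).symm
  have hEq2 := hEq.of_subset_closure (hG.add hPc) continuousOn_const Ioo_subset_Icc_self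
    (closure_Ioo hlt.ne).ge
  have h1 := hEq2 ⟨hs, hst.trans ht⟩
  have h2 := hEq2 ⟨hs.trans hst, ht⟩
  have h3 := intervalIntegral.integral_add_adjacent_intervals
    (hki t₁ s le_rfl hlt.le hs (hst.trans ht)) (hki s t hs (hst.trans ht) (hs.trans hst) ht)
  rw [intervalIntegral.integral_of_le hst, integral_Ioc_eq_integral_Ioo] at h3
  simp only [hP] at h1 h2
  linarith

end TimeDerivative

/-! ### The weak formulation integrated in time -/

section WeakForm

variable {N n : ℕ} {p q t₁ t₂ : ℝ} {U : Set (Space n)}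

lemma spatialGrad_eq_zero {ψ : Space n → Vec N} {x : Space n} (hx : x ∉ tsupport ψ) :
    spatialGrad ψ x = 0 := by
  have h : fderiv ℝ ψ x = 0 := by
    by_contra hne
    exact hx (support_fderiv_subset ℝ hne)
  ext ij
  simp [spatialGrad, h]

/-- The weak formulation integrated in time. -/
lemma integrated_weak_form (hU : volume U ≠ ⊤) {u : ℝ → Space n → Vec N}
    {H : ℝ × Space n → Mat N n}
    (hu2 : ∀ t ∈ Icc t₁ t₂, MemLp (u t) 2 (volume.restrict U))
    (huc : ∀ t ∈ Icc t₁ t₂,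
      Tendsto (fun s => eLpNorm (fun x => u s x - u t x) 2 (volume.restrict U))
        (𝓝[Icc t₁ t₂] t) (𝓝 0))
    (hui : IntegrableOn (Function.uncurry u) (Ioo t₁ t₂ ×ˢ U))
    (hHi : IntegrableOn H (Ioo t₁ t₂ ×ˢ U))
    (hweak : ∀ φ : ℝ × Space n → Vec N, ContDiff ℝ 1 φ → HasCompactSupport φ →
      tsupport φ ⊆ Ioo t₁ t₂ ×ˢ U →
      ∫ z in Ioo t₁ t₂ ×ˢ U, (inner ℝ (u z.1 z.2) (fderiv ℝ φ z (1, 0))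
        - inner ℝ (H z) (spatialGrad (fun y => φ (z.1, y)) z.2) : ℝ) = 0)
    {ψ : Space n → Vec N} (hψ : ContDiff ℝ 1 ψ) (hψc : HasCompactSupport ψ)
    (hψU : tsupport ψ ⊆ U) {s t : ℝ} (hs : t₁ ≤ s) (hst : s ≤ t) (ht : t ≤ t₂) :
    (∫ x in U, (inner ℝ (u t x) (ψ x) : ℝ)) - ∫ x in U, (inner ℝ (u s x) (ψ x) : ℝ) =
      -∫ r in Ioo s t, ∫ x in U, (inner ℝ (H (r, x)) (spatialGrad ψ x) : ℝ) := by
  have : IsFiniteMeasure (volume.restrict U) := ⟨by simpa using hU.lt_top⟩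
  have hψ2 : MemLp ψ 2 (volume.restrict U) := hψ.continuous.memLp_of_hasCompactSupport hψc
  have hprod : (volume.restrict (Ioo t₁ t₂)).prod (volume.restrict U) =
      (volume.restrict (Ioo t₁ t₂ ×ˢ U) : Measure (ℝ × Space n)) := Measure.prod_restrict _ _
  have hi : IntegrableOn (fun z : ℝ × Space n => (inner ℝ (H z) (spatialGrad ψ z.2) : ℝ))
      (Ioo t₁ t₂ ×ˢ U) := by
    have h1 : MemLp (spatialGrad ψ) ⊤ (volume.restrict U) := memLp_spatialGrad hψ hψc _ _
    have h2 := h1.comp_snd (volume.restrict (Ioo t₁ t₂))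
    rw [hprod] at h2
    exact integrable_inner_of_memLp (memLp_one_iff_integrable.2 hHi) h2
  refine sub_eq_neg_integral_of_weak_deriv (t₁ := t₁) (t₂ := t₂)
    (G := fun t => ∫ x in U, (inner ℝ (u t x) (ψ x) : ℝ))
    (k := fun r => ∫ x in U, (inner ℝ (H (r, x)) (spatialGrad ψ x) : ℝ)) ?_ ?_ ?_ hs hst ht
  · intro t ht
    refine tendsto_integral_of_L1' _ (integrable_inner_of_memLp (hu2 t ht) hψ2).1 ?_ ?_
    · filter_upwards [self_mem_nhdsWithin] with s hs
      exact integrable_inner_of_memLp (hu2 s hs) hψ2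
    · have hlim := ENNReal.Tendsto.mul_const (b := eLpNorm ψ 2 (volume.restrict U)) (huc t ht)
        (Or.inr hψ2.2.ne)
      rw [zero_mul] at hlim
      refine tendsto_of_tendsto_of_tendsto_of_le_of_le' tendsto_const_nhds hlim
        (Eventually.of_forall fun _ => zero_le) ?_
      filter_upwards [self_mem_nhdsWithin] with s hs
      refine le_trans (le_of_eq ?_) (eLpNorm_inner_le ((hu2 s hs).1.sub (hu2 t ht).1) hψ2.1)
      refine eLpNorm_congr_ae (Eventually.of_forall fun x => ?_)
      simp [inner_sub_left]
  · rw [IntegrableOn, ← hprod] at hi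
    exact hi.integral_prod_left
  · intro χ h1 h2 h3
    -- Product test functions reduce the equation to the statement that `t ↦ ∫ ⟨u(t), ψ⟩` has
    -- distributional derivative `-∫ ⟨H(t), ∇ψ⟩`.
    set φ : ℝ × Space n → Vec N := fun z => χ z.1 • ψ z.2 with hφ
    have hφ1 : ContDiff ℝ 1 φ := (h1.comp contDiff_fst).smul (hψ.comp contDiff_snd)
    have hzero : ∀ z : ℝ × Space n, z ∉ tsupport χ ×ˢ tsupport ψ → φ z = 0 := by
      intro z hz
      rw [mem_prod, not_and_or] at hz
      rcases hz with hz | hz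
      · simp [hφ, image_eq_zero_of_notMem_tsupport hz]
      · simp [hφ, image_eq_zero_of_notMem_tsupport hz]
    have hK : IsCompact (tsupport χ ×ˢ tsupport ψ) := IsCompact.prod h2 hψc
    have hsub : tsupport φ ⊆ tsupport χ ×ˢ tsupport ψ :=
      closure_minimal (fun z hz => by
        by_contra hcon
        exact hz (hzero z hcon)) hK.isClosed
    have h4 := hweak φ hφ1 (HasCompactSupport.intro hK hzero) (hsub.trans (prod_mono h3 hψU))
    have e1 : ∀ z : ℝ × Space n, fderiv ℝ φ z (1, 0) = deriv χ z.1 • ψ z.2 := by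
      intro z
      have hc : HasFDerivAt (fun z : ℝ × Space n => χ z.1)
          ((ContinuousLinearMap.toSpanSingleton ℝ (deriv χ z.1)).comp (ContinuousLinearMap.fst ℝ ℝ (Space n))) z :=
        ((h1.differentiable one_ne_zero) z.1).hasDerivAt.hasFDerivAt.comp z hasFDerivAt_fst
      have hd : HasFDerivAt (fun z : ℝ × Space n => ψ z.2)
          ((fderiv ℝ ψ z.2).comp (ContinuousLinearMap.snd ℝ ℝ (Space n))) z :=
        ((hψ.differentiable one_ne_zero) z.2).hasFDerivAt.comp z hasFDerivAt_snd
      have he : fderiv ℝ φ z = _ := (hc.smul hd).fderiv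
      rw [he]
      simp
    have e2 : ∀ z : ℝ × Space n, spatialGrad (fun y => φ (z.1, y)) z.2 =
        χ z.1 • spatialGrad ψ z.2 := by
      intro z
      have : fderiv ℝ (fun y => φ (z.1, y)) z.2 = χ z.1 • fderiv ℝ ψ z.2 :=
        (((hψ.differentiable one_ne_zero) z.2).hasFDerivAt.const_smul (χ z.1)).fderiv
      ext ij
      simp only [spatialGrad, this]
      rfl
    simp only [e1, e2, real_inner_smul_right] at h4
    obtain ⟨C, hC⟩ := h2.exists_bound_of_continuous h1.continuous
    obtain ⟨C', hC'⟩ := (h2.deriv).exists_bound_of_continuous (h1.continuous_deriv le_rfl)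
    have hi1 : IntegrableOn (fun z : ℝ × Space n => χ z.1 * (inner ℝ (H z) (spatialGrad ψ z.2) : ℝ))
        (Ioo t₁ t₂ ×ˢ U) :=
      hi.bdd_mul (c := C) (h1.continuous.comp continuous_fst).aestronglyMeasurable
        (Eventually.of_forall fun z => hC _)
    have hi2 : IntegrableOn (fun z : ℝ × Space n => deriv χ z.1 * (inner ℝ (u z.1 z.2) (ψ z.2) : ℝ))
        (Ioo t₁ t₂ ×ˢ U) := by
      have h5 : MemLp ψ ⊤ (volume.restrict U) := hψ.continuous.memLp_of_hasCompactSupport hψc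
      have h6 := h5.comp_snd (volume.restrict (Ioo t₁ t₂))
      rw [hprod] at h6
      have h7 := integrable_inner_of_memLp (memLp_one_iff_integrable.2 hui) h6
      exact h7.bdd_mul (c := C') ((h1.continuous_deriv le_rfl).comp
        continuous_fst).aestronglyMeasurable (Eventually.of_forall fun z => hC' _)
    rw [integral_sub hi2 hi1, sub_eq_zero, Measure.volume_eq_prod, setIntegral_prod _ hi2,
      setIntegral_prod _ hi1] at h4
    simp only [integral_const_mul] at h4
    exact h4

lemma memLp_flux {α : Type*} [MeasurableSpace α] {μ : Measure α} (hpq : p.HolderConjugate q)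
    {W : α → Mat N n} (hW : MemLp W (ENNReal.ofReal p) μ) :
    MemLp (fun x => flux p (W x)) (ENNReal.ofReal q) μ := by
  have h1 := hW.norm_rpow_div (ENNReal.ofReal (p - 1))
  rw [ENNReal.toReal_ofReal (by linarith [hpq.lt]), ← ENNReal.ofReal_div_of_pos
    (by linarith [hpq.lt]), ← hpq.conjugate_eq] at h1
  refine h1.mono (measurable_flux.comp_aemeasurable hW.1.aemeasurable).aestronglyMeasurable
    (Eventually.of_forall fun x => ?_)
  rw [norm_flux hpq.lt]
  exact le_abs_self _

lemma memLp_coeff_smul_flux {α : Type*} [MeasurableSpace α] {μ : Measure α}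
    (hpq : p.HolderConjugate q) {W : α → Mat N n} (hW : MemLp W (ENNReal.ofReal p) μ)
    {c : α → ℝ} (hc : AEStronglyMeasurable c μ) {C : ℝ} (hC : ∀ᵐ x ∂μ, |c x| ≤ C) :
    MemLp (fun x => c x • flux p (W x)) (ENNReal.ofReal q) μ := by
  have h := memLp_flux hpq hW
  refine h.of_le_mul (c := C) (hc.smul h.1) ?_
  filter_upwards [hC] with x hx
  rw [norm_smul, Real.norm_eq_abs]
  gcongr

lemma IsWeakSolution.integrated (hpq : p.HolderConjugate q) (hU : volume U ≠ ⊤)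
    {a : ℝ → Space n → ℝ} {F Du : ℝ → Space n → Mat N n} {u : ℝ → Space n → Vec N}
    (h : IsWeakSolution p t₁ t₂ U a F u Du)
    (ha : AEStronglyMeasurable (Function.uncurry a) (volume.restrict (Ioo t₁ t₂ ×ˢ U)))
    {C : ℝ} (haC : ∀ᵐ z ∂(volume.restrict (Ioo t₁ t₂ ×ˢ U)), |a z.1 z.2| ≤ C)
    (hF : MemLp (Function.uncurry F) (ENNReal.ofReal p) (volume.restrict (Ioo t₁ t₂ ×ˢ U)))
    {ψ : Space n → Vec N} (hψ : ContDiff ℝ 1 ψ) (hψc : HasCompactSupport ψ)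
    (hψU : tsupport ψ ⊆ U) {s t : ℝ} (hs : t₁ ≤ s) (hst : s ≤ t) (ht : t ≤ t₂) :
    (∫ x in U, (inner ℝ (u t x) (ψ x) : ℝ)) - ∫ x in U, (inner ℝ (u s x) (ψ x) : ℝ) =
      -∫ r in Ioo s t, ∫ x in U,
        (inner ℝ (a r x • flux p (Du r x) + flux p (F r x)) (spatialGrad ψ x) : ℝ) := by
  have hprod : (volume.restrict (Ioo t₁ t₂)).prod (volume.restrict U) =
      (volume.restrict (Ioo t₁ t₂ ×ˢ U) : Measure (ℝ × Space n)) := Measure.prod_restrict _ _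
  have : IsFiniteMeasure (volume.restrict U) := ⟨by simpa using hU.lt_top⟩
  have : IsFiniteMeasure (volume.restrict (Ioo t₁ t₂ ×ˢ U) : Measure (ℝ × Space n)) := by
    rw [← hprod]; infer_instance
  have h1 : MemLp (fun z : ℝ × Space n => a z.1 z.2 • flux p (Du z.1 z.2) + flux p (F z.1 z.2))
      (ENNReal.ofReal q) (volume.restrict (Ioo t₁ t₂ ×ˢ U)) :=
    (memLp_coeff_smul_flux hpq h.memLp_grad ha haC).add (memLp_flux hpq hF)
  refine integrated_weak_form (t₁ := t₁) (t₂ := t₂)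
    (H := fun z => a z.1 z.2 • flux p (Du z.1 z.2) + flux p (F z.1 z.2)) hU h.memLp_two
    h.continuous (h.memLp.integrable (by simpa using hpq.lt.le))
    (h1.integrable (by simpa using hpq.symm.lt.le)) (fun φ h2 h3 h4 => ?_) hψ hψc hψU hs hst ht
  rw [← h.weakForm φ h2 h3 h4]
  congr 1
  funext z
  rw [inner_add_left, real_inner_smul_left]
  ring

end WeakForm

/-! ### The equation for the difference of the two solutions -/

section Comparison

variable {N n : ℕ} {p q : ℝ} {Ω B : Set (Space n)}

lemma MemW1pZero.neg {f : Space n → Vec N} {Df : Space n → Mat N n} (h : MemW1pZero p B f Df) :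
    MemW1pZero p B (fun x => -f x) (fun x => -Df x) := by
  obtain ⟨φ, h1, h2, h3⟩ := h
  refine ⟨fun k x => -φ k x, fun k => ⟨(h1 k).1.neg, ?_, ?_⟩, h2.congr fun k => ?_,
    h3.congr fun k => ?_⟩
  · exact (h1 k).2.1.comp_left (g := fun y : Vec N => -y) neg_zero
  · exact (tsupport_comp_subset (g := fun y : Vec N => -y) neg_zero (φ k)).trans (h1 k).2.2
  · rw [← eLpNorm_neg]
    congr 1
    funext x
    simp only [Pi.neg_apply]
    abel
  · rw [← eLpNorm_neg]
    congr 1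
    funext x
    have h4 : spatialGrad (fun x => -φ k x) x = -spatialGrad (φ k) x := by
      have h5 : fderiv ℝ (fun x => -φ k x) x = -fderiv ℝ (φ k) x :=
        ((((h1 k).1.differentiable (by simp)) x).hasFDerivAt.neg).fderiv
      ext ij
      simp only [spatialGrad, h5]
      rfl
    simp only [Pi.neg_apply, h4]
    abel

lemma ae_time_ne (μ : Measure (Space n)) (c : ℝ) : ∀ᵐ z ∂((volume : Measure ℝ).prod μ), z.1 ≠ c := by
  have h : ∀ᵐ t ∂(volume : Measure ℝ), t ≠ c := by simp [ae_iff]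
  exact Measure.quasiMeasurePreserving_fst.ae h

/-- Extension by zero to negative times preserves `L^r`. -/
lemma memLp_of_eq_zero_of_neg {E : Type*} [NormedAddCommGroup E] {r : ℝ≥0∞} {T t₁ t₀ : ℝ}
    {f : ℝ × Space n → E} (hΩ : MeasurableSet Ω) (hB : MeasurableSet B) (hBΩ : B ⊆ Ω)
    (ht₀ : t₀ ≤ T) (hf : MemLp f r (volume.restrict (Ioo 0 T ×ˢ Ω)))
    (h0 : ∀ t < 0, ∀ x, f (t, x) = 0) : MemLp f r (volume.restrict (Ioo t₁ t₀ ×ˢ B)) := by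
  have hS : MeasurableSet (Ioo 0 T ×ˢ Ω) := measurableSet_Ioo.prod hΩ
  have hS' : MeasurableSet (Ioo t₁ t₀ ×ˢ B) := measurableSet_Ioo.prod hB
  have h1 : MemLp ((Ioo 0 T ×ˢ Ω).indicator f) r volume := (memLp_indicator_iff_restrict hS).2 hf
  refine (memLp_congr_ae ?_).1 (h1.restrict (Ioo t₁ t₀ ×ˢ B))
  filter_upwards [ae_restrict_mem hS', ae_restrict_of_ae (ae_time_ne volume 0)] with z hz hz0
  by_cases hz1 : z ∈ Ioo 0 T ×ˢ Ω
  · rw [indicator_of_mem hz1]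
  · rw [indicator_of_notMem hz1]
    rcases lt_or_gt_of_ne hz0 with h | h
    · exact (h0 z.1 h z.2).symm
    · exact absurd ⟨⟨h, hz.1.2.trans_le ht₀⟩, hBΩ hz.2⟩ hz1

/-- Extension by zero to negative times preserves continuity in time with values in `L²`. -/
lemma tendsto_eLpNorm_of_eq_zero_of_neg {T t₁ t₀ : ℝ} {u : ℝ → Space n → Vec N} (hBΩ : B ⊆ Ω)
    (hT : 0 ≤ T) (ht₀ : t₀ ≤ T) (hu : ∀ t < 0, u t = 0) (hu0 : u 0 =ᵐ[volume.restrict Ω] 0)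
    (huc : ∀ t ∈ Icc 0 T, Tendsto (fun s => eLpNorm (fun x => u s x - u t x) 2 (volume.restrict Ω))
      (𝓝[Icc 0 T] t) (𝓝 0)) (t : ℝ) (ht : t ∈ Icc t₁ t₀) :
    Tendsto (fun s => eLpNorm (fun x => u s x - u t x) 2 (volume.restrict B))
      (𝓝[Icc t₁ t₀] t) (𝓝 0) := by
  have hle : volume.restrict B ≤ volume.restrict Ω := Measure.restrict_mono hBΩ le_rfl
  have hc : ∀ t ∈ Icc 0 T, Tendsto (fun s => eLpNorm (fun x => u s x - u t x) 2 (volume.restrict B))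
      (𝓝[Icc 0 T] t) (𝓝 0) := fun t ht =>
    tendsto_of_tendsto_of_tendsto_of_le_of_le tendsto_const_nhds (huc t ht) (fun _ => zero_le)
      fun s => eLpNorm_mono_measure _ hle
  have hu0B : u 0 =ᵐ[volume.restrict B] 0 := ae_mono hle hu0
  have hsub : Icc t₁ t₀ ⊆ Iio 0 ∪ Icc 0 T := fun s hs => by
    rcases lt_or_ge s 0 with h | h
    · exact Or.inl h
    · exact Or.inr ⟨h, hs.2.trans ht₀⟩
  refine Tendsto.mono_left ?_ (nhdsWithin_mono t hsub)
  rw [nhdsWithin_union]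
  rcases lt_trichotomy t 0 with h | h | h
  · have h1 : Tendsto (fun s => eLpNorm (fun x => u s x - u t x) 2 (volume.restrict B))
        (𝓝 t) (𝓝 0) := by
      refine tendsto_const_nhds.congr' ?_
      filter_upwards [Iio_mem_nhds h] with s hs
      rw [hu s hs, hu t h]
      simp
    exact (h1.mono_left nhdsWithin_le_nhds).sup (h1.mono_left nhdsWithin_le_nhds)
  · subst h
    refine Tendsto.sup ?_ (hc 0 ⟨le_rfl, hT⟩)
    refine tendsto_const_nhds.congr' ?_
    filter_upwards [self_mem_nhdsWithin] with s hs
    symm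
    have h1 : (fun x => u s x - u 0 x) =ᵐ[volume.restrict B] 0 := by
      filter_upwards [hu0B] with x hx
      rw [hx, hu s hs]
      simp
    rw [eLpNorm_congr_ae h1, eLpNorm_zero]
  · refine Tendsto.sup ?_ (hc t ⟨h.le, ht.2.trans ht₀⟩)
    have : 𝓝[Iio 0] t = ⊥ := by
      rw [← notMem_closure_iff_nhdsWithin_eq_bot, closure_Iio, mem_Iic]
      exact not_le.2 h
    rw [this]
    exact tendsto_bot

/-- The difference between a solution extended by zero to negative times and a comparison map. -/
lemma IsDirichletSolution.sub_isZeroDataSolution (hpq : p.HolderConjugate q)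
    (hΩ : MeasurableSet Ω) (hΩf : volume Ω ≠ ⊤) (hB : MeasurableSet B) (hBΩ : B ⊆ Ω)
    {T t₁ t₀ : ℝ} (h0t : 0 ≤ t₀) (ht₀ : t₀ ≤ T)
    {a b : ℝ → Space n → ℝ} (ha : Measurable (Function.uncurry a)) {C : ℝ}
    (haC : ∀ t ≤ T, ∀ x ∈ Ω, |a t x| ≤ C) (hb : Measurable (Function.uncurry b))
    (hbC : ∀ t ≤ T, ∀ x ∈ B, |b t x| ≤ C) {F : ℝ → Space n → Mat N n}
    (hF : MemLp (Function.uncurry F) (ENNReal.ofReal p) (volume.restrict (Ioo 0 T ×ˢ Ω)))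
    {u : ℝ → Space n → Vec N} {Du : ℝ → Space n → Mat N n}
    (hu : IsDirichletSolution p 0 T Ω a F 0 0 u Du)
    (hneg : ∀ t < 0, u t = 0 ∧ Du t = 0 ∧ F t = 0)
    {w : ℝ → Space n → Vec N} {Dw : ℝ → Space n → Mat N n}
    (hw : IsDirichletSolution p t₁ t₀ B b 0 u Du w Dw) :
    IsZeroDataSolution p q t₁ t₀ B (fun t x => u t x - w t x) (fun t x => Du t x - Dw t x)
      (fun z => a z.1 z.2 • flux p (Du z.1 z.2) + flux p (F z.1 z.2)
        - b z.1 z.2 • flux p (Dw z.1 z.2)) := by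
  have hT : 0 ≤ T := h0t.trans ht₀
  have hle : volume.restrict B ≤ volume.restrict Ω := Measure.restrict_mono hBΩ le_rfl
  have hBf : volume B ≠ ⊤ := ((measure_mono hBΩ).trans_lt hΩf.lt_top).ne
  have hS : MeasurableSet (Ioo t₁ t₀ ×ˢ B) := measurableSet_Ioo.prod hB
  have hp : (1 : ℝ≥0∞) ≤ ENNReal.ofReal p := by simpa using hpq.lt.le
  have hu0 : u 0 =ᵐ[volume.restrict Ω] 0 := hu.initial
  have hu2 : ∀ t ∈ Icc t₁ t₀, MemLp (u t) 2 (volume.restrict B) := fun t ht => by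
    rcases lt_or_ge t 0 with h | h
    · rw [(hneg t h).1]; exact MemLp.zero
    · exact (hu.memLp_two t ⟨h, ht.2.trans ht₀⟩).mono_measure hle
  have huc := tendsto_eLpNorm_of_eq_zero_of_neg (B := B) (t₁ := t₁) hBΩ hT ht₀
    (fun t ht => (hneg t ht).1) hu0 hu.continuous
  have hup : MemLp (Function.uncurry u) (ENNReal.ofReal p) (volume.restrict (Ioo t₁ t₀ ×ˢ B)) :=
    memLp_of_eq_zero_of_neg hΩ hB hBΩ ht₀ hu.memLp fun t ht x => by
      simp [Function.uncurry, (hneg t ht).1]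
  have hDup : MemLp (Function.uncurry Du) (ENNReal.ofReal p) (volume.restrict (Ioo t₁ t₀ ×ˢ B)) :=
    memLp_of_eq_zero_of_neg hΩ hB hBΩ ht₀ hu.memLp_grad fun t ht x => by
      simp [Function.uncurry, (hneg t ht).2.1]
  have hFp : MemLp (Function.uncurry F) (ENNReal.ofReal p) (volume.restrict (Ioo t₁ t₀ ×ˢ B)) :=
    memLp_of_eq_zero_of_neg hΩ hB hBΩ ht₀ hF fun t ht x => by
      simp [Function.uncurry, (hneg t ht).2.2]
  have haC' : ∀ᵐ z ∂(volume.restrict (Ioo t₁ t₀ ×ˢ B)), |a z.1 z.2| ≤ C := by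
    filter_upwards [ae_restrict_mem hS] with z hz
    exact haC _ (hz.1.2.le.trans ht₀) _ (hBΩ hz.2)
  have hbC' : ∀ᵐ z ∂(volume.restrict (Ioo t₁ t₀ ×ˢ B)), |b z.1 z.2| ≤ C := by
    filter_upwards [ae_restrict_mem hS] with z hz
    exact hbC _ (hz.1.2.le.trans ht₀) _ hz.2
  have haC'' : ∀ᵐ z ∂(volume.restrict (Ioo 0 T ×ˢ Ω)), |a z.1 z.2| ≤ C := by
    filter_upwards [ae_restrict_mem (measurableSet_Ioo.prod hΩ)] with z hz
    exact haC _ hz.1.2.le _ hz.2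
  have hHu : MemLp (fun z : ℝ × Space n => a z.1 z.2 • flux p (Du z.1 z.2) + flux p (F z.1 z.2))
      (ENNReal.ofReal q) (volume.restrict (Ioo t₁ t₀ ×ˢ B)) :=
    (memLp_coeff_smul_flux hpq hDup ha.aestronglyMeasurable haC').add (_root_.memLp_flux hpq hFp)
  have hHw : MemLp (fun z : ℝ × Space n => b z.1 z.2 • flux p (Dw z.1 z.2))
      (ENNReal.ofReal q) (volume.restrict (Ioo t₁ t₀ ×ˢ B)) :=
    memLp_coeff_smul_flux hpq hw.memLp_grad hb.aestronglyMeasurable hbC'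
  refine ⟨fun t ht => (hu2 t ht).sub (hw.memLp_two t ht), fun t ht => ?_,
    hup.1.sub hw.memLp.1, hDup.sub hw.memLp_grad, hHu.sub hHw, ?_, ?_, ?_⟩
  · have hlim := (huc t ht).add (hw.continuous t ht)
    rw [add_zero] at hlim
    refine tendsto_of_tendsto_of_tendsto_of_le_of_le' tendsto_const_nhds hlim
      (Eventually.of_forall fun _ => zero_le) ?_
    filter_upwards [self_mem_nhdsWithin] with s hs
    refine le_trans (le_of_eq ?_) (eLpNorm_sub_le ((hu2 s hs).1.sub (hu2 t ht).1)
      ((hw.memLp_two s hs).1.sub (hw.memLp_two t ht).1) (by norm_num))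
    congr 1
    funext x
    simp only [Pi.sub_apply]
    abel
  · filter_upwards [hw.lateral] with t ht
    have := ht.neg
    simpa only [neg_sub] using this
  · filter_upwards [hw.initial] with x hx
    simp [hx]
  · intro s t hs hst ht ψ hψ hψc hψB
    have hψ2 : MemLp ψ 2 (volume.restrict B) := hψ.continuous.memLp_of_hasCompactSupport hψc
    have h1 := hw.toIsWeakSolution.integrated hpq hBf hb.aestronglyMeasurable hbC' MemLp.zero
      hψ hψc hψB hs hst ht
    simp only [Pi.zero_apply, flux_zero, add_zero] at h1
    -- the equation for `u`, restricted to `B` and extended to negative times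
    set k : ℝ → ℝ := fun r => ∫ x in B,
      (inner ℝ (a r x • flux p (Du r x) + flux p (F r x)) (spatialGrad ψ x) : ℝ) with hk
    have hk0 : ∀ r < 0, k r = 0 := fun r hr => by
      simp [hk, (hneg r hr).2.1, (hneg r hr).2.2, flux_zero]
    -- A test function supported in `B` is admissible for the equation in `Ω`, and all its integrals
    -- live on `B`.
    have hΩB : ∀ f : Space n → ℝ, (∀ x ∉ tsupport ψ, f x = 0) → ∫ x in Ω, f x = ∫ x in B, f x :=
      fun f hf => setIntegral_eq_of_subset_of_forall_sdiff_eq_zero hΩ hBΩ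
        fun x hx => hf x fun h => hx.2 (hψB h)
    have h2 : ∀ s t, 0 ≤ s → s ≤ t → t ≤ T →
        (∫ x in B, (inner ℝ (u t x) (ψ x) : ℝ)) - ∫ x in B, (inner ℝ (u s x) (ψ x) : ℝ) =
          -∫ r in Ioo s t, k r := by
      intro s t hs hst ht
      have h3 := hu.toIsWeakSolution.integrated hpq hΩf ha.aestronglyMeasurable haC'' hF
        hψ hψc (hψB.trans hBΩ) hs hst ht
      have e1 : ∀ y : Space n → Vec N, ∫ x in Ω, (inner ℝ (y x) (ψ x) : ℝ) =
          ∫ x in B, (inner ℝ (y x) (ψ x) : ℝ) := fun y =>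
        hΩB _ fun x hx => by simp [image_eq_zero_of_notMem_tsupport hx]
      have e2 : ∀ y : Space n → Mat N n, ∫ x in Ω, (inner ℝ (y x) (spatialGrad ψ x) : ℝ) =
          ∫ x in B, (inner ℝ (y x) (spatialGrad ψ x) : ℝ) := fun y =>
        hΩB _ fun x hx => by simp [spatialGrad_eq_zero hx]
      simp_rw [e1, e2] at h3
      exact h3
    -- The cylinder may reach below time zero. Because `u` vanishes at negative times and almost
    -- everywhere at time `0`, any time `t` may be replaced by `max t 0`; the flux term is
    -- unaffected for the same reason.
    have e3 : ∀ t, ∫ x in B, (inner ℝ (u t x) (ψ x) : ℝ) =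
        ∫ x in B, (inner ℝ (u (max t 0) x) (ψ x) : ℝ) := by
      intro t
      rcases le_or_gt 0 t with h | h
      · rw [max_eq_left h]
      · rw [max_eq_right h.le, (hneg t h).1]
        have : (fun x => (inner ℝ (u 0 x) (ψ x) : ℝ)) =ᵐ[volume.restrict B] fun _ => 0 := by
          filter_upwards [ae_mono hle hu0] with x hx
          rw [hx]; simp
        rw [integral_congr_ae this]
        simp
    have e4 : ∫ r in Ioo s t, k r = ∫ r in Ioo (max s 0) (max t 0), k r := by
      rcases le_or_gt t 0 with h | h
      · rw [max_eq_right h, max_eq_right (hst.trans h), Ioo_self, Measure.restrict_empty,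
          integral_zero_measure]
        exact setIntegral_eq_zero_of_forall_eq_zero fun r hr => hk0 r (hr.2.trans_le h)
      · rw [max_eq_left h.le]
        refine setIntegral_eq_of_subset_of_ae_sdiff_eq_zero measurableSet_Ioo.nullMeasurableSet
          (Ioo_subset_Ioo_left (le_max_left _ _)) ?_
        have hne : ∀ᵐ r ∂(volume : Measure ℝ), r ≠ 0 := by simp [ae_iff]
        filter_upwards [hne] with r hr0 hr
        refine hk0 r (lt_of_le_of_ne ?_ hr0)
        by_contra hcon
        exact hr.2 ⟨max_lt hr.1.1 (not_le.1 hcon), hr.1.2⟩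
    have h3 := h2 (max s 0) (max t 0) (le_max_right _ _) (max_le_max_right 0 hst)
      (max_le (ht.trans ht₀) hT)
    rw [← e3, ← e3, ← e4] at h3
    -- combine
    have i1 : ∀ t ∈ Icc t₁ t₀, ∫ x in B, (inner ℝ (u t x - w t x) (ψ x) : ℝ) =
        (∫ x in B, (inner ℝ (u t x) (ψ x) : ℝ)) - ∫ x in B, (inner ℝ (w t x) (ψ x) : ℝ) := by
      intro t ht
      rw [← integral_sub (integrable_inner_of_memLp (hu2 t ht) hψ2)
        (integrable_inner_of_memLp (hw.memLp_two t ht) hψ2)]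
      simp only [inner_sub_left]
    rw [i1 t ⟨hs.trans hst, ht⟩, i1 s ⟨hs, hst.trans ht⟩]
    have hprod : (volume.restrict (Ioo t₁ t₀)).prod (volume.restrict B) =
      (volume.restrict (Ioo t₁ t₀ ×ˢ B) : Measure (ℝ × Space n)) := Measure.prod_restrict _ _
    have : IsFiniteMeasure (volume.restrict B) := ⟨by simpa using hBf.lt_top⟩
    have hgr : MemLp (fun z : ℝ × Space n => spatialGrad ψ z.2) (ENNReal.ofReal p)
        (volume.restrict (Ioo t₁ t₀ ×ˢ B)) := by
      rw [← hprod]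
      exact (memLp_spatialGrad hψ hψc _ _).comp_snd _
    have hpq' := hpq.symm.ennrealOfReal
    have hsec : ∀ H : ℝ × Space n → Mat N n, MemLp H (ENNReal.ofReal q)
        (volume.restrict (Ioo t₁ t₀ ×ˢ B)) → IntegrableOn (fun r =>
        ∫ x in B, (inner ℝ (H (r, x)) (spatialGrad ψ x) : ℝ)) (Ioo s t) ∧
        ∀ᵐ r ∂(volume.restrict (Ioo s t)), IntegrableOn
          (fun x => (inner ℝ (H (r, x)) (spatialGrad ψ x) : ℝ)) B := by
      intro H hH
      have h4 := integrable_inner_of_memLp hH hgr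
      rw [← hprod] at h4
      have h5 : volume.restrict (Ioo s t) ≤ volume.restrict (Ioo t₁ t₀) :=
        Measure.restrict_mono (Ioo_subset_Ioo hs ht) le_rfl
      exact ⟨h4.integral_prod_left.mono_measure h5, ae_mono h5 h4.prod_right_ae⟩
    obtain ⟨j1, j2⟩ := hsec _ hHu
    obtain ⟨j3, j4⟩ := hsec _ hHw
    have e5 : ∫ r in Ioo s t, ∫ x in B, (inner ℝ (a r x • flux p (Du r x) + flux p (F r x)
        - b r x • flux p (Dw r x)) (spatialGrad ψ x) : ℝ) =
        (∫ r in Ioo s t, k r) - ∫ r in Ioo s t, ∫ x in B,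
          (inner ℝ (b r x • flux p (Dw r x)) (spatialGrad ψ x) : ℝ) := by
      rw [← integral_sub j1 j3]
      refine integral_congr_ae ?_
      filter_upwards [j2, j4] with r h5 h6
      rw [← integral_sub h5 h6]
      refine integral_congr_ae (Eventually.of_forall fun x => ?_)
      exact inner_sub_left _ _ _
    rw [e5]
    linarith

end Comparison

/-! ### The energy inequality with nonnegative integrands -/

section LintegralEnergy

variable {N n : ℕ} {p q : ℝ} {U : Set (Space n)} {g : Vec N → Vec N} {Φ : Vec N → ℝ} {L : ℝ}

/-- The energy inequality when the tested flux is bounded below by `A - S`. -/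
lemma IsZeroDataSolution.lintegral_energy_le (hpq : p.HolderConjugate q) (hUm : MeasurableSet U)
    (hUf : volume U ≠ ⊤) {v : ℝ → Space n → Vec N} {Dv : ℝ → Space n → Mat N n}
    {H : ℝ × Space n → Mat N n} {t₁ t₂ τ : ℝ} (hv : IsZeroDataSolution p q t₁ t₂ U v Dv H)
    (hτ : t₁ < τ) (hτ2 : τ ≤ t₂)
    (hg : ContDiff ℝ 1 g) (hg0 : g 0 = 0) (hL : ∀ y, ‖fderiv ℝ g y‖ ≤ L)
    (hΦ0 : Φ 0 = 0) (hΦc : Continuous Φ) (hΦn : ∀ a, 0 ≤ Φ a)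
    (hΦ : ∀ a b, Φ b - Φ a ≤ inner ℝ (g b) (b - a)) {A S : ℝ × Space n → ℝ}
    (hA : AEStronglyMeasurable A (volume.restrict (Ioo t₁ t₂ ×ˢ U)))
    (hS : AEStronglyMeasurable S (volume.restrict (Ioo t₁ t₂ ×ˢ U)))
    (hA0 : ∀ z, 0 ≤ A z) (hS0 : ∀ z, 0 ≤ S z)
    (hAS : ∀ z ∈ Ioo t₁ t₂ ×ˢ U,
      A z - S z ≤ inner ℝ (H z) (matMap (fderiv ℝ g (v z.1 z.2)) (Dv z.1 z.2))) :
    (∫⁻ x in U, ENNReal.ofReal (Φ (v τ x))) + ∫⁻ z in Ioo t₁ τ ×ˢ U, ENNReal.ofReal (A z) ≤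
      ∫⁻ z in Ioo t₁ t₂ ×ˢ U, ENNReal.ofReal (S z) := by
  have hpq' := hpq.symm.ennrealOfReal
  have hsub : Ioo t₁ τ ×ˢ U ⊆ Ioo t₁ t₂ ×ˢ U := prod_mono_left (Ioo_subset_Ioo_right hτ2)
  have hle : volume.restrict (Ioo t₁ τ ×ˢ U) ≤ volume.restrict (Ioo t₁ t₂ ×ˢ U) :=
    Measure.restrict_mono hsub le_rfl
  have hSm : MeasurableSet (Ioo t₁ τ ×ˢ U) := measurableSet_Ioo.prod hUm
  -- If the right side is infinite there is nothing to show. Otherwise `S` is integrable, and `A` is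
  -- then integrable because it is dominated by the tested flux plus `S`.
  rcases eq_or_ne (∫⁻ z in Ioo t₁ t₂ ×ˢ U, ENNReal.ofReal (S z)) ⊤ with h | h
  · rw [h]; exact le_top
  have hSi : IntegrableOn S (Ioo t₁ t₂ ×ˢ U) :=
    ⟨hS, (hasFiniteIntegral_iff_ofReal (Eventually.of_forall hS0)).2 h.lt_top⟩
  have hSi' : IntegrableOn S (Ioo t₁ τ ×ˢ U) := hSi.mono_set hsub
  have hHi : IntegrableOn (fun z : ℝ × Space n =>
      (inner ℝ (H z) (matMap (fderiv ℝ g (v z.1 z.2)) (Dv z.1 z.2)) : ℝ)) (Ioo t₁ τ ×ˢ U) :=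
    integrable_inner_of_memLp (hv.memLp_flux.mono_measure hle)
      (memLp_matMap hg hL (hv.measurable.mono_measure hle) (hv.memLp_grad.mono_measure hle))
  have hAi : IntegrableOn A (Ioo t₁ τ ×ˢ U) := by
    refine Integrable.mono' (hHi.add hSi') (hA.mono_measure hle) ?_
    refine (ae_restrict_iff' hSm).2 (Eventually.of_forall fun z hz => ?_)
    rw [Real.norm_of_nonneg (hA0 z)]
    have := hAS z (hsub hz)
    simp only [Pi.add_apply]
    linarith
  have hΦi := integrable_comp_of_convex hg hg0 hL hΦ0 hΦc hΦ
    (hv.memLp_two τ ⟨hτ.le, hτ2⟩)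
  have h1 := hv.energy_inequality hpq hUm hUf hτ hτ2 hg hg0 hL hΦ0 hΦc hΦ
  have h2 : ∫ z in Ioo t₁ τ ×ˢ U, A z ≤ (∫ z in Ioo t₁ τ ×ˢ U,
      (inner ℝ (H z) (matMap (fderiv ℝ g (v z.1 z.2)) (Dv z.1 z.2)) : ℝ)) +
        ∫ z in Ioo t₁ τ ×ˢ U, S z := by
    rw [← integral_add hHi hSi']
    refine setIntegral_mono_on hAi (hHi.add hSi') hSm fun z hz => ?_
    have := hAS z (hsub hz)
    linarith
  rw [← ofReal_integral_eq_lintegral_ofReal (f := fun x => Φ (v τ x)) hΦi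
      (Eventually.of_forall fun x => hΦn _), ← ofReal_integral_eq_lintegral_ofReal hAi (Eventually.of_forall hA0),
    ← ENNReal.ofReal_add (integral_nonneg fun x => hΦn _) (integral_nonneg hA0)]
  refine le_trans ?_ (lintegral_mono_set hsub)
  rw [← ofReal_integral_eq_lintegral_ofReal hSi' (Eventually.of_forall hS0)]
  exact ENNReal.ofReal_le_ofReal (by linarith)

end LintegralEnergy

/-! ### Radial test fields `φ(|v|²)v` -/

section Radial

variable {N n : ℕ}

/-- A bounded increasing weight `φ` on `[0, ∞)` with derivative `φ'` and `s φ'(s) ≤ K φ(s)`. -/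
structure IsRadialWeight (K L : ℝ) (φ φ' : ℝ → ℝ) : Prop where
  hasDerivAt : ∀ s, 0 ≤ s → HasDerivAt φ (φ' s) s
  continuousOn : ContinuousOn φ' (Ici 0)
  nonneg : ∀ s, 0 ≤ s → 0 ≤ φ s
  deriv_nonneg : ∀ s, 0 ≤ s → 0 ≤ φ' s
  mul_deriv_le : ∀ s, 0 ≤ s → s * φ' s ≤ K * φ s
  le_bound : ∀ s, 0 ≤ s → φ s ≤ L

/-- The radial vector field `v ↦ φ(|v|²) v`. -/
def radialField (φ : ℝ → ℝ) (v : Vec N) : Vec N := φ (‖v‖ ^ 2) • v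

/-- The potential of the radial vector field. -/
def radialPotential (φ : ℝ → ℝ) (v : Vec N) : ℝ :=
  1 / 2 * ∫ r in (0 : ℝ)..‖v‖ ^ 2, φ (max 0 r)

variable {K L : ℝ} {φ φ' : ℝ → ℝ}

lemma IsRadialWeight.hasFDerivAt (h : IsRadialWeight K L φ φ') (v : Vec N) :
    HasFDerivAt (radialField φ) (φ (‖v‖ ^ 2) • ContinuousLinearMap.id ℝ (Vec N)
      + (2 * φ' (‖v‖ ^ 2)) • selfTensor v) v := by
  have h1 : HasFDerivAt (fun y : Vec N => ‖y‖ ^ 2) (2 • innerSL ℝ v) v :=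
    (hasStrictFDerivAt_norm_sq v).hasFDerivAt
  have h2 := (h.hasDerivAt _ (sq_nonneg ‖v‖)).comp_hasFDerivAt v h1
  have h3 := h2.smul (hasFDerivAt_id v)
  refine h3.congr_fderiv ?_
  ext1 y
  simp only [add_apply, smul_apply, selfTensor_apply,
    ContinuousLinearMap.smulRight_apply, Function.comp_apply, id_eq, innerSL_apply_apply,
    ContinuousLinearMap.id_apply, smul_eq_mul, nsmul_eq_mul, smul_smul]
  congr 2
  push_cast
  ring

lemma IsRadialWeight.fderiv (h : IsRadialWeight K L φ φ') (v : Vec N) :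
    fderiv ℝ (radialField φ) v = φ (‖v‖ ^ 2) • ContinuousLinearMap.id ℝ (Vec N)
      + (2 * φ' (‖v‖ ^ 2)) • selfTensor v := (h.hasFDerivAt v).fderiv

lemma IsRadialWeight.contDiff (h : IsRadialWeight K L φ φ') :
    ContDiff ℝ 1 (radialField φ : Vec N → Vec N) := by
  rw [contDiff_one_iff_fderiv]
  refine ⟨fun v => (h.hasFDerivAt v).differentiableAt, ?_⟩
  have e : _root_.fderiv ℝ (radialField φ : Vec N → Vec N) = fun v => φ (‖v‖ ^ 2) •
      ContinuousLinearMap.id ℝ (Vec N) + (2 * φ' (‖v‖ ^ 2)) • selfTensor v := funext h.fderiv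
  rw [e]
  have h1 : ContinuousOn φ (Ici 0) := fun s hs => (h.hasDerivAt s hs).continuousAt.continuousWithinAt
  have h2 : Continuous fun v : Vec N => φ (‖v‖ ^ 2) :=
    h1.comp_continuous (by fun_prop) fun v => sq_nonneg ‖v‖
  have h3 : Continuous fun v : Vec N => φ' (‖v‖ ^ 2) :=
    h.continuousOn.comp_continuous (by fun_prop) fun v => sq_nonneg ‖v‖
  exact (h2.smul continuous_const).add ((continuous_const.mul h3).smul continuous_selfTensor)

/-- The rank-one part of the derivative has size `2φ'(s)s` with `s = |v|²`, so `sφ' ≤ Kφ` makes it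
comparable to the weight itself, however rapidly `φ` grows. -/
lemma IsRadialWeight.norm_smul_selfTensor_le (h : IsRadialWeight K L φ φ') (v : Vec N) :
    ‖(2 * φ' (‖v‖ ^ 2)) • selfTensor v‖ ≤ 2 * K * φ (‖v‖ ^ 2) := by
  have h1 := h.deriv_nonneg _ (sq_nonneg ‖v‖)
  rw [norm_smul, Real.norm_of_nonneg (by positivity)]
  calc 2 * φ' (‖v‖ ^ 2) * ‖selfTensor v‖ ≤ 2 * φ' (‖v‖ ^ 2) * ‖v‖ ^ 2 := by
        gcongr; exact norm_selfTensor_le v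
    _ = 2 * (‖v‖ ^ 2 * φ' (‖v‖ ^ 2)) := by ring
    _ ≤ 2 * (K * φ (‖v‖ ^ 2)) := by
        have := h.mul_deriv_le _ (sq_nonneg ‖v‖)
        linarith
    _ = _ := by ring

lemma IsRadialWeight.norm_fderiv_le' (h : IsRadialWeight K L φ φ') (v : Vec N) :
    ‖_root_.fderiv ℝ (radialField φ) v‖ ≤ (1 + 2 * K) * φ (‖v‖ ^ 2) := by
  have h0 := h.nonneg _ (sq_nonneg ‖v‖)
  rw [h.fderiv v]
  refine (norm_add_le _ _).trans ?_
  have h2 : ‖φ (‖v‖ ^ 2) • ContinuousLinearMap.id ℝ (Vec N)‖ ≤ φ (‖v‖ ^ 2) := by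
    rw [norm_smul, Real.norm_of_nonneg h0]
    exact mul_le_of_le_one_right h0 ContinuousLinearMap.norm_id_le
  linarith [h.norm_smul_selfTensor_le v]

lemma IsRadialWeight.norm_fderiv_le (hK : 0 ≤ K) (h : IsRadialWeight K L φ φ') (v : Vec N) :
    ‖_root_.fderiv ℝ (radialField φ) v‖ ≤ (1 + 2 * K) * L := by
  refine (h.norm_fderiv_le' v).trans ?_
  gcongr
  exact h.le_bound _ (sq_nonneg ‖v‖)

lemma radialField_zero : radialField φ (0 : Vec N) = 0 := smul_zero _

lemma radialPotential_zero : radialPotential φ (0 : Vec N) = 0 := by simp [radialPotential]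

/-- Freezing the weight at its value at `0` for negative arguments gives a function continuous on
the whole line, so its primitive is differentiable also at `0`. -/
lemma IsRadialWeight.continuous_max (h : IsRadialWeight K L φ φ') :
    Continuous fun r => φ (max 0 r) :=
  ContinuousOn.comp_continuous (s := Ici 0)
    (fun s hs => (h.hasDerivAt s hs).continuousAt.continuousWithinAt) (by fun_prop)
    fun r => le_max_left 0 r

lemma IsRadialWeight.hasDerivAt_primitive (h : IsRadialWeight K L φ φ') (s : ℝ) :
    HasDerivAt (fun s => ∫ r in (0 : ℝ)..s, φ (max 0 r)) (φ (max 0 s)) s :=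
  intervalIntegral.integral_hasDerivAt_right (h.continuous_max.intervalIntegrable _ _)
    (h.continuous_max.stronglyMeasurableAtFilter _ _) h.continuous_max.continuousAt

lemma IsRadialWeight.monotoneOn (h : IsRadialWeight K L φ φ') : MonotoneOn φ (Ici 0) := by
  refine monotoneOn_of_deriv_nonneg (convex_Ici 0)
    (fun s hs => (h.hasDerivAt s hs).continuousAt.continuousWithinAt) ?_ ?_
  · intro s hs
    rw [interior_Ici] at hs
    exact (h.hasDerivAt s (le_of_lt hs)).differentiableAt.differentiableWithinAt
  · intro s hs
    rw [interior_Ici] at hs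
    rw [(h.hasDerivAt s (le_of_lt hs)).deriv]
    exact h.deriv_nonneg s (le_of_lt hs)

lemma IsRadialWeight.continuous_potential (h : IsRadialWeight K L φ φ') :
    Continuous (radialPotential φ : Vec N → ℝ) := by
  have h1 : Continuous fun s => ∫ r in (0 : ℝ)..s, φ (max 0 r) :=
    continuous_iff_continuousAt.2 fun s => (h.hasDerivAt_primitive s).continuousAt
  exact continuous_const.mul (h1.comp (by fun_prop))

/-- As `φ` increases, its primitive lies above its tangents, so its increment from `|a|²` to `|b|²`
is at most `φ(|b|²)(|b|²-|a|²)`. The inequality `2⟨b,a⟩ ≤ |a|²+|b|²` turns this into the subgradient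
inequality. -/
lemma IsRadialWeight.potential_sub_le (h : IsRadialWeight K L φ φ') (a b : Vec N) :
    radialPotential φ b - radialPotential φ a ≤ inner ℝ (radialField φ b) (b - a) := by
  have hb := h.nonneg _ (sq_nonneg ‖b‖)
  have key : (∫ r in (0 : ℝ)..‖b‖ ^ 2, φ (max 0 r)) - ∫ r in (0 : ℝ)..‖a‖ ^ 2, φ (max 0 r) ≤
      φ (‖b‖ ^ 2) * (‖b‖ ^ 2 - ‖a‖ ^ 2) := by
    rw [intervalIntegral.integral_interval_sub_left (h.continuous_max.intervalIntegrable _ _)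
      (h.continuous_max.intervalIntegrable _ _)]
    have hc : ∀ x y : ℝ, ∫ _ in x..y, φ (‖b‖ ^ 2) = φ (‖b‖ ^ 2) * (y - x) := fun x y => by
      rw [intervalIntegral.integral_const, smul_eq_mul, mul_comm]
    rcases le_total (‖a‖ ^ 2) (‖b‖ ^ 2) with hab | hab
    · rw [← hc]
      refine intervalIntegral.integral_mono_on hab (h.continuous_max.intervalIntegrable _ _)
        (by simp) fun r hr => ?_
      have hr0 : 0 ≤ r := (sq_nonneg ‖a‖).trans hr.1
      rw [max_eq_right hr0]
      exact h.monotoneOn hr0 (sq_nonneg ‖b‖) hr.2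
    · rw [intervalIntegral.integral_symm]
      have := intervalIntegral.integral_mono_on hab (f := fun _ => φ (‖b‖ ^ 2)) (by simp)
        (h.continuous_max.intervalIntegrable (μ := volume) (‖b‖ ^ 2) (‖a‖ ^ 2)) fun r hr => ?_
      · rw [hc] at this
        linarith
      · have hr0 : 0 ≤ r := (sq_nonneg ‖b‖).trans hr.1
        rw [max_eq_right hr0]
        exact h.monotoneOn (sq_nonneg ‖b‖) hr0 hr.1
  have h1 : (inner ℝ (radialField φ b) (b - a) : ℝ) = φ (‖b‖ ^ 2) * (‖b‖ ^ 2 - inner ℝ b a) := by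
    rw [radialField, real_inner_smul_left, inner_sub_right, real_inner_self_eq_norm_sq]
  have h2 : (inner ℝ b a : ℝ) ≤ 1 / 2 * (‖b‖ ^ 2 + ‖a‖ ^ 2) := by
    have := real_inner_le_norm b a
    nlinarith [sq_nonneg (‖b‖ - ‖a‖)]
  rw [h1]
  have h3 : φ (‖b‖ ^ 2) * inner ℝ b a ≤ φ (‖b‖ ^ 2) * (1 / 2 * (‖b‖ ^ 2 + ‖a‖ ^ 2)) := by gcongr
  unfold radialPotential
  nlinarith

/-- Since `sφ' ≤ Kφ`, the function `(1+K)∫₀^s φ - sφ(s)` has nonnegative derivative and vanishes at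
`0`. So the potential really controls the weighted square at a fixed time. -/
lemma IsRadialWeight.le_potential (hK : 0 ≤ K) (h : IsRadialWeight K L φ φ') (v : Vec N) :
    φ (‖v‖ ^ 2) * ‖v‖ ^ 2 / (2 * (1 + K)) ≤ radialPotential φ v := by
  have hd : ∀ s, 0 ≤ s → HasDerivAt
      (fun s => (1 + K) * (∫ r in (0 : ℝ)..s, φ (max 0 r)) - s * φ s)
      ((1 + K) * φ s - (1 * φ s + s * φ' s)) s := fun s hs => by
    have h1 := h.hasDerivAt_primitive s
    rw [max_eq_right hs] at h1
    exact (h1.const_mul _).sub ((hasDerivAt_id s).mul (h.hasDerivAt s hs))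
  have hm : MonotoneOn (fun s => (1 + K) * (∫ r in (0 : ℝ)..s, φ (max 0 r)) - s * φ s) (Ici 0) := by
    refine monotoneOn_of_deriv_nonneg (convex_Ici 0)
      (fun s hs => (hd s hs).continuousAt.continuousWithinAt) ?_ ?_
    · intro s hs
      rw [interior_Ici] at hs
      exact (hd s (le_of_lt hs)).differentiableAt.differentiableWithinAt
    · intro s hs
      rw [interior_Ici] at hs
      rw [(hd s (le_of_lt hs)).deriv]
      have := h.mul_deriv_le s (le_of_lt hs)
      linarith
  have h1 := hm (mem_Ici.2 le_rfl) (mem_Ici.2 (sq_nonneg ‖v‖)) (sq_nonneg ‖v‖)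
  simp only [intervalIntegral.integral_same, mul_zero, zero_mul, sub_zero] at h1
  rw [div_le_iff₀ (by positivity), radialPotential]
  nlinarith

lemma IsRadialWeight.potential_nonneg (hK : 0 ≤ K) (h : IsRadialWeight K L φ φ') (v : Vec N) :
    0 ≤ radialPotential φ v := by
  refine le_trans ?_ (h.le_potential hK v)
  have := h.nonneg _ (sq_nonneg ‖v‖)
  positivity

/-- The matrix `Dg(v) M` for the radial field `g`. -/
lemma IsRadialWeight.exists_matMap_eq (h : IsRadialWeight K L φ φ') (hK : 0 ≤ K) (v : Vec N)
    (M : Mat N n) : ∃ T : Mat N n, 0 ≤ inner ℝ M T ∧ ‖T‖ ≤ 2 * K * ‖M‖ ∧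
      matMap (_root_.fderiv ℝ (radialField φ) v) M = φ (‖v‖ ^ 2) • (M + T) := by
  have h0 := h.nonneg _ (sq_nonneg ‖v‖)
  have h1 := h.deriv_nonneg _ (sq_nonneg ‖v‖)
  rw [h.fderiv v, matMap_add_left, matMap_smul_left, matMap_id]
  have h2 := (norm_matMap_le ((2 * φ' (‖v‖ ^ 2)) • selfTensor v) M).trans
    (mul_le_mul_of_nonneg_right (h.norm_smul_selfTensor_le v) (norm_nonneg M))
  -- Where the weight vanishes, so does the rank-one part, by its bound in terms of the weight, and
  -- `T = 0` works. Elsewhere `T` is the rank-one part divided by the weight.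
  rcases h0.eq_or_lt with hφ | hφ
  · refine ⟨0, by simp, by simp; positivity, ?_⟩
    rw [← hφ] at h2 ⊢
    simp only [mul_zero, zero_mul, norm_le_zero_iff] at h2
    rw [h2]
    simp
  · refine ⟨(φ (‖v‖ ^ 2))⁻¹ • matMap ((2 * φ' (‖v‖ ^ 2)) • selfTensor v) M, ?_, ?_, ?_⟩
    · rw [matMap_smul_left, real_inner_smul_right, real_inner_smul_right]
      have := inner_matMap_selfTensor_nonneg v M
      positivity
    · rw [norm_smul, Real.norm_of_nonneg (by positivity), inv_mul_le_iff₀ hφ]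
      linarith
    · rw [smul_add, smul_smul, mul_inv_cancel₀ hφ.ne', one_smul]

end Radial

/-! ### Bounded approximations of powers -/

section TruncatedPower

/-- The bounded approximation `(ks / (k + s))^α (ks / (1 + ks))^β` of `s^α`. -/
def truncPow (α β k s : ℝ) : ℝ :=
  k ^ (α + β) * s ^ (α + β) * (k + s) ^ (-α) * (1 + k * s) ^ (-β)

variable {α β k s : ℝ}

lemma truncPow_zero (h : α + β ≠ 0) : truncPow α β k 0 = 0 := by
  simp [truncPow, Real.zero_rpow h]

/-- The first factor saturates for large `s` and keeps the weight bounded. The second makes it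
vanish like `s^{α+β}` at the origin, hence `C¹` there when `α+β > 1` even if `α` is small. The
expanded definition leaves `s^{α+β}` as the only factor that can be singular at `0`. -/
lemma truncPow_eq (hα : 0 < α) (hβ : 0 < β) (hk : 0 < k) (hs : 0 ≤ s) :
    truncPow α β k s = (k * s / (k + s)) ^ α * (k * s / (1 + k * s)) ^ β := by
  rcases hs.eq_or_lt with rfl | hs'
  · rw [truncPow_zero (by positivity)]
    simp [Real.zero_rpow hα.ne']
  · rw [Real.div_rpow (by positivity) (by positivity), Real.div_rpow (by positivity) (by positivity),
      Real.mul_rpow hk.le hs, Real.mul_rpow hk.le hs, truncPow, Real.rpow_add hk, Real.rpow_add hs',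
      Real.rpow_neg (by positivity), Real.rpow_neg (by positivity)]
    field_simp

lemma truncPow_nonneg (hk : 0 < k) (hs : 0 ≤ s) : 0 ≤ truncPow α β k s := by
  unfold truncPow
  positivity

lemma truncPow_le_rpow (hα : 0 < α) (hβ : 0 < β) (hk : 0 < k) (hs : 0 ≤ s) :
    truncPow α β k s ≤ s ^ α := by
  rw [truncPow_eq hα hβ hk hs]
  have h1 : k * s / (k + s) ≤ s := by
    rw [div_le_iff₀ (by positivity)]
    nlinarith
  have h2 : k * s / (1 + k * s) ≤ 1 := by
    rw [div_le_iff₀ (by positivity)]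
    linarith
  calc _ ≤ s ^ α * 1 := by
        gcongr
        exact Real.rpow_le_one (by positivity) h2 hβ.le
    _ = _ := mul_one _

lemma truncPow_le_bound (hα : 0 < α) (hβ : 0 < β) (hk : 0 < k) (hs : 0 ≤ s) :
    truncPow α β k s ≤ k ^ α := by
  rw [truncPow_eq hα hβ hk hs]
  have h1 : k * s / (k + s) ≤ k := by
    rw [div_le_iff₀ (by positivity)]
    nlinarith
  have h2 : k * s / (1 + k * s) ≤ 1 := by
    rw [div_le_iff₀ (by positivity)]
    linarith
  calc _ ≤ k ^ α * 1 := by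
        gcongr
        exact Real.rpow_le_one (by positivity) h2 hβ.le
    _ = _ := mul_one _

/-- The family is closed under powers. So the weight `φ` of the energy estimate, with parameters
`(ϑ/2, p)`, is exactly the `p`-th power of the weight with parameters `(ϑ/(2p), 1)` to which the
Sobolev inequality is applied. -/
lemma truncPow_rpow (hα : 0 < α) (hβ : 0 < β) (hk : 0 < k) (hs : 0 ≤ s) {p : ℝ} (hp : 0 < p) :
    truncPow α β k s ^ p = truncPow (α * p) (β * p) k s := by
  rw [truncPow_eq hα hβ hk hs, truncPow_eq (by positivity) (by positivity) hk hs,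
    Real.mul_rpow (by positivity) (by positivity), Real.rpow_mul (by positivity),
    Real.rpow_mul (by positivity)]

lemma tendsto_truncPow (hα : 0 < α) (hβ : 0 < β) (hs : 0 ≤ s) :
    Tendsto (fun k : ℕ => truncPow α β (k + 1) s) atTop (𝓝 (s ^ α)) := by
  rcases hs.eq_or_lt with rfl | hs'
  · rw [Real.zero_rpow hα.ne']
    exact tendsto_const_nhds.congr fun k => (truncPow_zero (by positivity)).symm
  have hk : Tendsto (fun k : ℕ => ((k : ℝ) + 1)⁻¹) atTop (𝓝 0) :=
    tendsto_inv_atTop_zero.comp (tendsto_atTop_add_const_right _ _ tendsto_natCast_atTop_atTop)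
  have h1 : Tendsto (fun k : ℕ => (((k : ℝ) + 1) * s / ((k + 1) + s)) ^ α) atTop (𝓝 (s ^ α)) := by
    have h : Tendsto (fun k : ℕ => s / (1 + s * ((k : ℝ) + 1)⁻¹)) atTop (𝓝 (s / (1 + s * 0))) :=
      tendsto_const_nhds.div (tendsto_const_nhds.add (tendsto_const_nhds.mul hk)) (by simp)
    rw [mul_zero, add_zero, div_one] at h
    refine (h.rpow_const (Or.inr hα.le)).congr fun k => ?_
    congr 1
    field_simp
  have h2 : Tendsto (fun k : ℕ => (((k : ℝ) + 1) * s / (1 + (k + 1) * s)) ^ β) atTop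
      (𝓝 (1 : ℝ)) := by
    have h : Tendsto (fun k : ℕ => s / (((k : ℝ) + 1)⁻¹ + s)) atTop (𝓝 (s / (0 + s))) :=
      tendsto_const_nhds.div (hk.add tendsto_const_nhds) (by simpa using hs'.ne')
    rw [zero_add, div_self hs'.ne'] at h
    have h' := h.rpow_const (p := β) (Or.inr hβ.le)
    rw [Real.one_rpow] at h'
    refine h'.congr fun k => ?_
    congr 1
    field_simp
  have h3 := h1.mul h2
  rw [mul_one] at h3
  exact h3.congr fun k => (truncPow_eq hα hβ (by positivity) hs).symm

/-- The derivative of `truncPow`. -/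
def truncPowDeriv (α β k s : ℝ) : ℝ :=
  k ^ (α + β) * ((α + β) * s ^ (α + β - 1) * (k + s) ^ (-α) * (1 + k * s) ^ (-β)
    - s ^ (α + β) * (α * (k + s) ^ (-α - 1)) * (1 + k * s) ^ (-β)
    - s ^ (α + β) * (k + s) ^ (-α) * (β * k * (1 + k * s) ^ (-β - 1)))

lemma hasDerivAt_truncPow (h : 1 ≤ α + β) (hk : 0 < k) (hs : 0 ≤ s) :
    HasDerivAt (truncPow α β k) (truncPowDeriv α β k s) s := by
  have h1 : HasDerivAt (fun s : ℝ => s ^ (α + β)) ((α + β) * s ^ (α + β - 1)) s :=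
    Real.hasDerivAt_rpow_const (Or.inr h)
  have h2 : HasDerivAt (fun s : ℝ => (k + s) ^ (-α)) (1 * (-α) * (k + s) ^ (-α - 1)) s :=
    ((hasDerivAt_id s).const_add k).rpow_const (Or.inl (by simp; positivity))
  have h3 : HasDerivAt (fun s : ℝ => (1 + k * s) ^ (-β))
      (k * 1 * (-β) * (1 + k * s) ^ (-β - 1)) s :=
    (((hasDerivAt_id s).const_mul k).const_add 1).rpow_const (Or.inl (by simp; positivity))
  refine (((h1.const_mul (k ^ (α + β))).mul h2).mul h3).congr_deriv ?_
  unfold truncPowDeriv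
  simp only [Pi.mul_apply]
  ring

lemma mul_truncPowDeriv (h : 1 < α + β) (hk : 0 < k) (hs : 0 ≤ s) :
    s * truncPowDeriv α β k s =
      truncPow α β k s * (α + β - α * (s / (k + s)) - β * (k * s / (1 + k * s))) := by
  rcases hs.eq_or_lt with rfl | hs'
  · rw [truncPow_zero (by linarith)]; simp
  have h1 : s ^ (α + β - 1) = s ^ (α + β) / s := Real.rpow_sub_one hs'.ne' _
  have h2 : (k + s) ^ (-α - 1) = (k + s) ^ (-α) / (k + s) :=
    Real.rpow_sub_one (by positivity) _
  have h3 : (1 + k * s) ^ (-β - 1) = (1 + k * s) ^ (-β) / (1 + k * s) :=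
    Real.rpow_sub_one (by positivity) _
  unfold truncPowDeriv truncPow
  rw [h1, h2, h3]
  field_simp

/-- The logarithmic derivative `sφ'/φ = α + β - α s/(k+s) - β ks/(1+ks)` lies between `0` and `α+β`.
Hence the structural constant does not depend on the truncation parameter `k`; only the upper bound
`k^α` does. -/
lemma isRadialWeight_truncPow (hα : 0 < α) (hβ : 0 < β) (h : 1 < α + β) (hk : 0 < k) :
    IsRadialWeight (α + β) (k ^ α) (truncPow α β k) (truncPowDeriv α β k) := by
  have key : ∀ s, 0 ≤ s → 0 ≤ s / (k + s) ∧ s / (k + s) ≤ 1 ∧ 0 ≤ k * s / (1 + k * s) ∧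
      k * s / (1 + k * s) ≤ 1 := fun s hs => by
    refine ⟨by positivity, ?_, by positivity, ?_⟩
    · rw [div_le_iff₀ (by positivity)]; linarith
    · rw [div_le_iff₀ (by positivity)]; linarith
  refine ⟨fun s hs => hasDerivAt_truncPow h.le hk hs, ?_, fun s hs => truncPow_nonneg hk hs, ?_, ?_,
    fun s hs => truncPow_le_bound hα hβ hk hs⟩
  · unfold truncPowDeriv
    have c1 : ∀ r : ℝ, ContinuousOn (fun s : ℝ => (k + s) ^ r) (Ici 0) := fun r =>
      ContinuousOn.rpow_const (by fun_prop) fun s hs => Or.inl (by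
        have : 0 ≤ s := hs
        positivity)
    have c2 : ∀ r : ℝ, ContinuousOn (fun s : ℝ => (1 + k * s) ^ r) (Ici 0) := fun r =>
      ContinuousOn.rpow_const (by fun_prop) fun s hs => Or.inl (by
        have : 0 ≤ s := hs
        positivity)
    have c3 : ∀ r : ℝ, 0 ≤ r → ContinuousOn (fun s : ℝ => s ^ r) (Ici 0) := fun r hr =>
      ContinuousOn.rpow_const (by fun_prop) fun s _ => Or.inr hr
    have d1 := c3 (α + β - 1) (by linarith)
    have d2 := c3 (α + β) (by linarith)
    exact continuousOn_const.mul (((((continuousOn_const.mul d1).mul (c1 _)).mul (c2 _)).sub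
      ((d2.mul (continuousOn_const.mul (c1 _))).mul (c2 _))).sub
      ((d2.mul (c1 _)).mul (continuousOn_const.mul (c2 _))))
  · intro s hs
    rcases hs.eq_or_lt with rfl | hs'
    · simp [truncPowDeriv, Real.zero_rpow (show α + β ≠ 0 by linarith),
        Real.zero_rpow (show α + β - 1 ≠ 0 by linarith)]
    · obtain ⟨k1, k2, k3, k4⟩ := key s hs
      have h1 : 0 ≤ s * truncPowDeriv α β k s := by
        rw [mul_truncPowDeriv h hk hs]
        refine mul_nonneg (truncPow_nonneg hk hs) ?_
        nlinarith
      exact nonneg_of_mul_nonneg_right h1 hs'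
  · intro s hs
    obtain ⟨k1, k2, k3, k4⟩ := key s hs
    rw [mul_truncPowDeriv h hk hs, mul_comm]
    refine mul_le_mul_of_nonneg_right ?_ (truncPow_nonneg hk hs)
    have := mul_nonneg hα.le k1
    have := mul_nonneg hβ.le k3
    linarith

end TruncatedPower

/-! ### Energy estimates for the difference, plain and weighted -/

section ComparisonEnergy

variable {N n : ℕ} {p q : ℝ}

/-- The flux of the difference of two solutions, tested with the gradient of the difference. -/
lemma inner_comparison_flux_ge (hp : 1 < p) (hp2 : p < 2) {cₐ a b D ε : ℝ} (hc : 0 < cₐ)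
    (hb : cₐ ≤ b) (hε : 0 < ε) (hε1 : ε ≤ 1) {ξ M F : Mat N n} (hD : 0 ≤ D)
    (hDa : |a - b| * ‖ξ‖ ^ (p - 1) ≤ (D * ‖ξ‖) ^ (p - 1)) :
    cₐ * (p - 1) / 6 * ε * ‖M‖ ^ p - (cₐ * (p - 1) / 3 * ε * (ε * ‖ξ‖ ^ p) +
      (12 / (cₐ * (p - 1) * ε)) ^ (1 / (p - 1)) * ((D * ‖ξ‖) ^ p + ‖F‖ ^ p)) ≤
      inner ℝ (a • flux p ξ + flux p F - b • flux p (ξ - M)) M := by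
  have hp1 : 0 < p - 1 := by linarith
  have h0 := inner_flux_sub_nonneg hp hp2 ξ (ξ - M)
  rw [sub_sub_cancel] at h0
  have h1 := norm_rpow_le_eps_add hp hp2 hε hε1 ξ M
  set d := (inner ℝ (flux p ξ - flux p (ξ - M)) M : ℝ) with hd
  have e : (inner ℝ (a • flux p ξ + flux p F - b • flux p (ξ - M)) M : ℝ) =
      b * d + (a - b) * inner ℝ (flux p ξ) M + inner ℝ (flux p F) M := by
    rw [hd]
    simp only [inner_add_left, inner_sub_left, real_inner_smul_left]
    ring
  have h2 : -((D * ‖ξ‖) ^ (p - 1) * ‖M‖) ≤ (a - b) * inner ℝ (flux p ξ) M := by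
    have h3 : |(a - b) * inner ℝ (flux p ξ) M| ≤ |a - b| * ‖ξ‖ ^ (p - 1) * ‖M‖ := by
      rw [abs_mul, mul_assoc, ← norm_flux hp ξ]
      gcongr
      exact abs_real_inner_le_norm _ _
    have h4 := mul_le_mul_of_nonneg_right hDa (norm_nonneg M)
    linarith [neg_abs_le ((a - b) * inner ℝ (flux p ξ) M)]
  have h3 : -(‖F‖ ^ (p - 1) * ‖M‖) ≤ inner ℝ (flux p F) M := by
    have h3 := abs_real_inner_le_norm (flux p F) M
    rw [norm_flux hp] at h3
    linarith [neg_abs_le (inner ℝ (flux p F) M : ℝ)]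
  -- Monotonicity provides `cₐ(p-1)ε/3` times `|M|^p`. The coefficient error and the datum each
  -- consume `θ|M|^p` in Young's inequality, which leaves one half of it.
  set θ := cₐ * (p - 1) * ε / 12 with hθ
  have hθ0 : 0 < θ := by positivity
  have y1 := young_flux hp zero_le_one hθ0 (mul_nonneg hD (norm_nonneg ξ)) (norm_nonneg M)
  have y2 := young_flux hp zero_le_one hθ0 (norm_nonneg F) (norm_nonneg M)
  have e2 : (12 / (cₐ * (p - 1) * ε)) = 1 / θ := by rw [hθ, one_div_div]
  rw [one_mul] at y1 y2
  rw [mul_one] at y1 y2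
  rw [e, e2]
  have h5 : cₐ * d ≤ b * d := by gcongr
  have h6 : cₐ * (p - 1) / 3 * ε * (‖M‖ ^ p - ε * ‖ξ‖ ^ p) ≤ cₐ * d := by
    have : ‖M‖ ^ p - ε * ‖ξ‖ ^ p ≤ 3 / (p - 1) * ε⁻¹ * d := by linarith
    calc cₐ * (p - 1) / 3 * ε * (‖M‖ ^ p - ε * ‖ξ‖ ^ p)
        ≤ cₐ * (p - 1) / 3 * ε * (3 / (p - 1) * ε⁻¹ * d) := by gcongr
      _ = cₐ * d := by field_simp
  have h7 : θ * ‖M‖ ^ p = cₐ * (p - 1) / 12 * ε * ‖M‖ ^ p := by rw [hθ]; ring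
  linarith

/-- A constant of the weighted energy estimate. -/
def weightedEnergyConst (p cₐ Cₐ K : ℝ) : ℝ :=
  Cₐ * ((6 * (1 + K)) ^ (1 / (p - 1)) * (3 * (1 + K))) +
    2 * (((1 + K) / (cₐ / 8)) ^ (1 / (p - 1)) * (1 + K))

lemma weightedEnergyConst_nonneg {cₐ Cₐ K : ℝ} (hc : 0 < cₐ) (hC : 0 ≤ Cₐ) (hK : 0 ≤ K) :
    0 ≤ weightedEnergyConst p cₐ Cₐ K := by
  unfold weightedEnergyConst
  positivity

/-- The flux of the difference, tested with a perturbation of the gradient of the difference. -/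
lemma inner_comparison_flux_add_ge (hp : 1 < p) (hp2 : p < 2) {cₐ Cₐ a b D K : ℝ} (hc : 0 < cₐ)
    (hb : cₐ ≤ b) (hbC : b ≤ Cₐ) (hK : 0 ≤ K) {ξ M F T : Mat N n} (hD : 0 ≤ D)
    (hDa : |a - b| * ‖ξ‖ ^ (p - 1) ≤ (D * ‖ξ‖) ^ (p - 1))
    (hT : 0 ≤ inner ℝ M T) (hTK : ‖T‖ ≤ K * ‖M‖) :
    cₐ / 4 * ‖M‖ ^ p - weightedEnergyConst p cₐ Cₐ K * (min ‖M‖ ‖ξ‖ + D * ‖ξ‖ + ‖F‖) ^ p ≤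
      inner ℝ (a • flux p ξ + flux p F - b • flux p (ξ - M)) (M + T) := by
  have hp1 : 0 < p - 1 := by linarith
  have h1 := inner_flux_sub_add_ge hp hp2 hK hT hTK (ξ := ξ)
  set d := (inner ℝ (flux p ξ - flux p (ξ - M)) (M + T) : ℝ) with hd
  set c := (6 * (1 + K)) ^ (1 / (p - 1)) * (3 * (1 + K)) with hcdef
  have hMT : ‖M + T‖ ≤ (1 + K) * ‖M‖ := by linarith [norm_add_le M T]
  have e : (inner ℝ (a • flux p ξ + flux p F - b • flux p (ξ - M)) (M + T) : ℝ) =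
      b * d + (a - b) * inner ℝ (flux p ξ) (M + T) + inner ℝ (flux p F) (M + T) := by
    rw [hd]
    simp only [inner_add_left, inner_sub_left, real_inner_smul_left]
    ring
  have h2 : -((1 + K) * (D * ‖ξ‖) ^ (p - 1) * ‖M‖) ≤ (a - b) * inner ℝ (flux p ξ) (M + T) := by
    have h3 : |(a - b) * inner ℝ (flux p ξ) (M + T)| ≤
        |a - b| * ‖ξ‖ ^ (p - 1) * ((1 + K) * ‖M‖) := by
      rw [abs_mul, mul_assoc, ← norm_flux hp ξ]
      gcongr
      exact (abs_real_inner_le_norm _ _).trans (by gcongr)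
    have h4 := mul_le_mul_of_nonneg_right hDa (a := (1 + K) * ‖M‖) (by positivity)
    linarith [neg_abs_le ((a - b) * inner ℝ (flux p ξ) (M + T))]
  have h3 : -((1 + K) * ‖F‖ ^ (p - 1) * ‖M‖) ≤ inner ℝ (flux p F) (M + T) := by
    have h3 := abs_real_inner_le_norm (flux p F) (M + T)
    rw [norm_flux hp] at h3
    have h4 : ‖F‖ ^ (p - 1) * ‖M + T‖ ≤ ‖F‖ ^ (p - 1) * ((1 + K) * ‖M‖) := by gcongr
    linarith [neg_abs_le (inner ℝ (flux p F) (M + T) : ℝ)]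
  -- Two applications with `cₐ/8` reduce the leading coefficient from `cₐ/2` to `cₐ/4`.
  have y1 := young_flux hp (K := 1 + K) (δ := cₐ / 8) (by positivity) (by positivity)
    (mul_nonneg hD (norm_nonneg ξ)) (norm_nonneg M)
  have y2 := young_flux hp (K := 1 + K) (δ := cₐ / 8) (by positivity) (by positivity)
    (norm_nonneg F) (norm_nonneg M)
  set c' := ((1 + K) / (cₐ / 8)) ^ (1 / (p - 1)) * (1 + K) with hc'
  have hc0 : 0 ≤ c := by positivity
  have hc0' : 0 ≤ c' := by positivity
  set m := min ‖M‖ ‖ξ‖ with hm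
  have hm0 : 0 ≤ m := le_min (norm_nonneg _) (norm_nonneg _)
  set S := m + D * ‖ξ‖ + ‖F‖ with hS
  have hDξ : 0 ≤ D * ‖ξ‖ := by positivity
  have s1 : m ^ p ≤ S ^ p := Real.rpow_le_rpow hm0 (by linarith [norm_nonneg F]) (by linarith)
  have s2 : (D * ‖ξ‖) ^ p ≤ S ^ p := Real.rpow_le_rpow hDξ (by linarith [norm_nonneg F]) (by linarith)
  have s3 : ‖F‖ ^ p ≤ S ^ p := Real.rpow_le_rpow (norm_nonneg _) (by linarith) (by linarith)
  have hMp : 0 ≤ ‖M‖ ^ p := by positivity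
  have hSp : 0 ≤ S ^ p := by positivity
  have hmp : 0 ≤ m ^ p := by positivity
  have h5 : b * (1 / 2 * ‖M‖ ^ p - c * m ^ p) ≤ b * d := mul_le_mul_of_nonneg_left h1 (by linarith)
  have h6 : cₐ * (1 / 2 * ‖M‖ ^ p) ≤ b * (1 / 2 * ‖M‖ ^ p) := by gcongr
  have h7 : b * (c * m ^ p) ≤ Cₐ * (c * S ^ p) := by
    have : 0 ≤ Cₐ := by linarith
    gcongr
  have h8 := mul_le_mul_of_nonneg_left s2 hc0'
  have h9 := mul_le_mul_of_nonneg_left s3 hc0'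
  rw [e]
  have e2 : weightedEnergyConst p cₐ Cₐ K = Cₐ * c + 2 * c' := rfl
  rw [e2]
  linarith

/-- The difference `v` of two solutions with coefficients `a` and `b`, where `ξ` is the gradient
of the first one, `F` is its datum and `D` measures the distance of the coefficients. -/
structure IsComparison (p q cₐ Cₐ t₁ t₂ : ℝ) (U : Set (Space n)) (v : ℝ → Space n → Vec N)
    (Dv : ℝ → Space n → Mat N n) (ξ F : ℝ × Space n → Mat N n) (a b D : ℝ × Space n → ℝ) :
    Prop where
  sol : IsZeroDataSolution p q t₁ t₂ U v Dv
    (fun z => a z • flux p (ξ z) + flux p (F z) - b z • flux p (ξ z - Dv z.1 z.2))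
  aesm_grad : AEStronglyMeasurable ξ (volume.restrict (Ioo t₁ t₂ ×ˢ U))
  aesm_datum : AEStronglyMeasurable F (volume.restrict (Ioo t₁ t₂ ×ˢ U))
  aesm_dist : AEStronglyMeasurable D (volume.restrict (Ioo t₁ t₂ ×ˢ U))
  bounds : ∀ z ∈ Ioo t₁ t₂ ×ˢ U, cₐ ≤ b z ∧ b z ≤ Cₐ
  dist_nonneg : ∀ z, 0 ≤ D z
  dist_ge : ∀ z ∈ Ioo t₁ t₂ ×ˢ U, |a z - b z| * ‖ξ z‖ ^ (p - 1) ≤ (D z * ‖ξ z‖) ^ (p - 1)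

variable {cₐ Cₐ t₁ t₂ : ℝ} {U : Set (Space n)} {v : ℝ → Space n → Vec N}
  {Dv : ℝ → Space n → Mat N n} {ξ F : ℝ × Space n → Mat N n} {a b D : ℝ × Space n → ℝ}

/-- The part of the gradient of the difference that is controlled by the data, with the data. -/
def sourceTerm (Dv : ℝ → Space n → Mat N n) (ξ F : ℝ × Space n → Mat N n) (D : ℝ × Space n → ℝ)
    (z : ℝ × Space n) : ℝ :=
  min ‖Dv z.1 z.2‖ ‖ξ z‖ + D z * ‖ξ z‖ + ‖F z‖

lemma IsComparison.sourceTerm_nonneg (h : IsComparison p q cₐ Cₐ t₁ t₂ U v Dv ξ F a b D)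
    (z : ℝ × Space n) : 0 ≤ sourceTerm Dv ξ F D z :=
  add_nonneg (add_nonneg (le_min (norm_nonneg _) (norm_nonneg _))
    (mul_nonneg (h.dist_nonneg z) (norm_nonneg _))) (norm_nonneg _)

lemma IsComparison.aesm_sourceTerm (h : IsComparison p q cₐ Cₐ t₁ t₂ U v Dv ξ F a b D) :
    AEStronglyMeasurable (sourceTerm Dv ξ F D) (volume.restrict (Ioo t₁ t₂ ×ˢ U)) := by
  have h1 : AEStronglyMeasurable (fun z : ℝ × Space n => Dv z.1 z.2)
    (volume.restrict (Ioo t₁ t₂ ×ˢ U)) := h.sol.memLp_grad.1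
  exact ((h1.norm.inf h.aesm_grad.norm).add (h.aesm_dist.mul h.aesm_grad.norm)).add
    h.aesm_datum.norm

/-- Energy estimate for the difference. -/
lemma IsComparison.lintegral_grad_le (h : IsComparison p q cₐ Cₐ t₁ t₂ U v Dv ξ F a b D)
    (hpq : p.HolderConjugate q) (hp2 : p < 2) (hUm : MeasurableSet U) (hUf : volume U ≠ ⊤)
    (hc : 0 < cₐ) (ht : t₁ < t₂) {ε : ℝ} (hε : 0 < ε) (hε1 : ε ≤ 1) :
    ∫⁻ z in Ioo t₁ t₂ ×ˢ U, ENNReal.ofReal (‖Dv z.1 z.2‖ ^ p) ≤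
      ∫⁻ z in Ioo t₁ t₂ ×ˢ U, ENNReal.ofReal (2 * ε * ‖ξ z‖ ^ p + 6 / (cₐ * (p - 1) * ε) *
        (12 / (cₐ * (p - 1) * ε)) ^ (1 / (p - 1)) * ((D z * ‖ξ z‖) ^ p + ‖F z‖ ^ p)) := by
  have hp := hpq.lt
  have hp1 : 0 < p - 1 := by linarith
  have hDm : AEStronglyMeasurable (fun z : ℝ × Space n => Dv z.1 z.2)
    (volume.restrict (Ioo t₁ t₂ ×ˢ U)) := h.sol.memLp_grad.1
  have key := h.sol.lintegral_energy_le (g := fun x => x) (Φ := fun x => 1 / 2 * ‖x‖ ^ 2) (L := 1)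
    (A := fun z => cₐ * (p - 1) / 6 * ε * ‖Dv z.1 z.2‖ ^ p)
    (S := fun z => cₐ * (p - 1) / 3 * ε * (ε * ‖ξ z‖ ^ p) +
      (12 / (cₐ * (p - 1) * ε)) ^ (1 / (p - 1)) * ((D z * ‖ξ z‖) ^ p + ‖F z‖ ^ p))
    hpq hUm hUf ht le_rfl contDiff_id rfl (fun y => ?_) (by simp) (by fun_prop)
    (fun a => by positivity) (fun a b => ?_) ?_ ?_ (fun z => by positivity) (fun z => ?_)
    (fun z hz => ?_)
  · have h1 := (le_add_self.trans key)
    have e1 : ∀ z : ℝ × Space n, ENNReal.ofReal (‖Dv z.1 z.2‖ ^ p) =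
        ENNReal.ofReal (6 / (cₐ * (p - 1) * ε)) *
          ENNReal.ofReal (cₐ * (p - 1) / 6 * ε * ‖Dv z.1 z.2‖ ^ p) := fun z => by
      rw [← ENNReal.ofReal_mul (by positivity)]
      congr 1
      field_simp
    have e2 : ∀ z : ℝ × Space n, ENNReal.ofReal (2 * ε * ‖ξ z‖ ^ p + 6 / (cₐ * (p - 1) * ε) *
        (12 / (cₐ * (p - 1) * ε)) ^ (1 / (p - 1)) * ((D z * ‖ξ z‖) ^ p + ‖F z‖ ^ p)) =
        ENNReal.ofReal (6 / (cₐ * (p - 1) * ε)) *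
          ENNReal.ofReal (cₐ * (p - 1) / 3 * ε * (ε * ‖ξ z‖ ^ p) +
      (12 / (cₐ * (p - 1) * ε)) ^ (1 / (p - 1)) * ((D z * ‖ξ z‖) ^ p + ‖F z‖ ^ p)) := fun z => by
      rw [← ENNReal.ofReal_mul (by positivity)]
      congr 1
      field_simp
      ring
    simp only [e1, e2]
    rw [lintegral_const_mul' _ _ ENNReal.ofReal_ne_top, lintegral_const_mul' _ _ ENNReal.ofReal_ne_top]
    gcongr
  · rw [fderiv_fun_id]
    exact ContinuousLinearMap.norm_id_le
  · have h2 : (inner ℝ b (b - a) : ℝ) = ‖b‖ ^ 2 - inner ℝ b a := by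
      rw [inner_sub_right, real_inner_self_eq_norm_sq]
    have := real_inner_le_norm b a
    rw [h2]
    nlinarith [sq_nonneg (‖b‖ - ‖a‖)]
  · exact ((hDm.norm.aemeasurable.pow_const p).const_mul _).aestronglyMeasurable
  · exact (((h.aesm_grad.norm.aemeasurable.pow_const p).const_mul ε).const_mul _ |>.add
      ((((h.aesm_dist.mul h.aesm_grad.norm).aemeasurable.pow_const p).add
        (h.aesm_datum.norm.aemeasurable.pow_const p)).const_mul _)).aestronglyMeasurable
  · have := h.dist_nonneg z
    positivity
  · rw [fderiv_fun_id, matMap_id]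
    exact inner_comparison_flux_ge hp hp2 hc (h.bounds z hz).1 hε hε1 (h.dist_nonneg z)
      (h.dist_ge z hz)

variable {K L : ℝ} {φ φ' : ℝ → ℝ}

lemma IsComparison.aesm_weight (h : IsComparison p q cₐ Cₐ t₁ t₂ U v Dv ξ F a b D)
    (hφ : IsRadialWeight K L φ φ') :
    AEStronglyMeasurable (fun z : ℝ × Space n => φ (‖v z.1 z.2‖ ^ 2))
      (volume.restrict (Ioo t₁ t₂ ×ˢ U)) := by
  have h1 : Continuous fun y : Vec N => φ (‖y‖ ^ 2) := ContinuousOn.comp_continuous (s := Ici 0)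
    (fun s hs => (hφ.hasDerivAt s hs).continuousAt.continuousWithinAt) (by fun_prop)
    fun y => sq_nonneg ‖y‖
  exact h1.comp_aestronglyMeasurable h.sol.measurable

/-- Weighted energy estimate for the difference. -/
lemma IsComparison.lintegral_weight_add_le (h : IsComparison p q cₐ Cₐ t₁ t₂ U v Dv ξ F a b D)
    (hpq : p.HolderConjugate q) (hp2 : p < 2) (hUm : MeasurableSet U) (hUf : volume U ≠ ⊤)
    (hc : 0 < cₐ) (hC : 0 ≤ Cₐ) (hK : 0 ≤ K) (hφ : IsRadialWeight K L φ φ') {τ : ℝ} (hτ : t₁ < τ)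
    (hτ2 : τ ≤ t₂) :
    (∫⁻ x in U, ENNReal.ofReal (radialPotential φ (v τ x))) + ∫⁻ z in Ioo t₁ τ ×ˢ U,
      ENNReal.ofReal (cₐ / 4 * (φ (‖v z.1 z.2‖ ^ 2) * ‖Dv z.1 z.2‖ ^ p)) ≤
    ∫⁻ z in Ioo t₁ t₂ ×ˢ U, ENNReal.ofReal (weightedEnergyConst p cₐ Cₐ (2 * K) *
      (φ (‖v z.1 z.2‖ ^ 2) * sourceTerm Dv ξ F D z ^ p)) := by
  have hp := hpq.lt
  have hDm : AEStronglyMeasurable (fun z : ℝ × Space n => Dv z.1 z.2)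
    (volume.restrict (Ioo t₁ t₂ ×ˢ U)) := h.sol.memLp_grad.1
  have hK2 : 0 ≤ 2 * K := by linarith
  refine h.sol.lintegral_energy_le (g := radialField φ) hpq hUm hUf hτ hτ2 hφ.contDiff
    radialField_zero (hφ.norm_fderiv_le hK) radialPotential_zero hφ.continuous_potential
    (hφ.potential_nonneg hK) hφ.potential_sub_le ?_ ?_ (fun z => ?_) (fun z => ?_) (fun z hz => ?_)
  · exact (((h.aesm_weight hφ).aemeasurable.mul
      (hDm.norm.aemeasurable.pow_const p)).const_mul _).aestronglyMeasurable
  · exact (((h.aesm_weight hφ).aemeasurable.mul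
      (h.aesm_sourceTerm.aemeasurable.pow_const p)).const_mul _).aestronglyMeasurable
  · have := hφ.nonneg _ (sq_nonneg ‖v z.1 z.2‖)
    positivity
  · have := hφ.nonneg _ (sq_nonneg ‖v z.1 z.2‖)
    have := h.sourceTerm_nonneg z
    have := weightedEnergyConst_nonneg (p := p) hc hC hK2
    positivity
  · obtain ⟨T, hT, hTK, hTe⟩ := hφ.exists_matMap_eq hK (v z.1 z.2) (Dv z.1 z.2)
    rw [hTe, real_inner_smul_right]
    have h1 := inner_comparison_flux_add_ge hp hp2 (F := F z) hc (h.bounds z hz).1 (h.bounds z hz).2 hK2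
      (h.dist_nonneg z) (h.dist_ge z hz) hT hTK
    have h2 := mul_le_mul_of_nonneg_left h1 (hφ.nonneg _ (sq_nonneg ‖v z.1 z.2‖))
    refine le_trans (le_of_eq ?_) h2
    unfold sourceTerm
    ring

/-- The part of the weighted energy at a fixed time. Its right-hand side does not depend on `τ`, so
it acts as a bound on the supremum over time. -/
lemma IsComparison.lintegral_weight_sq_le (h : IsComparison p q cₐ Cₐ t₁ t₂ U v Dv ξ F a b D)
    (hpq : p.HolderConjugate q) (hp2 : p < 2) (hUm : MeasurableSet U) (hUf : volume U ≠ ⊤)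
    (hc : 0 < cₐ) (hC : 0 ≤ Cₐ) (hK : 0 ≤ K) (hφ : IsRadialWeight K L φ φ') {τ : ℝ} (hτ : t₁ < τ)
    (hτ2 : τ ≤ t₂) :
    ∫⁻ x in U, ENNReal.ofReal (φ (‖v τ x‖ ^ 2) * ‖v τ x‖ ^ 2) ≤
    ENNReal.ofReal (2 * (1 + K) * weightedEnergyConst p cₐ Cₐ (2 * K)) *
      ∫⁻ z in Ioo t₁ t₂ ×ˢ U, ENNReal.ofReal (φ (‖v z.1 z.2‖ ^ 2) * sourceTerm Dv ξ F D z ^ p) := by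
  have hw := weightedEnergyConst_nonneg (p := p) hc hC (K := 2 * K) (by linarith)
  have h1 := le_self_add.trans (h.lintegral_weight_add_le hpq hp2 hUm hUf hc hC hK hφ hτ hτ2)
  simp only [ENNReal.ofReal_mul hw] at h1
  rw [lintegral_const_mul' _ _ ENNReal.ofReal_ne_top] at h1
  rw [ENNReal.ofReal_mul (by positivity), mul_assoc]
  refine le_trans ?_ (mul_le_mul_right h1 _)
  rw [← lintegral_const_mul' _ _ ENNReal.ofReal_ne_top]
  refine lintegral_mono fun x => ?_
  rw [← ENNReal.ofReal_mul (by positivity)]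
  refine ENNReal.ofReal_le_ofReal ?_
  have := hφ.le_potential hK (v τ x)
  rw [div_le_iff₀ (by positivity)] at this
  linarith

lemma IsComparison.lintegral_weight_grad_le (h : IsComparison p q cₐ Cₐ t₁ t₂ U v Dv ξ F a b D)
    (hpq : p.HolderConjugate q) (hp2 : p < 2) (hUm : MeasurableSet U) (hUf : volume U ≠ ⊤)
    (hc : 0 < cₐ) (hC : 0 ≤ Cₐ) (hK : 0 ≤ K) (hφ : IsRadialWeight K L φ φ') (ht : t₁ < t₂) :
    ∫⁻ z in Ioo t₁ t₂ ×ˢ U, ENNReal.ofReal (φ (‖v z.1 z.2‖ ^ 2) * ‖Dv z.1 z.2‖ ^ p) ≤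
    ENNReal.ofReal (4 / cₐ * weightedEnergyConst p cₐ Cₐ (2 * K)) *
      ∫⁻ z in Ioo t₁ t₂ ×ˢ U, ENNReal.ofReal (φ (‖v z.1 z.2‖ ^ 2) * sourceTerm Dv ξ F D z ^ p) := by
  have hw := weightedEnergyConst_nonneg (p := p) hc hC (K := 2 * K) (by linarith)
  have h1 := le_add_self.trans (h.lintegral_weight_add_le hpq hp2 hUm hUf hc hC hK hφ ht le_rfl)
  simp only [ENNReal.ofReal_mul hw] at h1
  rw [lintegral_const_mul' _ _ ENNReal.ofReal_ne_top] at h1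
  rw [ENNReal.ofReal_mul (by positivity), mul_assoc]
  refine le_trans ?_ (mul_le_mul_right h1 _)
  rw [← lintegral_const_mul' _ _ ENNReal.ofReal_ne_top]
  refine lintegral_mono fun x => ?_
  rw [← ENNReal.ofReal_mul (by positivity)]
  refine ENNReal.ofReal_le_ofReal (le_of_eq ?_)
  field_simp

end ComparisonEnergy

/-! ### The John–Nirenberg inequality inside a ball -/

section JohnNirenberg

variable {n : ℕ}

lemma volume_ball_mul (y z : Space n) {c r : ℝ} (hc : 0 < c) (hr : 0 < r) :
    volume (ball y (c * r)) = ENNReal.ofReal (c ^ n) * volume (ball z r) := by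
  have h := Measure.addHaar_ball_mul_of_pos (volume : Measure (Space n)) y hc r
  rw [finrank_euclideanSpace_fin] at h
  rw [h, Measure.addHaar_ball_of_pos _ _ hr, Measure.addHaar_ball_of_pos _ z hr]

/-- Two balls centred in a ball overlap in a set that contains a ball of comparable size. -/
lemma exists_ball_subset_inter {x₀ y z : Space n} {ρ r₀ r : ℝ} (hz : z ∈ ball x₀ ρ)
    (hr₀ : r₀ ≤ ρ) (hr : 0 < r) (hrr : r ≤ r₀) (hyz : y ∈ ball z r₀) (hy : y ∈ ball x₀ ρ) :
    ∃ c : Space n, ball c (r / 4) ⊆ ball y r ∩ (ball z r₀ ∩ ball x₀ ρ) := by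
  have hr₀0 : 0 < r₀ := hr.trans_le hrr
  have hρ : 0 < ρ := hr₀0.trans_le hr₀
  -- Moving `z` towards `x₀` by at most `r₀/2` gives a point whose ball of radius `r₀/2` lies in
  -- both `B(z,r₀)` and `B(x₀,ρ)`.
  set e : Space n := z + (r₀ / (2 * ρ)) • (x₀ - z) with he
  have hzx : ‖x₀ - z‖ < ρ := by rwa [mem_ball, dist_comm, dist_eq_norm] at hz
  have hez : ‖e - z‖ ≤ r₀ / 2 := by
    rw [he, add_sub_cancel_left, norm_smul, Real.norm_of_nonneg (by positivity)]
    calc r₀ / (2 * ρ) * ‖x₀ - z‖ ≤ r₀ / (2 * ρ) * ρ := by gcongr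
      _ = r₀ / 2 := by field_simp
  have hex : ‖e - x₀‖ ≤ ρ - r₀ / 2 := by
    have h1 : e - x₀ = (1 - r₀ / (2 * ρ)) • (z - x₀) := by
      rw [he]
      module
    have h2 : r₀ / (2 * ρ) ≤ 1 := by rw [div_le_one (by positivity)]; linarith
    rw [h1, norm_smul, Real.norm_of_nonneg (by linarith), norm_sub_rev]
    calc (1 - r₀ / (2 * ρ)) * ‖x₀ - z‖ ≤ (1 - r₀ / (2 * ρ)) * ρ := by
          gcongr
      _ = ρ - r₀ / 2 := by field_simp
  have hsub : ∀ w : Space n, ‖w‖ < r₀ / 2 → e + w ∈ ball z r₀ ∩ ball x₀ ρ := fun w hw => by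
    refine ⟨?_, ?_⟩
    · rw [mem_ball, dist_eq_norm, add_sub_right_comm]
      linarith [norm_add_le (e - z) w]
    · rw [mem_ball, dist_eq_norm, add_sub_right_comm]
      linarith [norm_add_le (e - x₀) w]
  -- The homothety with centre `y` and ratio `t` maps that ball to one of radius `r/4`. By convexity
  -- the image stays in the intersection, and since `|e-y| ≤ 3r₀/2` it also lies in `B(y,r)`.
  set t := r / (2 * r₀) with ht
  have ht0 : 0 < t := by positivity
  have ht1 : t ≤ 1 := by rw [ht, div_le_one (by positivity)]; linarith
  have htr : t * r₀ = r / 2 := by rw [ht]; field_simp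
  have hconv : Convex ℝ (ball z r₀ ∩ ball x₀ ρ) := (convex_ball _ _).inter (convex_ball _ _)
  refine ⟨y + t • (e - y), fun w hw => ?_⟩
  rw [mem_ball, dist_eq_norm] at hw
  refine ⟨?_, ?_⟩
  · have h1 : ‖e - y‖ ≤ 3 / 2 * r₀ := by
      rw [mem_ball, dist_comm, dist_eq_norm] at hyz
      have : e - y = (e - z) + (z - y) := by abel
      rw [this]
      linarith [norm_add_le (e - z) (z - y)]
    rw [mem_ball, dist_eq_norm]
    have h2 : w - y = (w - (y + t • (e - y))) + t • (e - y) := by abel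
    have h3 : ‖t • (e - y)‖ ≤ 3 / 4 * r := by
      rw [norm_smul, Real.norm_of_nonneg ht0.le]
      calc t * ‖e - y‖ ≤ t * (3 / 2 * r₀) := by gcongr
        _ = 3 / 4 * r := by linarith
    rw [h2]
    linarith [norm_add_le (w - (y + t • (e - y))) (t • (e - y))]
  · set d := t⁻¹ • (w - (y + t • (e - y))) with hd
    have hd1 : ‖d‖ < r₀ / 2 := by
      rw [hd, norm_smul, norm_inv, Real.norm_of_nonneg ht0.le, inv_mul_lt_iff₀ ht0]
      linarith
    have h1 := hconv.add_smul_sub_mem ⟨hyz, hy⟩ (hsub d hd1) ⟨ht0.le, ht1⟩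
    have h2 : y + t • (e + d - y) = w := by
      have : t • d = w - (y + t • (e - y)) := by rw [hd, smul_smul, mul_inv_cancel₀ ht0.ne', one_smul]
      rw [show e + d - y = (e - y) + d by abel, smul_add, this]
      abel
    rwa [h2] at h1

variable {f : Space n → ℝ} {Ω : Set (Space n)} {x₀ : Space n} {ρ δ : ℝ}

/-- The mean value of `f` over `B_r(z) ∩ Ω`. -/
def ballMean (f : Space n → ℝ) (Ω : Set (Space n)) (z : Space n) (r : ℝ) : ℝ :=
  ⨍ y in ball z r ∩ Ω, f y

/-- Integrate `|mean - c| ≤ |f - c| + |f - mean|` over `P`. So when a mean deviates from `c`, the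
function `|f - c|` has large mass on every sizable part `P` of the ball. -/
lemma enorm_ballMean_sub_mul_le {P : Set (Space n)} (hf : Measurable f) {y : Space n} {r c : ℝ}
    (hosc : ∫⁻ x in ball y r ∩ Ω, ‖f x - ballMean f Ω y r‖ₑ ≤
      ENNReal.ofReal δ * volume (ball y r)) (hP : P ⊆ ball y r ∩ Ω) :
    ‖ballMean f Ω y r - c‖ₑ * volume P ≤
      (∫⁻ x in P, ‖f x - c‖ₑ) + ENNReal.ofReal δ * volume (ball y r) := by
  calc ‖ballMean f Ω y r - c‖ₑ * volume P = ∫⁻ _ in P, ‖ballMean f Ω y r - c‖ₑ := by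
        rw [setLIntegral_const]
    _ ≤ ∫⁻ x in P, (‖f x - c‖ₑ + ‖f x - ballMean f Ω y r‖ₑ) := by
        refine lintegral_mono fun x => ?_
        have h : ballMean f Ω y r - c = (f x - c) - (f x - ballMean f Ω y r) := by ring
        simp only
        rw [h]
        exact enorm_sub_le
    _ = (∫⁻ x in P, ‖f x - c‖ₑ) + ∫⁻ x in P, ‖f x - ballMean f Ω y r‖ₑ :=
        lintegral_add_left (hf.sub_const c).enorm _
    _ ≤ _ := by
        gcongr
        exact (lintegral_mono_set hP).trans hosc

/-- Almost every point of an open set is the limit of the means over small balls. -/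
lemma ae_tendsto_ballMean (hΩ : IsOpen Ω) (hf : Measurable f) {C : ℝ} (hC : ∀ x ∈ Ω, |f x| ≤ C) :
    ∀ᵐ y ∂(volume : Measure (Space n)), y ∈ Ω → ∀ r₀ : ℝ, 0 < r₀ →
      Tendsto (fun j : ℕ => ballMean f Ω y (r₀ * (1 / 5) ^ j)) atTop (𝓝 (f y)) := by
  have hloc : LocallyIntegrable (Ω.indicator f) (volume : Measure (Space n)) := by
    have hm : Measurable (Ω.indicator f) := hf.indicator hΩ.measurableSet
    refine (locallyIntegrable_const (|C|)).mono hm.aestronglyMeasurable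
      (Eventually.of_forall fun x => ?_)
    by_cases hx : x ∈ Ω
    · rw [indicator_of_mem hx, Real.norm_eq_abs, norm_abs_eq_norm, Real.norm_eq_abs]
      exact (hC x hx).trans (le_abs_self C)
    · rw [indicator_of_notMem hx]; simp
  filter_upwards [IsUnifLocDoublingMeasure.ae_tendsto_average volume hloc 0] with y hy hyΩ r₀ hr₀
  have hr : Tendsto (fun j : ℕ => r₀ * (1 / 5 : ℝ) ^ j) atTop (𝓝[>] 0) := by
    refine tendsto_nhdsWithin_iff.2 ⟨?_, Eventually.of_forall fun j => ?_⟩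
    · have := (tendsto_pow_atTop_nhds_zero_of_lt_one (r := (1 / 5 : ℝ)) (by norm_num)
        (by norm_num)).const_mul r₀
      rwa [mul_zero] at this
    · exact mem_Ioi.2 (by positivity)
  have h1 := hy (fun _ : ℕ => y) _ hr (Eventually.of_forall fun j => by simp)
  rw [indicator_of_mem hyΩ] at h1
  obtain ⟨d, hd, hdΩ⟩ := Metric.isOpen_iff.1 hΩ y hyΩ
  have h2 : ∀ᶠ j : ℕ in atTop, r₀ * (1 / 5 : ℝ) ^ j < d :=
    (tendsto_nhdsWithin_iff.1 hr).1.eventually (gt_mem_nhds hd)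
  refine h1.congr' ?_
  filter_upwards [h2] with j hj
  have hrj : 0 < r₀ * (1 / 5 : ℝ) ^ j := by positivity
  have h3 : ball y (r₀ * (1 / 5) ^ j) ⊆ Ω := (ball_subset_ball hj.le).trans hdΩ
  rw [ballMean, inter_eq_left.2 h3]
  have h4 : (closedBall y (r₀ * (1 / 5 : ℝ) ^ j)) =ᵐ[volume] ball y (r₀ * (1 / 5) ^ j) := by
    refine (ball_subset_closedBall.eventuallyLE.antisymm ?_).symm
    rw [ae_le_set, closedBall_sdiff_ball]
    exact Measure.addHaar_sphere_of_ne_zero _ _ hrj.ne'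
  rw [setAverage_congr h4, setAverage_eq, setAverage_eq]
  congr 1
  exact setIntegral_congr_fun measurableSet_ball fun x hx => indicator_of_mem (h3 hx) f

/-- The superlevel set of the oscillation of `f` in a ball. -/
def oscSet (f : Space n → ℝ) (Ω : Set (Space n)) (x₀ : Space n) (ρ : ℝ) (z : Space n) (r s : ℝ) :
    Set (Space n) :=
  {y ∈ ball z r ∩ ball x₀ ρ | s < |f y - ballMean f Ω z r|}

/-- The step of the exponential decay of the distribution of the oscillation. -/
def jnStep (n : ℕ) (δ : ℝ) : ℝ := 4 ^ n * (1 + 2 * 5 ^ n) * δ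

/-- A stopping-time argument. At almost every point with `|f - m| > s + κ` the means over shrinking
balls approach `f`, so there is a first radius at which they deviate from `m` by more than `κ`,
while at five times this radius they do not. Vitali's lemma selects disjoint stopping balls whose
fivefold enlargements cover these points. On an enlargement the mean is within `κ` of `m`, so `|f -
mean| > s` there and the bound with `A` applies. The deviation above `κ` forces the selected balls
to be small in total, which produces the factor `1/2`. -/
lemma volume_oscSet_add_le (hΩ : IsOpen Ω) (hf : Measurable f) {C : ℝ} (hC : ∀ x ∈ Ω, |f x| ≤ C)
    (hsub : ball x₀ ρ ⊆ Ω) (hδ : 0 < δ)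
    (hosc : ∀ z ∈ ball x₀ ρ, ∀ r ∈ Ioc 0 ρ, ∫⁻ y in ball z r ∩ Ω, ‖f y - ballMean f Ω z r‖ₑ ≤
      ENNReal.ofReal δ * volume (ball z r)) {s : ℝ} (hs : 0 ≤ s) {A : ℝ≥0∞}
    (hA : ∀ z ∈ ball x₀ ρ, ∀ r ∈ Ioc 0 ρ, volume (oscSet f Ω x₀ ρ z r s) ≤ A * volume (ball z r))
    {z : Space n} (hz : z ∈ ball x₀ ρ) {r₀ : ℝ} (hr₀ : r₀ ∈ Ioc 0 ρ) :
    volume (oscSet f Ω x₀ ρ z r₀ (s + jnStep n δ)) ≤ A / 2 * volume (ball z r₀) := by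
  set κ := jnStep n δ with hκ
  have hκ0 : 0 < κ := by rw [hκ, jnStep]; positivity
  set m := ballMean f Ω z r₀ with hm
  set P : Space n → ℝ → Set (Space n) := fun y r => ball y r ∩ (ball z r₀ ∩ ball x₀ ρ) with hP
  have hPm : ∀ y r, MeasurableSet (P y r) := fun y r =>
    measurableSet_ball.inter (measurableSet_ball.inter measurableSet_ball)
  have hPsub : ∀ y r, P y r ⊆ ball y r ∩ Ω := fun y r x hx => ⟨hx.1, hsub hx.2.2⟩
  have hPsub' : ∀ y r, P y r ⊆ ball z r₀ ∩ Ω := fun y r x hx => ⟨hx.2.1, hsub hx.2.2⟩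
  have h4 : ENNReal.ofReal ((1 / 4 : ℝ) ^ n) = (4 ^ n)⁻¹ := by
    rw [ENNReal.ofReal_pow (by norm_num), one_div, ENNReal.ofReal_inv_of_pos (by norm_num),
      ENNReal.inv_pow]
    norm_num
  have hPvol : ∀ y r, y ∈ ball z r₀ → y ∈ ball x₀ ρ → 0 < r → r ≤ r₀ →
      ENNReal.ofReal ((1 / 4 : ℝ) ^ n) * volume (ball y r) ≤ volume (P y r) := by
    intro y r hyz hy hr hrr
    obtain ⟨c, hc⟩ := exists_ball_subset_inter hz hr₀.2 hr hrr hyz hy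
    refine le_trans (le_of_eq ?_) (measure_mono hc)
    rw [← volume_ball_mul c y (by norm_num) hr]
    congr 2
    ring
  -- the means over balls of the same size are close
  have hstart : ∀ y ∈ ball z r₀, y ∈ ball x₀ ρ → |ballMean f Ω y r₀ - m| ≤ κ := by
    intro y hyz hy
    have h1 := enorm_ballMean_sub_mul_le (c := m) hf (hosc y hy r₀ hr₀) (hPsub y r₀)
    have h2 := (lintegral_mono_set (hPsub' y r₀)).trans (hosc z hz r₀ hr₀)
    have h3 : volume (ball z r₀) = volume (ball y r₀) := by
      have := volume_ball_mul z y one_pos hr₀.1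
      simpa using this
    rw [h3] at h2
    have hb0 : volume (ball y r₀) ≠ 0 := (measure_ball_pos _ _ hr₀.1).ne'
    have hbt : volume (ball y r₀) ≠ ⊤ := measure_ball_lt_top.ne
    have h5 : ‖ballMean f Ω y r₀ - m‖ₑ * (ENNReal.ofReal ((1 / 4 : ℝ) ^ n) * volume (ball y r₀)) ≤
        ENNReal.ofReal (2 * δ) * volume (ball y r₀) := by
      calc _ ≤ ‖ballMean f Ω y r₀ - m‖ₑ * volume (P y r₀) := by
            gcongr
            exact hPvol y r₀ hyz hy hr₀.1 le_rfl
        _ ≤ _ := h1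
        _ ≤ ENNReal.ofReal δ * volume (ball y r₀) + ENNReal.ofReal δ * volume (ball y r₀) := by
            gcongr
        _ = _ := by rw [two_mul, ENNReal.ofReal_add hδ.le hδ.le, add_mul]
    rw [← mul_assoc, ENNReal.mul_le_mul_iff_left hb0 hbt, Real.enorm_eq_ofReal_abs,
      ← ENNReal.ofReal_mul (abs_nonneg _), ENNReal.ofReal_le_ofReal_iff (by positivity)] at h5
    rw [div_pow, one_pow, mul_one_div, div_le_iff₀ (by positivity)] at h5
    refine h5.trans ?_
    rw [hκ, jnStep]
    have : (1 : ℝ) ≤ 5 ^ n := one_le_pow₀ (by norm_num)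
    have h4n : (0 : ℝ) < 4 ^ n := by positivity
    nlinarith [mul_pos h4n hδ]
  -- the first radius at which the mean is large
  set G : Set (Space n) := {y | (y ∈ Ω → ∀ r₀ : ℝ, 0 < r₀ →
      Tendsto (fun j : ℕ => ballMean f Ω y (r₀ * (1 / 5) ^ j)) atTop (𝓝 (f y)))} ∩
      oscSet f Ω x₀ ρ z r₀ (s + κ) with hG
  have hrad : ∀ y : Space n, ∃ r : ℝ, y ∈ G → 0 < r ∧ 5 * r ≤ r₀ ∧
      κ < |ballMean f Ω y r - m| ∧ |ballMean f Ω y (5 * r) - m| ≤ κ := by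
    intro y
    by_cases hy : y ∈ G
    swap
    · exact ⟨0, fun h => absurd h hy⟩
    obtain ⟨hyt, ⟨hyz, hyx⟩, hyk⟩ := hy
    have ht := ((hyt (hsub hyx) r₀ hr₀.1).sub_const m).abs
    have hex : ∃ j : ℕ, κ < |ballMean f Ω y (r₀ * (1 / 5) ^ j) - m| :=
      (ht.eventually (lt_mem_nhds (a := κ) (by linarith [hyk]))).exists
    classical
    set j := Nat.find hex with hj
    have hj1 := Nat.find_spec hex
    rw [← hj] at hj1
    have hj0 : j ≠ 0 := by
      intro h0
      rw [h0, pow_zero, mul_one] at hj1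
      exact absurd (hstart y hyz hyx) (not_le.2 hj1)
    obtain ⟨i, hi⟩ := Nat.exists_eq_succ_of_ne_zero hj0
    have hi1 := Nat.find_min hex (m := i) (by rw [← hj, hi]; exact Nat.lt_succ_self i)
    have e5 : 5 * (r₀ * (1 / 5 : ℝ) ^ j) = r₀ * (1 / 5) ^ i := by
      rw [hi, Nat.succ_eq_add_one, pow_succ]; ring
    refine ⟨r₀ * (1 / 5) ^ j, fun _ => ⟨by have := hr₀.1; positivity, ?_, hj1, ?_⟩⟩
    · rw [e5]
      exact mul_le_of_le_one_right hr₀.1.le (pow_le_one₀ (by norm_num) (by norm_num))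
    · rw [e5]
      exact not_lt.1 hi1
  choose R hR using hrad
  -- Enlargement by `4` rather than `5` leaves room to pass from closed balls to open balls of
  -- radius `5R`, the scale of the preceding stopping step.
  obtain ⟨u, huG, hdisj, hcov⟩ := Vitali.exists_disjoint_subfamily_covering_enlargement_closedBall
    G (fun y => y) R r₀ (fun y hy => by have := hR y hy; linarith) 4 (by norm_num)
  have hucount : u.Countable := by
    refine hdisj.countable_of_nonempty_interior fun y hy => ?_
    exact ⟨y, ball_subset_interior_closedBall (mem_ball_self (hR y (huG hy)).1)⟩
  have hball : ∀ y ∈ G, y ∈ ball z r₀ ∧ y ∈ ball x₀ ρ := fun y hy => hy.2.1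
  -- the selected balls are small
  have hsmall : ∑' y : u, ENNReal.ofReal (2 * 5 ^ n) * volume (ball (y : Space n) (R y)) ≤
      volume (ball z r₀) := by
    have hδ0 : ENNReal.ofReal δ ≠ 0 := by simpa using hδ
    rw [← ENNReal.mul_le_mul_iff_right hδ0 ENNReal.ofReal_ne_top, ← ENNReal.tsum_mul_left]
    calc ∑' y : u, ENNReal.ofReal δ * (ENNReal.ofReal (2 * 5 ^ n) *
          volume (ball (y : Space n) (R y)))
        ≤ ∑' y : u, ∫⁻ x in P y (R y), ‖f x - m‖ₑ := by
          refine ENNReal.tsum_le_tsum fun y => ?_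
          obtain ⟨r1, r2, r3, r4⟩ := hR y (huG y.2)
          obtain ⟨b1, b2⟩ := hball y (huG y.2)
          have hrρ : R y ∈ Ioc 0 ρ := ⟨r1, by linarith [hr₀.2]⟩
          have h1 := enorm_ballMean_sub_mul_le (c := m) hf (hosc y b2 (R y) hrρ) (hPsub y (R y))
          have h2 : ENNReal.ofReal κ * (ENNReal.ofReal ((1 / 4 : ℝ) ^ n) *
              volume (ball (y : Space n) (R y))) ≤
              ‖ballMean f Ω y (R y) - m‖ₑ * volume (P y (R y)) := by
            gcongr
            · rw [Real.enorm_eq_ofReal_abs]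
              exact ENNReal.ofReal_le_ofReal r3.le
            · exact hPvol y (R y) b1 b2 r1 (by linarith)
          -- This is the reason for the form of `jnStep`: `4^n` compensates the overlap of balls,
          -- one `δ` cancels the oscillation on the selected ball, and `2·5^n δ` pays for the
          -- enlargement and the halving.
          have h3 : ENNReal.ofReal κ * (ENNReal.ofReal ((1 / 4 : ℝ) ^ n) *
              volume (ball (y : Space n) (R y))) = ENNReal.ofReal δ * volume (ball (y : Space n) (R y))
              + ENNReal.ofReal δ * (ENNReal.ofReal (2 * 5 ^ n) *
                volume (ball (y : Space n) (R y))) := by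
            rw [← mul_assoc, ← mul_assoc, ← ENNReal.ofReal_mul hκ0.le, ← ENNReal.ofReal_mul hδ.le,
              ← add_mul, ← ENNReal.ofReal_add hδ.le (by positivity)]
            congr 2
            rw [hκ, jnStep, div_pow, one_pow]
            field_simp
          have h5 := h2.trans h1
          rw [h3, add_comm (∫⁻ x in P y (R y), ‖f x - m‖ₑ)] at h5
          exact ENNReal.le_of_add_le_add_left
            (ENNReal.mul_ne_top ENNReal.ofReal_ne_top measure_ball_lt_top.ne) h5
      _ = ∫⁻ x in ⋃ y ∈ u, P y (R y), ‖f x - m‖ₑ := by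
          rw [lintegral_biUnion hucount (fun y _ => hPm y (R y))]
          intro y hy y' hy' hne
          exact (hdisj hy hy' hne).mono (fun x hx => ball_subset_closedBall hx.1)
            fun x hx => ball_subset_closedBall hx.1
      _ ≤ ∫⁻ x in ball z r₀ ∩ Ω, ‖f x - m‖ₑ :=
          lintegral_mono_set (iUnion₂_subset fun y _ => hPsub' y (R y))
      _ ≤ _ := hosc z hz r₀ hr₀
  -- covering
  have hcover : G ⊆ ⋃ y ∈ u, oscSet f Ω x₀ ρ y (5 * R y) s := by
    intro y hy
    obtain ⟨y', hy', hyy⟩ := hcov y hy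
    obtain ⟨r1, r2, r3, r4⟩ := hR y' (huG hy')
    have hy1 : y ∈ closedBall y' (4 * R y') := hyy (mem_closedBall_self (hR y hy).1.le)
    refine mem_iUnion₂.2 ⟨y', hy', ⟨?_, (hball y hy).2⟩, ?_⟩
    · rw [mem_closedBall] at hy1
      rw [mem_ball]
      linarith
    · have h1 : s + κ < |f y - m| := hy.2.2
      have h2 := abs_sub_le (f y) (ballMean f Ω y' (5 * R y')) m
      linarith
  calc volume (oscSet f Ω x₀ ρ z r₀ (s + κ)) ≤ volume G := by
        refine measure_mono_ae ?_
        filter_upwards [ae_tendsto_ballMean hΩ hf hC] with y hy hy'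
        exact ⟨hy, hy'⟩
    _ ≤ ∑' y : u, volume (oscSet f Ω x₀ ρ y (5 * R y) s) :=
        (measure_mono hcover).trans (measure_biUnion_le _ hucount _)
    _ ≤ ∑' y : u, A / 2 * (ENNReal.ofReal (2 * 5 ^ n) * volume (ball (y : Space n) (R y))) := by
        refine ENNReal.tsum_le_tsum fun y => ?_
        obtain ⟨r1, r2, r3, r4⟩ := hR y (huG y.2)
        refine (hA y (hball y (huG y.2)).2 (5 * R y) ⟨by positivity, r2.trans hr₀.2⟩).trans ?_
        rw [volume_ball_mul _ (y : Space n) (by norm_num) r1, ENNReal.ofReal_mul (by norm_num),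
          ENNReal.ofReal_ofNat, ← mul_assoc, ← mul_assoc, ← mul_assoc,
          ENNReal.div_mul_cancel (by norm_num) (by norm_num)]
    _ ≤ _ := by
        rw [ENNReal.tsum_mul_left]
        gcongr

/-- Exponential decay of the distribution of the oscillation. -/
lemma volume_oscSet_le (hΩ : IsOpen Ω) (hf : Measurable f) {C : ℝ} (hC : ∀ x ∈ Ω, |f x| ≤ C)
    (hsub : ball x₀ ρ ⊆ Ω) (hδ : 0 < δ)
    (hosc : ∀ z ∈ ball x₀ ρ, ∀ r ∈ Ioc 0 ρ, ∫⁻ y in ball z r ∩ Ω, ‖f y - ballMean f Ω z r‖ₑ ≤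
      ENNReal.ofReal δ * volume (ball z r)) (j : ℕ) :
    ∀ z ∈ ball x₀ ρ, ∀ r ∈ Ioc 0 ρ,
      volume (oscSet f Ω x₀ ρ z r (j * jnStep n δ)) ≤ (2⁻¹) ^ j * volume (ball z r) := by
  have hκ0 : 0 < jnStep n δ := by rw [jnStep]; positivity
  induction j with
  | zero =>
    intro z _ r _
    rw [pow_zero, one_mul]
    exact measure_mono fun y hy => hy.1.1
  | succ j ih =>
    intro z hz r hr
    have h := volume_oscSet_add_le hΩ hf hC hsub hδ hosc (by positivity) ih hz hr
    rw [pow_succ, ← div_eq_mul_inv]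
    refine le_trans (le_of_eq ?_) h
    congr 2
    push_cast
    ring

/-- The constant of the John--Nirenberg inequality. -/
def jnConst (n : ℕ) (Q : ℝ) : ℝ :=
  (4 ^ n * (1 + 2 * 5 ^ n)) ^ Q * ∑' j : ℕ, ((j : ℝ) + 1) ^ Q * (1 / 2) ^ j

lemma summable_rpow_mul_half (Q : ℝ) : Summable fun j : ℕ => ((j : ℝ) + 1) ^ Q * (1 / 2) ^ j := by
  obtain ⟨k, hk⟩ := exists_nat_ge Q
  have h1 := summable_pow_mul_geometric_of_norm_lt_one (R := ℝ) k (r := 1 / 2) (by norm_num)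
  have h2 := ((summable_nat_add_iff 1).2 h1).mul_left 2
  refine h2.of_nonneg_of_le (fun j => by positivity) fun j => ?_
  have h3 : ((j : ℝ) + 1) ^ Q ≤ ((j : ℝ) + 1) ^ k := by
    rw [← Real.rpow_natCast]
    exact Real.rpow_le_rpow_of_exponent_le (by linarith [Nat.cast_nonneg (α := ℝ) j]) hk
  push_cast
  calc ((j : ℝ) + 1) ^ Q * (1 / 2) ^ j ≤ ((j : ℝ) + 1) ^ k * (1 / 2) ^ j := by gcongr
    _ = _ := by rw [pow_succ]; ring

/-- The John--Nirenberg inequality, in integrated form. -/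
lemma lintegral_oscillation_rpow_le (hΩ : IsOpen Ω) (hf : Measurable f) {C : ℝ}
    (hC : ∀ x ∈ Ω, |f x| ≤ C) (hsub : ball x₀ ρ ⊆ Ω) (hρ : 0 < ρ) (hδ : 0 < δ)
    (hosc : ∀ z ∈ ball x₀ ρ, ∀ r ∈ Ioc 0 ρ, ∫⁻ y in ball z r ∩ Ω, ‖f y - ballMean f Ω z r‖ₑ ≤
      ENNReal.ofReal δ * volume (ball z r)) {Q : ℝ} (hQ : 0 < Q) :
    ∫⁻ y in ball x₀ ρ, ENNReal.ofReal (|f y - ⨍ x in ball x₀ ρ, f x| ^ Q) ≤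
      ENNReal.ofReal (jnConst n Q * δ ^ Q) * volume (ball x₀ ρ) := by
  set κ := jnStep n δ with hκ
  have hκ0 : 0 < κ := by rw [hκ, jnStep]; positivity
  have hm : ballMean f Ω x₀ ρ = ⨍ x in ball x₀ ρ, f x := by rw [ballMean, inter_eq_left.2 hsub]
  rw [← hm]
  set m := ballMean f Ω x₀ ρ
  have hEm : ∀ s, MeasurableSet (oscSet f Ω x₀ ρ x₀ ρ s) := fun s =>
    (measurableSet_ball.inter measurableSet_ball).inter
      (measurableSet_lt measurable_const (hf.sub_const m).abs)
  -- A discrete layer-cake decomposition: if `jκ < |f - m| ≤ (j+1)κ`, the `j`-th term of the sum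
  -- alone dominates.
  have hpt : ∀ y ∈ ball x₀ ρ, ENNReal.ofReal (|f y - m| ^ Q) ≤
      ∑' j : ℕ, (oscSet f Ω x₀ ρ x₀ ρ (j * κ)).indicator
        (fun _ => ENNReal.ofReal ((((j : ℝ) + 1) * κ) ^ Q)) y := by
    intro y hy
    rcases (abs_nonneg (f y - m)).eq_or_lt with h0 | h0
    · rw [← h0, Real.zero_rpow hQ.ne']; simp
    set i := ⌈|f y - m| / κ⌉₊ with hi
    have hi0 : i ≠ 0 := by
      rw [hi, Ne, Nat.ceil_eq_zero, not_le]
      positivity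
    obtain ⟨j, hj⟩ := Nat.exists_eq_succ_of_ne_zero hi0
    refine le_trans ?_ (ENNReal.le_tsum j)
    have h1 : (j : ℝ) * κ < |f y - m| := by
      have : j < ⌈|f y - m| / κ⌉₊ := by rw [← hi, hj]; exact Nat.lt_succ_self j
      rw [Nat.lt_ceil, lt_div_iff₀ hκ0] at this
      exact this
    have h2 : |f y - m| ≤ ((j : ℝ) + 1) * κ := by
      have := Nat.le_ceil (|f y - m| / κ)
      rw [← hi, hj, div_le_iff₀ hκ0] at this
      push_cast at this
      exact this
    rw [indicator_of_mem (show y ∈ oscSet f Ω x₀ ρ x₀ ρ (j * κ) from ⟨⟨hy, hy⟩, h1⟩)]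
    exact ENNReal.ofReal_le_ofReal (Real.rpow_le_rpow (abs_nonneg _) h2 hQ.le)
  calc ∫⁻ y in ball x₀ ρ, ENNReal.ofReal (|f y - m| ^ Q)
      ≤ ∫⁻ y in ball x₀ ρ, ∑' j : ℕ, (oscSet f Ω x₀ ρ x₀ ρ (j * κ)).indicator
        (fun _ => ENNReal.ofReal ((((j : ℝ) + 1) * κ) ^ Q)) y :=
        setLIntegral_mono' measurableSet_ball hpt
    _ ≤ ∫⁻ y, ∑' j : ℕ, (oscSet f Ω x₀ ρ x₀ ρ (j * κ)).indicator
        (fun _ => ENNReal.ofReal ((((j : ℝ) + 1) * κ) ^ Q)) y := setLIntegral_le_lintegral _ _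
    _ = ∑' j : ℕ, ENNReal.ofReal ((((j : ℝ) + 1) * κ) ^ Q) *
          volume (oscSet f Ω x₀ ρ x₀ ρ (j * κ)) := by
        rw [lintegral_tsum fun j => (measurable_const.indicator (hEm _)).aemeasurable]
        congr 1
        funext j
        rw [lintegral_indicator (hEm _), setLIntegral_const]
    _ ≤ ∑' j : ℕ, ENNReal.ofReal ((((j : ℝ) + 1) * κ) ^ Q * (1 / 2) ^ j) * volume (ball x₀ ρ) := by
        refine ENNReal.tsum_le_tsum fun j => ?_
        have h1 := volume_oscSet_le hΩ hf hC hsub hδ hosc j x₀ (mem_ball_self hρ) ρ ⟨hρ, le_rfl⟩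
        have h2 : ENNReal.ofReal ((1 / 2 : ℝ) ^ j) = 2⁻¹ ^ j := by
          rw [ENNReal.ofReal_pow (by norm_num), one_div, ENNReal.ofReal_inv_of_pos (by norm_num)]
          norm_num
        rw [ENNReal.ofReal_mul (by positivity), h2, mul_assoc]
        gcongr
    _ = _ := by
        rw [ENNReal.tsum_mul_right]
        congr 1
        have e : ∀ j : ℕ, (((j : ℝ) + 1) * κ) ^ Q * (1 / 2) ^ j =
            κ ^ Q * (((j : ℝ) + 1) ^ Q * (1 / 2) ^ j) := fun j => by
          rw [Real.mul_rpow (by positivity) hκ0.le]; ring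
        simp only [e]
        rw [← ENNReal.ofReal_tsum_of_nonneg (fun j => by positivity)
          ((summable_rpow_mul_half Q).mul_left _), tsum_mul_left, hκ, jnStep, jnConst,
          Real.mul_rpow (by positivity) hδ.le]
        congr 1
        ring

end JohnNirenberg

/-! ### Parabolic integrability of the difference -/

section ParabolicSobolev

variable {N n : ℕ}

/-- The constant of the Sobolev inequality for truncated powers. -/
def truncSobolevConst (N n : ℕ) (p ϑ : ℝ) : ℝ≥0 :=
  (SNormLESNormFDerivOfEqConst (E := Space n) (Vec N) volume p *
    Real.toNNReal (1 + 2 * (ϑ / (2 * p) + 1))) ^ p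

/-- The truncated form of `|v|^σ = (|v|^{ϑ/p}|v|)^p (|v|^ϑ|v|²)^{p/n}`. Since `σ/ϑ = 1 + p/n +
(p+2p/n)/ϑ`, the first two powers of the weight are kept, and the last is bounded through `φ ≤ s^ϑ`.
-/
lemma truncPow_rpow_le {n p ϑ σ k s : ℝ} (hn : 0 < n) (hp : 0 < p) (hϑ : 0 < ϑ) (hk : 0 < k)
    (hs : 0 ≤ s) (hσ : σ = p + ϑ + p * (ϑ + 2) / n) :
    truncPow (ϑ / 2) p k (s ^ 2) ^ (σ / ϑ) ≤
      (truncPow (ϑ / (2 * p)) 1 k (s ^ 2) * s) ^ p *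
        (truncPow (ϑ / 2) p k (s ^ 2) * s ^ 2) ^ (p / n) := by
  have hs2 : 0 ≤ s ^ 2 := sq_nonneg s
  set φ := truncPow (ϑ / 2) p k (s ^ 2) with hφ
  have hφ0 : 0 ≤ φ := truncPow_nonneg hk hs2
  have hψ : truncPow (ϑ / (2 * p)) 1 k (s ^ 2) ^ p = φ := by
    rw [truncPow_rpow (by positivity) one_pos hk hs2 hp, one_mul, hφ]
    congr 1
    field_simp
  have hφs : φ ≤ s ^ ϑ := by
    refine (truncPow_le_rpow (by positivity) hp hk hs2).trans (le_of_eq ?_)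
    rw [← Real.rpow_natCast, ← Real.rpow_mul hs]
    congr 1
    push_cast
    ring
  have hpn : 0 < p / n := by positivity
  set e := (p + 2 * (p / n)) / ϑ with he
  have he0 : 0 ≤ e := by positivity
  have e1 : σ / ϑ = 1 + p / n + e := by
    rw [hσ, he]
    field_simp
    ring
  have e2 : (s ^ ϑ) ^ e = s ^ p * (s ^ 2) ^ (p / n) := by
    rw [← Real.rpow_natCast, ← Real.rpow_mul hs, ← Real.rpow_mul hs,
      ← Real.rpow_add_of_nonneg hs (by positivity) (by positivity), he]
    congr 1
    push_cast
    field_simp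
  rw [e1, Real.rpow_add_of_nonneg hφ0 (by positivity) he0,
    Real.rpow_add_of_nonneg hφ0 (by positivity) (by positivity), Real.rpow_one,
    Real.mul_rpow (truncPow_nonneg hk hs2) hs, hψ, Real.mul_rpow hφ0 hs2]
  have h3 : φ ^ e ≤ s ^ p * (s ^ 2) ^ (p / n) := by
    rw [← e2]
    exact Real.rpow_le_rpow hφ0 hφs he0
  calc φ * φ ^ (p / n) * φ ^ e ≤ φ * φ ^ (p / n) * (s ^ p * (s ^ 2) ^ (p / n)) := by gcongr
    _ = _ := by ring

/-- A Gagliardo--Nirenberg inequality for truncated powers, at a fixed time. -/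
lemma MemW1pZero.lintegral_truncPow_le {p ϑ σ k : ℝ} (hp : 1 < p) (hpn : p < n) (hϑ : 0 < ϑ)
    (hk : 0 < k) (hσ : σ = p + ϑ + p * (ϑ + 2) / n) {U : Set (Space n)} {V : Space n → Vec N}
    {DV : Space n → Mat N n} (hV : MemW1pZero p U V DV)
    (hVm : AEStronglyMeasurable V (volume.restrict U))
    (hDV : MemLp DV (ENNReal.ofReal p) (volume.restrict U)) :
    ∫⁻ x in U, ENNReal.ofReal (truncPow (ϑ / 2) p k (‖V x‖ ^ 2) ^ (σ / ϑ)) ≤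
      truncSobolevConst N n p ϑ *
        (∫⁻ x in U, ENNReal.ofReal (truncPow (ϑ / 2) p k (‖V x‖ ^ 2) * ‖DV x‖ ^ p)) *
        (∫⁻ x in U, ENNReal.ofReal (truncPow (ϑ / 2) p k (‖V x‖ ^ 2) * ‖V x‖ ^ 2)) ^ (p / n) := by
  have hp0 : 0 < p := by linarith
  have hn : (0 : ℝ) < n := by linarith
  lift p to ℝ≥0 using hp0.le
  have hnp : 0 < (n : ℝ) - p := by linarith
  have hq0 : 0 < (n : ℝ) * p / (n - p) := by positivity
  obtain ⟨q, hq⟩ : ∃ q : ℝ≥0, (q : ℝ) = n * p / (n - p) := ⟨⟨_, hq0.le⟩, rfl⟩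
  have hqi : (q : ℝ)⁻¹ = (p : ℝ)⁻¹ - (n : ℝ)⁻¹ := by
    rw [hq]
    field_simp
  -- The Sobolev inequality is applied to the radial field with weight `ψ = φ^{1/p}`; the `p`-th
  -- power of its gradient is at most a constant times `φ|DV|^p`.
  have hw : IsRadialWeight (ϑ / (2 * p) + 1) (k ^ (ϑ / (2 * p)))
      (truncPow (ϑ / (2 * p)) 1 k) (truncPowDeriv (ϑ / (2 * p)) 1 k) :=
    isRadialWeight_truncPow (by positivity) one_pos (by linarith [show 0 < ϑ / (2 * p) by positivity]) hk
  have hK : 0 ≤ ϑ / (2 * (p : ℝ)) + 1 := by positivity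
  set K := ϑ / (2 * (p : ℝ)) + 1 with hKdef
  set ψ := truncPow (ϑ / (2 * (p : ℝ))) 1 k with hψdef
  set φ := truncPow (ϑ / 2) p k with hφdef
  have hψ0 : ∀ s : ℝ, 0 ≤ ψ (s ^ 2) := fun s => truncPow_nonneg hk (sq_nonneg s)
  have hφ0 : ∀ s : ℝ, 0 ≤ φ (s ^ 2) := fun s => truncPow_nonneg hk (sq_nonneg s)
  have hψφ : ∀ s : ℝ, ψ (s ^ 2) ^ (p : ℝ) = φ (s ^ 2) := fun s => by
    rw [hψdef, truncPow_rpow (by positivity) one_pos hk (sq_nonneg s) hp0, one_mul, hφdef]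
    congr 1
    field_simp
  have hp1 : (1 : ℝ≥0) ≤ p := by exact_mod_cast hp.le
  have hofp : ENNReal.ofReal (p : ℝ) = p := by simp
  rw [hofp] at hDV
  have hS := hV.eLpNorm_comp_le hp1 (by exact_mod_cast hn) hqi hVm hDV hw.contDiff radialField_zero
    (hw.norm_fderiv_le hK)
  have hp0' : p ≠ 0 := by intro h; rw [h] at hp0; simp at hp0
  have hq0' : q ≠ 0 := by intro h; rw [h] at hq; simp at hq; linarith
  rw [eLpNorm_nnreal_eq_lintegral hq0', eLpNorm_nnreal_eq_lintegral hp0'] at hS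
  have e1 : ∀ x, ‖radialField ψ (V x)‖ₑ ^ (q : ℝ) =
      ENNReal.ofReal ((ψ (‖V x‖ ^ 2) * ‖V x‖) ^ (q : ℝ)) := fun x => by
    rw [← ofReal_norm, radialField, norm_smul, Real.norm_of_nonneg (hψ0 _),
      ENNReal.ofReal_rpow_of_nonneg (mul_nonneg (hψ0 _) (norm_nonneg _)) q.coe_nonneg]
  have e2 : ∫⁻ x in U, ‖matMap (fderiv ℝ (radialField ψ) (V x)) (DV x)‖ₑ ^ (p : ℝ) ≤
      ENNReal.ofReal ((1 + 2 * K) ^ (p : ℝ)) *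
        ∫⁻ x in U, ENNReal.ofReal (φ (‖V x‖ ^ 2) * ‖DV x‖ ^ (p : ℝ)) := by
    rw [← lintegral_const_mul' _ _ ENNReal.ofReal_ne_top]
    refine lintegral_mono fun x => ?_
    rw [← ofReal_norm, ENNReal.ofReal_rpow_of_nonneg (norm_nonneg _) p.coe_nonneg,
      ← ENNReal.ofReal_mul (by positivity)]
    refine ENNReal.ofReal_le_ofReal ?_
    rw [← hψφ, ← mul_assoc, ← Real.mul_rpow (by positivity) (hψ0 _),
      ← Real.mul_rpow (mul_nonneg (by positivity) (hψ0 _)) (norm_nonneg _)]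
    refine Real.rpow_le_rpow (norm_nonneg _) ((norm_matMap_le _ _).trans ?_) p.coe_nonneg
    gcongr
    exact hw.norm_fderiv_le' _
  simp only [e1] at hS
  set G := ∫⁻ x in U, ENNReal.ofReal (φ (‖V x‖ ^ 2) * ‖DV x‖ ^ (p : ℝ)) with hG
  set Y := ∫⁻ x in U, ENNReal.ofReal ((ψ (‖V x‖ ^ 2) * ‖V x‖) ^ (q : ℝ)) with hY
  have hYG : Y ^ ((p : ℝ) / q) ≤ truncSobolevConst N n p ϑ * G := by
    have h1 := ENNReal.rpow_le_rpow hS hp0.le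
    rw [← ENNReal.rpow_mul, ENNReal.mul_rpow_of_nonneg _ _ hp0.le, ← ENNReal.rpow_mul,
      one_div_mul_cancel hp0.ne', ENNReal.rpow_one, one_div_mul_eq_div] at h1
    refine h1.trans ?_
    refine (mul_le_mul_right e2 _).trans (le_of_eq ?_)
    rw [← mul_assoc, truncSobolevConst, NNReal.mul_rpow, ENNReal.coe_mul,
      ENNReal.coe_rpow_of_nonneg _ hp0.le, ENNReal.coe_rpow_of_nonneg _ hp0.le,
      ← ENNReal.ofReal_rpow_of_nonneg (by positivity) hp0.le]
    rfl
  -- With the Sobolev exponent `q = np/(n-p)`, the Hölder exponents `1 - p/n` and `p/n` add up to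
  -- one and leave the gradient integral to the first power.
  have hpq : (p : ℝ) / q = 1 - p / n := by
    rw [hq]
    field_simp
  have hpn1 : (p : ℝ) / n ≤ 1 := by rw [div_le_one hn]; exact hpn.le
  have hVa : AEMeasurable (fun x => ‖V x‖) (volume.restrict U) := hVm.norm.aemeasurable
  have hcont : ∀ {χ χ' : ℝ → ℝ} {K L : ℝ}, IsRadialWeight K L χ χ' →
      AEMeasurable (fun x => χ (‖V x‖ ^ 2)) (volume.restrict U) := fun {χ χ' K L} h => by
    have h1 : Continuous fun y : ℝ => χ (y ^ 2) := ContinuousOn.comp_continuous (s := Ici 0)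
      (fun s hs => (h.hasDerivAt s hs).continuousAt.continuousWithinAt) (by fun_prop)
      fun y => sq_nonneg y
    exact h1.measurable.comp_aemeasurable hVa
  have hwφ := isRadialWeight_truncPow (α := ϑ / 2) (β := (p : ℝ)) (by positivity) hp0
    (by linarith) hk
  calc ∫⁻ x in U, ENNReal.ofReal (φ (‖V x‖ ^ 2) ^ (σ / ϑ))
      ≤ ∫⁻ x in U, ENNReal.ofReal ((ψ (‖V x‖ ^ 2) * ‖V x‖) ^ (q : ℝ)) ^ (1 - (p : ℝ) / n) *
          ENNReal.ofReal (φ (‖V x‖ ^ 2) * ‖V x‖ ^ 2) ^ ((p : ℝ) / n) := by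
        refine lintegral_mono fun x => ?_
        have h0 := mul_nonneg (hψ0 ‖V x‖) (norm_nonneg (V x))
        have h1 := mul_nonneg (hφ0 ‖V x‖) (sq_nonneg ‖V x‖)
        simp only
        rw [ENNReal.ofReal_rpow_of_nonneg (by positivity) (by linarith),
          ENNReal.ofReal_rpow_of_nonneg h1 (by positivity), ← ENNReal.ofReal_mul (by positivity),
          ← Real.rpow_mul h0, ← hpq, mul_div_cancel₀ _ (by rw [hq]; positivity)]
        exact ENNReal.ofReal_le_ofReal (truncPow_rpow_le hn hp0 hϑ hk (norm_nonneg _) hσ)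
    _ ≤ Y ^ (1 - (p : ℝ) / n) *
          (∫⁻ x in U, ENNReal.ofReal (φ (‖V x‖ ^ 2) * ‖V x‖ ^ 2)) ^ ((p : ℝ) / n) := by
        refine ENNReal.lintegral_mul_norm_pow_le ?_ ?_ (by linarith) (by positivity) (by ring)
        · exact (((hcont hw).mul hVa).pow_const _).ennreal_ofReal
        · exact ((hcont hwφ).mul (hVa.pow_const 2)).ennreal_ofReal
    _ ≤ _ := by
        rw [← hpq]
        gcongr

variable {p q cₐ Cₐ t₁ t₂ : ℝ} {U : Set (Space n)} {v : ℝ → Space n → Vec N}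
  {Dv : ℝ → Space n → Mat N n} {ξ F : ℝ × Space n → Mat N n} {a b D : ℝ × Space n → ℝ}

/-- Powers of exponent less than one are absorbed. -/
lemma ENNReal.rpow_le_of_le_mul_rpow {X Y A : ℝ≥0∞} {θ m : ℝ} (hX : X ≠ ⊤) (hθ : 0 ≤ θ)
    (hθ1 : θ < 1) (hm : 0 < m) (h : X ≤ A * X ^ θ * Y) : X ^ m ≤ (A * Y) ^ (m / (1 - θ)) := by
  rcases eq_or_ne X 0 with rfl | h0
  · rw [ENNReal.zero_rpow_of_pos hm]; exact zero_le
  have h1 : X ^ θ * X ^ (1 - θ) ≤ X ^ θ * (A * Y) := by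
    rw [← ENNReal.rpow_add _ _ h0 hX, add_sub_cancel, ENNReal.rpow_one]
    refine h.trans (le_of_eq ?_)
    ring
  rw [ENNReal.mul_le_mul_iff_right (by simp [h0, hX]) (ENNReal.rpow_ne_top_of_nonneg hθ hX)] at h1
  have h2 := ENNReal.rpow_le_rpow h1 (z := m / (1 - θ)) (div_nonneg hm.le (by linarith))
  rwa [← ENNReal.rpow_mul, mul_div_cancel₀ _ (by linarith)] at h2

/-- The constant of the parabolic integrability estimate. -/
def parabolicConst (N n : ℕ) (p cₐ Cₐ ϑ : ℝ) : ℝ≥0 :=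
  truncSobolevConst N n p ϑ *
    Real.toNNReal (4 / cₐ * weightedEnergyConst p cₐ Cₐ (2 * (ϑ / 2 + p))) *
    Real.toNNReal (2 * (1 + (ϑ / 2 + p)) * weightedEnergyConst p cₐ Cₐ (2 * (ϑ / 2 + p))) ^ (p / n)

/-- At almost every time the spatial inequality has one factor linear in the weighted gradient and
one power `p/n` of the weighted square. The second is bounded uniformly in time and the first is
integrated. Both are controlled by the same source integral, whence its power `1 + p/n`. -/
lemma IsComparison.lintegral_truncPow_le (h : IsComparison p q cₐ Cₐ t₁ t₂ U v Dv ξ F a b D)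
    (hpq : p.HolderConjugate q) (hp2 : p < 2) (hn : 2 ≤ n) (hUm : MeasurableSet U)
    (hUf : volume U ≠ ⊤) (hc : 0 < cₐ) (hC : 0 ≤ Cₐ) (ht : t₁ < t₂) {ϑ σ k : ℝ} (hϑ : 0 < ϑ)
    (hk : 0 < k) (hσ : σ = p + ϑ + p * (ϑ + 2) / n) :
    ∫⁻ z in Ioo t₁ t₂ ×ˢ U, ENNReal.ofReal (truncPow (ϑ / 2) p k (‖v z.1 z.2‖ ^ 2) ^ (σ / ϑ)) ≤
      parabolicConst N n p cₐ Cₐ ϑ * (∫⁻ z in Ioo t₁ t₂ ×ˢ U, ENNReal.ofReal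
        (truncPow (ϑ / 2) p k (‖v z.1 z.2‖ ^ 2) * sourceTerm Dv ξ F D z ^ p)) ^ (1 + p / n) := by
  have hp := hpq.lt
  have hp0 : 0 < p := by linarith
  have hn0 : (0 : ℝ) < n := by exact_mod_cast (by omega : 0 < n)
  have hpn : p < n := by
    have : (2 : ℝ) ≤ n := by exact_mod_cast hn
    linarith
  have hw := isRadialWeight_truncPow (α := ϑ / 2) (β := p) (by positivity) hp0
    (by linarith) hk
  have hK : 0 ≤ ϑ / 2 + p := by positivity
  have hwK := weightedEnergyConst_nonneg (p := p) hc hC (K := 2 * (ϑ / 2 + p)) (by linarith)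
  have hprod : (volume.restrict (Ioo t₁ t₂)).prod (volume.restrict U) =
    (volume.restrict (Ioo t₁ t₂ ×ˢ U) : Measure (ℝ × Space n)) := Measure.prod_restrict _ _
  set φ := truncPow (ϑ / 2) p k with hφ
  set J := ∫⁻ z in Ioo t₁ t₂ ×ˢ U, ENNReal.ofReal
    (φ (‖v z.1 z.2‖ ^ 2) * sourceTerm Dv ξ F D z ^ p) with hJ
  set c₁ := 2 * (1 + (ϑ / 2 + p)) * weightedEnergyConst p cₐ Cₐ (2 * (ϑ / 2 + p)) with hc₁
  have hφm := h.aesm_weight hw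
  have hDm : AEStronglyMeasurable (fun z : ℝ × Space n => Dv z.1 z.2)
    (volume.restrict (Ioo t₁ t₂ ×ˢ U)) := h.sol.memLp_grad.1
  have hm1 : AEMeasurable (fun z : ℝ × Space n =>
      ENNReal.ofReal (φ (‖v z.1 z.2‖ ^ 2) ^ (σ / ϑ)))
      (volume.restrict (Ioo t₁ t₂ ×ˢ U)) := (hφm.aemeasurable.pow_const _).ennreal_ofReal
  have hm2 : AEMeasurable (fun z : ℝ × Space n =>
      ENNReal.ofReal (φ (‖v z.1 z.2‖ ^ 2) * ‖Dv z.1 z.2‖ ^ p))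
      (volume.restrict (Ioo t₁ t₂ ×ˢ U)) :=
    (hφm.aemeasurable.mul (hDm.norm.aemeasurable.pow_const _)).ennreal_ofReal
  have hgrad := h.lintegral_weight_grad_le hpq hp2 hUm hUf hc hC hK hw ht
  have hsec : ∀ᵐ t ∂(volume.restrict (Ioo t₁ t₂)),
      ∫⁻ x in U, ENNReal.ofReal (φ (‖v t x‖ ^ 2) ^ (σ / ϑ)) ≤
      truncSobolevConst N n p ϑ *
        (∫⁻ x in U, ENNReal.ofReal (φ (‖v t x‖ ^ 2) * ‖Dv t x‖ ^ p)) *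
        (ENNReal.ofReal c₁ * J) ^ (p / n) := by
    have hg := h.sol.memLp_grad
    rw [← hprod] at hg
    filter_upwards [h.sol.lateral, memLp_ae_section hp0 hg, ae_restrict_mem measurableSet_Ioo]
      with t h1 h2 h3
    refine (h1.lintegral_truncPow_le hp hpn hϑ hk hσ
      (h.sol.memLp_two t ⟨h3.1.le, h3.2.le⟩).1 h2).trans ?_
    gcongr
    exact h.lintegral_weight_sq_le hpq hp2 hUm hUf hc hC hK hw h3.1 h3.2.le
  rw [← hprod] at hm1 hm2 hgrad ⊢
  rw [lintegral_prod _ hm1]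
  rw [lintegral_prod _ hm2] at hgrad
  calc _ ≤ ∫⁻ t in Ioo t₁ t₂, truncSobolevConst N n p ϑ *
        (∫⁻ x in U, ENNReal.ofReal (φ (‖v t x‖ ^ 2) * ‖Dv t x‖ ^ p)) *
        (ENNReal.ofReal c₁ * J) ^ (p / n) := lintegral_mono_ae hsec
    _ = truncSobolevConst N n p ϑ *
        (∫⁻ t in Ioo t₁ t₂, ∫⁻ x in U, ENNReal.ofReal (φ (‖v t x‖ ^ 2) * ‖Dv t x‖ ^ p)) *
        (ENNReal.ofReal c₁ * J) ^ (p / n) := by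
        rw [lintegral_mul_const'', lintegral_const_mul' _ _ ENNReal.coe_ne_top]
        exact hm2.lintegral_prod_right'.const_mul _
    _ ≤ truncSobolevConst N n p ϑ *
        (ENNReal.ofReal (4 / cₐ * weightedEnergyConst p cₐ Cₐ (2 * (ϑ / 2 + p))) * J) *
        (ENNReal.ofReal c₁ * J) ^ (p / n) := by
        rw [hprod] at hgrad
        gcongr
    _ = _ := by
        rw [ENNReal.rpow_add_of_nonneg _ _ zero_le_one (by positivity), ENNReal.rpow_one,
          ENNReal.mul_rpow_of_nonneg _ _ (by positivity), parabolicConst, ENNReal.coe_mul,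
          ENNReal.coe_mul, ENNReal.coe_rpow_of_nonneg _ (by positivity)]
        simp only [ENNReal.ofReal, hc₁]
        ring

/-- The integrability exponents of the difference and of the data. -/
lemma exponent_identities {n p ϑ σ σ₁ : ℝ} (hn : 0 < n) (hp : 0 < p) (hϑ : 0 < ϑ)
    (hσ : σ = p + ϑ + p * (ϑ + 2) / n) (hσ₁ : σ₁ = p + n * ϑ / (n + ϑ + 2)) :
    0 < σ ∧ 0 < σ₁ ∧ ϑ / σ + p / σ₁ = 1 ∧ 1 - ϑ / σ * (1 + p / n) = p * (n + 2) / (n * σ) := by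
  have h1 : 0 < σ := by rw [hσ]; positivity
  have h2 : 0 < σ₁ := by rw [hσ₁]; positivity
  have h3 : σ * n = σ₁ * (n + ϑ + 2) := by
    rw [hσ, hσ₁]
    field_simp
    ring
  have h4 : σ * n = p * n + ϑ * n + p * (ϑ + 2) := by
    rw [hσ]
    field_simp
  refine ⟨h1, h2, ?_, ?_⟩
  · have h5 : σ₁ = σ * n / (n + ϑ + 2) := by
      rw [eq_div_iff (by positivity)]
      exact h3.symm
    rw [h5]
    field_simp
    linarith
  · field_simp
    linarith

/-- Higher integrability of the difference of two solutions in terms of the data. -/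
lemma IsComparison.lintegral_norm_rpow_le (h : IsComparison p q cₐ Cₐ t₁ t₂ U v Dv ξ F a b D)
    (hpq : p.HolderConjugate q) (hp2 : p < 2) (hn : 2 ≤ n) (hUm : MeasurableSet U)
    (hUf : volume U ≠ ⊤) (hc : 0 < cₐ) (hC : 0 ≤ Cₐ) (ht : t₁ < t₂) {ϑ σ σ₁ : ℝ} (hϑ : 0 < ϑ)
    (hσ : σ = p + ϑ + p * (ϑ + 2) / n) (hσ₁ : σ₁ = p + n * ϑ / (n + ϑ + 2)) :
    (∫⁻ z in Ioo t₁ t₂ ×ˢ U, ENNReal.ofReal (‖v z.1 z.2‖ ^ σ)) ^ (1 / σ) ≤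
      (parabolicConst N n p cₐ Cₐ ϑ : ℝ≥0∞) ^ (n / (p * (n + 2)) : ℝ) *
        (∫⁻ z in Ioo t₁ t₂ ×ˢ U, ENNReal.ofReal (sourceTerm Dv ξ F D z ^ σ₁))
          ^ ((n + p) / (σ₁ * (n + 2))) := by
  have hp := hpq.lt
  have hp0 : 0 < p := by linarith
  have hn0 : (0 : ℝ) < n := by exact_mod_cast (by omega : 0 < n)
  obtain ⟨hσ0, hσ₁0, hid1, hid2⟩ := exponent_identities hn0 hp0 hϑ hσ hσ₁
  set Y := ∫⁻ z in Ioo t₁ t₂ ×ˢ U, ENNReal.ofReal (sourceTerm Dv ξ F D z ^ σ₁) with hY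
  have hθ1 : ϑ / σ * (1 + p / n) < 1 := by
    have : 0 < p * (n + 2) / (n * σ) := by positivity
    linarith
  have hcyl : volume (Ioo t₁ t₂ ×ˢ U) ≠ ⊤ := by
    rw [Measure.volume_eq_prod, Measure.prod_prod]
    exact ENNReal.mul_ne_top (by simp) hUf
  -- the estimate for the truncated powers
  have htrunc : ∀ k : ℝ, 0 < k → (∫⁻ z in Ioo t₁ t₂ ×ˢ U,
      ENNReal.ofReal (truncPow (ϑ / 2) p k (‖v z.1 z.2‖ ^ 2) ^ (σ / ϑ))) ^ (1 / σ) ≤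
      (parabolicConst N n p cₐ Cₐ ϑ : ℝ≥0∞) ^ (n / (p * (n + 2)) : ℝ) *
        Y ^ ((n + p) / (σ₁ * (n + 2))) := by
    intro k hk
    have hw := isRadialWeight_truncPow (α := ϑ / 2) (β := p) (by positivity) hp0 (by linarith) hk
    have h1 := h.lintegral_truncPow_le hpq hp2 hn hUm hUf hc hC ht hϑ hk hσ
    have hφm := (h.aesm_weight hw).aemeasurable
    set φ := truncPow (ϑ / 2) p k with hφ
    have hφ0 : ∀ z : ℝ × Space n, 0 ≤ φ (‖v z.1 z.2‖ ^ 2) := fun z =>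
      truncPow_nonneg hk (sq_nonneg _)
    set X := ∫⁻ z in Ioo t₁ t₂ ×ˢ U, ENNReal.ofReal (φ (‖v z.1 z.2‖ ^ 2) ^ (σ / ϑ)) with hX
    -- Finiteness, which the absorption requires, holds because the truncated weight is bounded and
    -- the cylinder has finite volume. The bound depends on `k`, but the estimate obtained after
    -- absorption does not.
    have hXt : X ≠ ⊤ := by
      have h2 : X ≤ ∫⁻ _ in Ioo t₁ t₂ ×ˢ U, ENNReal.ofReal ((k ^ (ϑ / 2)) ^ (σ / ϑ)) := by
        refine lintegral_mono fun z => ENNReal.ofReal_le_ofReal ?_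
        exact Real.rpow_le_rpow (hφ0 z) (hw.le_bound _ (sq_nonneg _)) (by positivity)
      rw [setLIntegral_const] at h2
      exact (h2.trans_lt (ENNReal.mul_lt_top ENNReal.ofReal_lt_top hcyl.lt_top)).ne
    have hJ : ∫⁻ z in Ioo t₁ t₂ ×ˢ U, ENNReal.ofReal
        (φ (‖v z.1 z.2‖ ^ 2) * sourceTerm Dv ξ F D z ^ p) ≤ X ^ (ϑ / σ) * Y ^ (p / σ₁) := by
      refine le_trans (le_of_eq ?_) (ENNReal.lintegral_mul_norm_pow_le
        (hφm.pow_const (σ / ϑ)).ennreal_ofReal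
        (h.aesm_sourceTerm.aemeasurable.pow_const σ₁).ennreal_ofReal (by positivity)
        (by positivity) hid1)
      refine lintegral_congr fun z => ?_
      have h3 := h.sourceTerm_nonneg z
      have h4 := hφ0 z
      rw [ENNReal.ofReal_rpow_of_nonneg (by positivity) (by positivity),
        ENNReal.ofReal_rpow_of_nonneg (by positivity) (by positivity),
        ← ENNReal.ofReal_mul (by positivity), ← Real.rpow_mul h4, ← Real.rpow_mul h3]
      congr 2
      · rw [show σ / ϑ * (ϑ / σ) = 1 by field_simp, Real.rpow_one]
      · rw [mul_div_cancel₀ _ hσ₁0.ne']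
    have h2 : X ≤ parabolicConst N n p cₐ Cₐ ϑ * X ^ (ϑ / σ * (1 + p / n)) *
        Y ^ (p / σ₁ * (1 + p / n)) := by
      refine h1.trans ?_
      rw [mul_assoc, ENNReal.rpow_mul, ENNReal.rpow_mul,
        ← ENNReal.mul_rpow_of_nonneg _ _ (by positivity)]
      gcongr
    have h3 := ENNReal.rpow_le_of_le_mul_rpow (m := 1 / σ) hXt (by positivity) hθ1 (by positivity) h2
    refine h3.trans (le_of_eq ?_)
    have e1 : 1 / σ / (1 - ϑ / σ * (1 + p / n)) = n / (p * (n + 2)) := by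
      rw [hid2]
      field_simp
    rw [e1, ENNReal.mul_rpow_of_nonneg _ _ (by positivity), ← ENNReal.rpow_mul]
    congr 2
    field_simp
  -- passage to the limit
  have hlim : ∫⁻ z in Ioo t₁ t₂ ×ˢ U, ENNReal.ofReal (‖v z.1 z.2‖ ^ σ) ≤
      liminf (fun k : ℕ => ∫⁻ z in Ioo t₁ t₂ ×ˢ U,
        ENNReal.ofReal (truncPow (ϑ / 2) p (k + 1) (‖v z.1 z.2‖ ^ 2) ^ (σ / ϑ))) atTop := by
    refine le_trans (le_of_eq ?_) (lintegral_liminf_le' fun k => ?_)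
    · refine lintegral_congr fun z => ?_
      have h1 := tendsto_truncPow (α := ϑ / 2) (β := p) (by positivity) hp0 (sq_nonneg ‖v z.1 z.2‖)
      have h2 := ENNReal.tendsto_ofReal (h1.rpow_const (p := σ / ϑ) (Or.inr (by positivity)))
      rw [h2.liminf_eq]
      congr 1
      rw [← Real.rpow_natCast, ← Real.rpow_mul (norm_nonneg _), ← Real.rpow_mul (norm_nonneg _)]
      congr 1
      push_cast
      field_simp
    · have hw := isRadialWeight_truncPow (α := ϑ / 2) (β := p) (k := (k : ℝ) + 1) (by positivity)
        hp0 (by linarith) (by positivity)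
      exact ((h.aesm_weight hw).aemeasurable.pow_const _).ennreal_ofReal
  set B := (parabolicConst N n p cₐ Cₐ ϑ : ℝ≥0∞) ^ (n / (p * (n + 2)) : ℝ) *
        Y ^ ((n + p) / (σ₁ * (n + 2))) with hB
  have h5 : ∫⁻ z in Ioo t₁ t₂ ×ˢ U, ENNReal.ofReal (‖v z.1 z.2‖ ^ σ) ≤ B ^ σ := by
    refine hlim.trans (liminf_le_of_frequently_le' (Frequently.of_forall fun k => ?_))
    have := ENNReal.rpow_le_rpow (htrunc (k + 1) (by positivity)) hσ0.le
    rwa [← ENNReal.rpow_mul, one_div_mul_cancel hσ0.ne', ENNReal.rpow_one] at this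
  have h6 := ENNReal.rpow_le_rpow h5 (z := 1 / σ) (by positivity)
  rwa [← ENNReal.rpow_mul, mul_one_div_cancel hσ0.ne', ENNReal.rpow_one] at h6

end ParabolicSobolev

/-! ### Means in `L^r`: Hölder's inequality and interpolation -/

section LpMean

variable {α : Type*} [MeasurableSpace α]

/-- The `L^r` norm of a nonnegative function, for finite `r`. -/
def lpMean (ν : Measure α) (r : ℝ) (f : α → ℝ≥0∞) : ℝ≥0∞ := (∫⁻ z, f z ^ r ∂ν) ^ (1 / r)

variable {ν : Measure α} {f g x y d : α → ℝ≥0∞} {r s p σ₁ : ℝ}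

lemma lpMean_rpow (e : ℝ) :
    lpMean ν r f ^ e = (∫⁻ z, f z ^ r ∂ν) ^ (e / r) := by
  rw [lpMean, ← ENNReal.rpow_mul, one_div_mul_eq_div]

lemma lpMean_rpow_self (hr : 0 < r) : lpMean ν r f ^ r = ∫⁻ z, f z ^ r ∂ν := by
  rw [lpMean_rpow, div_self hr.ne', ENNReal.rpow_one]

lemma lpMean_add_le (hf : AEMeasurable f ν) (hg : AEMeasurable g ν) (hr : 1 ≤ r) :
    lpMean ν r (fun z => f z + g z) ≤ lpMean ν r f + lpMean ν r g :=
  ENNReal.lintegral_Lp_add_le hf hg hr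

lemma lpMean_mul_le {a b : ℝ} (hf : AEMeasurable f ν) (hg : AEMeasurable g ν) (hr : 0 < r)
    (ha : 0 < a) (hb : 0 < b) (h : r / a + r / b = 1) :
    lpMean ν r (fun z => f z * g z) ≤ lpMean ν a f * lpMean ν b g := by
  have h1 := ENNReal.lintegral_mul_norm_pow_le (hf.pow_const a) (hg.pow_const b)
    (p := r / a) (q := r / b) (by positivity) (by positivity) h
  have h2 := ENNReal.rpow_le_rpow h1 (z := 1 / r) (by positivity)
  rw [ENNReal.mul_rpow_of_nonneg _ _ (by positivity), ← ENNReal.rpow_mul, ← ENNReal.rpow_mul] at h2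
  refine le_trans (le_of_eq ?_) (h2.trans (le_of_eq ?_))
  · rw [lpMean]
    congr 1
    refine lintegral_congr fun z => ?_
    rw [← ENNReal.rpow_mul, ← ENNReal.rpow_mul, mul_div_cancel₀ _ ha.ne', mul_div_cancel₀ _ hb.ne',
      ENNReal.mul_rpow_of_nonneg _ _ hr.le]
  · rw [lpMean, lpMean]
    congr 2 <;> field_simp

lemma lpMean_mono_exponent [IsProbabilityMeasure ν] (hf : AEMeasurable f ν) (hr : 0 < r)
    (hrs : r ≤ s) : lpMean ν r f ≤ lpMean ν s f := by
  have hs : 0 < s := hr.trans_le hrs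
  have h1 := ENNReal.lintegral_mul_norm_pow_le (hf.pow_const s) (aemeasurable_const (b := (1 : ℝ≥0∞)))
    (μ := ν) (p := r / s) (q := 1 - r / s) (by positivity)
    (by rw [sub_nonneg, div_le_one hs]; exact hrs) (by ring)
  simp only [ENNReal.one_rpow, mul_one, lintegral_const, measure_univ] at h1
  have h2 := ENNReal.rpow_le_rpow h1 (z := 1 / r) (by positivity)
  rw [← ENNReal.rpow_mul] at h2
  refine le_trans (le_of_eq ?_) (h2.trans (le_of_eq ?_))
  · rw [lpMean]
    congr 1
    refine lintegral_congr fun z => ?_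
    rw [← ENNReal.rpow_mul, mul_div_cancel₀ _ hs.ne']
  · rw [lpMean]
    congr 1
    field_simp

/-- Write `σ₁` as a combination of `p` and `s`, and estimate the minimum by `g` in one part and by
`x` in the other. Thus smallness of `g` in `L^p` passes to `L^{σ₁}` with integrability above `σ₁`
assumed only for `x`. -/
lemma lpMean_min_le (hg : AEMeasurable g ν) (hx : AEMeasurable x ν) (hp : 0 < p) (h1 : p < σ₁)
    (h2 : σ₁ < s) : lpMean ν σ₁ (fun z => min (g z) (x z)) ≤
      lpMean ν p g ^ (p * (s - σ₁) / (σ₁ * (s - p))) *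
        lpMean ν s x ^ (1 - p * (s - σ₁) / (σ₁ * (s - p))) := by
  have hs : 0 < s := by linarith
  have hσ : 0 < σ₁ := by linarith
  have hsp : 0 < s - p := by linarith
  have hsσ : 0 < s - σ₁ := by linarith
  have hσp : 0 < σ₁ - p := by linarith
  have e0 : (s - σ₁) / (s - p) + (σ₁ - p) / (s - p) = 1 := by field_simp; ring
  have h3 := ENNReal.lintegral_mul_norm_pow_le (hg.pow_const p) (hx.pow_const s)
    (p := (s - σ₁) / (s - p)) (q := (σ₁ - p) / (s - p)) (by positivity) (by positivity) e0
  have e1 : 1 - p * (s - σ₁) / (σ₁ * (s - p)) = s * (σ₁ - p) / (σ₁ * (s - p)) := by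
    field_simp
    ring
  have h4 : ∫⁻ z, min (g z) (x z) ^ σ₁ ∂ν ≤
      ∫⁻ z, (g z ^ p) ^ ((s - σ₁) / (s - p)) * (x z ^ s) ^ ((σ₁ - p) / (s - p)) ∂ν := by
    refine lintegral_mono fun z => ?_
    have e2 : σ₁ = p * ((s - σ₁) / (s - p)) + s * ((σ₁ - p) / (s - p)) := by
      field_simp
      ring
    simp only
    rw [← ENNReal.rpow_mul, ← ENNReal.rpow_mul]
    nth_rewrite 1 [e2]
    rw [ENNReal.rpow_add_of_nonneg _ _ (by positivity) (by positivity)]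
    gcongr
    · exact min_le_left _ _
    · exact min_le_right _ _
  have h5 := ENNReal.rpow_le_rpow (h4.trans h3) (z := 1 / σ₁) (by positivity)
  rw [ENNReal.mul_rpow_of_nonneg _ _ (by positivity), ← ENNReal.rpow_mul, ← ENNReal.rpow_mul] at h5
  rw [e1, lpMean_rpow, lpMean_rpow]
  refine h5.trans (le_of_eq ?_)
  congr 2 <;> field_simp

/-- The first comparison estimate, abstractly. -/
lemma lpMean_le_of_energy [IsProbabilityMeasure ν] (hx : AEMeasurable x ν)
    (hd : AEMeasurable d ν) (hp : 1 < p) (hpσ : p < σ₁) {e A J δ : ℝ}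
    (he : 0 ≤ e) (hA : 0 ≤ A) (hJ : 0 ≤ J) (hδ : 0 ≤ δ)
    (hen : ∫⁻ z, g z ^ p ∂ν ≤ ENNReal.ofReal e * ∫⁻ z, x z ^ p ∂ν +
      ENNReal.ofReal A * (∫⁻ z, (d z * x z) ^ p ∂ν + ∫⁻ z, y z ^ p ∂ν))
    (hdJ : lpMean ν (p * σ₁ / (σ₁ - p)) d ≤ ENNReal.ofReal (J * δ)) :
    lpMean ν p g ≤ ENNReal.ofReal (e ^ (1 / p) + A ^ (1 / p) * (J * δ)) * lpMean ν σ₁ x +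
      ENNReal.ofReal (A ^ (1 / p)) * lpMean ν p y := by
  have hp0 : 0 < p := by linarith
  have hσ : 0 < σ₁ := by linarith
  have hσp : 0 < σ₁ - p := by linarith
  have hp1 : 1 / p ≤ 1 := by rw [div_le_one hp0]; exact hp.le
  have hip : 0 ≤ 1 / p := by positivity
  have h1 := ENNReal.rpow_le_rpow hen hip
  have h2 : lpMean ν p (fun z => d z * x z) ≤ ENNReal.ofReal (J * δ) * lpMean ν σ₁ x := by
    refine (lpMean_mul_le hd hx hp0 (a := p * σ₁ / (σ₁ - p)) (by positivity) hσ ?_).trans ?_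
    · field_simp
      ring
    · gcongr
  calc lpMean ν p g ≤ _ := h1
    _ ≤ (ENNReal.ofReal e * ∫⁻ z, x z ^ p ∂ν) ^ (1 / p) + (ENNReal.ofReal A *
        (∫⁻ z, (d z * x z) ^ p ∂ν + ∫⁻ z, y z ^ p ∂ν)) ^ (1 / p) :=
        ENNReal.rpow_add_le_add_rpow _ _ hip hp1
    _ = ENNReal.ofReal (e ^ (1 / p)) * lpMean ν p x + ENNReal.ofReal (A ^ (1 / p)) *
        (∫⁻ z, (d z * x z) ^ p ∂ν + ∫⁻ z, y z ^ p ∂ν) ^ (1 / p) := by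
        rw [ENNReal.mul_rpow_of_nonneg _ _ hip, ENNReal.mul_rpow_of_nonneg _ _ hip,
          ENNReal.ofReal_rpow_of_nonneg he hip, ENNReal.ofReal_rpow_of_nonneg hA hip, lpMean]
    _ ≤ ENNReal.ofReal (e ^ (1 / p)) * lpMean ν σ₁ x + ENNReal.ofReal (A ^ (1 / p)) *
        (ENNReal.ofReal (J * δ) * lpMean ν σ₁ x + lpMean ν p y) := by
        gcongr
        · exact lpMean_mono_exponent hx hp0 hpσ.le
        · refine (ENNReal.rpow_add_le_add_rpow _ _ hip hp1).trans ?_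
          exact add_le_add h2 le_rfl
    _ = _ := by
        rw [ENNReal.ofReal_add (by positivity) (by positivity),
          ENNReal.ofReal_mul (p := A ^ (1 / p)) (by positivity)]
        ring

/-- An interpolation term is split into a small multiple of one factor and a large multiple of the
datum. -/
lemma rpow_mul_rpow_le_add {P X Y : ℝ≥0∞} {c K γ : ℝ} (hc : 0 < c) (hK : 0 < K) (hγ : 0 ≤ γ)
    (hγ1 : γ ≤ 1) (h : P ≤ ENNReal.ofReal c * X + ENNReal.ofReal K * Y) :
    P ^ γ * X ^ (1 - γ) ≤ ENNReal.ofReal ((2 * c) ^ γ) * X +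
      ENNReal.ofReal ((2 * K) ^ γ * (K / c) ^ (1 - γ)) * Y := by
  have h1γ : 0 ≤ 1 - γ := by linarith
  have e : ∀ Z : ℝ≥0∞, Z ^ γ * Z ^ (1 - γ) = Z := fun Z => by
    rw [← ENNReal.rpow_add_of_nonneg _ _ hγ h1γ, add_sub_cancel, ENNReal.rpow_one]
  have e2 : ∀ {b : ℝ}, 0 ≤ b → ∀ Z : ℝ≥0∞, ENNReal.ofReal b * Z + ENNReal.ofReal b * Z =
      ENNReal.ofReal (2 * b) * Z := fun {b} hb Z => by
    rw [← two_mul, ENNReal.ofReal_mul zero_le_two, ENNReal.ofReal_ofNat, mul_assoc]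
  -- Either `P ≤ 2cX` and the product is a small multiple of `X`, or `X ≤ (K/c)Y` and `P ≤ 2KY`, so
  -- that the datum dominates.
  rcases le_total (ENNReal.ofReal K * Y) (ENNReal.ofReal c * X) with hle | hle
  · refine le_trans ?_ le_self_add
    calc P ^ γ * X ^ (1 - γ) ≤ (ENNReal.ofReal (2 * c) * X) ^ γ * X ^ (1 - γ) := by
          gcongr
          rw [← e2 hc.le]
          exact h.trans (by gcongr)
      _ = _ := by
          rw [ENNReal.mul_rpow_of_nonneg _ _ hγ, mul_assoc, e,
            ENNReal.ofReal_rpow_of_nonneg (by positivity) hγ]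
  · refine le_trans ?_ le_add_self
    have hX : X ≤ ENNReal.ofReal (K / c) * Y := by
      have h1 : ENNReal.ofReal c⁻¹ * (ENNReal.ofReal c * X) = X := by
        rw [← mul_assoc, ← ENNReal.ofReal_mul (by positivity), inv_mul_cancel₀ hc.ne',
          ENNReal.ofReal_one, one_mul]
      rw [← h1, div_eq_inv_mul, ENNReal.ofReal_mul (by positivity), mul_assoc]
      gcongr
    calc P ^ γ * X ^ (1 - γ) ≤ (ENNReal.ofReal (2 * K) * Y) ^ γ *
          (ENNReal.ofReal (K / c) * Y) ^ (1 - γ) := by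
          gcongr
          rw [← e2 hK.le]
          exact h.trans (by gcongr)
      _ = ENNReal.ofReal ((2 * K) ^ γ) * ENNReal.ofReal ((K / c) ^ (1 - γ)) *
          (Y ^ γ * Y ^ (1 - γ)) := by
          rw [ENNReal.mul_rpow_of_nonneg _ _ hγ, ENNReal.mul_rpow_of_nonneg _ _ h1γ,
            ENNReal.ofReal_rpow_of_nonneg (by positivity) hγ,
            ENNReal.ofReal_rpow_of_nonneg (by positivity) h1γ]
          ring
      _ = _ := by rw [e, ENNReal.ofReal_mul (by positivity)]

/-- Interpolation for a bounded function that is small in a weaker norm. -/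
lemma lpMean_le_of_le {L : ℝ} (hL : 1 ≤ L) (hr : 0 < r) (hrs : r ≤ s)
    (hs1 : 1 ≤ s) {E δ : ℝ} (hE : 1 ≤ E)
    (hδ : 0 ≤ δ) (hfL : ∀ᵐ z ∂ν, f z ≤ ENNReal.ofReal L)
    (hf : ∫⁻ z, f z ^ r ∂ν ≤ ENNReal.ofReal (E * δ)) :
    lpMean ν s f ≤ ENNReal.ofReal (L * E * δ ^ (1 / s)) := by
  have hs : 0 < s := hr.trans_le hrs
  have h1 : ∫⁻ z, f z ^ s ∂ν ≤ ENNReal.ofReal (L ^ (s - r)) * ENNReal.ofReal (E * δ) := by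
    refine le_trans ?_ (mul_le_mul_right hf _)
    rw [← lintegral_const_mul' _ _ ENNReal.ofReal_ne_top]
    refine lintegral_mono_ae ?_
    filter_upwards [hfL] with z hz
    have e : s = (s - r) + r := by ring
    nth_rewrite 1 [e]
    rw [ENNReal.rpow_add_of_nonneg _ _ (by linarith) hr.le,
      ← ENNReal.ofReal_rpow_of_nonneg (by linarith) (by linarith)]
    have := ENNReal.rpow_le_rpow hz (z := s - r) (by linarith)
    gcongr
  refine (ENNReal.rpow_le_rpow h1 (z := 1 / s) (by positivity)).trans ?_
  rw [← ENNReal.ofReal_mul (by positivity), ENNReal.ofReal_rpow_of_nonneg (by positivity)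
    (by positivity), Real.mul_rpow (by positivity) (by positivity),
    Real.mul_rpow (by positivity) hδ, ← Real.rpow_mul (by positivity), ← mul_assoc]
  refine ENNReal.ofReal_le_ofReal ?_
  -- Here and for `E` the exponent is at most one, so the constant does not depend on `s`. This
  -- matters because the estimate is used with an exponent that tends to infinity as `κ₀` tends to
  -- zero.
  have h2 : L ^ ((s - r) * (1 / s)) ≤ L := by
    refine (Real.rpow_le_rpow_of_exponent_le hL ?_).trans (Real.rpow_one L).le
    rw [mul_one_div, div_le_one hs]
    linarith
  have h3 : E ^ (1 / s) ≤ E := by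
    refine (Real.rpow_le_rpow_of_exponent_le hE ?_).trans (Real.rpow_one E).le
    rw [div_le_one hs]
    exact hs1
  gcongr

end LpMean

/-! ### The coefficient, its oscillation and the comparison problem -/

section Setting

variable {N n : ℕ} {p q : ℝ} {Ω : Set (Space n)} {T : ℝ} {a : ℝ → Space n → ℝ}

/-- A bound on the seminorm controls the mean oscillations over balls. -/
lemma lintegral_osc_le_of_bmoSeminorm_le (hΩ : IsOpen Ω) {ρ δ : ℝ}
    (h : bmoSeminorm T Ω a ρ ≤ ENNReal.ofReal δ) {t : ℝ} (ht : t ∈ Icc 0 T) {z : Space n}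
    (hz : z ∈ Ω) {r : ℝ} (hr : r ∈ Ioc 0 ρ) :
    ∫⁻ y in ball z r ∩ Ω, ‖a t y - ballMean (a t) Ω z r‖ₑ ≤
      ENNReal.ofReal δ * volume (ball z r) := by
  simp only [bmoSeminorm, iSup_le_iff] at h
  have h1 := h t ht z hz r hr
  rw [setLAverage_eq] at h1
  have hpos : volume (ball z r ∩ Ω) ≠ 0 :=
    ((isOpen_ball.inter hΩ).measure_pos _ ⟨z, mem_ball_self hr.1, hz⟩).ne'
  have hfin : volume (ball z r ∩ Ω) ≠ ⊤ :=
    ((measure_mono inter_subset_left).trans_lt measure_ball_lt_top).ne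
  rw [ENNReal.div_le_iff hpos hfin] at h1
  refine h1.trans ?_
  gcongr
  exact inter_subset_left

/-- The power of the distance of `a` to its spatial mean over `B`, at nonnegative times. -/
def coeffDist (p : ℝ) (a : ℝ → Space n → ℝ) (B : Set (Space n)) (z : ℝ × Space n) : ℝ :=
  if z.1 < 0 then 0 else |a z.1 z.2 - ⨍ y in B, a z.1 y| ^ (1 / (p - 1))

variable {B : Set (Space n)}

lemma coeffDist_nonneg (z : ℝ × Space n) : 0 ≤ coeffDist p a B z := by
  unfold coeffDist
  split_ifs
  · exact le_rfl
  · positivity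

lemma measurable_spatialMean (ha : Measurable (Function.uncurry a)) :
    Measurable fun t => ⨍ y in B, a t y := by
  simp only [setAverage_eq, smul_eq_mul]
  have h : StronglyMeasurable fun t => ∫ y in B, a t y :=
    ha.stronglyMeasurable.integral_prod_right
  exact h.measurable.const_mul _

lemma measurable_coeffDist (ha : Measurable (Function.uncurry a)) :
    Measurable (coeffDist p a B) := by
  refine Measurable.ite (measurableSet_lt measurable_fst measurable_const) measurable_const ?_
  have h1 : Measurable fun z : ℝ × Space n => a z.1 z.2 := ha
  exact (h1.sub ((measurable_spatialMean ha).comp measurable_fst)).abs.pow_const _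

lemma spatialMean_mem {cₐ Cₐ t : ℝ} (ha : Measurable (Function.uncurry a)) (hBm : MeasurableSet B)
    (hB0 : volume B ≠ 0) (hBf : volume B ≠ ⊤) (h : ∀ x ∈ B, cₐ ≤ a t x ∧ a t x ≤ Cₐ) :
    cₐ ≤ ⨍ y in B, a t y ∧ ⨍ y in B, a t y ≤ Cₐ := by
  have hm : Measurable (a t) := ha.comp measurable_prodMk_left
  have hi : IntegrableOn (a t) B := by
    refine Measure.integrableOn_of_bounded (M := max |cₐ| |Cₐ|) hBf hm.aestronglyMeasurable ?_
    refine (ae_restrict_iff' hBm).2 (Eventually.of_forall fun x hx => ?_)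
    rw [Real.norm_eq_abs]
    exact abs_le_max_abs_abs (h x hx).1 (h x hx).2
  have hV : 0 < volume.real B := ENNReal.toReal_pos hB0 hBf
  have hc : ∀ c : ℝ, IntegrableOn (fun _ : Space n => c) B := fun c => integrableOn_const hBf
  rw [setAverage_eq, smul_eq_mul]
  constructor
  · rw [le_inv_mul_iff₀ hV]
    have := setIntegral_mono_on (hc cₐ) hi hBm fun x hx => (h x hx).1
    rwa [setIntegral_const, smul_eq_mul] at this
  · rw [inv_mul_le_iff₀ hV]
    have := setIntegral_mono_on hi (hc Cₐ) hBm fun x hx => (h x hx).2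
    rwa [setIntegral_const, smul_eq_mul] at this

/-- The John--Nirenberg inequality on a cylinder. -/
lemma lintegral_coeffDist_rpow_le (hp : 1 < p) (hΩ : IsOpen Ω)
    (ha : Measurable (Function.uncurry a)) {C : ℝ} (haC : ∀ t ≤ T, ∀ x ∈ Ω, |a t x| ≤ C)
    {x₀ : Space n} {ρ δ t₁ t₀ : ℝ} (hρ : 0 < ρ) (hδ : 0 < δ) (hB : ball x₀ ρ ⊆ Ω) (ht₀ : t₀ ≤ T)
    (h : bmoSeminorm T Ω a ρ ≤ ENNReal.ofReal δ) {r : ℝ} (hr : 0 < r) :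
    ∫⁻ z in Ioo t₁ t₀ ×ˢ ball x₀ ρ, ENNReal.ofReal (coeffDist p a (ball x₀ ρ) z ^ r) ≤
      ENNReal.ofReal (jnConst n (r / (p - 1)) * δ ^ (r / (p - 1))) *
        volume (Ioo t₁ t₀ ×ˢ ball x₀ ρ) := by
  have hp1 : 0 < p - 1 := by linarith
  have hQ : 0 < r / (p - 1) := by positivity
  have hm : Measurable fun z => ENNReal.ofReal (coeffDist p a (ball x₀ ρ) z ^ r) :=
    ((measurable_coeffDist ha).pow_const r).ennreal_ofReal
  rw [Measure.volume_eq_prod, ← Measure.prod_restrict, lintegral_prod _ hm.aemeasurable,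
    Measure.prod_prod]
  have hsec : ∀ t ∈ Ioo t₁ t₀, ∫⁻ x in ball x₀ ρ,
      ENNReal.ofReal (coeffDist p a (ball x₀ ρ) (t, x) ^ r) ≤
      ENNReal.ofReal (jnConst n (r / (p - 1)) * δ ^ (r / (p - 1))) * volume (ball x₀ ρ) := by
    intro t ht
    rcases lt_or_ge t 0 with h0 | h0
    · have : ∀ x : Space n, coeffDist p a (ball x₀ ρ) (t, x) = 0 := fun x => if_pos h0
      simp [this, Real.zero_rpow hr.ne']
    · have htT : t ∈ Icc 0 T := ⟨h0, ht.2.le.trans ht₀⟩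
      have hmt : Measurable (a t) := ha.comp measurable_prodMk_left
      refine le_trans (le_of_eq ?_) (lintegral_oscillation_rpow_le hΩ hmt (haC t htT.2) hB hρ hδ
        (fun z hz r hr => lintegral_osc_le_of_bmoSeminorm_le hΩ h htT (hB hz) hr) hQ)
      refine lintegral_congr fun x => ?_
      have : coeffDist p a (ball x₀ ρ) (t, x) =
        |a t x - ⨍ y in ball x₀ ρ, a t y| ^ (1 / (p - 1)) := if_neg (not_lt.2 h0)
      rw [this, ← Real.rpow_mul (abs_nonneg _), one_div_mul_eq_div]
  refine (setLIntegral_mono' measurableSet_Ioo hsec).trans (le_of_eq ?_)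
  rw [setLIntegral_const]
  ring

/-- The difference of the two solutions of the comparison problem. -/
lemma isComparison_of_isDirichletSolution (hpq : p.HolderConjugate q) {cₐ Cₐ : ℝ} (hc : 0 < cₐ)
    (hΩ : IsOpen Ω) (hΩb : Bornology.IsBounded Ω) (ha : Measurable (Function.uncurry a))
    (hab : ∀ t ≤ T, ∀ x ∈ Ω, cₐ ≤ a t x ∧ a t x ≤ Cₐ) {F : ℝ → Space n → Mat N n}
    (hF : MemLp (Function.uncurry F) (ENNReal.ofReal p) (volume.restrict (Ioo 0 T ×ˢ Ω)))
    {u : ℝ → Space n → Vec N} {Du : ℝ → Space n → Mat N n}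
    (hu : IsDirichletSolution p 0 T Ω a F 0 0 u Du)
    (hneg : ∀ t < 0, u t = 0 ∧ Du t = 0 ∧ F t = 0) {x₀ : Space n} {ρ t₁ t₀ : ℝ} (hρ : 0 < ρ)
    (hB : ball x₀ ρ ⊆ Ω) (h0t : 0 ≤ t₀) (ht₀ : t₀ ≤ T)
    {w : ℝ → Space n → Vec N} {Dw : ℝ → Space n → Mat N n}
    (hw : IsDirichletSolution p t₁ t₀ (ball x₀ ρ) (fun t _ => ⨍ y in ball x₀ ρ, a t y) 0 u Du w Dw) :
    IsComparison p q cₐ Cₐ t₁ t₀ (ball x₀ ρ) (fun t x => u t x - w t x)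
      (fun t x => Du t x - Dw t x) (Function.uncurry Du) (Function.uncurry F) (Function.uncurry a)
      (fun z => ⨍ y in ball x₀ ρ, a z.1 y) (coeffDist p a (ball x₀ ρ)) := by
  have hp := hpq.lt
  have hp1 : 0 < p - 1 := by linarith
  have hmean : ∀ t ≤ T, cₐ ≤ ⨍ y in ball x₀ ρ, a t y ∧ ⨍ y in ball x₀ ρ, a t y ≤ Cₐ := fun t ht =>
    spatialMean_mem ha measurableSet_ball (measure_ball_pos _ _ hρ).ne' measure_ball_lt_top.ne
      fun x hx => hab t ht x (hB hx)
  have habs : ∀ {c : ℝ}, cₐ ≤ c ∧ c ≤ Cₐ → |c| ≤ Cₐ := fun {c} h => by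
    rw [abs_of_pos (hc.trans_le h.1)]
    exact h.2
  have hbm : Measurable (Function.uncurry fun (t : ℝ) (_ : Space n) => ⨍ y in ball x₀ ρ, a t y) :=
    (measurable_spatialMean ha).comp measurable_fst
  have hsol := hu.sub_isZeroDataSolution hpq hΩ.measurableSet hΩb.measure_lt_top.ne
    measurableSet_ball hB h0t ht₀ ha (fun t ht x hx => habs (hab t ht x hx)) hbm
    (fun t ht x _ => habs (hmean t ht)) hF hneg hw
  have hsub : ∀ {E : Type} [NormedAddCommGroup E] {f : ℝ × Space n → E} {r : ℝ≥0∞},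
      MemLp f r (volume.restrict (Ioo 0 T ×ˢ Ω)) → (∀ t < 0, ∀ x, f (t, x) = 0) →
      MemLp f r (volume.restrict (Ioo t₁ t₀ ×ˢ ball x₀ ρ)) := fun hf hf0 =>
    memLp_of_eq_zero_of_neg hΩ.measurableSet measurableSet_ball hB ht₀ hf hf0
  refine ⟨?_, ?_, ?_, (measurable_coeffDist ha).aestronglyMeasurable, ?_, coeffDist_nonneg, ?_⟩
  · convert hsol using 2
    simp [Function.uncurry]
  · exact (hsub hu.memLp_grad fun t ht x => by
      simp [Function.uncurry, (hneg t ht).2.1]).1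
  · exact (hsub hF fun t ht x => by simp [Function.uncurry, (hneg t ht).2.2]).1
  · intro z hz
    exact hmean z.1 (hz.1.2.le.trans ht₀)
  · intro z _
    have h0 := coeffDist_nonneg (p := p) (a := a) (B := ball x₀ ρ) z
    -- The seminorm says nothing about negative times, but there `∇u = 0`, so the distance may be
    -- set to zero.
    by_cases hz : z.1 < 0
    · have : Function.uncurry Du z = 0 := by
        simp [Function.uncurry, (hneg z.1 hz).2.1]
      rw [this, norm_zero, mul_zero, Real.zero_rpow hp1.ne', mul_zero]
    · rw [Real.mul_rpow h0 (norm_nonneg _), coeffDist, if_neg hz, ← Real.rpow_mul (abs_nonneg _),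
        one_div_mul_cancel hp1.ne', Real.rpow_one]
      exact le_rfl

end Setting

/-! ### The estimates in terms of mean values -/

section Averages

variable {N n : ℕ} {p q cₐ Cₐ t₁ t₂ : ℝ} {U : Set (Space n)} {v : ℝ → Space n → Vec N}
  {Dv : ℝ → Space n → Mat N n} {ξ F : ℝ × Space n → Mat N n} {a b D : ℝ × Space n → ℝ}

/-- The normalized restriction of the Lebesgue measure, whose integral is the mean value. -/
def meanMeasure {α : Type*} [MeasureSpace α] (Q : Set α) : Measure α :=
  (volume.restrict Q univ)⁻¹ • volume.restrict Q

lemma lintegral_meanMeasure {α : Type*} [MeasureSpace α] (Q : Set α) (f : α → ℝ≥0∞) :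
    ∫⁻ z, f z ∂(meanMeasure Q) = (volume Q)⁻¹ * ∫⁻ z in Q, f z := by
  rw [meanMeasure, lintegral_smul_measure, Measure.restrict_apply_univ, smul_eq_mul]

lemma isProbabilityMeasure_meanMeasure {α : Type*} [MeasureSpace α] {Q : Set α}
    (h0 : volume Q ≠ 0) (h1 : volume Q ≠ ⊤) : IsProbabilityMeasure (meanMeasure Q) := by
  refine ⟨?_⟩
  rw [meanMeasure, Measure.smul_apply, Measure.restrict_apply_univ, smul_eq_mul,
    ENNReal.inv_mul_cancel h0 h1]

lemma meanMeasure_absolutelyContinuous {α : Type*} [MeasureSpace α] (Q : Set α) :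
    meanMeasure Q ≪ volume.restrict Q := Measure.smul_absolutelyContinuous

lemma volume_Ioo_prod (t₁ t₂ : ℝ) (U : Set (Space n)) :
    volume (Ioo t₁ t₂ ×ˢ U) = ENNReal.ofReal (t₂ - t₁) * volume U := by
  rw [Measure.volume_eq_prod, Measure.prod_prod, Real.volume_Ioo]

lemma enorm_smul_rpow {E : Type*} [NormedAddCommGroup E] [NormedSpace ℝ E] {lam r : ℝ}
    (hlam : 0 < lam) (hr : 0 ≤ r) (x : E) :
    ‖lam • x‖ₑ ^ r = ENNReal.ofReal (lam ^ r) * ENNReal.ofReal (‖x‖ ^ r) := by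
  rw [← ENNReal.ofReal_mul (by positivity), ← Real.mul_rpow hlam.le (norm_nonneg _), ← ofReal_norm,
    norm_smul, Real.norm_of_nonneg hlam.le, ENNReal.ofReal_rpow_of_nonneg (by positivity) hr]

/-- The energy estimate for the difference, in terms of mean values. -/
lemma IsComparison.mean_grad_le (h : IsComparison p q cₐ Cₐ t₁ t₂ U v Dv ξ F a b D)
    (hpq : p.HolderConjugate q) (hp2 : p < 2) (hUm : MeasurableSet U) (hUf : volume U ≠ ⊤)
    (hc : 0 < cₐ) (ht : t₁ < t₂) {ε lam : ℝ} (hε : 0 < ε) (hε1 : ε ≤ 1) (hlam : 0 < lam) :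
    ∫⁻ z, ‖lam • Dv z.1 z.2‖ₑ ^ p ∂(meanMeasure (Ioo t₁ t₂ ×ˢ U)) ≤
      ENNReal.ofReal (2 * ε) * ∫⁻ z, ‖lam • ξ z‖ₑ ^ p ∂(meanMeasure (Ioo t₁ t₂ ×ˢ U)) +
      ENNReal.ofReal (6 / (cₐ * (p - 1) * ε) * (12 / (cₐ * (p - 1) * ε)) ^ (1 / (p - 1))) *
        (∫⁻ z, (ENNReal.ofReal (D z) * ‖lam • ξ z‖ₑ) ^ p ∂(meanMeasure (Ioo t₁ t₂ ×ˢ U)) +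
          ∫⁻ z, ‖lam • F z‖ₑ ^ p ∂(meanMeasure (Ioo t₁ t₂ ×ˢ U))) := by
  have hp := hpq.lt
  have hp0 : 0 < p := by linarith
  have hp1 : 0 < p - 1 := by linarith
  have hA : 0 ≤ 6 / (cₐ * (p - 1) * ε) * (12 / (cₐ * (p - 1) * ε)) ^ (1 / (p - 1)) := by positivity
  have h1 := h.lintegral_grad_le hpq hp2 hUm hUf hc ht hε hε1
  set A := 6 / (cₐ * (p - 1) * ε) * (12 / (cₐ * (p - 1) * ε)) ^ (1 / (p - 1))
  have e1 : ∀ z, ENNReal.ofReal (2 * ε * ‖ξ z‖ ^ p + A * ((D z * ‖ξ z‖) ^ p + ‖F z‖ ^ p)) =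
      ENNReal.ofReal (2 * ε) * ENNReal.ofReal (‖ξ z‖ ^ p) + ENNReal.ofReal A *
        (ENNReal.ofReal ((D z * ‖ξ z‖) ^ p) + ENNReal.ofReal (‖F z‖ ^ p)) := fun z => by
    have hD := h.dist_nonneg z
    rw [ENNReal.ofReal_add (by positivity) (by positivity), ENNReal.ofReal_mul (by positivity),
      ENNReal.ofReal_mul hA, ENNReal.ofReal_add (by positivity) (by positivity)]
  have m1 : AEMeasurable (fun z => ENNReal.ofReal (‖ξ z‖ ^ p))
    (volume.restrict (Ioo t₁ t₂ ×ˢ U)) := (h.aesm_grad.norm.aemeasurable.pow_const p).ennreal_ofReal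
  have m2 : AEMeasurable (fun z => ENNReal.ofReal ((D z * ‖ξ z‖) ^ p))
    (volume.restrict (Ioo t₁ t₂ ×ˢ U)) :=
    ((h.aesm_dist.mul h.aesm_grad.norm).aemeasurable.pow_const p).ennreal_ofReal
  simp only [e1] at h1
  rw [lintegral_add_left' (m1.const_mul _), lintegral_const_mul' _ _ ENNReal.ofReal_ne_top,
    lintegral_const_mul' _ _ ENNReal.ofReal_ne_top, lintegral_add_left' m2] at h1
  have e2 : ∀ z, (ENNReal.ofReal (D z) * ‖lam • ξ z‖ₑ) ^ p =
      ENNReal.ofReal (lam ^ p) * ENNReal.ofReal ((D z * ‖ξ z‖) ^ p) := fun z => by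
    have hD := h.dist_nonneg z
    rw [ENNReal.mul_rpow_of_nonneg _ _ hp0.le, enorm_smul_rpow hlam hp0.le,
      ENNReal.ofReal_rpow_of_nonneg hD hp0.le, Real.mul_rpow hD (norm_nonneg _),
      ENNReal.ofReal_mul (by positivity)]
    ring
  simp only [e2, enorm_smul_rpow hlam hp0.le]
  simp only [lintegral_meanMeasure, lintegral_const_mul' _ _ ENNReal.ofReal_ne_top]
  refine (mul_le_mul_right (mul_le_mul_right h1 _) _).trans (le_of_eq ?_)
  ring

/-- Higher integrability of the difference, in terms of mean values. -/
lemma IsComparison.mean_norm_le (h : IsComparison p q cₐ Cₐ t₁ t₂ U v Dv ξ F a b D)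
    (hpq : p.HolderConjugate q) (hp2 : p < 2) (hn : 2 ≤ n) (hUm : MeasurableSet U)
    (hUf : volume U ≠ ⊤) (hU0 : volume U ≠ 0)
    (hc : 0 < cₐ) (hC : 0 ≤ Cₐ) (ht : t₁ < t₂) {ϑ σ σ₁ : ℝ} (hϑ : 0 < ϑ)
    (hσ : σ = p + ϑ + p * (ϑ + 2) / n) (hσ₁ : σ₁ = p + n * ϑ / (n + ϑ + 2)) (hσ2 : 2 ≤ σ)
    {lam c V : ℝ} (hlam : 0 < lam) (hc0 : 0 < c) (hV0 : 0 < V)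
    (hV : volume (Ioo t₁ t₂ ×ˢ U) = ENNReal.ofReal V) :
    (⨍⁻ t in Ioo t₁ t₂, (⨍⁻ x in U, ‖c • v t x‖ₑ ^ σ ∂volume) ^ (2 / σ) ∂volume) ^ (1 / 2 : ℝ) ≤
      ENNReal.ofReal (c * V ^ (1 / (n + 2) : ℝ) * lam ^ (-((n + p) / (n + 2) : ℝ))) *
      (parabolicConst N n p cₐ Cₐ ϑ : ℝ≥0∞) ^ (n / (p * (n + 2)) : ℝ) *
        lpMean (meanMeasure (Ioo t₁ t₂ ×ˢ U)) σ₁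
          (fun z => ENNReal.ofReal (lam * sourceTerm Dv ξ F D z)) ^ ((n + p) / (n + 2) : ℝ) := by
  have hp := hpq.lt
  have hp0 : 0 < p := by linarith
  have hn0 : (0 : ℝ) < n := by exact_mod_cast (by omega : 0 < n)
  obtain ⟨hσ0, hσ₁0, hid1, hid2⟩ := exponent_identities hn0 hp0 hϑ hσ hσ₁
  have hmain := h.lintegral_norm_rpow_le hpq hp2 hn hUm hUf hc hC ht hϑ hσ hσ₁
  set X := ∫⁻ z in Ioo t₁ t₂ ×ˢ U, ENNReal.ofReal (‖v z.1 z.2‖ ^ σ) with hX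
  have hI0 : volume (Ioo t₁ t₂) ≠ 0 := by simpa using ht
  have hI1 : volume (Ioo t₁ t₂) ≠ ⊤ := by simp
  have hprod : (volume.restrict (Ioo t₁ t₂)).prod (volume.restrict U) =
    (volume.restrict (Ioo t₁ t₂ ×ˢ U) : Measure (ℝ × Space n)) := Measure.prod_restrict _ _
  have hvm : AEMeasurable (fun z : ℝ × Space n => ENNReal.ofReal (‖v z.1 z.2‖ ^ σ))
    (volume.restrict (Ioo t₁ t₂ ×ˢ U)) :=
    (h.sol.measurable.norm.aemeasurable.pow_const σ).ennreal_ofReal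
  rw [← hprod] at hvm
  have hin : ∀ t, ⨍⁻ x in U, ‖c • v t x‖ₑ ^ σ ∂volume = ENNReal.ofReal (c ^ σ) * ((volume U)⁻¹ *
      ∫⁻ x in U, ENNReal.ofReal (‖v t x‖ ^ σ)) := fun t => by
    simp only [enorm_smul_rpow hc0 hσ0.le]
    rw [setLAverage_eq, lintegral_const_mul' _ _ ENNReal.ofReal_ne_top, ENNReal.div_eq_inv_mul]
    ring
  have hsm : AEMeasurable (fun t => (⨍⁻ x in U, ‖c • v t x‖ₑ ^ σ ∂volume) ^ (1 / σ))
      (meanMeasure (Ioo t₁ t₂)) := by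
    simp only [hin]
    exact (((hvm.lintegral_prod_right'.const_mul _).const_mul _).pow_const _).mono_ac
      (meanMeasure_absolutelyContinuous _)
  have hvol : volume (Ioo t₁ t₂) * volume U = ENNReal.ofReal V := by
    rw [← hV, Measure.volume_eq_prod, Measure.prod_prod]
  have hP := isProbabilityMeasure_meanMeasure hI0 hI1
  -- As `σ ≥ 2`, Jensen's inequality in time replaces the exponent `2` by `σ`, and the mixed norm
  -- becomes a space-time norm in `L^σ`.
  have hjen := lpMean_mono_exponent (ν := meanMeasure (Ioo t₁ t₂)) hsm two_pos hσ2
  have hL : (⨍⁻ t in Ioo t₁ t₂, (⨍⁻ x in U, ‖c • v t x‖ₑ ^ σ ∂volume) ^ (2 / σ) ∂volume) ^ (1 / 2 : ℝ) =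
      lpMean (meanMeasure (Ioo t₁ t₂)) 2 (fun t => (⨍⁻ x in U, ‖c • v t x‖ₑ ^ σ ∂volume) ^ (1 / σ)) := by
    simp only [lpMean, ← ENNReal.rpow_mul, one_div_mul_eq_div]
    rfl
  have hRHS : lpMean (meanMeasure (Ioo t₁ t₂)) σ
      (fun t => (⨍⁻ x in U, ‖c • v t x‖ₑ ^ σ ∂volume) ^ (1 / σ)) =
      ENNReal.ofReal c * ENNReal.ofReal (V ^ (-(1 / σ))) * X ^ (1 / σ) := by
    simp only [lpMean, ← ENNReal.rpow_mul, one_div_mul_cancel hσ0.ne', ENNReal.rpow_one, hin]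
    rw [lintegral_const_mul' _ _ ENNReal.ofReal_ne_top, lintegral_const_mul' _ _ (by simp [hU0]),
      lintegral_meanMeasure, ← lintegral_prod _ hvm, hprod,
      ENNReal.mul_rpow_of_nonneg _ _ (by positivity),
      ENNReal.ofReal_rpow_of_nonneg (by positivity) (by positivity), ← Real.rpow_mul hc0.le,
      mul_one_div_cancel hσ0.ne', Real.rpow_one, mul_assoc, ← mul_assoc ((volume U)⁻¹),
      ← ENNReal.mul_inv (Or.inl hU0) (Or.inl hUf), mul_comm (volume U), hvol, ENNReal.mul_rpow_of_nonneg _ _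
        (by positivity), ← ENNReal.ofReal_inv_of_pos hV0,
      ENNReal.ofReal_rpow_of_nonneg (by positivity) (by positivity), Real.rpow_neg hV0.le,
      Real.inv_rpow hV0.le]
  have hS : ∫⁻ z in Ioo t₁ t₂ ×ˢ U, ENNReal.ofReal (sourceTerm Dv ξ F D z ^ σ₁) =
      ENNReal.ofReal (V * lam ^ (-σ₁)) * lpMean (meanMeasure (Ioo t₁ t₂ ×ˢ U)) σ₁
          (fun z => ENNReal.ofReal (lam * sourceTerm Dv ξ F D z)) ^ σ₁ := by
    rw [lpMean_rpow_self hσ₁0, lintegral_meanMeasure, hV]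
    have e1 : ∀ z, ENNReal.ofReal (lam * sourceTerm Dv ξ F D z) ^ σ₁ =
        ENNReal.ofReal (lam ^ σ₁) * ENNReal.ofReal (sourceTerm Dv ξ F D z ^ σ₁) := fun z => by
      have hs := h.sourceTerm_nonneg z
      rw [ENNReal.ofReal_rpow_of_nonneg (by positivity) hσ₁0.le, Real.mul_rpow hlam.le hs,
        ENNReal.ofReal_mul (by positivity)]
    simp only [e1]
    rw [lintegral_const_mul' _ _ ENNReal.ofReal_ne_top, ← ENNReal.ofReal_inv_of_pos hV0,
      ← mul_assoc, ← mul_assoc, ← ENNReal.ofReal_mul (by positivity),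
      ← ENNReal.ofReal_mul (by positivity)]
    have e2 : V * lam ^ (-σ₁) * V⁻¹ * lam ^ σ₁ = 1 := by
      rw [Real.rpow_neg hlam.le]
      field_simp
    rw [e2, ENNReal.ofReal_one, one_mul]
  rw [hL]
  refine hjen.trans ?_
  rw [hRHS]
  refine (mul_le_mul_right hmain _).trans (le_of_eq ?_)
  rw [hS, ENNReal.mul_rpow_of_nonneg _ _ (by positivity), ← ENNReal.rpow_mul,
    ENNReal.ofReal_rpow_of_nonneg (by positivity) (by positivity)]
  have e3 : σ₁ * ((n + p) / (σ₁ * (n + 2))) = (n + p) / (n + 2) := by field_simp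
  -- The volume enters with the power `-1/σ` from the mean on the left and `(n+p)/(σ₁(n+2))` from
  -- the one on the right. By the relation between `σ` and `σ₁` these add up to `1/(n+2)`, whatever
  -- `ϑ` is.
  have e4 : c * V ^ (1 / (n + 2) : ℝ) * lam ^ (-((n + p) / (n + 2) : ℝ)) =
      c * V ^ (-(1 / σ)) * (V * lam ^ (-σ₁)) ^ ((n + p) / (σ₁ * (n + 2))) := by
    rw [Real.mul_rpow hV0.le (by positivity), ← Real.rpow_mul hlam.le, neg_mul, e3, mul_assoc,
      mul_assoc, ← mul_assoc (V ^ (-(1 / σ))), ← Real.rpow_add hV0]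
    congr 3
    have h3 : σ * n = σ₁ * (n + ϑ + 2) := by
      rw [hσ, hσ₁]
      field_simp
      ring
    have h4 : σ * n = p * n + ϑ * n + p * (ϑ + 2) := by
      rw [hσ]
      field_simp
    have h5 : σ₁ = σ * n / (n + ϑ + 2) := by
      rw [eq_div_iff (by positivity)]
      exact h3.symm
    rw [h5]
    field_simp
    linarith
  rw [e3, e4, ENNReal.ofReal_mul (by positivity), ENNReal.ofReal_mul hc0.le]
  ring

end Averages

/-! ### Choice of `ε` as a power of `η` -/

section Bounds

variable {α : Type*} [MeasurableSpace α] {ν : Measure α} {x y d g : α → ℝ≥0∞}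
  {p σ₁ κ₀ c₁ J δ η M : ℝ}

/-- The gradient of the difference of two solutions is bounded by the data. -/
lemma lpMean_grad_le [IsProbabilityMeasure ν] (hx : AEMeasurable x ν) (hd : AEMeasurable d ν)
    (hp : 1 < p) (hpσ : p < σ₁) (hc₁ : 0 < c₁) (hJ : 0 ≤ J) (hδ : 0 < δ) {ε : ℝ} (hε : 0 < ε)
    (hen : ∫⁻ z, g z ^ p ∂ν ≤ ENNReal.ofReal (2 * ε) * ∫⁻ z, x z ^ p ∂ν +
      ENNReal.ofReal ((c₁ * ε ^ (-(1 / (p - 1)))) ^ p) *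
        (∫⁻ z, (d z * x z) ^ p ∂ν + ∫⁻ z, y z ^ p ∂ν))
    (hdJ : lpMean ν (p * σ₁ / (σ₁ - p)) d ≤ ENNReal.ofReal (J * δ ^ (1 / (p - 1)))) :
    lpMean ν p g ≤ ENNReal.ofReal (2 * ε ^ (1 / p) + c₁ * J * (δ / ε) ^ (1 / (p - 1))) *
      lpMean ν σ₁ x + ENNReal.ofReal (c₁ * ε ^ (-(1 / (p - 1)))) * lpMean ν p y := by
  have hp0 : 0 < p := by linarith
  have hp1 : 0 < p - 1 := by linarith
  have h := lpMean_le_of_energy hx hd hp hpσ (by positivity) (by positivity) hJ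
    (by positivity : 0 ≤ δ ^ (1 / (p - 1))) hen hdJ
  have e1 : ((c₁ * ε ^ (-(1 / (p - 1)))) ^ p) ^ (1 / p) = c₁ * ε ^ (-(1 / (p - 1))) := by
    rw [← Real.rpow_mul (by positivity), mul_one_div_cancel hp0.ne', Real.rpow_one]
  have e2 : c₁ * ε ^ (-(1 / (p - 1))) * (J * δ ^ (1 / (p - 1))) =
      c₁ * J * (δ / ε) ^ (1 / (p - 1)) := by
    rw [Real.div_rpow hδ.le hε.le, Real.rpow_neg hε.le]
    ring
  have e3 : (2 * ε) ^ (1 / p) ≤ 2 * ε ^ (1 / p) := by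
    rw [Real.mul_rpow zero_le_two hε.le]
    gcongr
    refine (Real.rpow_le_rpow_of_exponent_le one_le_two ?_).trans (Real.rpow_one _).le
    rw [div_le_one hp0]
    exact hp.le
  rw [e1, e2] at h
  exact h.trans (by gcongr)

lemma rpow_le_rpow_of_ge {η a b : ℝ} (hη : 0 < η) (hη1 : η < 1) (h : a ≤ b) : η ^ b ≤ η ^ a :=
  Real.rpow_le_rpow_of_exponent_ge hη hη1.le h

/-- The choice `ε = η^{2p}` makes `ε^{1/p} = η²`, and `M ≥ 4p` makes the coefficient term at most of
the same order. The power `η²` instead of `η` leaves one factor to absorb constants later. -/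
lemma lpMean_grad_le_sq [IsProbabilityMeasure ν] (hx : AEMeasurable x ν) (hd : AEMeasurable d ν)
    (hp : 1 < p) (hpσ : p < σ₁) (hc₁ : 0 < c₁) (hJ : 0 ≤ J) (hη : 0 < η) (hη1 : η < 1)
    (hM : 4 * p ≤ M)
    (hen : ∀ ε, 0 < ε → ε ≤ 1 → ∫⁻ z, g z ^ p ∂ν ≤ ENNReal.ofReal (2 * ε) * ∫⁻ z, x z ^ p ∂ν +
      ENNReal.ofReal ((c₁ * ε ^ (-(1 / (p - 1)))) ^ p) *
        (∫⁻ z, (d z * x z) ^ p ∂ν + ∫⁻ z, y z ^ p ∂ν))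
    (hdJ : lpMean ν (p * σ₁ / (σ₁ - p)) d ≤ ENNReal.ofReal (J * (η ^ M) ^ (1 / (p - 1)))) :
    lpMean ν p g ≤ ENNReal.ofReal (c₁ * (η ^ (2 * p)) ^ (-(1 / (p - 1)))) * lpMean ν p y +
      ENNReal.ofReal ((2 + c₁ * J) * η ^ 2) * lpMean ν σ₁ x := by
  have hp0 : 0 < p := by linarith
  have hp1 : 0 < p - 1 := by linarith
  have hε : 0 < η ^ (2 * p) := by positivity
  have hε1 : η ^ (2 * p) ≤ 1 := Real.rpow_le_one hη.le hη1.le (by positivity)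
  refine (lpMean_grad_le hx hd hp hpσ hc₁ hJ (by positivity) hε (hen _ hε hε1) hdJ).trans ?_
  rw [add_comm]
  have e1 : (η ^ (2 * p)) ^ (1 / p) = η ^ 2 := by
    rw [← Real.rpow_mul hη.le, ← Real.rpow_natCast]
    congr 1
    push_cast
    field_simp
  have e2 : (η ^ M / η ^ (2 * p)) ^ (1 / (p - 1)) ≤ η ^ 2 := by
    rw [← Real.rpow_sub hη, ← Real.rpow_mul hη.le, ← Real.rpow_natCast]
    refine rpow_le_rpow_of_ge hη hη1 ?_
    rw [mul_one_div, le_div_iff₀ hp1]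
    push_cast
    linarith
  gcongr
  rw [e1, add_mul]
  gcongr

/-- The coefficient of the datum in the estimate of the source term. -/
def sourceConst (p c₁ C δ γ : ℝ) : ℝ :=
  (2 * (c₁ * (δ ^ (1 / 2 : ℝ)) ^ (-(1 / (p - 1))))) ^ γ *
    (c₁ * (δ ^ (1 / 2 : ℝ)) ^ (-(1 / (p - 1))) / (C * δ ^ (1 / 4 : ℝ))) ^ (1 - γ) + 1

/-- The minimum is interpolated between the gradient bound in `L^p` and `x` in `L^s`, the product `d
x` is split by Hölder's inequality, and `y` is kept. The interpolation exponents degenerate as `s`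
approaches `σ₁`; the lower bounds on `M` still yield `η⁴` in both terms. -/
lemma lpMean_source_le [IsProbabilityMeasure ν] (hx : AEMeasurable x ν) (hd : AEMeasurable d ν)
    (hy : AEMeasurable y ν) (hg : AEMeasurable g ν)
    (hp : 1 < p) (hp2 : p < 2) (hpσ : p < σ₁) (hc₁ : 0 < c₁) (hJ : 0 ≤ J) (hη : 0 < η)
    (hη1 : η < 1) (hM0 : 0 < M) {s γ B : ℝ} (hs : σ₁ < s)
    (hγ : γ = p * (s - σ₁) / (σ₁ * (s - p))) (hMγ : 16 ≤ M * γ) (hB : 0 ≤ B)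
    (hMs : 4 ≤ M * ((s - σ₁) / (σ₁ * s)))
    (hen : ∀ ε, 0 < ε → ε ≤ 1 → ∫⁻ z, g z ^ p ∂ν ≤ ENNReal.ofReal (2 * ε) * ∫⁻ z, x z ^ p ∂ν +
      ENNReal.ofReal ((c₁ * ε ^ (-(1 / (p - 1)))) ^ p) *
        (∫⁻ z, (d z * x z) ^ p ∂ν + ∫⁻ z, y z ^ p ∂ν))
    (hdJ : lpMean ν (p * σ₁ / (σ₁ - p)) d ≤ ENNReal.ofReal (J * (η ^ M) ^ (1 / (p - 1))))
    (hdB : lpMean ν (σ₁ * s / (s - σ₁)) d ≤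
      ENNReal.ofReal (B * (η ^ M) ^ (1 / (σ₁ * s / (s - σ₁))))) :
    lpMean ν σ₁ (fun z => min (g z) (x z) + d z * x z + y z) ≤
      ENNReal.ofReal ((2 * (2 + c₁ * J) + B) * η ^ 4) * lpMean ν s x +
        ENNReal.ofReal (sourceConst p c₁ (2 + c₁ * J) (η ^ M) γ) * lpMean ν σ₁ y := by
  have hp0 : 0 < p := by linarith
  have hp1 : 0 < p - 1 := by linarith
  have hσ0 : 0 < σ₁ := by linarith
  have hs0 : 0 < s := by linarith
  have hsσ : 0 < s - σ₁ := by linarith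
  have hsp : 0 < s - p := by linarith
  have hσp : 0 < σ₁ - p := by linarith
  set δ := η ^ M with hδdef
  have hδ : 0 < δ := by positivity
  have hδ1 : δ < 1 := Real.rpow_lt_one hη.le hη1 hM0
  -- With `ε = δ^{1/2}`, both `ε^{1/p}` and `(δ/ε)^{1/(p-1)}` are at most `δ^{1/4}`, because `p <
  -- 2`.
  have hε : 0 < δ ^ (1 / 2 : ℝ) := by positivity
  have hε1 : δ ^ (1 / 2 : ℝ) ≤ 1 := Real.rpow_le_one hδ.le hδ1.le (by positivity)
  set K := c₁ * (δ ^ (1 / 2 : ℝ)) ^ (-(1 / (p - 1))) with hK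
  have hK0 : 0 < K := by positivity
  set C := 2 + c₁ * J with hC
  have hC2 : 2 ≤ C := by
    have : 0 ≤ c₁ * J := by positivity
    linarith
  set X := lpMean ν s x with hX
  set Y := lpMean ν σ₁ y with hY
  have hγ0 : 0 ≤ γ := by rw [hγ]; positivity
  have hγ1 : γ ≤ 1 := by
    rw [hγ, div_le_one (by positivity)]
    nlinarith
  have hP : lpMean ν p g ≤ ENNReal.ofReal (C * δ ^ (1 / 4 : ℝ)) * X + ENNReal.ofReal K * Y := by
    refine (lpMean_grad_le hx hd hp hpσ hc₁ hJ hδ hε (hen _ hε hε1) hdJ).trans ?_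
    gcongr
    · have e1 : (δ ^ (1 / 2 : ℝ)) ^ (1 / p) ≤ δ ^ (1 / 4 : ℝ) := by
        rw [← Real.rpow_mul hδ.le]
        refine rpow_le_rpow_of_ge hδ hδ1 ?_
        rw [one_div_mul_one_div, div_le_div_iff₀ (by norm_num) (by positivity)]
        linarith
      have e2 : (δ / δ ^ (1 / 2 : ℝ)) ^ (1 / (p - 1)) ≤ δ ^ (1 / 4 : ℝ) := by
        have e3 : δ / δ ^ (1 / 2 : ℝ) = δ ^ (1 / 2 : ℝ) := by
          nth_rewrite 1 [← Real.rpow_one δ]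
          rw [← Real.rpow_sub hδ]
          norm_num
        rw [e3, ← Real.rpow_mul hδ.le]
        refine rpow_le_rpow_of_ge hδ hδ1 ?_
        rw [one_div_mul_one_div, div_le_div_iff₀ (by norm_num) (by positivity)]
        linarith
      rw [hC, add_mul]
      gcongr
    · exact lpMean_mono_exponent hx hσ0 hs.le
    · have hym : lpMean ν p y ≤ lpMean ν σ₁ y := lpMean_mono_exponent hy hp0 hpσ.le
      exact hym
  have h1 : lpMean ν σ₁ (fun z => min (g z) (x z)) ≤
      ENNReal.ofReal ((2 * (C * δ ^ (1 / 4 : ℝ))) ^ γ) * X +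
      ENNReal.ofReal ((2 * K) ^ γ * (K / (C * δ ^ (1 / 4 : ℝ))) ^ (1 - γ)) * Y := by
    refine (lpMean_min_le hg hx hp0 hpσ hs).trans ?_
    rw [← hγ]
    exact rpow_mul_rpow_le_add (by positivity) hK0 hγ0 hγ1 hP
  have h2 : lpMean ν σ₁ (fun z => d z * x z) ≤
      ENNReal.ofReal (B * δ ^ (1 / (σ₁ * s / (s - σ₁)))) * X := by
    refine (lpMean_mul_le hd hx hσ0 (a := σ₁ * s / (s - σ₁)) (by positivity) hs0 ?_).trans ?_
    · field_simp
      ring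
    · gcongr
  have e1 : (2 * (C * δ ^ (1 / 4 : ℝ))) ^ γ ≤ 2 * C * η ^ 4 := by
    rw [← mul_assoc, Real.mul_rpow (by positivity) (by positivity)]
    have f1 : (2 * C) ^ γ ≤ 2 * C :=
      (Real.rpow_le_rpow_of_exponent_le (by linarith) hγ1).trans (Real.rpow_one _).le
    have f2 : (δ ^ (1 / 4 : ℝ)) ^ γ ≤ η ^ 4 := by
      rw [hδdef, ← Real.rpow_mul hη.le, ← Real.rpow_mul hη.le, ← Real.rpow_natCast]
      refine rpow_le_rpow_of_ge hη hη1 ?_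
      push_cast
      linarith
    gcongr
  have e2 : B * δ ^ (1 / (σ₁ * s / (s - σ₁))) ≤ B * η ^ 4 := by
    gcongr
    rw [hδdef, ← Real.rpow_mul hη.le, ← Real.rpow_natCast]
    refine rpow_le_rpow_of_ge hη hη1 ?_
    rw [one_div_div]
    push_cast
    linarith
  have hmin : AEMeasurable (fun z => min (g z) (x z)) ν := hg.min hx
  have hdx : AEMeasurable (fun z => d z * x z) ν := hd.mul hx
  calc lpMean ν σ₁ (fun z => min (g z) (x z) + d z * x z + y z)
      ≤ lpMean ν σ₁ (fun z => min (g z) (x z) + d z * x z) + lpMean ν σ₁ y :=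
        lpMean_add_le (hmin.add hdx) hy (by linarith)
    _ ≤ lpMean ν σ₁ (fun z => min (g z) (x z)) + lpMean ν σ₁ (fun z => d z * x z) + Y := by
        gcongr
        exact lpMean_add_le hmin hdx (by linarith)
    _ ≤ (ENNReal.ofReal (2 * C * η ^ 4) * X +
          ENNReal.ofReal ((2 * K) ^ γ * (K / (C * δ ^ (1 / 4 : ℝ))) ^ (1 - γ)) * Y) +
          ENNReal.ofReal (B * η ^ 4) * X + Y := by
        gcongr
        · exact h1.trans (by gcongr)
        · exact h2.trans (by gcongr)
    _ = _ := by
        rw [sourceConst, ← hK, ENNReal.ofReal_add (by positivity) zero_le_one, ENNReal.ofReal_one,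
          add_mul (2 * C), ENNReal.ofReal_add (by positivity) (by positivity)]
        ring

end Bounds

/-! ### Inequalities between the exponents -/

section Exponents

variable {n : ℕ} {p ϑ σ σ₁ : ℝ}

/-- The lower bound on `ϑ` says that `p(ϑ+2+n) > 2n`, and the two lower bounds for `σ` and `σ₁` in
terms of `2 - p` reduce to this. The last inequality only uses `p(n+2) ≤ 2n`; it lets the factor
`(p-1)^{-4}` in the smallness exponent dominate powers of `n+4`. -/
lemma exponent_bounds (hn : 3 ≤ n) (hp : 1 < p) (hpn : p ≤ 2 * n / (n + 2))
    (hϑ : 2 * n / p - (2 + n) < ϑ) (hσ : σ = p + ϑ + p * (ϑ + 2) / n)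
    (hσ₁ : σ₁ = p + n * ϑ / (n + ϑ + 2)) :
    p < 2 ∧ 0 < ϑ ∧ 2 < σ ∧ n * (2 - p) / p < σ ∧ n * (2 - p) / 2 < σ₁ ∧ p < σ₁ ∧ σ₁ < p + n ∧
      (n + 4) * (p - 1) ≤ n := by
  have hn3 : (3 : ℝ) ≤ n := by exact_mod_cast hn
  have hn0 : (0 : ℝ) < n := by linarith
  have hp0 : 0 < p := by linarith
  have h1 : p * (n + 2) ≤ 2 * n := by rwa [le_div_iff₀ (by positivity)] at hpn
  have hp2 : p < 2 := by nlinarith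
  have h2 : 2 * n < p * (ϑ + 2 + n) := by
    have : 2 * n / p < ϑ + 2 + n := by linarith
    rw [div_lt_iff₀ hp0] at this
    linarith
  have hϑ0 : 0 < ϑ := by
    by_contra hcon
    push Not at hcon
    nlinarith
  have hs : 0 < n + ϑ + 2 := by positivity
  have h3 : 2 + ϑ < σ := by
    have : 2 < p + p * (ϑ + 2) / n := by
      rw [← sub_pos]
      have e : p + p * (ϑ + 2) / n - 2 = (p * (ϑ + 2 + n) - 2 * n) / n := by
        field_simp
        ring
      rw [e]
      apply div_pos _ hn0
      linarith
    linarith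
  refine ⟨hp2, hϑ0, by linarith, ?_, ?_, ?_, ?_, ?_⟩
  · have : n * (2 - p) / p = 2 * n / p - n := by field_simp
    linarith
  · rw [hσ₁, ← sub_pos]
    have e : p + n * ϑ / (n + ϑ + 2) - n * (2 - p) / 2 =
        (n + 2) * (p * (ϑ + 2 + n) - 2 * n) / (2 * (n + ϑ + 2)) := by
      field_simp
      ring
    rw [e]
    apply div_pos _ (by positivity)
    apply mul_pos (by positivity)
    linarith
  · rw [hσ₁]
    have : 0 < n * ϑ / (n + ϑ + 2) := by positivity
    linarith
  · rw [hσ₁]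
    have : n * ϑ / (n + ϑ + 2) < n := by
      rw [div_lt_iff₀ hs]
      nlinarith
    linarith
  · nlinarith

/-- The size of the exponent in the smallness condition on the coefficient. -/
lemma smallness_exponent_bounds (hn : 3 ≤ n) (hp : 1 < p) (hp2 : p < 2)
    (hnp : (n + 4) * (p - 1) ≤ (n : ℝ)) (hσp : p < σ₁) (hσn : σ₁ < p + n) {κ₀ : ℝ} (hκ : 0 < κ₀)
    (hκ1 : κ₀ < 1) :
    4 * p ≤ (n : ℝ) ^ 4 / (κ₀ ^ 4 * (p - 1) ^ 4) ∧
    16 ≤ (n : ℝ) ^ 4 / (κ₀ ^ 4 * (p - 1) ^ 4) * (p * κ₀ / (σ₁ * (σ₁ + κ₀ - p))) ∧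
    4 ≤ (n : ℝ) ^ 4 / (κ₀ ^ 4 * (p - 1) ^ 4) * (κ₀ / (σ₁ * (σ₁ + κ₀))) := by
  have hn3 : (3 : ℝ) ≤ n := by exact_mod_cast hn
  have hp1 : 0 < p - 1 := by linarith
  -- Since `σ₁ + κ₀ < n + 4`, a lower bound of `M` by `(n+4)⁴/κ₀` is enough for all three claims.
  have hM : ((n : ℝ) + 4) ^ 4 / κ₀ ^ 4 ≤ (n : ℝ) ^ 4 / (κ₀ ^ 4 * (p - 1) ^ 4) := by
    rw [div_le_div_iff₀ (by positivity) (by positivity)]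
    have h1 : (((n : ℝ) + 4) * (p - 1)) ^ 4 ≤ (n : ℝ) ^ 4 := pow_le_pow_left₀ (by positivity) hnp 4
    have h2 : 0 < κ₀ ^ 4 := by positivity
    nlinarith
  have hM' : ((n : ℝ) + 4) ^ 4 / κ₀ ≤ (n : ℝ) ^ 4 / (κ₀ ^ 4 * (p - 1) ^ 4) := by
    refine le_trans ?_ hM
    gcongr
    calc κ₀ ^ 4 ≤ κ₀ ^ 1 := pow_le_pow_of_le_one hκ.le hκ1.le (by norm_num)
      _ = κ₀ := pow_one _
  have h4 : (49 : ℝ) ≤ (n + 4) ^ 2 := by nlinarith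
  have hκM : ((n : ℝ) + 4) ^ 4 ≤ (n : ℝ) ^ 4 / (κ₀ ^ 4 * (p - 1) ^ 4) * κ₀ := by
    rwa [div_le_iff₀ hκ] at hM'
  have hA : 49 * ((n : ℝ) + 4) ^ 2 ≤ (n : ℝ) ^ 4 / (κ₀ ^ 4 * (p - 1) ^ 4) * κ₀ := by
    refine le_trans ?_ hκM
    nlinarith [sq_nonneg ((n : ℝ) + 4)]
  set M := (n : ℝ) ^ 4 / (κ₀ ^ 4 * (p - 1) ^ 4) with hMdef
  have hσ0 : 0 < σ₁ := by linarith
  have hσκ : 0 < σ₁ + κ₀ - p := by linarith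
  refine ⟨?_, ?_, ?_⟩
  · have h5 : M * κ₀ ≤ M := mul_le_of_le_one_right (by positivity) hκ1.le
    nlinarith
  · have h6 : σ₁ * (σ₁ + κ₀ - p) ≤ (n + 4) * (n + 4) :=
      mul_le_mul (by linarith) (by linarith) (by positivity) (by positivity)
    rw [← mul_div_assoc, le_div_iff₀ (by positivity)]
    have h7 : M * κ₀ ≤ M * (p * κ₀) := by
      have : 0 ≤ M := by positivity
      have : κ₀ ≤ p * κ₀ := by nlinarith
      gcongr
    nlinarith
  · have h6 : σ₁ * (σ₁ + κ₀) ≤ (n + 4) * (n + 4) :=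
      mul_le_mul (by linarith) (by linarith) (by positivity) (by positivity)
    rw [← mul_div_assoc, le_div_iff₀ (by positivity)]
    nlinarith

end Exponents

/-! ### Explicit constants and the intrinsic scaling -/

section Main

variable {N n : ℕ} {p q : ℝ}

lemma jnConst_nonneg (n : ℕ) (Q : ℝ) : 0 ≤ jnConst n Q := by
  unfold jnConst
  have : 0 ≤ ∑' j : ℕ, ((j : ℝ) + 1) ^ Q * (1 / 2) ^ j := tsum_nonneg fun j => by positivity
  positivity

/-- The constant of the energy estimate for the difference. -/
def energyConst (p cₐ : ℝ) : ℝ :=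
  (6 / (cₐ * (p - 1)) * (12 / (cₐ * (p - 1))) ^ (1 / (p - 1))) ^ (1 / p)

lemma energyConst_pos {cₐ : ℝ} (hp : 1 < p) (hc : 0 < cₐ) : 0 < energyConst p cₐ := by
  have hp1 : 0 < p - 1 := by linarith
  unfold energyConst
  positivity

/-- The energy constant depends on `ε` exactly through `ε^{-p/(p-1)}`, so its `p`-th root is a fixed
number times `ε^{-1/(p-1)}`. -/
lemma energyConst_mul_rpow {cₐ ε : ℝ} (hp : 1 < p) (hc : 0 < cₐ) (hε : 0 < ε) :
    (energyConst p cₐ * ε ^ (-(1 / (p - 1)))) ^ p =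
      6 / (cₐ * (p - 1) * ε) * (12 / (cₐ * (p - 1) * ε)) ^ (1 / (p - 1)) := by
  have hp1 : 0 < p - 1 := by linarith
  have hp0 : 0 < p := by linarith
  have e1 : ε ^ (-(1 / (p - 1)) * p) = ε⁻¹ * (ε ^ (1 / (p - 1)))⁻¹ := by
    rw [← Real.rpow_neg hε.le, ← Real.rpow_neg_one, ← Real.rpow_add hε]
    congr 1
    field_simp
    ring
  rw [Real.mul_rpow (energyConst_pos hp hc).le (by positivity), energyConst,
    ← Real.rpow_mul (by positivity), one_div_mul_cancel hp0.ne', Real.rpow_one,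
    ← Real.rpow_mul hε.le, e1, ← div_div 12 (cₐ * (p - 1)) ε, Real.div_rpow (by positivity) hε.le]
  field_simp

/-- The constant in the bound of the mean oscillation in `L^r`. -/
def oscConst (n : ℕ) (p r : ℝ) : ℝ := jnConst n (r / (p - 1)) ^ (1 / r)

lemma oscConst_nonneg (n : ℕ) (p r : ℝ) : 0 ≤ oscConst n p r :=
  Real.rpow_nonneg (jnConst_nonneg n _) _

/-- The constant in the bound of the oscillation of a bounded coefficient. -/
def boundedOscConst (n : ℕ) (p Cₐ : ℝ) : ℝ := max 1 (Cₐ ^ (1 / (p - 1))) * max 1 (jnConst n 1)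

/-- The constant of the integrability estimate on intrinsic cylinders. -/
def cylinderConst (N n : ℕ) (p cₐ Cₐ ϑ : ℝ) : ℝ≥0 :=
  Real.toNNReal (2 * volume.real (ball (0 : Space n) 1) ^ (1 / (n + 2) : ℝ)) *
    parabolicConst N n p cₐ Cₐ ϑ ^ (n / (p * (n + 2)) : ℝ)

lemma ofReal_mul_sourceTerm {Dv : ℝ → Space n → Mat N n} {ξ F : ℝ × Space n → Mat N n}
    {D : ℝ × Space n → ℝ} {lam : ℝ} (hlam : 0 < lam) (hD : ∀ z, 0 ≤ D z) (z : ℝ × Space n) :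
    ENNReal.ofReal (lam * sourceTerm Dv ξ F D z) =
      min ‖lam • Dv z.1 z.2‖ₑ ‖lam • ξ z‖ₑ + ENNReal.ofReal (D z) * ‖lam • ξ z‖ₑ + ‖lam • F z‖ₑ := by
  have e : ∀ M : Mat N n, ‖lam • M‖ₑ = ENNReal.ofReal (lam * ‖M‖) := fun M => by
    rw [← ofReal_norm, norm_smul, Real.norm_of_nonneg hlam.le]
  have hD' := hD z
  rw [e, e, e, ← ENNReal.ofReal_min, ← ENNReal.ofReal_mul (hD z),
    ← ENNReal.ofReal_add (le_min (by positivity) (by positivity)) (by positivity),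
    ← ENNReal.ofReal_add (add_nonneg (le_min (by positivity) (by positivity)) (by positivity))
      (by positivity)]
  congr 1
  rw [sourceTerm, ← mul_min_of_nonneg _ _ hlam.le]
  ring

lemma volume_cylinder {lam R t₀ : ℝ} (hlam : 0 < lam) (hR : 0 < R) (x₀ : Space n) :
    volume (Ioo (t₀ - lam ^ (p - 2) * (2 * R) ^ 2) t₀ ×ˢ ball x₀ (2 * R)) =
      ENNReal.ofReal (lam ^ (p - 2) * (2 * R) ^ (n + 2) * volume.real (ball (0 : Space n) 1)) := by
  have h := Measure.addHaar_ball_of_pos (volume : Measure (Space n)) x₀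
    (show 0 < 2 * R by positivity)
  rw [finrank_euclideanSpace_fin] at h
  rw [volume_Ioo_prod, sub_sub_cancel, h, ← ofReal_measureReal (measure_ball_lt_top.ne),
    ← ENNReal.ofReal_mul (by positivity), ← ENNReal.ofReal_mul (by positivity)]
  congr 1
  ring

/-- The powers of `R` cancel because the cylinder has volume proportional to `R^{n+2}`, and those of
`λ` because its length in time carries `λ^{p-2}`. So the final constant does not depend on the
cylinder. -/
lemma intrinsic_scaling {lam R V : ℝ} (hlam : 0 < lam) (hR : 0 < R) (hV : 0 ≤ V) :
    lam / R * (lam ^ (p - 2) * (2 * R) ^ (n + 2) * V) ^ (1 / (n + 2) : ℝ) *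
      lam ^ (-((n + p) / (n + 2) : ℝ)) = 2 * V ^ (1 / (n + 2) : ℝ) := by
  have hn : (0 : ℝ) < n + 2 := by positivity
  have e1 : ((2 * R) ^ (n + 2)) ^ (1 / (n + 2) : ℝ) = 2 * R := by
    rw [← Real.rpow_natCast, ← Real.rpow_mul (by positivity)]
    push_cast
    rw [mul_one_div_cancel hn.ne', Real.rpow_one]
  have e2 : lam * (lam ^ (p - 2)) ^ (1 / (n + 2) : ℝ) * lam ^ (-((n + p) / (n + 2) : ℝ)) = 1 := by
    rw [← Real.rpow_mul hlam.le]
    nth_rewrite 1 [← Real.rpow_one lam]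
    rw [← Real.rpow_add hlam, ← Real.rpow_add hlam]
    have : 1 + (p - 2) * (1 / (n + 2)) + -((n + p) / (n + 2)) = (0 : ℝ) := by
      field_simp
      ring
    rw [this, Real.rpow_zero]
  rw [Real.mul_rpow (by positivity) hV, Real.mul_rpow (by positivity) (by positivity), e1]
  calc _ = (lam * (lam ^ (p - 2)) ^ (1 / (n + 2) : ℝ) * lam ^ (-((n + p) / (n + 2) : ℝ))) *
        (2 * V ^ (1 / (n + 2) : ℝ)) := by field_simp
    _ = _ := by rw [e2, one_mul]

/-- Both comparison estimates, with explicit constants. -/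
lemma comparison_estimates (hn : 3 ≤ n) (hp : 1 < p) (hpn : p ≤ 2 * n / (n + 2)) {cₐ Cₐ : ℝ}
    (hc : 0 < cₐ) {ϑ σ σ₁ : ℝ} (hϑ : 2 * n / p - (2 + n) < ϑ)
    (hσ : σ = p + ϑ + p * (ϑ + 2) / n) (hσ₁ : σ₁ = p + n * ϑ / (n + ϑ + 2))
    {η κ₀ : ℝ} (hη : 0 < η) (hη1 : η < 1) (hκ : 0 < κ₀) (hκ1 : κ₀ < 1)
    {Ω : Set (Space n)} {T : ℝ} (hΩ : IsOpen Ω) (hΩb : Bornology.IsBounded Ω)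
    {a : ℝ → Space n → ℝ} (ha : Measurable (Function.uncurry a))
    (hab : ∀ t ≤ T, ∀ x ∈ Ω, cₐ ≤ a t x ∧ a t x ≤ Cₐ) {F : ℝ → Space n → Mat N n}
    (hF : MemLp (Function.uncurry F) (ENNReal.ofReal p) (volume.restrict (Ioo 0 T ×ˢ Ω)))
    {u : ℝ → Space n → Vec N} {Du : ℝ → Space n → Mat N n}
    (hu : IsDirichletSolution p 0 T Ω a F 0 0 u Du)
    (hneg : ∀ t < 0, u t = 0 ∧ Du t = 0 ∧ F t = 0)
    {lam R t₀ : ℝ} {x₀ : Space n} (hlam : 0 < lam) (hR : 0 < R)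
    (hB : closedBall x₀ (2 * R) ⊆ Ω) (h0t : 0 ≤ t₀) (ht₀ : t₀ ≤ T)
    {w : ℝ → Space n → Vec N} {Dw : ℝ → Space n → Mat N n}
    (hw : IsDirichletSolution p (t₀ - lam ^ (p - 2) * (2 * R) ^ 2) t₀ (ball x₀ (2 * R))
      (fun t _ => ⨍ y in ball x₀ (2 * R), a t y) 0 u Du w Dw)
    (hbmo : bmoSeminorm T Ω a (2 * R) ≤
      ENNReal.ofReal (η ^ ((n : ℝ) ^ 4 / (κ₀ ^ 4 * (p - 1) ^ 4)))) :
    lpMean (meanMeasure (cyl p lam (2 * R) x₀ t₀)) p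
        (fun z => ‖lam • (Du z.1 z.2 - Dw z.1 z.2)‖ₑ) ≤
      ENNReal.ofReal (energyConst p cₐ * (η ^ (2 * p)) ^ (-(1 / (p - 1)))) *
        lpMean (meanMeasure (cyl p lam (2 * R) x₀ t₀)) p (fun z => ‖lam • F z.1 z.2‖ₑ) +
      ENNReal.ofReal ((2 + energyConst p cₐ * oscConst n p (p * σ₁ / (σ₁ - p))) * η ^ 2) *
        lpMean (meanMeasure (cyl p lam (2 * R) x₀ t₀)) σ₁ (fun z => ‖lam • Du z.1 z.2‖ₑ) ∧
    (⨍⁻ t in cylTime p lam (2 * R) t₀,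
      (⨍⁻ x in ball x₀ (2 * R), ‖(lam / R) • (u t x - w t x)‖ₑ ^ σ ∂volume) ^ (2 / σ) ∂volume)
        ^ (1 / 2 : ℝ) ≤
      cylinderConst N n p cₐ Cₐ ϑ *
        (ENNReal.ofReal ((2 * (2 + energyConst p cₐ * oscConst n p (p * σ₁ / (σ₁ - p))) +
          boundedOscConst n p Cₐ) * η ^ 4) *
          lpMean (meanMeasure (cyl p lam (2 * R) x₀ t₀)) (σ₁ + κ₀) (fun z => ‖lam • Du z.1 z.2‖ₑ) +
        ENNReal.ofReal (sourceConst p (energyConst p cₐ)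
          (2 + energyConst p cₐ * oscConst n p (p * σ₁ / (σ₁ - p)))
          (η ^ ((n : ℝ) ^ 4 / (κ₀ ^ 4 * (p - 1) ^ 4))) (p * κ₀ / (σ₁ * (σ₁ + κ₀ - p)))) *
          lpMean (meanMeasure (cyl p lam (2 * R) x₀ t₀)) σ₁ (fun z => ‖lam • F z.1 z.2‖ₑ))
          ^ ((n + p) / (n + 2) : ℝ) := by
  obtain ⟨hp2, hϑ0, hσ2, -, -, hσp, hσn, hnp⟩ := exponent_bounds hn hp hpn hϑ hσ hσ₁
  obtain ⟨hM1, hM2, hM3⟩ := smallness_exponent_bounds hn hp hp2 hnp hσp hσn hκ hκ1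
  have hn0 : (0 : ℝ) < n := by exact_mod_cast (by omega : 0 < n)
  have hp1 : 0 < p - 1 := by linarith
  have hp0 : 0 < p := by linarith
  have hσ0 : 0 < σ₁ := by linarith
  set M := (n : ℝ) ^ 4 / (κ₀ ^ 4 * (p - 1) ^ 4) with hM
  have hM0 : 0 < M := by positivity
  have hδ : 0 < η ^ M := by positivity
  have hpq : p.HolderConjugate (p.conjExponent) := Real.HolderConjugate.conjExponent hp
  have hρ : 0 < 2 * R := by positivity
  have hbΩ : ball x₀ (2 * R) ⊆ Ω := ball_subset_closedBall.trans hB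
  have hCa : cₐ ≤ Cₐ := by
    have := hab T le_rfl x₀ (hbΩ (mem_ball_self hρ))
    exact this.1.trans this.2
  have hCa0 : 0 ≤ Cₐ := hc.le.trans hCa
  have hcmp := isComparison_of_isDirichletSolution hpq hc hΩ hΩb ha hab hF hu hneg hρ hbΩ h0t ht₀ hw
  have ht : t₀ - lam ^ (p - 2) * (2 * R) ^ 2 < t₀ := by
    have : 0 < lam ^ (p - 2) * (2 * R) ^ 2 := by positivity
    linarith
  have hcyl : cyl p lam (2 * R) x₀ t₀ =
      Ioo (t₀ - lam ^ (p - 2) * (2 * R) ^ 2) t₀ ×ˢ ball x₀ (2 * R) := rfl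
  have hvol := volume_cylinder (p := p) (t₀ := t₀) hlam hR x₀
  have hunit : 0 < volume.real (ball (0 : Space n) 1) :=
    ENNReal.toReal_pos (measure_ball_pos _ _ one_pos).ne' measure_ball_lt_top.ne
  set V := lam ^ (p - 2) * (2 * R) ^ (n + 2) * volume.real (ball (0 : Space n) 1) with hV
  have hV0 : 0 < V := by positivity
  have hb0 : volume (ball x₀ (2 * R)) ≠ 0 := (measure_ball_pos _ _ hρ).ne'
  have hbt : volume (ball x₀ (2 * R)) ≠ ⊤ := measure_ball_lt_top.ne
  rw [hcyl]
  have hprob := isProbabilityMeasure_meanMeasure (Q := Ioo (t₀ - lam ^ (p - 2) * (2 * R) ^ 2) t₀ ×ˢ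
    ball x₀ (2 * R)) (by rw [hvol]; simpa using hV0) (by rw [hvol]; exact ENNReal.ofReal_ne_top)
  set t₁ := t₀ - lam ^ (p - 2) * (2 * R) ^ 2 with ht₁
  set Q := Ioo t₁ t₀ ×ˢ ball x₀ (2 * R) with hQ
  have hac := meanMeasure_absolutelyContinuous Q
  set ν := meanMeasure Q with hν
  have hvol0 : volume Q ≠ 0 := by rw [hvol]; simpa using hV0
  have hvolt : volume Q ≠ ⊤ := by rw [hvol]; exact ENNReal.ofReal_ne_top
  set D := coeffDist p a (ball x₀ (2 * R)) with hD
  have hxm : AEMeasurable (fun z : ℝ × Space n => ‖lam • Du z.1 z.2‖ₑ) ν :=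
    ((hcmp.aesm_grad.const_smul lam).enorm).mono_ac hac
  have hym : AEMeasurable (fun z : ℝ × Space n => ‖lam • F z.1 z.2‖ₑ) ν :=
    ((hcmp.aesm_datum.const_smul lam).enorm).mono_ac hac
  have hdm : AEMeasurable (fun z : ℝ × Space n => ENNReal.ofReal (D z)) ν :=
    (measurable_coeffDist ha).ennreal_ofReal.aemeasurable
  have hgm : AEMeasurable (fun z : ℝ × Space n => ‖lam • (Du z.1 z.2 - Dw z.1 z.2)‖ₑ) ν :=
    ((hcmp.sol.memLp_grad.1.const_smul lam).enorm).mono_ac hac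
  have hen : ∀ ε, 0 < ε → ε ≤ 1 → ∫⁻ z, ‖lam • (Du z.1 z.2 - Dw z.1 z.2)‖ₑ ^ p ∂ν ≤
      ENNReal.ofReal (2 * ε) * ∫⁻ z, ‖lam • Du z.1 z.2‖ₑ ^ p ∂ν +
      ENNReal.ofReal ((energyConst p cₐ * ε ^ (-(1 / (p - 1)))) ^ p) *
        (∫⁻ z, (ENNReal.ofReal (D z) * ‖lam • Du z.1 z.2‖ₑ) ^ p ∂ν +
          ∫⁻ z, ‖lam • F z.1 z.2‖ₑ ^ p ∂ν) := fun ε hε hε1 => by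
    rw [energyConst_mul_rpow hp hc hε]
    exact hcmp.mean_grad_le hpq hp2 measurableSet_ball hbt hc ht hε hε1 hlam
  have hosc : ∀ r : ℝ, 0 < r → ∫⁻ z, ENNReal.ofReal (D z) ^ r ∂ν ≤
      ENNReal.ofReal (jnConst n (r / (p - 1)) * (η ^ M) ^ (r / (p - 1))) := fun r hr => by
    have h1 := lintegral_coeffDist_rpow_le (t₁ := t₁) hp hΩ ha (C := Cₐ) (fun t ht x hx => by
      rw [abs_of_pos (hc.trans_le (hab t ht x hx).1)]
      exact (hab t ht x hx).2) hρ hδ hbΩ ht₀ hbmo hr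
    have h2 : ∀ z, ENNReal.ofReal (D z) ^ r = ENNReal.ofReal (D z ^ r) := fun z =>
      ENNReal.ofReal_rpow_of_nonneg (coeffDist_nonneg z) hr.le
    simp only [h2]
    rw [hν, lintegral_meanMeasure, mul_comm, ← div_eq_mul_inv, ENNReal.div_le_iff hvol0 hvolt]
    exact h1
  have hdJ : lpMean ν (p * σ₁ / (σ₁ - p)) (fun z => ENNReal.ofReal (D z)) ≤
      ENNReal.ofReal (oscConst n p (p * σ₁ / (σ₁ - p)) * (η ^ M) ^ (1 / (p - 1))) := by
    have hσp' : 0 < σ₁ - p := by linarith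
    have hr : 0 < p * σ₁ / (σ₁ - p) := by positivity
    set r := p * σ₁ / (σ₁ - p)
    have h1 := ENNReal.rpow_le_rpow (hosc r hr) (z := 1 / r) (by positivity)
    refine h1.trans (le_of_eq ?_)
    rw [ENNReal.ofReal_rpow_of_nonneg (mul_nonneg (jnConst_nonneg _ _) (by positivity))
      (by positivity), Real.mul_rpow (jnConst_nonneg _ _) (by positivity),
      ← Real.rpow_mul hδ.le, oscConst]
    congr 3
    field_simp
  have hdL : ∀ᵐ z ∂ν, ENNReal.ofReal (D z) ≤ ENNReal.ofReal (max 1 (Cₐ ^ (1 / (p - 1)))) := by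
    refine hac.ae_le ((ae_restrict_iff' (measurableSet_Ioo.prod measurableSet_ball)).2
      (Eventually.of_forall fun z hz => ENNReal.ofReal_le_ofReal ?_))
    rw [hD, coeffDist]
    split_ifs with h0
    · positivity
    · refine le_trans (Real.rpow_le_rpow (abs_nonneg _) ?_ (by positivity)) (le_max_right _ _)
      have h1 := hcmp.bounds z hz
      have h2 := hab z.1 (hz.1.2.le.trans ht₀) z.2 (hbΩ hz.2)
      rw [abs_le]
      constructor <;> linarith [h1.1, h1.2, h2.1, h2.2]
  have hκσ : σ₁ + κ₀ - σ₁ = κ₀ := by ring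
  -- The Hölder exponent here is `σ₁(σ₁+κ₀)/κ₀`, for which the John–Nirenberg constant would depend
  -- on `κ₀`. Instead the bounded function `D` is interpolated with its `L^{p-1}` mean, that is,
  -- with the mean oscillation of `a`. The weaker power of `η^M` obtained in this way is compensated
  -- by the size of `M`.
  have hdB : lpMean ν (σ₁ * (σ₁ + κ₀) / (σ₁ + κ₀ - σ₁)) (fun z => ENNReal.ofReal (D z)) ≤
      ENNReal.ofReal (boundedOscConst n p Cₐ *
        (η ^ M) ^ (1 / (σ₁ * (σ₁ + κ₀) / (σ₁ + κ₀ - σ₁)))) := by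
    have hs1 : 1 ≤ σ₁ * (σ₁ + κ₀) / (σ₁ + κ₀ - σ₁) := by
      rw [hκσ, le_div_iff₀ hκ]
      nlinarith
    refine lpMean_le_of_le (r := p - 1) (le_max_left _ _) hp1 (by linarith) hs1 (le_max_left _ _)
      hδ.le hdL ?_
    refine (hosc (p - 1) hp1).trans (ENNReal.ofReal_le_ofReal ?_)
    rw [div_self hp1.ne', Real.rpow_one]
    gcongr
    exact le_max_right _ _
  have hc1 := energyConst_pos hp hc
  have hJ0 := oscConst_nonneg n p (p * σ₁ / (σ₁ - p))
  refine ⟨lpMean_grad_le_sq hxm hdm hp hσp hc1 hJ0 hη hη1 hM1 hen hdJ, ?_⟩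
  have hsrc := lpMean_source_le (B := boundedOscConst n p Cₐ) (γ := p * κ₀ / (σ₁ * (σ₁ + κ₀ - p)))
    hxm hdm hym hgm hp hp2 hσp hc1 hJ0 hη hη1 hM0
    (s := σ₁ + κ₀) (by linarith) (by rw [hκσ]) hM2
    (by unfold boundedOscConst; positivity) (by rw [hκσ]; exact hM3) hen hdJ hdB
  have hW := hcmp.mean_norm_le hpq hp2 (by omega) measurableSet_ball hbt hb0 hc hCa0 ht hϑ0 hσ hσ₁
    hσ2.le hlam (show 0 < lam / R by positivity) hV0 hvol
  refine hW.trans ?_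
  rw [hV, intrinsic_scaling hlam hR hunit.le]
  have e1 : (cylinderConst N n p cₐ Cₐ ϑ : ℝ≥0∞) =
      ENNReal.ofReal (2 * volume.real (ball (0 : Space n) 1) ^ (1 / (n + 2) : ℝ)) *
      (parabolicConst N n p cₐ Cₐ ϑ : ℝ≥0∞) ^ (n / (p * (n + 2)) : ℝ) := by
    rw [cylinderConst, ENNReal.coe_mul, ENNReal.coe_rpow_of_nonneg _ (by positivity)]
    rfl
  rw [e1]
  gcongr
  refine le_trans (le_of_eq ?_) hsrc
  congr 1
  funext z
  exact ofReal_mul_sourceTerm hlam coeffDist_nonneg z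

end Main

end

/-! ### The theorem: choice of `η₀` and of the constants -/

theorem lemma2p1 (n N : ℕ) (hn : 3 ≤ n) (hN : 1 ≤ N) (p : ℝ) (hp : 1 < p)
    (hpn : p ≤ 2 * n / (n + 2)) (cₐ Cₐ : ℝ) (hcₐ : 0 < cₐ)
    (ϑ : ℝ) (hϑ : 2 * n / p - (2 + n) < ϑ)
    (σ σ₁ : ℝ) (hσ : σ = p + ϑ + p * (ϑ + 2) / n) (hσ₁ : σ₁ = p + n * ϑ / (n + ϑ + 2)) :
    n * (2 - p) / p < σ ∧ n * (2 - p) / 2 < σ₁ ∧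
    ∃ (η₀ : ℝ) (C₀ : ℝ≥0) (C₁ : ℝ → ℝ≥0) (C₂ : ℝ → ℝ → ℝ≥0), 0 < η₀ ∧ η₀ < 1 ∧
      ∀ (η κ₀ : ℝ), 0 < η → η < 1 → 0 < κ₀ → κ₀ < 1 →
      -- the domain, the coefficient and the datum
      ∀ (Ω : Set (Space n)) (T : ℝ), IsOpen Ω → Bornology.IsBounded Ω → 0 < T →
      ∀ a : ℝ → Space n → ℝ, Measurable (Function.uncurry a) →
        (∀ t ≤ T, ∀ x ∈ Ω, cₐ ≤ a t x ∧ a t x ≤ Cₐ) →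
      ∀ F : ℝ → Space n → Mat N n,
        MemLp (Function.uncurry F) (ENNReal.ofReal p) (volume.restrict (Ioo 0 T ×ˢ Ω)) →
      -- the solution, extended by zero to negative times
      ∀ (u : ℝ → Space n → Vec N) (Du : ℝ → Space n → Mat N n),
        IsDirichletSolution p 0 T Ω a F 0 0 u Du →
        (∀ t < 0, u t = 0 ∧ Du t = 0 ∧ F t = 0) →
      -- the cylinder
      ∀ (lam R : ℝ) (x₀ : Space n) (t₀ : ℝ), 0 < lam → 0 < R → closedBall x₀ (2 * R) ⊆ Ω →
        0 ≤ t₀ → t₀ ≤ T →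
      -- the comparison map
      ∀ (w : ℝ → Space n → Vec N) (Dw : ℝ → Space n → Mat N n),
        IsDirichletSolution p (t₀ - lam ^ (p - 2) * (2 * R) ^ 2) t₀ (ball x₀ (2 * R))
          (fun t _ => ⨍ y in ball x₀ (2 * R), a t y) 0 u Du w Dw →
      MemLp (Function.uncurry Du) (ENNReal.ofReal (σ₁ + κ₀))
        (volume.restrict (cyl p lam (2 * R) x₀ t₀)) →
      MemLp (Function.uncurry F) (ENNReal.ofReal σ₁)
        (volume.restrict (cyl p lam (2 * R) x₀ t₀)) →
      bmoSeminorm T Ω a (2 * R) ≤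
        ENNReal.ofReal (η ^ ((n : ℝ) ^ 4 / (κ₀ ^ 4 * (p - 1) ^ 4))) →
      (⨍⁻ z in cyl p lam (2 * R) x₀ t₀, ‖lam • (Du z.1 z.2 - Dw z.1 z.2)‖ₑ ^ p ∂volume) ^ (1 / p)
          ≤ C₁ η * (⨍⁻ z in cyl p lam (2 * R) x₀ t₀, ‖lam • F z.1 z.2‖ₑ ^ p ∂volume) ^ (1 / p)
            + ENNReal.ofReal (if η ≤ η₀ then η else C₀) *
              (⨍⁻ z in cyl p lam (2 * R) x₀ t₀, ‖lam • Du z.1 z.2‖ₑ ^ σ₁ ∂volume) ^ (1 / σ₁) ∧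
      (⨍⁻ t in cylTime p lam (2 * R) t₀,
          (⨍⁻ x in ball x₀ (2 * R), ‖(lam / R) • (u t x - w t x)‖ₑ ^ σ ∂volume) ^ (2 / σ) ∂volume)
            ^ (1 / 2 : ℝ)
          ≤ C₂ η κ₀ * (⨍⁻ z in cyl p lam (2 * R) x₀ t₀, ‖lam • F z.1 z.2‖ₑ ^ σ₁ ∂volume)
              ^ ((n + p) / (σ₁ * (n + 2)))
            + ENNReal.ofReal (if η ≤ η₀ then η else C₀) *
              (⨍⁻ z in cyl p lam (2 * R) x₀ t₀, ‖lam • Du z.1 z.2‖ₑ ^ (σ₁ + κ₀) ∂volume)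
                ^ ((n + p) / ((σ₁ + κ₀) * (n + 2))) := by
  obtain ⟨hp2, hϑ0, hσ2, hσa, hσb, hσp, hσn, hnp⟩ := exponent_bounds hn hp hpn hϑ hσ hσ₁
  refine ⟨hσa, hσb, ?_⟩
  have hc1 := energyConst_pos hp hcₐ
  have hJ0 := oscConst_nonneg n p (p * σ₁ / (σ₁ - p))
  have hp0 : 0 < p := by linarith
  have hσ0 : 0 < σ₁ := by linarith
  have hn0 : (0 : ℝ) < n := by exact_mod_cast (by omega : 0 < n)
  set A := 2 + energyConst p cₐ * oscConst n p (p * σ₁ / (σ₁ - p)) with hA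
  have hA2 : 2 ≤ A := by
    have : 0 ≤ energyConst p cₐ * oscConst n p (p * σ₁ / (σ₁ - p)) := by positivity
    linarith
  have hB0 : 0 ≤ boundedOscConst n p Cₐ := by unfold boundedOscConst; positivity
  set A' := 2 * A + boundedOscConst n p Cₐ with hA'
  have hA1 : 1 ≤ A' := by linarith
  set W := cylinderConst N n p cₐ Cₐ ϑ with hW
  -- One constant dominating those in front of the `∇u` terms in both estimates. It serves as `C₀`,
  -- and `η₀ = 1/C` lies in `(0,1)` because `C ≥ 2`.
  set C := A + W * A' with hC
  have hWA : 0 ≤ W * A' := by positivity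
  have hC2 : 2 ≤ C := by linarith
  set β : ℝ := (n + p) / (n + 2) with hβ
  have hβ0 : 0 ≤ β := by positivity
  have hβ1 : β ≤ 1 := by rw [hβ, div_le_one (by positivity)]; linarith
  -- The second estimate is raised to the power `β`; as `β ≥ 1/2`, the factor `η⁴` obtained for the
  -- source still gives `η²`.
  have hβ2 : 1 / 2 ≤ β := by rw [hβ, div_le_div_iff₀ (by norm_num) (by positivity)]; linarith
  refine ⟨1 / C, Real.toNNReal C,
    fun η => Real.toNNReal (energyConst p cₐ * (η ^ (2 * p)) ^ (-(1 / (p - 1)))),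
    fun η κ₀ => W * Real.toNNReal (sourceConst p (energyConst p cₐ) A
      (η ^ ((n : ℝ) ^ 4 / (κ₀ ^ 4 * (p - 1) ^ 4))) (p * κ₀ / (σ₁ * (σ₁ + κ₀ - p)))) ^ β,
    by positivity, by rw [div_lt_one (by positivity)]; linarith, ?_⟩
  intro η κ₀ hη hη1 hκ hκ1 Ω T hΩ hΩb hT a ha hab F hF u Du hu hneg lam R x₀ t₀ hlam hR hB h0t ht₀
    w Dw hw _ _ hbmo
  obtain ⟨h1, h2⟩ := comparison_estimates hn hp hpn hcₐ hϑ hσ hσ₁ hη hη1 hκ hκ1 hΩ hΩb ha hab hF hu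
    hneg hlam hR hB h0t ht₀ hw hbmo
  rw [← hA] at h1 h2
  -- For `η ≤ 1/C` one of the two factors `η` absorbs `C`; for larger `η` both are simply bounded by
  -- one.
  have hcη : C * η ^ 2 ≤ if η ≤ 1 / C then η else (Real.toNNReal C : ℝ) := by
    split_ifs with h
    · rw [le_div_iff₀ (by positivity)] at h
      nlinarith
    · rw [Real.coe_toNNReal _ (by positivity)]
      exact mul_le_of_le_one_right (by positivity) (pow_le_one₀ hη.le hη1.le)
  constructor
  · refine h1.trans ?_
    gcongr
    · exact le_rfl
    · exact le_rfl
    · refine le_trans ?_ hcη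
      gcongr
      linarith
    · exact le_rfl
  · refine h2.trans ?_
    have hs0 : 0 < σ₁ + κ₀ := by linarith
    have e1 : ∀ r, 0 < r → ∀ f : ℝ × Space n → ℝ≥0∞,
        lpMean (meanMeasure (cyl p lam (2 * R) x₀ t₀)) r f ^ β =
        (⨍⁻ z in cyl p lam (2 * R) x₀ t₀, f z ^ r ∂volume) ^ ((n + p) / (r * (n + 2))) := by
      intro r hr f
      rw [lpMean_rpow, hβ, div_div, mul_comm r]
      rfl
    rw [← e1 _ hσ0, ← e1 _ hs0]
    refine (mul_le_mul_right (ENNReal.rpow_add_le_add_rpow _ _ hβ0 hβ1) _).trans ?_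
    rw [ENNReal.mul_rpow_of_nonneg _ _ hβ0, ENNReal.mul_rpow_of_nonneg _ _ hβ0, mul_add, add_comm,
      ENNReal.coe_mul, ENNReal.coe_rpow_of_nonneg _ hβ0, ← mul_assoc, ← mul_assoc]
    gcongr
    · exact le_rfl
    · rw [ENNReal.ofReal_rpow_of_nonneg (by positivity) hβ0, ← ENNReal.ofReal_coe_nnreal,
        ← ENNReal.ofReal_mul (by positivity)]
      refine ENNReal.ofReal_le_ofReal (le_trans ?_ hcη)
      have f1 : A' ^ β ≤ A' := (Real.rpow_le_rpow_of_exponent_le hA1 hβ1).trans (Real.rpow_one _).le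
      have f2 : (η ^ 4) ^ β ≤ η ^ 2 := by
        rw [← Real.rpow_natCast, ← Real.rpow_natCast, ← Real.rpow_mul hη.le]
        refine rpow_le_rpow_of_ge hη hη1 ?_
        push_cast
        linarith
      calc (W : ℝ) * (A' * η ^ 4) ^ β = W * (A' ^ β * (η ^ 4) ^ β) := by
            rw [Real.mul_rpow (by positivity) (by positivity)]
        _ ≤ W * (A' * η ^ 2) := by gcongr
        _ ≤ C * η ^ 2 := by
            rw [← mul_assoc]
            gcongr
            linarith
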